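/- **Lemma 1.** Let $m>0$ and $0<\epsilon<\frac1{2m}$. For $k_x\in\mathbb R$, $k_y\in\mathbb C$ let $$H(k_x,k_y)=\begin{pmatrix} m-\epsilon(k_x^2+k_y^2) & -k_x+\mathrm i k_y\\ -k_x-\mathrm i k_y & -m+\epsilon(k_x^2+k_y^2)\end{pmatrix},$$ and for real $k_y$ let $\omega_+(k_x,k_y)=\sqrt{k_x^2+k_y^2+(m-\epsilon(k_x^2+k_y^2))^2}$, let $P_+=\frac12(1+H/\omega_+)$ be the eigenprojection of the upper band, and let $$C_+=\frac1{2\pi\mathrm i}\int_{\mathbb R^2}\operatorname{tr}\big(P_+[\partial_{k_x}P_+,\partial_{k_y}P_+]\big)\,dk_x\,dk_y$$ be its Chern number. On the half-line $y\ge 0$ let $$H^\sharp(k_x)=\begin{pmatrix} m-\epsilon k_x^2+\epsilon\partial_y^2 & -k_x+\partial_y\\ -k_x-\partial_y & -m+\epsilon k_x^2-\epsilon\partial_y^2\end{pmatrix}$$ with the boundary condition $A(k_x)\binom{\psi(0)}{\psi'(0)}=0$, where $A(k_x)=[\,B_0+\mathrm i k_xB_1\,|\,B_2\,]$ and $B_0,B_1,B_2\in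 M_2(\mathbb C)$. Assume that, for almost every $k_x\in\mathbb R$, this operator, with domain the functions in $H^2(\mathbb R_+)^2$ that satisfy the boundary condition, is self-adjoint on $L^2(\mathbb R_+)^2$. *Edge modes.* An edge mode at $(k_x,\omega)$ is an exponentially decaying solution of $H^\sharp(k_x)\psi=\omega\psi$ satisfying the boundary condition. The number $n_{\mathrm b}$ of edge modes below the upper band is the number of edge mode branches (counted with multiplicity) that emerge from the lower band limit $\omega=\omega_+(k_x,0)$, minus the number of those that disappear there, as $k_x$ increases through $\mathbb R$. Here the number of branches emerging (disappearing) at $k_0$ is the number of edge modes with energy in $(\omega_+(k_x,0)-\delta,\omega_+(k_x,0))$ for small $\delta>0$ and then for $k_x>k_0$ (respectively $k_x<k_0$) sufficiently close to $k_0$. *Scattering amplitude.* Let $\widehat\psi$ be a section of the upper band, $H\widehat\psi=\omega_+\widehat\psi$, $\|\widehat\psi\|=1$, that is $C^1$ on $\mathbb R^2\setminus\{0\}$ and has a limit at $\infty$. For $\kappa>0$ put $\kappa_{\mathrm{ev}}=\mathrm i\sqrt{\kappa^2+2k_x^2+(1-2\epsilon m)/\epsilon^2}$. A scattering state at $(k_x,\kappa)$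 is a function $$\widehat\psi(k_x,-\kappa)e^{-\mathrm i\kappa y}+S\,\widehat\psi(k_x,\kappa)e^{\mathrm i\kappa y}+v\,e^{\mathrm i\kappa_{\mathrm{ev}}y},\qquad S\in\mathbb C,\quad H(k_x,\kappa_{\mathrm{ev}})v=\omega_+(k_x,\kappa)v,$$ that satisfies the boundary condition. Assume that the scattering state is unique for all $(k_x,\kappa)$ with $\kappa>0$ and $\operatorname{rank}A(k_x)=2$, except possibly for finitely many. Let $S(k_x,\kappa)$ be its coefficient $S$, the scattering amplitude. *Asymptotic winding number.* For $\lambda,\delta>0$ let $\Gamma_\delta(\lambda)$ be the path $\lambda_x\mapsto\big(\frac{-\lambda_x}{\lambda_x^2+\delta^2},\frac{\delta}{\lambda_x^2+\delta^2}\big)$, $\lambda_x\in[-\lambda,\lambda]$, in the $(k_x,\kappa)$ half-plane, and let $$w_\infty=\lim_{\lambda\to0^+}\ \lim_{\delta\to0^+}\ \frac1{2\pi\mathrm i}\int_{\Gamma_\delta(\lambda)}S^{-1}\,dS .$$ Then only finitely many edge mode branches emerge or disappear at the lower limit of the upper band, the limits that define $w_\infty$ exist (the inner one for all sufficiently small $\lambda$),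 and $$C_+=n_{\mathrm b}+w_\infty .$$ -/

import Mathlib

open MeasureTheory Filter Topology Set Matrix

noncomputable section

namespace RegDirac

/-! ### Bulk: Hamiltonian, upper band, Chern number -/

/-- The bulk Hamiltonian `H(k_x, k_y)`; the momentum `k_y` may be complex (evanescent waves). -/
def bulkH (m ε kx : ℝ) (ky : ℂ) : Matrix (Fin 2) (Fin 2) ℂ :=
  !![(m : ℂ) - ε * ((kx : ℂ) ^ 2 + ky ^ 2), -(kx : ℂ) + Complex.I * ky;
     -(kx : ℂ) - Complex.I * ky, -(m : ℂ) + ε * ((kx : ℂ) ^ 2 + ky ^ 2)]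

/-- The upper energy band `ω₊(k_x, k_y)`. -/
def bandPlus (m ε kx ky : ℝ) : ℝ :=
  √(kx ^ 2 + ky ^ 2 + (m - ε * (kx ^ 2 + ky ^ 2)) ^ 2)

/-- The eigenprojection `P₊ = (1 + H / ω₊) / 2` of the upper band (recall `H² = ω₊²`). -/
def projPlus (m ε kx ky : ℝ) : Matrix (Fin 2) (Fin 2) ℂ :=
  (1 / 2 : ℂ) • (1 + ((bandPlus m ε kx ky : ℂ))⁻¹ • bulkH m ε kx ky)

/-- `∂P₊ / ∂k_x`, entry by entry. -/
def projPlusDx (m ε kx ky : ℝ) : Matrix (Fin 2) (Fin 2) ℂ :=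
  Matrix.of fun i j => deriv (fun t : ℝ => projPlus m ε t ky i j) kx

/-- `∂P₊ / ∂k_y`, entry by entry. -/
def projPlusDy (m ε kx ky : ℝ) : Matrix (Fin 2) (Fin 2) ℂ :=
  Matrix.of fun i j => deriv (fun t : ℝ => projPlus m ε kx t i j) ky

/-- The Chern number of the upper band,
`C₊ = (2πi)⁻¹ ∫ tr (P₊ [∂P₊/∂k_x, ∂P₊/∂k_y]) dk_x dk_y`. -/
def chernPlus (m ε : ℝ) : ℂ :=
  (2 * (Real.pi : ℂ) * Complex.I)⁻¹ *
    ∫ k : ℝ × ℝ, (projPlus m ε k.1 k.2 *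
      (projPlusDx m ε k.1 k.2 * projPlusDy m ε k.1 k.2 -
        projPlusDy m ε k.1 k.2 * projPlusDx m ε k.1 k.2)).trace

/-! ### Half-space: edge Hamiltonian and self-adjoint local boundary conditions -/

/-- The boundary matrix `A(k_x) = [B₀ + i k_x B₁ | B₂]`, a `2 × 4` matrix acting on the boundary
data `(ψ(0), ψ'(0))`. -/
def bcMatrix (B₀ B₁ B₂ : Matrix (Fin 2) (Fin 2) ℂ) (kx : ℝ) :
    Matrix (Fin 2) (Fin 2 ⊕ Fin 2) ℂ :=
  Matrix.fromCols (B₀ + (Complex.I * (kx : ℂ)) • B₁) B₂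

/-- The edge Hamiltonian `H♯(k_x)` at one point: `u`, `u'`, `u''` stand for the values of
a spinor, of its first and of its second `y`-derivative. -/
def edgeH (m ε kx : ℝ) (u u' u'' : EuclideanSpace ℂ (Fin 2)) : EuclideanSpace ℂ (Fin 2) :=
  !₂[((m : ℂ) - ε * kx ^ 2) * u 0 + ε * u'' 0 - kx * u 1 + u' 1,
     -(kx : ℂ) * u 0 - u' 0 + (-(m : ℂ) + ε * kx ^ 2) * u 1 - ε * u'' 1]

/-- `L²(ℝ₊) ⊕ L²(ℝ₊)`. -/
abbrev HalfLineL2 : Type :=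
  Lp (EuclideanSpace ℂ (Fin 2)) 2 (volume.restrict (Ioi (0 : ℝ)))

/-- `f` is (the `C¹` representative of) an element of the Sobolev space `H² ⊕ H²` of the half-line
`y ≥ 0`, with first derivative `f'` and second derivative `f''`. -/
structure IsH2 (f f' f'' : ℝ → EuclideanSpace ℂ (Fin 2)) : Prop where
  memLp : MemLp f 2 (volume.restrict (Ioi (0 : ℝ)))
  memLp' : MemLp f' 2 (volume.restrict (Ioi (0 : ℝ)))
  memLp'' : MemLp f'' 2 (volume.restrict (Ioi (0 : ℝ)))
  eq_integral : ∀ y : ℝ, 0 ≤ y → f y = f 0 + ∫ t in (0 : ℝ)..y, f' t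
  eq_integral' : ∀ y : ℝ, 0 ≤ y → f' y = f' 0 + ∫ t in (0 : ℝ)..y, f'' t

/-- The graph of `H♯(k_x)` with domain the functions in `H² ⊕ H²` that satisfy the boundary
condition `A (ψ(0), ψ'(0)) = 0`. -/
def edgeGraph (m ε kx : ℝ) (A : Matrix (Fin 2) (Fin 2 ⊕ Fin 2) ℂ) :
    Set (HalfLineL2 × HalfLineL2) :=
  {p | ∃ f f' f'' : ℝ → EuclideanSpace ℂ (Fin 2), IsH2 f f' f'' ∧
    A *ᵥ Sum.elim (fun i => f 0 i) (fun i => f' 0 i) = 0 ∧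
    p.1 =ᵐ[volume.restrict (Ioi (0 : ℝ))] f ∧
    p.2 =ᵐ[volume.restrict (Ioi (0 : ℝ))] fun y => edgeH m ε kx (f y) (f' y) (f'' y)}

/-- `H♯(k_x)` with the boundary condition `A` is self-adjoint: its graph is the graph of its
adjoint, the set of all `(u, v)` with `⟨u, H♯ w⟩ = ⟨v, w⟩` for all `w` in the domain. (The domain
is dense, since it contains the test functions on the open half-line.) -/
def IsSelfAdjointEdge (m ε kx : ℝ) (A : Matrix (Fin 2) (Fin 2 ⊕ Fin 2) ℂ) : Prop :=
  ∀ p : HalfLineL2 × HalfLineL2,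
    p ∈ edgeGraph m ε kx A ↔ ∀ q ∈ edgeGraph m ε kx A, inner ℂ p.1 q.2 = inner ℂ p.2 q.1

/-! ### Edge modes and their number below the upper band -/

/-- The edge modes at momentum `k_x` and energy `ω`: the exponentially decaying solutions of
`H♯ ψ = ω ψ` on the half-line `y ≥ 0` that satisfy the boundary condition. A function on the
half-line is represented by its extension by `0`. -/
def edgeModes (m ε kx : ℝ) (A : Matrix (Fin 2) (Fin 2 ⊕ Fin 2) ℂ) (ω : ℝ) :
    Set (ℝ → EuclideanSpace ℂ (Fin 2)) :=
  {ψ | (∀ y < 0, ψ y = 0) ∧ ∃ ψ' ψ'' : ℝ → EuclideanSpace ℂ (Fin 2),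
    (∀ y, 0 ≤ y → HasDerivWithinAt ψ (ψ' y) (Ici 0) y ∧
      HasDerivWithinAt ψ' (ψ'' y) (Ici 0) y ∧
      edgeH m ε kx (ψ y) (ψ' y) (ψ'' y) = (ω : ℂ) • ψ y) ∧
    A *ᵥ Sum.elim (fun i => ψ 0 i) (fun i => ψ' 0 i) = 0 ∧
    ∃ C c : ℝ, 0 < c ∧ ∀ y, 0 ≤ y → ‖ψ y‖ ≤ C * Real.exp (-c * y)}

/-- The number of edge modes, counted with multiplicity, at momentum `k_x` in the energy window of
width `δ` just below the lower limit `ω₊(k_x, 0)` of the upper bulk band. -/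
def edgeCount (m ε kx : ℝ) (A : Matrix (Fin 2) (Fin 2 ⊕ Fin 2) ℂ) (δ : ℝ) : ℕ :=
  ∑ᶠ ω ∈ Ioo (bandPlus m ε kx 0 - δ) (bandPlus m ε kx 0), Set.finrank ℂ (edgeModes m ε kx A ω)

/-- `n` edge mode branches emerge from the lower limit of the upper band at momentum `k₀`:
for small `δ`, there are `n` edge modes within `δ` below the band as soon as `k_x > k₀`
is close to `k₀`. -/
def Emerging (m ε : ℝ) (A : ℝ → Matrix (Fin 2) (Fin 2 ⊕ Fin 2) ℂ) (k₀ : ℝ) (n : ℕ) : Prop :=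
  ∀ᶠ δ in 𝓝[>] (0 : ℝ), ∀ᶠ k in 𝓝[>] k₀, edgeCount m ε k (A k) δ = n

/-- `n` edge mode branches disappear at the lower limit of the upper band at momentum `k₀`. -/
def Disappearing (m ε : ℝ) (A : ℝ → Matrix (Fin 2) (Fin 2 ⊕ Fin 2) ℂ) (k₀ : ℝ) (n : ℕ) : Prop :=
  ∀ᶠ δ in 𝓝[>] (0 : ℝ), ∀ᶠ k in 𝓝[<] k₀, edgeCount m ε k (A k) δ = n

/-- `n` is the number `n_b` of edge modes below the upper band: the number of edge mode
branches that emerge at the lower band limit, minus the number of those that disappear there,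
as `k_x` runs through `ℝ`. -/
def IsEdgeModeNumber (m ε : ℝ) (A : ℝ → Matrix (Fin 2) (Fin 2 ⊕ Fin 2) ℂ) (n : ℤ) : Prop :=
  ∃ e d : ℝ → ℕ, (∀ k₀, Emerging m ε A k₀ (e k₀)) ∧ (∀ k₀, Disappearing m ε A k₀ (d k₀)) ∧
    (Function.support e).Finite ∧ (Function.support d).Finite ∧
    n = ∑ᶠ k₀ : ℝ, ((e k₀ : ℤ) - (d k₀ : ℤ))

/-! ### Scattering amplitude and asymptotic winding number -/

/-- `ψ` is a normalized section of the upper band that is regular on `ℝ² ∖ {0}` and at `∞`. -/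
structure IsBulkSection (m ε : ℝ) (ψ : ℝ × ℝ → Fin 2 → ℂ) : Prop where
  eigen : ∀ k : ℝ × ℝ, k ≠ 0 →
    bulkH m ε k.1 k.2 *ᵥ ψ k = (bandPlus m ε k.1 k.2 : ℂ) • ψ k
  norm_eq_one : ∀ k : ℝ × ℝ, k ≠ 0 → ‖ψ k 0‖ ^ 2 + ‖ψ k 1‖ ^ 2 = 1
  regular : ContDiffOn ℝ 1 ψ {0}ᶜ
  regular_infty : ∃ v : Fin 2 → ℂ, Tendsto ψ (cocompact (ℝ × ℝ)) (𝓝 v)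

/-- The evanescent momentum `κ_ev`, in `i ℝ₊`. -/
def kappaEv (m ε kx κ : ℝ) : ℂ :=
  Complex.I * (√(κ ^ 2 + 2 * kx ^ 2 + (1 - 2 * ε * m) / ε ^ 2) : ℝ)

/-- Boundary data `(ψ(0), ψ'(0))` of the wave `v exp (i k_y y)`. -/
def waveData (v : Fin 2 → ℂ) (ky : ℂ) : Fin 2 ⊕ Fin 2 → ℂ :=
  Sum.elim v ((Complex.I * ky) • v)

/-- The wave `ψ(k_x,-κ) exp (-iκy) + S ψ(k_x,κ) exp (iκy) + v exp (i κ_ev y)` is a scattering state: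
`v` (that is, `T` times an evanescent bulk eigenstate) is a solution of the bulk eigenvalue equation
with momentum `(k_x, κ_ev)` and energy `ω₊(k_x, κ)`, and the boundary condition `A` holds. -/
def IsScatteringState (m ε : ℝ) (A : Matrix (Fin 2) (Fin 2 ⊕ Fin 2) ℂ)
    (ψ : ℝ × ℝ → Fin 2 → ℂ) (kx κ : ℝ) (S : ℂ) (v : Fin 2 → ℂ) : Prop :=
  bulkH m ε kx (kappaEv m ε kx κ) *ᵥ v = (bandPlus m ε kx κ : ℂ) • v ∧
  A *ᵥ (waveData (ψ (kx, -κ)) (-(κ : ℂ)) + S • waveData (ψ (kx, κ)) (κ : ℂ) +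
    waveData v (kappaEv m ε kx κ)) = 0

/-- There is exactly one scattering state at `(k_x, κ)`. -/
def UniqueScatteringState (m ε : ℝ) (A : Matrix (Fin 2) (Fin 2 ⊕ Fin 2) ℂ)
    (ψ : ℝ × ℝ → Fin 2 → ℂ) (kx κ : ℝ) : Prop :=
  ∃! p : ℂ × (Fin 2 → ℂ), IsScatteringState m ε A ψ kx κ p.1 p.2

/-- `S` is the scattering amplitude, wherever the scattering state is uniquely defined. -/
def IsScatteringAmplitude (m ε : ℝ) (A : ℝ → Matrix (Fin 2) (Fin 2 ⊕ Fin 2) ℂ)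
    (ψ : ℝ × ℝ → Fin 2 → ℂ) (S : ℝ × ℝ → ℂ) : Prop :=
  ∀ kx κ : ℝ, 0 < κ → UniqueScatteringState m ε (A kx) ψ kx κ →
    ∃ v : Fin 2 → ℂ, IsScatteringState m ε (A kx) ψ kx κ (S (kx, κ)) v

/-- The parametrization of the path `Γ_δ` near infinity by the dual variable `λ_x`. -/
def pathInfty (δ x : ℝ) : ℝ × ℝ :=
  (-x / (x ^ 2 + δ ^ 2), δ / (x ^ 2 + δ ^ 2))

/-- The integrand of `S⁻¹ dS` along `Γ_δ`. -/
def logDerivPath (S : ℝ × ℝ → ℂ) (δ x : ℝ) : ℂ :=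
  (S (pathInfty δ x))⁻¹ * deriv (fun t : ℝ => S (pathInfty δ t)) x

/-- `w` is the asymptotic winding number
`w_∞ = lim_{λ → 0} lim_{δ → 0} (2πi)⁻¹ ∫_{Γ_δ(λ)} S⁻¹ dS` of `S`, both limits being existent. -/
def IsAsymptoticWinding (S : ℝ × ℝ → ℂ) (w : ℂ) : Prop :=
  ∃ W : ℝ → ℂ,
    (∀ᶠ l in 𝓝[>] (0 : ℝ),
      (∀ᶠ δ in 𝓝[>] (0 : ℝ), IntervalIntegrable (logDerivPath S δ) volume (-l) l) ∧
      Tendsto (fun δ : ℝ => (2 * (Real.pi : ℂ) * Complex.I)⁻¹ * ∫ x in (-l)..l, logDerivPath S δ x)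
        (𝓝[>] 0) (𝓝 (W l))) ∧
    Tendsto W (𝓝[>] 0) (𝓝 w)

end RegDirac

end

/-! Both sides are governed by one integer-valued function of the momentum: the negative index ν(k)
of a Hermitian 3×3 matrix `thrMat`, built from the boundary condition and from the waves at the
threshold ω₊(k,0).

Boundary conditions. In the variables ψ and χ = (εψ₀' + ψ₁, -εψ₁') the boundary form of H♯ is the
standard symplectic form. Its vanishing on admissible data at two momenta forces the condition, off
finitely many momenta, into the shape (1-Π)ψ + Π(χ + Mψ) = 0 with a fixed orthogonal projection Π
and a Hermitian M = ΠMΠ affine in k (`exists_normalForm`): Robin, mixed or Dirichlet according to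
the rank of Π.

Edge modes. Just below the band there are two decaying waves. Their boundary data form a Lagrangian
plane, the graph of a real symmetric Weyl matrix, and edge modes are the kernel vectors of a
Hermitian matrix `edgeMat` made of the Weyl matrix and the condition (`finrank_edgeModes`). Near the
threshold the Weyl matrix decreases strictly with the energy (`eventually_weyl_sub_pos`), so the
modes in a window are counted by the growth of the negative index across it. At k₀ the lower end of
a small window is nondegenerate and has index ν(k₀), which persists for k near k₀; hence the count
is ν(k) - ν(k₀) (`eventually_edgeCount_eq`). Emerging minus disappearing branches at k₀ is therefore
the jump of ν. All entries are meromorphic along the momentum line, infinity included, so ν has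
one-sided limits everywhere and the jumps telescope: n_b = ν(+∞) - ν(-∞)
(`exists_isEdgeModeNumber`).

Scattering. By Cramer's rule S(k,κ) is, up to sign, a quotient of section components times
g(k,-κ)/g(k,κ), where g = `scatDet` is the determinant of the boundary values of the propagating and
the evanescent wave (`amplitude_eq`). A logarithm of g at large momenta off the axis κ = 0 turns w_∞
into a difference of its jumps across the axis at k → -∞ and k → +∞. To construct it, g is
multiplied by the conjugate determinant of the wave amplitudes; for Robin conditions the product G =
`formDet` is the determinant of the boundary form on the two waves. Flux conservation gives Im G =
-κ·(positive)·s, where s is the entry of the form on the evanescent wave, and Re G ≤ 0 where s = 0.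
So -G stays off the cut of the logarithm for κ ≠ 0, and the jump of log(-G), namely -1, 0 or 1 when
G ≠ 0 on the axis, counts the negative squares 0, 1 or 2 of the form. This number differs from ν(k)
only by the sign of one Weyl entry, which contributes 1 as k → +∞ and 0 as k → -∞
(`HasScatLift.of_form`). Hence w_∞ = 1 - n_b.

Bulk. The Berry curvature is a total radial derivative and integrates to C₊ = 1
(`chernPlus_eq_one`).

Uniqueness of scattering states matters for Robin conditions: it keeps the boundary value of the
evanescent wave, and with it g, from vanishing at large momenta off the axis. -/

noncomputable section
namespace RegDirac

/-! ### Inertia of Hermitian matrices -/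

section Inertia

variable {n : Type*} [Fintype n]

/-- The real quadratic form `Re (z* B z)` of a complex matrix. -/
def quadForm (B : Matrix n n ℂ) (z : n → ℂ) : ℝ := (star z ⬝ᵥ B *ᵥ z).re

/-- `B` is negative definite on the subspace `W`. -/
def NegOn (B : Matrix n n ℂ) (W : Submodule ℂ (n → ℂ)) : Prop :=
  ∀ z ∈ W, z ≠ 0 → quadForm B z < 0

/-- The negative index of inertia: the largest dimension of a subspace on which `B` is negative
definite. -/
def negIndex (B : Matrix n n ℂ) : ℕ :=
  sSup {d | ∃ W : Submodule ℂ (n → ℂ), Module.finrank ℂ W = d ∧ NegOn B W}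

/-- The dimension of the kernel. -/
def nullity (B : Matrix n n ℂ) : ℕ := Module.finrank ℂ (LinearMap.ker B.mulVecLin)

theorem bddAbove_negIndex (B : Matrix n n ℂ) :
    BddAbove {d | ∃ W : Submodule ℂ (n → ℂ), Module.finrank ℂ W = d ∧ NegOn B W} := by
  refine ⟨Fintype.card n, ?_⟩
  rintro d ⟨W, rfl, -⟩
  simpa using Submodule.finrank_le W

theorem NegOn.le_negIndex {B : Matrix n n ℂ} {W : Submodule ℂ (n → ℂ)} (h : NegOn B W) :
    Module.finrank ℂ W ≤ negIndex B :=
  le_csSup (bddAbove_negIndex B) ⟨W, rfl, h⟩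

theorem exists_negOn (B : Matrix n n ℂ) :
    ∃ W : Submodule ℂ (n → ℂ), Module.finrank ℂ W = negIndex B ∧ NegOn B W := by
  refine Nat.sSup_mem ?_ (bddAbove_negIndex B)
  exact ⟨0, ⊥, by simp, fun z hz hz0 => absurd ((Submodule.mem_bot ℂ).1 hz) hz0⟩

theorem quadForm_neg (B : Matrix n n ℂ) (z : n → ℂ) : quadForm (-B) z = -quadForm B z := by
  simp [quadForm, Matrix.neg_mulVec]

theorem quadForm_sub (B B' : Matrix n n ℂ) (z : n → ℂ) :
    quadForm (B - B') z = quadForm B z - quadForm B' z := by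
  simp [quadForm, Matrix.sub_mulVec]

theorem quadForm_congr {l : Type*} [Fintype l] (B : Matrix n n ℂ) (P : Matrix n l ℂ) (z : l → ℂ) :
    quadForm (Pᴴ * B * P) z = quadForm B (P *ᵥ z) := by
  simp only [quadForm, Matrix.mul_assoc]
  rw [← Matrix.mulVec_mulVec, ← Matrix.mulVec_mulVec, Matrix.star_mulVec,
    ← Matrix.dotProduct_mulVec]

theorem quadForm_add_ker {B : Matrix n n ℂ} (hB : B.IsHermitian) (z w : n → ℂ)
    (hw : B *ᵥ w = 0) : quadForm B (z + w) = quadForm B z := by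
  have h : star w ⬝ᵥ B *ᵥ z = 0 := by
    rw [Matrix.dotProduct_mulVec, ← hB.eq, ← Matrix.star_mulVec, hw]; simp
  simp [quadForm, Matrix.mulVec_add, hw, h]

theorem quadForm_zero (B : Matrix n n ℂ) : quadForm B 0 = 0 := by simp [quadForm]

theorem finrank_add_le_of_disjoint {W W' : Submodule ℂ (n → ℂ)} (h : W ⊓ W' = ⊥) :
    Module.finrank ℂ W + Module.finrank ℂ W' ≤ Fintype.card n := by
  have := Submodule.finrank_sup_add_finrank_inf_eq W W'
  rw [h, finrank_bot, add_zero] at this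
  rw [← this]
  simpa using Submodule.finrank_le (W ⊔ W')

/-- A negative subspace meets the sum of the kernel and a positive subspace only in 0, because
adding a kernel vector does not change the form. So the three dimensions fit into the whole space.
-/
theorem negIndex_add_le {B : Matrix n n ℂ} (hB : B.IsHermitian) :
    negIndex B + nullity B + negIndex (-B) ≤ Fintype.card n := by
  obtain ⟨W, hW, hWn⟩ := exists_negOn B
  obtain ⟨W', hW', hWn'⟩ := exists_negOn (-B)
  have h1 : LinearMap.ker B.mulVecLin ⊓ W' = ⊥ := by
    rw [eq_bot_iff]
    rintro z ⟨hz, hz'⟩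
    by_contra hne
    have h2 := hWn' z hz' hne
    have h3 : quadForm B z = 0 := by
      have : B *ᵥ z = 0 := by simpa using hz
      simp [quadForm, this]
    rw [quadForm_neg, h3] at h2
    simp at h2
  have h2 : W ⊓ (LinearMap.ker B.mulVecLin ⊔ W') = ⊥ := by
    rw [eq_bot_iff]
    rintro z ⟨hz, hz'⟩
    by_contra hne
    have h3 := hWn z hz hne
    obtain ⟨u, hu, v, hv, rfl⟩ := Submodule.mem_sup.1 hz'
    have hu' : B *ᵥ u = 0 := by simpa using hu
    rw [add_comm, quadForm_add_ker hB v u hu'] at h3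
    by_cases hv0 : v = 0
    · rw [hv0, quadForm_zero] at h3; exact lt_irrefl _ h3
    · have := hWn' v hv hv0
      rw [quadForm_neg] at this
      linarith
  have h3 := Submodule.finrank_sup_add_finrank_inf_eq (LinearMap.ker B.mulVecLin) W'
  rw [h1, finrank_bot, add_zero] at h3
  have h4 := finrank_add_le_of_disjoint h2
  rw [h3, hW, hW'] at h4
  unfold nullity
  omega

theorem finrank_span_single [DecidableEq n] (s : Finset n) :
    Module.finrank ℂ (Submodule.span ℂ ((fun i => (Pi.single i 1 : n → ℂ)) '' (s : Set n))) =
      s.card := by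
  have hli : LinearIndependent ℂ (fun i : n => (Pi.single i 1 : n → ℂ)) := by
    have := (Pi.basisFun ℂ n).linearIndependent
    have h : ⇑(Pi.basisFun ℂ n) = fun i : n => (Pi.single i 1 : n → ℂ) := by
      ext i j; simp
    rwa [h] at this
  have h : LinearIndependent ℂ (fun i : s => (Pi.single (i : n) 1 : n → ℂ)) :=
    hli.comp _ Subtype.val_injective
  have := finrank_span_eq_card h
  rw [← Fintype.card_coe s, ← this, Set.image_eq_range]
  rfl

theorem apply_eq_zero_of_mem_span_single [DecidableEq n] {s : Finset n} {z : n → ℂ}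
    (hz : z ∈ Submodule.span ℂ ((fun i => (Pi.single i 1 : n → ℂ)) '' (s : Set n))) {i : n}
    (hi : i ∉ s) : z i = 0 := by
  induction hz using Submodule.span_induction with
  | mem x h =>
    obtain ⟨j, hj, rfl⟩ := h
    have : i ≠ j := fun h => hi (h ▸ hj)
    simp [this]
  | zero => rfl
  | add x y _ _ hx hy => simp [hx, hy]
  | smul a x _ hx => simp [hx]

theorem quadForm_diagonal [DecidableEq n] (d : n → ℝ) (z : n → ℂ) :
    quadForm (diagonal fun i => (d i : ℂ)) z = ∑ i, d i * ‖z i‖ ^ 2 := by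
  simp only [quadForm, dotProduct, mulVec_diagonal, Complex.re_sum, Pi.star_apply, RCLike.star_def]
  refine Finset.sum_congr rfl fun i _ => ?_
  have : (starRingEnd ℂ) (z i) * ((d i : ℂ) * z i) = ((d i * ‖z i‖ ^ 2 : ℝ) : ℂ) := by
    rw [mul_left_comm, Complex.conj_mul']; push_cast; ring
  rw [this, Complex.ofReal_re]

theorem card_le_negIndex_diagonal [DecidableEq n] (d : n → ℝ) :
    (Finset.univ.filter fun i => d i < 0).card ≤ negIndex (diagonal fun i => (d i : ℂ)) := by
  rw [← finrank_span_single]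
  refine NegOn.le_negIndex fun z hz hz0 => ?_
  rw [quadForm_diagonal]
  obtain ⟨i, hi⟩ := Function.ne_iff.1 hz0
  have hzero : ∀ j, ¬ d j < 0 → z j = 0 := fun j hj =>
    apply_eq_zero_of_mem_span_single hz (by simpa using hj)
  refine Finset.sum_neg' (fun j _ => ?_) ⟨i, Finset.mem_univ _, ?_⟩
  · by_cases hj : d j < 0
    · nlinarith [sq_nonneg ‖z j‖]
    · simp [hzero j hj]
  · have : d i < 0 := by_contra fun h => hi (hzero i h)
    have hp : 0 < ‖z i‖ := norm_pos_iff.2 hi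
    nlinarith [pow_pos hp 2]

theorem negIndex_le_congr {l : Type*} [Fintype l] (B : Matrix n n ℂ) (P : Matrix n l ℂ)
    (hP : Function.Injective P.mulVec) : negIndex (Pᴴ * B * P) ≤ negIndex B := by
  obtain ⟨W, hW, hWn⟩ := exists_negOn (Pᴴ * B * P)
  have hinj : Function.Injective P.mulVecLin := hP
  rw [← hW, (Submodule.equivMapOfInjective _ hinj W).finrank_eq]
  refine NegOn.le_negIndex ?_
  rintro _ ⟨z, hz, rfl⟩ hne
  have hz0 : z ≠ 0 := by rintro rfl; simp at hne
  simpa [quadForm_congr] using hWn z hz hz0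

/-- Sylvester's law of inertia: an injective change of variables carries negative subspaces to
negative subspaces, and this applies to `P` and to its inverse. -/
theorem negIndex_congr [DecidableEq n] (B P : Matrix n n ℂ) (hP : IsUnit P) :
    negIndex (Pᴴ * B * P) = negIndex B := by
  refine le_antisymm (negIndex_le_congr B P (mulVec_injective_of_isUnit hP)) ?_
  have hdet : IsUnit P.det := (Matrix.isUnit_iff_isUnit_det P).1 hP
  have hP' : IsUnit P⁻¹ := by rw [Matrix.isUnit_nonsing_inv_iff]; exact hP
  have := negIndex_le_congr (Pᴴ * B * P) P⁻¹ (mulVec_injective_of_isUnit hP')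
  have h2 : (P⁻¹)ᴴ * (Pᴴ * B * P) * P⁻¹ = B := by
    have h3 : (P⁻¹)ᴴ * Pᴴ = 1 := by
      rw [← conjTranspose_mul, Matrix.mul_nonsing_inv _ hdet, conjTranspose_one]
    calc (P⁻¹)ᴴ * (Pᴴ * B * P) * P⁻¹ = ((P⁻¹)ᴴ * Pᴴ) * B * (P * P⁻¹) := by
          simp only [Matrix.mul_assoc]
      _ = B := by rw [h3, Matrix.mul_nonsing_inv _ hdet]; simp
  rwa [h2] at this

/-- The inertia of a Hermitian matrix adds up to its size. -/
theorem negIndex_add_eq [DecidableEq n] {B : Matrix n n ℂ} (hB : B.IsHermitian) :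
    negIndex B + nullity B + negIndex (-B) = Fintype.card n := by
  refine le_antisymm (negIndex_add_le hB) ?_
  set U : Matrix n n ℂ := (hB.eigenvectorUnitary : Matrix n n ℂ) with hU
  have hUu : IsUnit U := by
    have := Unitary.isUnit_coe (U := hB.eigenvectorUnitary)
    exact this
  have hdiag : Uᴴ * B * U = diagonal fun i => (hB.eigenvalues i : ℂ) := by
    have := hB.conjStarAlgAut_star_eigenvectorUnitary
    rw [Unitary.conjStarAlgAut_apply] at this
    simpa [Matrix.star_eq_conjTranspose, Function.comp_def] using this
  -- In the eigenbasis the coordinate subspaces bound both indices from below by eigenvalue counts;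
  -- together with the zero eigenvalues these counts exhaust the dimension, which meets the upper
  -- bound.
  have h1 := card_le_negIndex_diagonal hB.eigenvalues
  have h2 := card_le_negIndex_diagonal (fun i => -hB.eigenvalues i)
  rw [← hdiag, negIndex_congr _ _ hUu] at h1
  have h3 : (diagonal fun i => ((-hB.eigenvalues i : ℝ) : ℂ)) = Uᴴ * (-B) * U := by
    rw [Matrix.mul_neg, Matrix.neg_mul, hdiag]
    ext i j; by_cases h : i = j <;> simp [h]
  rw [h3, negIndex_congr _ _ hUu] at h2
  have h4 : nullity B = (Finset.univ.filter fun i => hB.eigenvalues i = 0).card := by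
    have hr := hB.rank_eq_card_non_zero_eigs
    have hk := LinearMap.finrank_range_add_finrank_ker B.mulVecLin
    rw [Module.finrank_fintype_fun_eq_card] at hk
    change B.rank + nullity B = _ at hk
    have hf : Fintype.card {i // hB.eigenvalues i ≠ 0} =
        (Finset.univ.filter fun i => ¬ hB.eigenvalues i = 0).card := by
      rw [Fintype.card_subtype]
    rw [hr, hf] at hk
    have := Finset.card_filter_add_card_filter_not (s := (Finset.univ : Finset n))
      (fun i => hB.eigenvalues i = 0)
    rw [Finset.card_univ] at this
    omega
  have h5 : Fintype.card n = (Finset.univ.filter fun i => hB.eigenvalues i < 0).card +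
      (Finset.univ.filter fun i => hB.eigenvalues i = 0).card +
      (Finset.univ.filter fun i => -hB.eigenvalues i < 0).card := by
    rw [← Finset.card_union_of_disjoint, ← Finset.card_union_of_disjoint, ← Finset.card_univ]
    · congr 1; ext i
      rcases lt_trichotomy (hB.eigenvalues i) 0 with h | h | h <;> simp [h]
    · rw [Finset.disjoint_left]; intro i; simp only [Finset.mem_union, Finset.mem_filter]
      rintro (⟨_, h⟩ | ⟨_, h⟩) ⟨_, h'⟩ <;> linarith
    · rw [Finset.disjoint_left]; intro i; simp only [Finset.mem_filter]
      rintro ⟨_, h⟩ ⟨_, h'⟩; linarith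
  omega

/-- Quadratic forms of a matrix and a small perturbation on the sphere of a subspace. -/
theorem eventually_negOn (B : Matrix n n ℂ) {W : Submodule ℂ (n → ℂ)} (hW : NegOn B W) :
    ∀ᶠ B' in 𝓝 B, NegOn B' W := by
  -- Compactness of the unit sphere of `W` makes strict negativity stable under small perturbations
  -- of the matrix; homogeneity extends it to all of `W`.
  have hcomp : IsCompact {z : n → ℂ | z ∈ W ∧ ‖z‖ = 1} := by
    have h1 : IsClosed (W : Set (n → ℂ)) := Submodule.closed_of_finiteDimensional W
    have : {z : n → ℂ | z ∈ W ∧ ‖z‖ = 1} = Metric.sphere 0 1 ∩ (W : Set (n → ℂ)) := by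
      ext z; simp [and_comm]
    rw [this]
    exact (isCompact_sphere 0 1).inter_right h1
  have hcont : Continuous fun p : Matrix n n ℂ × (n → ℂ) => quadForm p.1 p.2 := by
    unfold quadForm
    refine Complex.continuous_re.comp ?_
    exact Continuous.dotProduct (continuous_snd.star)
      (Continuous.matrix_mulVec continuous_fst continuous_snd)
  have h := hcomp.eventually_forall_of_forall_eventually (x₀ := B)
    (P := fun B' z => quadForm B' z < 0) (by
      intro z hz
      have hz0 : z ≠ 0 := by rintro rfl; simp at hz
      exact (hcont.tendsto (B, z)).eventually_lt_const (hW z hz.1 hz0))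
  filter_upwards [h] with B' hB' z hz hz0
  have hn : 0 < ‖z‖ := norm_pos_iff.2 hz0
  have h1 := hB' ((‖z‖⁻¹ : ℂ) • z) ⟨W.smul_mem _ hz, by
    rw [norm_smul]; simp [hn.ne']⟩
  have h2 : quadForm B' ((‖z‖⁻¹ : ℂ) • z) = ‖z‖⁻¹ ^ 2 * quadForm B' z := by
    unfold quadForm
    rw [Matrix.mulVec_smul, star_smul, smul_dotProduct, dotProduct_smul, smul_smul]
    have : (star (‖z‖⁻¹ : ℂ) * (‖z‖⁻¹ : ℂ)) = ((‖z‖⁻¹ ^ 2 : ℝ) : ℂ) := by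
      simp; ring
    rw [this, smul_eq_mul, Complex.re_ofReal_mul]
  rw [h2] at h1
  by_contra hcon
  have : 0 ≤ ‖z‖⁻¹ ^ 2 * quadForm B' z := mul_nonneg (by positivity) (not_lt.1 hcon)
  linarith

/-- Lower semicontinuity: under a small perturbation negative directions stay negative, so the index
can only grow, at the expense of the kernel. -/
theorem eventually_negIndex_le (B : Matrix n n ℂ) : ∀ᶠ B' in 𝓝 B, negIndex B ≤ negIndex B' := by
  obtain ⟨W, hW, hWn⟩ := exists_negOn B
  filter_upwards [eventually_negOn B hWn] with B' h
  rw [← hW]; exact h.le_negIndex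

theorem eventually_negIndex_neg_le (B : Matrix n n ℂ) :
    ∀ᶠ B' in 𝓝 B, negIndex (-B) ≤ negIndex (-B') :=
  (continuous_neg.tendsto B).eventually (eventually_negIndex_le (-B))

/-- Near a Hermitian matrix, Hermitian matrices of the same nullity have the same inertia. -/
theorem eventually_negIndex_eq [DecidableEq n] {B : Matrix n n ℂ} (hB : B.IsHermitian) :
    ∀ᶠ B' in 𝓝 B, B'.IsHermitian → nullity B' = nullity B → negIndex B' = negIndex B := by
  filter_upwards [eventually_negIndex_le B, eventually_negIndex_neg_le B] with B' h1 h2 hB' h3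
  have := negIndex_add_eq hB
  have := negIndex_add_eq hB'
  omega

theorem nullity_eq_zero_iff [DecidableEq n] (B : Matrix n n ℂ) : nullity B = 0 ↔ B.det ≠ 0 := by
  unfold nullity
  rw [Submodule.finrank_eq_zero, LinearMap.ker_eq_bot, ← isUnit_iff_ne_zero,
    ← Matrix.isUnit_iff_isUnit_det]
  exact Matrix.mulVec_injective_iff_isUnit

theorem eventually_negIndex_eq_of_det_ne_zero [DecidableEq n] {B : Matrix n n ℂ} (hB : B.IsHermitian)
    (hdet : B.det ≠ 0) :
    ∀ᶠ B' in 𝓝 B, B'.IsHermitian → B'.det ≠ 0 ∧ negIndex B' = negIndex B := by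
  have hc : ∀ᶠ B' in 𝓝 B, B'.det ≠ 0 :=
    (Continuous.matrix_det continuous_id).tendsto B |>.eventually_ne hdet
  filter_upwards [eventually_negIndex_eq hB, hc] with B' h1 h2 hB'
  exact ⟨h2, h1 hB' (by rw [(nullity_eq_zero_iff B').2 h2, (nullity_eq_zero_iff B).2 hdet])⟩

/-- Monotonicity: if `B ≤ B'`, and strictly so on the kernel of `B'`, the negative index of `B`
exceeds that of `B'` at least by the nullity of `B'`. -/
theorem negIndex_add_nullity_le {B B' : Matrix n n ℂ} (hB' : B'.IsHermitian)
    (hle : ∀ z, quadForm B z ≤ quadForm B' z)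
    (hlt : ∀ z, z ≠ 0 → B' *ᵥ z = 0 → quadForm B z < 0) :
    negIndex B' + nullity B' ≤ negIndex B := by
  obtain ⟨W, hW, hWn⟩ := exists_negOn B'
  have h1 : W ⊓ LinearMap.ker B'.mulVecLin = ⊥ := by
    rw [eq_bot_iff]
    rintro z ⟨hz, hz'⟩
    by_contra hne
    have h2 := hWn z hz hne
    have : B' *ᵥ z = 0 := by simpa using hz'
    simp [quadForm, this] at h2
  have h3 := Submodule.finrank_sup_add_finrank_inf_eq W (LinearMap.ker B'.mulVecLin)
  rw [h1, finrank_bot, add_zero, hW] at h3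
  unfold nullity
  rw [← h3]
  refine NegOn.le_negIndex fun z hz hz0 => ?_
  -- The test space is `W` plus the kernel of `B'`. On `u + v` the form of `B'` sees only `u`, so it
  -- is negative unless `u = 0`, where the strictness on the kernel takes over.
  obtain ⟨u, hu, v, hv, rfl⟩ := Submodule.mem_sup.1 hz
  have hv' : B' *ᵥ v = 0 := by simpa using hv
  by_cases hu0 : u = 0
  · subst hu0
    rw [zero_add] at hz0 ⊢
    exact hlt v hz0 hv'
  · calc quadForm B (u + v) ≤ quadForm B' (u + v) := hle _
      _ = quadForm B' u := quadForm_add_ker hB' u v hv'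
      _ < 0 := hWn u hu hu0

theorem negIndex_le_of_le {B B' : Matrix n n ℂ} (hle : ∀ z, quadForm B z ≤ quadForm B' z) :
    negIndex B' ≤ negIndex B := by
  obtain ⟨W, hW, hWn⟩ := exists_negOn B'
  rw [← hW]
  exact NegOn.le_negIndex fun z hz hz0 => (hle z).trans_lt (hWn z hz hz0)

end Inertia

end RegDirac
end

noncomputable section
namespace RegDirac

/-! ### Integer-valued functions with one-sided limits -/


/-- The sum of the jumps of a piecewise constant function. -/
theorem finsum_jump {ν L R : ℝ → ℤ} {a b : ℝ} (hab : a < b)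
    (hL : ∀ x ∈ Ioc a b, ∀ᶠ y in 𝓝[<] x, ν y = L x)
    (hR : ∀ x ∈ Ico a b, ∀ᶠ y in 𝓝[>] x, ν y = R x) :
    (Ioo a b ∩ Function.support fun x => R x - L x).Finite ∧
      ∑ᶠ x ∈ Ioo a b, (R x - L x) = L b - R a := by
  set f : ℝ → ℤ := fun x => R x - L x with hf
  -- `Q t` is the claim on the interval (a, t). It holds for `t` close to `a`, and its truth value
  -- is locally constant in `t`, so it reaches `b` by connectedness.
  set Q : ℝ → Prop := fun t => (Ioo a t ∩ Function.support f).Finite ∧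
    ∑ᶠ x ∈ Ioo a t, f x = L t - R a with hQ
  -- values on an interval where `ν` is constant
  have key : ∀ t y : ℝ, ∀ c : ℤ, a ≤ t → t < y → y ≤ b → (∀ z ∈ Ioo t y, ν z = c) →
      R t = c ∧ L y = c ∧ ∀ z ∈ Ioo t y, f z = 0 := by
    intro t y c hat hty hyb hc
    refine ⟨?_, ?_, ?_⟩
    · obtain ⟨z, h1, h2⟩ := ((hR t ⟨hat, hty.trans_le hyb⟩).and (Ioo_mem_nhdsGT hty)).exists
      rw [← h1, hc z h2]
    · obtain ⟨z, h1, h2⟩ := ((hL y ⟨hat.trans_lt hty, hyb⟩).and (Ioo_mem_nhdsLT hty)).exists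
      rw [← h1, hc z h2]
    · intro z hz
      obtain ⟨u, h1, h2⟩ := ((hR z ⟨hat.trans hz.1.le, hz.2.trans_le hyb⟩).and
        (Ioo_mem_nhdsGT hz.2)).exists
      obtain ⟨v, h3, h4⟩ := ((hL z ⟨hat.trans_lt hz.1, (hz.2.trans_le hyb).le⟩).and
        (Ioo_mem_nhdsLT hz.1)).exists
      simp only [hf]
      rw [← h1, ← h3, hc u ⟨hz.1.trans h2.1, h2.2⟩, hc v ⟨h4.1, h4.2.trans hz.2⟩, sub_self]
  -- Across an interval (t, y) of constancy only the point `t` is added to the sum, and its jump is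
  -- exactly the change of the left limit from `t` to `y`.
  have step : ∀ t y : ℝ, ∀ c : ℤ, a < t → t < y → y ≤ b → (∀ z ∈ Ioo t y, ν z = c) →
      (Q t ↔ Q y) := by
    intro t y c hat hty hyb hc
    obtain ⟨h1, h2, h3⟩ := key t y c hat.le hty hyb hc
    have hset : Ioo a y ∩ Function.support f = (insert t (Ioo a t)) ∩ Function.support f := by
      ext z
      simp only [mem_inter_iff, mem_Ioo, mem_insert_iff, Function.mem_support]
      constructor
      · rintro ⟨⟨hz1, hz2⟩, hz3⟩
        refine ⟨?_, hz3⟩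
        rcases lt_trichotomy z t with h | h | h
        · exact Or.inr ⟨hz1, h⟩
        · exact Or.inl h
        · exact absurd (h3 z ⟨h, hz2⟩) hz3
      · rintro ⟨rfl | ⟨hz1, hz2⟩, hz3⟩
        · exact ⟨⟨hat, hty⟩, hz3⟩
        · exact ⟨⟨hz1, hz2.trans hty⟩, hz3⟩
    have hfin : (Ioo a y ∩ Function.support f).Finite ↔ (Ioo a t ∩ Function.support f).Finite := by
      rw [hset]
      constructor
      · exact fun h => h.subset (inter_subset_inter_left _ (subset_insert _ _))
      · intro h
        refine (h.insert t).subset ?_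
        rintro z ⟨hz1 | hz1, hz2⟩
        · exact Or.inl hz1
        · exact Or.inr ⟨hz1, hz2⟩
    have hsum : (Ioo a t ∩ Function.support f).Finite →
        ∑ᶠ x ∈ Ioo a y, f x = f t + ∑ᶠ x ∈ Ioo a t, f x := by
      intro h
      rw [finsum_mem_inter_support_eq f _ _ hset,
        finsum_mem_insert' f (by simp) h]
    simp only [hQ]
    rw [hfin]
    refine and_congr_right fun h => ?_
    rw [hsum h, h2, ← h1]
    simp only [hf]
    constructor <;> intro h' <;> linarith
  have hloc : ∀ x ∈ Ioc a b, ∀ᶠ y in 𝓝[Ioc a b] x, (Q x → Q y) ∧ (Q y → Q x) := by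
    intro x hx
    have hleft : ∀ᶠ y in 𝓝[<] x, y ∈ Ioc a b → (Q x ↔ Q y) := by
      obtain ⟨l, hl, hl'⟩ := mem_nhdsLT_iff_exists_Ioo_subset.1 (hL x hx)
      filter_upwards [Ioo_mem_nhdsLT hl] with y hy hyab
      exact (step y x (L x) hyab.1 hy.2 hx.2 fun z hz => hl' ⟨hy.1.trans hz.1, hz.2⟩).symm
    have hright : ∀ᶠ y in 𝓝[>] x, y ∈ Ioc a b → (Q x ↔ Q y) := by
      rcases hx.2.eq_or_lt with rfl | hxb
      · filter_upwards [self_mem_nhdsWithin] with y hy hyab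
        exact absurd hyab.2 (not_le.2 hy)
      · obtain ⟨r, hr, hr'⟩ := mem_nhdsGT_iff_exists_Ioo_subset.1 (hR x ⟨hx.1.le, hxb⟩)
        filter_upwards [Ioo_mem_nhdsGT hr] with y hy hyab
        exact step x y (R x) hx.1 hy.1 hyab.2 fun z hz => hr' ⟨hz.1, hz.2.trans hy.2⟩
    have h3 : ∀ᶠ y in 𝓝[≠] x, y ∈ Ioc a b → (Q x ↔ Q y) := by
      rw [← Iio_union_Ioi, nhdsWithin_union]
      exact eventually_sup.2 ⟨hleft, hright⟩
    have h4 : ∀ᶠ y in 𝓝 x, y ∈ Ioc a b → (Q x ↔ Q y) := by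
      rw [eventually_nhdsWithin_iff] at h3
      filter_upwards [h3] with y hy hyab
      by_cases h : y = x
      · rw [h]
      · exact hy h hyab
    filter_upwards [eventually_nhdsWithin_of_eventually_nhds h4, self_mem_nhdsWithin] with y hy hyab
    exact ⟨(hy hyab).1, (hy hyab).2⟩
  obtain ⟨r, hr, hr'⟩ := mem_nhdsGT_iff_exists_Ioo_subset.1 (hR a ⟨le_rfl, hab⟩)
  set y₀ := min ((a + r) / 2) b with hy₀
  have hr0 : a < r := hr
  have hay : a < y₀ := lt_min (by linarith) hab
  have hyr : y₀ < r := (min_le_left _ _).trans_lt (by linarith)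
  have hQ0 : Q y₀ := by
    obtain ⟨h1, h2, h3⟩ := key a y₀ (R a) le_rfl hay (min_le_right _ _)
      fun z hz => hr' ⟨hz.1, hz.2.trans hyr⟩
    have hempty : Ioo a y₀ ∩ Function.support f = ∅ := by
      ext z; simp only [mem_inter_iff, Function.mem_support, mem_empty_iff_false, iff_false]
      rintro ⟨hz, hz'⟩; exact hz' (h3 z hz)
    refine ⟨by rw [hempty]; exact finite_empty, ?_⟩
    rw [finsum_mem_congr rfl h3, finsum_mem_zero, h2, sub_self]
  have := isPreconnected_Ioc.induction₂ (s := Ioc a b) (fun x y => (Q x → Q y) ∧ (Q y → Q x))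
    hloc (fun x y z _ _ _ h1 h2 => ⟨h2.1 ∘ h1.1, h1.2 ∘ h2.2⟩) (fun x y _ _ h => ⟨h.2, h.1⟩)
    (x := y₀) (y := b) ⟨hay, min_le_right _ _⟩ ⟨hab, le_rfl⟩
  exact this.1 hQ0

/-- The sum of all jumps of a piecewise constant function on the line. -/
theorem finsum_jump_univ {ν L R : ℝ → ℤ} {Lb Ra : ℤ}
    (hL : ∀ x, ∀ᶠ y in 𝓝[<] x, ν y = L x) (hR : ∀ x, ∀ᶠ y in 𝓝[>] x, ν y = R x)
    (htop : ∀ᶠ y in atTop, ν y = Lb) (hbot : ∀ᶠ y in atBot, ν y = Ra) :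
    ∃ s : Set ℝ, s.Finite ∧ (∀ x ∉ s, ν x = L x ∧ ν x = R x) ∧
      ∑ᶠ x, (R x - L x) = Lb - Ra := by
  obtain ⟨b, hb⟩ := eventually_atTop.1 htop
  obtain ⟨a, ha⟩ := eventually_atBot.1 hbot
  -- The margin puts both endpoints strictly inside the regions where `ν` is constant, so the
  -- one-sided limits there are the values at infinity.
  set a' := min a b - 1 with ha'
  set b' := max a b + 1 with hb'
  have h1 : a' < b' := by have := min_le_max (a := a) (b := b); linarith
  have hbb : b < b' := by have := le_max_right a b; linarith
  have haa : a' < a := by have := min_le_left a b; linarith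
  have hval : ∀ x, b < x → L x = Lb ∧ R x = Lb := by
    intro x hx
    obtain ⟨z, h2, h3⟩ := ((hL x).and (Ioo_mem_nhdsLT hx)).exists
    obtain ⟨z', h2', h3'⟩ := ((hR x).and self_mem_nhdsWithin).exists
    exact ⟨by rw [← h2, hb z h3.1.le], by rw [← h2', hb z' (hx.trans h3').le]⟩
  have hval' : ∀ x, x < a → L x = Ra ∧ R x = Ra := by
    intro x hx
    obtain ⟨z, h2, h3⟩ := ((hR x).and (Ioo_mem_nhdsGT hx)).exists
    obtain ⟨z', h2', h3'⟩ := ((hL x).and self_mem_nhdsWithin).exists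
    exact ⟨by rw [← h2', ha z' (lt_trans h3' hx).le], by rw [← h2, ha z h3.2.le]⟩
  -- the points where `ν` is not locally constant are isolated
  have hiso : ∀ x : ℝ, ∀ᶠ y in 𝓝[≠] x, ν y = L y ∧ ν y = R y := by
    have aux : ∀ y (u v : ℝ) (c : ℤ), u < y → y < v → (∀ z ∈ Ioo u v, ν z = c) →
        ν y = L y ∧ ν y = R y := by
      intro y u v c huy hyv hc
      obtain ⟨z, h2, h3⟩ := ((hL y).and (Ioo_mem_nhdsLT huy)).exists
      obtain ⟨z', h2', h3'⟩ := ((hR y).and (Ioo_mem_nhdsGT hyv)).exists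
      rw [← h2, ← h2', hc y ⟨huy, hyv⟩, hc z ⟨h3.1, h3.2.trans hyv⟩,
        hc z' ⟨huy.trans h3'.1, h3'.2⟩]
      exact ⟨rfl, rfl⟩
    intro x
    rw [← Iio_union_Ioi, nhdsWithin_union]
    refine eventually_sup.2 ⟨?_, ?_⟩
    · obtain ⟨l, hl, hl'⟩ := mem_nhdsLT_iff_exists_Ioo_subset.1 (hL x)
      filter_upwards [Ioo_mem_nhdsLT hl] with y hy
      exact aux y l x (L x) hy.1 hy.2 fun z hz => hl' hz
    · obtain ⟨r, hr, hr'⟩ := mem_nhdsGT_iff_exists_Ioo_subset.1 (hR x)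
      filter_upwards [Ioo_mem_nhdsGT hr] with y hy
      exact aux y x r (R x) hy.1 hy.2 fun z hz => hr' hz
  set s : Set ℝ := {x | ¬ (ν x = L x ∧ ν x = R x)} with hs
  have hsub : s ⊆ Icc a b := by
    intro x hx
    by_contra hcon
    rw [mem_Icc, not_and_or, not_le, not_le] at hcon
    rcases hcon with h | h
    · exact hx ⟨by rw [ha x h.le, (hval' x h).1], by rw [ha x h.le, (hval' x h).2]⟩
    · exact hx ⟨by rw [hb x h.le, (hval x h).1], by rw [hb x h.le, (hval x h).2]⟩
  -- The exceptional points lie in a compact interval, so infinitely many of them would accumulate;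
  -- but each point has a punctured neighbourhood free of them.
  have hsfin : s.Finite := by
    by_contra hinf
    obtain ⟨x, -, hx⟩ := (Set.Infinite.exists_accPt_of_subset_isCompact hinf isCompact_Icc hsub)
    rw [accPt_iff_frequently_nhdsNE] at hx
    exact hx ((hiso x).mono fun y hy h => h hy)
  refine ⟨s, hsfin, fun x hx => not_not.1 hx, ?_⟩
  obtain ⟨-, h3⟩ := finsum_jump h1 (fun x _ => hL x) (fun x _ => hR x)
  rw [(hval b' hbb).1, (hval' a' haa).2] at h3
  rw [← h3, ← finsum_mem_univ]
  refine finsum_mem_inter_support_eq _ _ _ ?_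
  ext x
  simp only [univ_inter, mem_inter_iff, Function.mem_support]
  refine ⟨fun h => ⟨?_, h⟩, fun h => h.2⟩
  have hxs : x ∈ s := fun h' => h (by rw [← h'.1, ← h'.2, sub_self])
  have := hsub hxs
  exact ⟨haa.trans_le this.1, this.2.trans_lt hbb⟩

/-! ### Tame functions -/

/-- The functions `f` such that `t ↦ f (φ t)` extends meromorphically from small `t > 0` to `t = 0`.
Used with `φ t = k₀ ± t` and `φ t = ± 1 / t`. -/
def tameRing (φ : ℝ → ℝ) : Subring (ℝ → ℂ) where
  carrier := {f | ∃ F : ℝ → ℂ, MeromorphicAt F 0 ∧ ∀ᶠ t in 𝓝[>] (0 : ℝ), f (φ t) = F t}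
  mul_mem' := by
    rintro f g ⟨F, hF, h1⟩ ⟨G, hG, h2⟩
    refine ⟨F * G, hF.mul hG, ?_⟩
    filter_upwards [h1, h2] with t h1 h2
    simp [h1, h2]
  one_mem' := ⟨fun _ => 1, MeromorphicAt.const 1 0, by simp⟩
  add_mem' := by
    rintro f g ⟨F, hF, h1⟩ ⟨G, hG, h2⟩
    refine ⟨F + G, hF.add hG, ?_⟩
    filter_upwards [h1, h2] with t h1 h2
    simp [h1, h2]
  zero_mem' := ⟨fun _ => 0, MeromorphicAt.const 0 0, by simp⟩
  neg_mem' := by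
    rintro f ⟨F, hF, h1⟩
    refine ⟨-F, hF.neg, ?_⟩
    filter_upwards [h1] with t h1
    simp [h1]

theorem tameRing_inv {φ : ℝ → ℝ} {f : ℝ → ℂ} (hf : f ∈ tameRing φ) : f⁻¹ ∈ tameRing φ := by
  obtain ⟨F, hF, h1⟩ := hf
  refine ⟨F⁻¹, hF.inv, ?_⟩
  filter_upwards [h1] with t h1
  simp [h1]

theorem tameRing_const {φ : ℝ → ℝ} (c : ℂ) : (fun _ => c) ∈ tameRing φ :=
  ⟨fun _ => c, MeromorphicAt.const c 0, by simp⟩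

/-- A meromorphic germ either vanishes identically near 0 or has no zeros in a punctured
neighbourhood. -/
theorem tameRing_dichotomy {φ : ℝ → ℝ} {f : ℝ → ℂ} (hf : f ∈ tameRing φ) :
    (∀ᶠ t in 𝓝[>] (0 : ℝ), f (φ t) = 0) ∨ ∀ᶠ t in 𝓝[>] (0 : ℝ), f (φ t) ≠ 0 := by
  obtain ⟨F, hF, h1⟩ := hf
  have hle : 𝓝[>] (0 : ℝ) ≤ 𝓝[≠] 0 := nhdsWithin_mono _ fun x hx => (ne_of_gt hx)
  rcases hF.eventually_eq_zero_or_eventually_ne_zero with h | h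
  · left; filter_upwards [h1, hle h] with t h1 h2; rw [h1, h2]
  · right; filter_upwards [h1, hle h] with t h1 h2; rwa [h1]

/-- The family is a single matrix over the ring of tame functions, and evaluation at `k` is a ring
homomorphism, so it commutes with the characteristic polynomial. -/
theorem tameRing_charpoly_coeff {n : Type*} [Fintype n] [DecidableEq n] {φ : ℝ → ℝ}
    {B : ℝ → Matrix n n ℂ} (hB : ∀ i j, (fun k => B k i j) ∈ tameRing φ) (l : ℕ) :
    (fun k => (B k).charpoly.coeff l) ∈ tameRing φ := by
  set M : Matrix n n (tameRing φ) := Matrix.of fun i j => ⟨fun k => B k i j, hB i j⟩ with hM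
  have : (fun k => (B k).charpoly.coeff l) = ((M.charpoly.coeff l : tameRing φ) : ℝ → ℂ) := by
    funext k
    set ev : tameRing φ →+* ℂ := (Pi.evalRingHom (fun _ : ℝ => ℂ) k).comp (tameRing φ).subtype
    have hmap : B k = M.map ev := by
      ext i j; simp [hM, ev]
    rw [hmap, Matrix.charpoly_map, Polynomial.coeff_map]
    simp [ev]
  rw [this]
  exact (M.charpoly.coeff l).2

/-- For a Hermitian matrix the multiplicity of the root 0 of the characteristic polynomial is the
dimension of the kernel. This makes the nullity depend only on which coefficients vanish. -/
theorem nullity_eq_natTrailingDegree {n : Type*} [Fintype n] [DecidableEq n] {B : Matrix n n ℂ}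
    (hB : B.IsHermitian) : nullity B = B.charpoly.natTrailingDegree := by
  have hk := LinearMap.finrank_range_add_finrank_ker B.mulVecLin
  rw [Module.finrank_fintype_fun_eq_card] at hk
  change B.rank + nullity B = _ at hk
  have hr : B.rank = (Finset.univ.filter fun i => ¬ hB.eigenvalues i = 0).card := by
    rw [hB.rank_eq_card_non_zero_eigs, Fintype.card_subtype]
  have h1 := Finset.card_filter_add_card_filter_not (s := (Finset.univ : Finset n))
    (fun i => hB.eigenvalues i = 0)
  rw [Finset.card_univ] at h1
  have h2 : B.charpoly.rootMultiplicity 0 =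
      (Finset.univ.filter fun i => hB.eigenvalues i = 0).card := by
    rw [← Polynomial.count_roots, hB.roots_charpoly_eq_eigenvalues, Multiset.count_map,
      Finset.card_def, Finset.filter_val]
    congr 1
    refine Multiset.filter_congr fun i _ => ?_
    rw [Function.comp_apply, eq_comm, RCLike.ofReal_eq_zero]
  rw [← Polynomial.rootMultiplicity_eq_natTrailingDegree', h2]
  omega

/-- The nullity is read off from the support of the characteristic polynomial, and each coefficient
is eventually zero or eventually nonzero. -/
theorem eventually_nullity_eq {n : Type*} [Fintype n] [DecidableEq n] {φ : ℝ → ℝ}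
    {B : ℝ → Matrix n n ℂ} (hH : ∀ k, (B k).IsHermitian)
    (hB : ∀ i j, (fun k => B k i j) ∈ tameRing φ) :
    ∃ c : ℕ, ∀ᶠ t in 𝓝[>] (0 : ℝ), nullity (B (φ t)) = c := by
  have hdeg : ∀ k, (B k).charpoly.natDegree = Fintype.card n := fun k =>
    Matrix.charpoly_natDegree_eq_dim _
  have h1 : ∀ l ∈ Finset.range (Fintype.card n + 1), ∃ b : Prop,
      ∀ᶠ t in 𝓝[>] (0 : ℝ), ((B (φ t)).charpoly.coeff l = 0 ↔ b) := by
    intro l _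
    rcases tameRing_dichotomy (tameRing_charpoly_coeff hB l) with h | h
    · exact ⟨True, h.mono fun t ht => by simpa using ht⟩
    · exact ⟨False, h.mono fun t ht => by simpa using ht⟩
  choose! b hb using h1
  have h2 := (Finset.eventually_all (Finset.range (Fintype.card n + 1))).2 hb
  obtain ⟨t₀, ht₀⟩ := h2.exists
  refine ⟨nullity (B (φ t₀)), h2.mono fun t ht => ?_⟩
  have hsupp : (B (φ t)).charpoly.support = (B (φ t₀)).charpoly.support := by
    ext l
    rw [Polynomial.mem_support_iff, Polynomial.mem_support_iff]
    by_cases hl : l ∈ Finset.range (Fintype.card n + 1)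
    · rw [not_iff_not, ht l hl, ht₀ l hl]
    · have : Fintype.card n < l := by simpa using hl
      rw [Polynomial.coeff_eq_zero_of_natDegree_lt (by rwa [hdeg]),
        Polynomial.coeff_eq_zero_of_natDegree_lt (by rwa [hdeg])]
  rw [nullity_eq_natTrailingDegree (hH _), nullity_eq_natTrailingDegree (hH _)]
  unfold Polynomial.natTrailingDegree Polynomial.trailingDegree
  rw [hsupp]

/-- The inertia of a continuous tame family of Hermitian matrices is eventually constant. -/
theorem eventually_negIndex_const {n : Type*} [Fintype n] [DecidableEq n] {φ : ℝ → ℝ}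
    (hφ : ContinuousOn φ (Ioi 0))
    {B : ℝ → Matrix n n ℂ} (hH : ∀ k, (B k).IsHermitian) (hcont : Continuous B)
    (hB : ∀ i j, (fun k => B k i j) ∈ tameRing φ) :
    ∃ c : ℕ, ∀ᶠ t in 𝓝[>] (0 : ℝ), negIndex (B (φ t)) = c := by
  obtain ⟨c, hc⟩ := eventually_nullity_eq hH hB
  obtain ⟨r, hr, hr'⟩ := mem_nhdsGT_iff_exists_Ioo_subset.1 hc
  have hr0 : (0 : ℝ) < r := hr
  refine ⟨negIndex (B (φ (r / 2))), ?_⟩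
  filter_upwards [Ioo_mem_nhdsGT hr0] with t ht
  -- With constant nullity the index cannot change under small Hermitian perturbations, so it is
  -- locally constant on a connected interval.
  refine isPreconnected_Ioo.induction₂ (s := Ioo (0 : ℝ) r)
    (fun x y => negIndex (B (φ x)) = negIndex (B (φ y))) ?_
    (fun x y z _ _ _ h1 h2 => h1.trans h2) (fun x y _ _ h => h.symm) ht ⟨by linarith, by linarith⟩
  intro x hx
  have hct : Tendsto (fun y => B (φ y)) (𝓝[Ioo 0 r] x) (𝓝 (B (φ x))) :=
    (hcont.tendsto (φ x)).comp
      (((hφ x hx.1).mono Ioo_subset_Ioi_self))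
  filter_upwards [hct.eventually (eventually_negIndex_eq (hH (φ x))), self_mem_nhdsWithin]
    with y hy hyr
  exact (hy (hH _) ((hr' hyr).trans (hr' hx).symm)).symm

end RegDirac
end

noncomputable section
namespace RegDirac

/-! ### Decaying waves below the upper band -/

/-- `q < η` are the decay rates of the two decaying waves of energy `ω`. -/
structure Rates (m ε k ω q η : ℝ) : Prop where
  q_nonneg : 0 ≤ q
  q_lt : q < η
  sum_sq : q ^ 2 + η ^ 2 = 2 * k ^ 2 + (1 - 2 * ε * m) / ε ^ 2
  disp : ω ^ 2 = k ^ 2 - q ^ 2 + (m - ε * (k ^ 2 - q ^ 2)) ^ 2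
  mu_pos : 0 < ω + m - ε * k ^ 2
  den_pos : 0 < (ω + m - ε * k ^ 2) * (q + η - k) + ε * k * (q * η)

/-- Ratio of the spinor components of the wave with decay rate `x`. -/
def ratio (m ε k ω x : ℝ) : ℝ := (x - k) / (ω + m - ε * k ^ 2 + ε * x ^ 2)

/-- Numerator and denominator of the last Weyl entry -`weylNum`/(ε `weylDen`). The denominator is,
up to a positive factor, the determinant of the data (ψ₀, -εψ₁') of the two decaying waves; its
positivity makes the decaying plane a graph over these coordinates. -/
def weylNum (m ε k ω q η : ℝ) : ℝ := ω + m - ε * k ^ 2 - ε * (q * η) + ε * k * (q + η)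

def weylDen (m ε k ω q η : ℝ) : ℝ := (ω + m - ε * k ^ 2) * (q + η - k) + ε * k * (q * η)

/-- The entries of the Weyl matrix, which maps `(ψ₀, -ε ψ₁')` to `(ε ψ₀' + ψ₁, -ψ₁)` on the decaying
solutions. -/
def weyl₀₀ (m ε k ω q η : ℝ) : ℝ :=
  (q * η - k * (q + η) + k ^ 2 - ε * (q * η) * weylNum m ε k ω q η) / weylDen m ε k ω q η

def weyl₀₁ (m ε k ω q η : ℝ) : ℝ :=
  -(q * η - k * (q + η) + k ^ 2) / weylDen m ε k ω q η

def weyl₁₁ (m ε k ω q η : ℝ) : ℝ :=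
  -weylNum m ε k ω q η / (ε * weylDen m ε k ω q η)

/-- The two conclusions are the two rows of the equation H♯ψ = ωψ for the wave (1, ρ) exp(-xy),
where ρ is `ratio`. The first fixes ρ, the second is then the dispersion relation. -/
theorem ratio_eigen {m ε k ω x : ℝ} (hr : 0 < ω + m - ε * k ^ 2 + ε * x ^ 2)
    (hd : ω ^ 2 = k ^ 2 - x ^ 2 + (m - ε * (k ^ 2 - x ^ 2)) ^ 2) :
    ω = m - ε * (k ^ 2 - x ^ 2) - (k + x) * ratio m ε k ω x ∧
      ω * ratio m ε k ω x = (x - k) - (m - ε * (k ^ 2 - x ^ 2)) * ratio m ε k ω x := by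
  unfold ratio
  constructor
  · field_simp
    linear_combination hd
  · have h : (x - k) / (ω + m - ε * k ^ 2 + ε * x ^ 2) * (ω + m - ε * k ^ 2 + ε * x ^ 2) = x - k :=
      div_mul_cancel₀ _ hr.ne'
    linear_combination h

/-- The wave (1, ρ) exp(-qy) has input data (1, ερq) and output data (-εq + ρ, -ρ). The Weyl entries
are the real symmetric matrix with this property for both rates; being symmetric in q and η, they
need checking on one wave only. -/
theorem weyl_apply {m ε k ω q η : ℝ} (hε : ε ≠ 0)
    (hr : 0 < ω + m - ε * k ^ 2 + ε * q ^ 2)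
    (hsum : q ^ 2 + η ^ 2 = 2 * k ^ 2 + (1 - 2 * ε * m) / ε ^ 2)
    (hd : ω ^ 2 = k ^ 2 - q ^ 2 + (m - ε * (k ^ 2 - q ^ 2)) ^ 2)
    (hden : weylDen m ε k ω q η ≠ 0) :
    weyl₀₀ m ε k ω q η + weyl₀₁ m ε k ω q η * (ε * ratio m ε k ω q * q) =
        -ε * q + ratio m ε k ω q ∧
      weyl₀₁ m ε k ω q η + weyl₁₁ m ε k ω q η * (ε * ratio m ε k ω q * q) =
        -ratio m ε k ω q := by
  set r := ω + m - ε * k ^ 2 + ε * q ^ 2 with hr_def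
  set Δ := weylDen m ε k ω q η with hΔ
  set Θ := weylNum m ε k ω q η with hΘ
  have hΔ' : Δ = (η - k) * r + Θ * q := by
    simp only [hΔ, hΘ, hr_def, weylDen, weylNum]; ring
  have hsum' : ε ^ 2 * (q ^ 2 + η ^ 2) = 2 * ε ^ 2 * k ^ 2 + (1 - 2 * ε * m) := by
    rw [hsum]; field_simp
  have hr0 : r ≠ 0 := hr.ne'
  have h1 : weyl₀₁ m ε k ω q η = -((q - k) * (η - k)) / Δ := by
    simp only [weyl₀₁]; congr 1; ring
  have h2 : weyl₀₀ m ε k ω q η = ((q - k) * (η - k) - ε * (q * η) * Θ) / Δ := by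
    simp only [weyl₀₀]; congr 1; ring
  have h3 : weyl₁₁ m ε k ω q η = -Θ / (ε * Δ) := rfl
  have hrat : ratio m ε k ω q = (q - k) / r := rfl
  rw [h1, h2, h3, hrat]
  constructor
  · rw [div_add' _ _ _ hden, div_eq_iff hden]
    field_simp
    -- After clearing denominators the first identity is q times this one. It combines the
    -- dispersion relation with the sum rule for the squared rates; the extra factor ε keeps the sum
    -- rule polynomial.
    have key : -ε * Θ * r * (η - q) - ε * (η - k) * ((q - k) ^ 2 - r ^ 2) = (q - k) * Θ := by
      have hε2 : ε ^ 2 ≠ 0 := pow_ne_zero 2 hε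
      have : ε * (-ε * Θ * r * (η - q) - ε * (η - k) * ((q - k) ^ 2 - r ^ 2) - (q - k) * Θ) = 0 := by
        simp only [hΘ, weylNum, hr_def]
        linear_combination (ε ^ 2 * (q - k)) * hd +
          (ε * (q - k) * (ω + m - ε * k ^ 2 + ε * q ^ 2)) * hsum'
      have h := (mul_eq_zero.1 this).resolve_left hε
      linarith
    rw [hΔ']
    linear_combination q * key
  · rw [div_add' _ _ _ hden, div_eq_iff hden]
    field_simp
    rw [hΔ']; ring

/-- At fixed energy the dispersion relation is quadratic in the squared rate, and `sum_sq` is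
Vieta's formula for its two roots. -/
theorem Rates.disp' {m ε k ω q η : ℝ} (hε : ε ≠ 0) (h : Rates m ε k ω q η) :
    ω ^ 2 = k ^ 2 - η ^ 2 + (m - ε * (k ^ 2 - η ^ 2)) ^ 2 := by
  have h1 : ε ^ 2 * (q ^ 2 + η ^ 2) = 2 * ε ^ 2 * k ^ 2 + (1 - 2 * ε * m) := by
    rw [h.sum_sq]; field_simp
  have h2 := h.disp
  linear_combination h2 + (η ^ 2 - q ^ 2) * h1 * (-1)

theorem Rates.r_pos {m ε k ω q η : ℝ} (hε : 0 < ε) (h : Rates m ε k ω q η) (x : ℝ) :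
    0 < ω + m - ε * k ^ 2 + ε * x ^ 2 := by
  have := h.mu_pos; positivity

theorem Rates.weyl_slow {m ε k ω q η : ℝ} (hε : 0 < ε) (h : Rates m ε k ω q η) :
    weyl₀₀ m ε k ω q η + weyl₀₁ m ε k ω q η * (ε * ratio m ε k ω q * q) =
        -ε * q + ratio m ε k ω q ∧
      weyl₀₁ m ε k ω q η + weyl₁₁ m ε k ω q η * (ε * ratio m ε k ω q * q) =
        -ratio m ε k ω q :=
  weyl_apply hε.ne' (h.r_pos hε q) h.sum_sq h.disp h.den_pos.ne'

theorem Rates.weyl_fast {m ε k ω q η : ℝ} (hε : 0 < ε) (h : Rates m ε k ω q η) :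
    weyl₀₀ m ε k ω q η + weyl₀₁ m ε k ω q η * (ε * ratio m ε k ω η * η) =
        -ε * η + ratio m ε k ω η ∧
      weyl₀₁ m ε k ω q η + weyl₁₁ m ε k ω q η * (ε * ratio m ε k ω η * η) =
        -ratio m ε k ω η := by
  have hN : weylNum m ε k ω q η = weylNum m ε k ω η q := by unfold weylNum; ring
  have hD : weylDen m ε k ω q η = weylDen m ε k ω η q := by unfold weylDen; ring
  have h00 : weyl₀₀ m ε k ω q η = weyl₀₀ m ε k ω η q := by
    unfold weyl₀₀; rw [hN, hD, mul_comm q η, add_comm q η]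
  have h01 : weyl₀₁ m ε k ω q η = weyl₀₁ m ε k ω η q := by
    unfold weyl₀₁; rw [hD, mul_comm q η, add_comm q η]
  have h11 : weyl₁₁ m ε k ω q η = weyl₁₁ m ε k ω η q := by
    unfold weyl₁₁; rw [hN, hD]
  rw [h00, h01, h11]
  refine weyl_apply hε.ne' (h.r_pos hε η) ?_ (h.disp' hε.ne') ?_
  · rw [add_comm]; exact h.sum_sq
  · rw [← hD]; exact h.den_pos.ne'

/-- The difference is a positive multiple of `weylDen`. It says that the input data (1, s) of the
slow and the fast wave are linearly independent. -/
theorem Rates.slope_lt {m ε k ω q η : ℝ} (hε : 0 < ε) (h : Rates m ε k ω q η) :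
    ε * ratio m ε k ω q * q < ε * ratio m ε k ω η * η := by
  have h1 := h.r_pos hε q
  have h2 := h.r_pos hε η
  have hden := h.den_pos
  have hlt := h.q_lt
  have key : ε * ratio m ε k ω η * η - ε * ratio m ε k ω q * q =
      ε * (η - q) * ((ω + m - ε * k ^ 2) * (q + η - k) + ε * k * (q * η)) /
        ((ω + m - ε * k ^ 2 + ε * q ^ 2) * (ω + m - ε * k ^ 2 + ε * η ^ 2)) := by
    unfold ratio
    set r₁ := ω + m - ε * k ^ 2 + ε * q ^ 2 with hr₁
    set r₂ := ω + m - ε * k ^ 2 + ε * η ^ 2 with hr₂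
    rw [eq_div_iff (mul_pos h1 h2).ne']
    field_simp
    rw [hr₁, hr₂]; ring
  have : 0 < ε * ratio m ε k ω η * η - ε * ratio m ε k ω q * q := by
    rw [key]
    exact div_pos (mul_pos (mul_pos hε (sub_pos.2 hlt)) hden) (mul_pos h1 h2)
  linarith

/-- The boundary form of two decaying waves of different energies. -/
theorem wave_boundary_form {m ε k ω ω' x x' ρ ρ' : ℝ}
    (h1 : ω = m - ε * (k ^ 2 - x ^ 2) - (k + x) * ρ)
    (h2 : ω * ρ = (x - k) - (m - ε * (k ^ 2 - x ^ 2)) * ρ)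
    (h1' : ω' = m - ε * (k ^ 2 - x' ^ 2) - (k + x') * ρ')
    (h2' : ω' * ρ' = (x' - k) - (m - ε * (k ^ 2 - x' ^ 2)) * ρ') :
    (ε * (x - x') * (1 - ρ * ρ') + ρ' - ρ) * (x + x') = (ω - ω') * (1 + ρ * ρ') := by
  linear_combination (-1) * h1 + h1' - ρ' * h2 + ρ * h2'

/-- Strict monotonicity of the Weyl matrix in the energy, as soon as two explicit quantities, which
have positive limits at the threshold, are positive. -/
theorem weyl_sub_pos {m ε k ω ω' q q' η η' : ℝ} (hε : 0 < ε) (h : Rates m ε k ω q η)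
    (h' : Rates m ε k ω' q' η') (hlt : ω' < ω) (hq : 0 < q + q')
    (hE₁ : 0 < (1 + ratio m ε k ω q * ratio m ε k ω' q') + (q + q') *
      (-((1 + ratio m ε k ω q * ratio m ε k ω' η') / (q + η'))
        - (1 + ratio m ε k ω η * ratio m ε k ω' q') / (η + q')
        + (1 + ratio m ε k ω η * ratio m ε k ω' η') / (η + η')))
    (hE₂ : 0 < (1 + ratio m ε k ω q * ratio m ε k ω' q') *
        ((1 + ratio m ε k ω η * ratio m ε k ω' η') / (η + η')) - (q + q') *
      ((1 + ratio m ε k ω q * ratio m ε k ω' η') / (q + η') *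
        ((1 + ratio m ε k ω η * ratio m ε k ω' q') / (η + q')))) :
    0 < weyl₁₁ m ε k ω' q' η' - weyl₁₁ m ε k ω q η ∧
      0 < (weyl₀₀ m ε k ω' q' η' - weyl₀₀ m ε k ω q η) *
        (weyl₁₁ m ε k ω' q' η' - weyl₁₁ m ε k ω q η) -
        (weyl₀₁ m ε k ω' q' η' - weyl₀₁ m ε k ω q η) ^ 2 := by
  have hs := h.slope_lt hε
  have hs' := h'.slope_lt hε
  obtain ⟨a1, a2⟩ := h.weyl_slow hε
  obtain ⟨b1, b2⟩ := h.weyl_fast hε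
  obtain ⟨a1', a2'⟩ := h'.weyl_slow hε
  obtain ⟨b1', b2'⟩ := h'.weyl_fast hε
  obtain ⟨e1, e2⟩ := ratio_eigen (h.r_pos hε q) h.disp
  obtain ⟨f1, f2⟩ := ratio_eigen (h.r_pos hε η) (h.disp' hε.ne')
  obtain ⟨e1', e2'⟩ := ratio_eigen (h'.r_pos hε q') h'.disp
  obtain ⟨f1', f2'⟩ := ratio_eigen (h'.r_pos hε η') (h'.disp' hε.ne')
  have g11 := wave_boundary_form e1 e2 e1' e2'
  have g12 := wave_boundary_form e1 e2 f1' f2'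
  have g21 := wave_boundary_form f1 f2 e1' e2'
  have g22 := wave_boundary_form f1 f2 f1' f2'
  have p12 : 0 < q + η' := by linarith [h.q_nonneg, h'.q_nonneg, h'.q_lt]
  have p21 : 0 < η + q' := by linarith [h.q_nonneg, h'.q_nonneg, h.q_lt]
  have p22 : 0 < η + η' := by linarith [h.q_nonneg, h'.q_nonneg, h'.q_lt, h.q_lt]
  set ρ₁ := ratio m ε k ω q
  set ρ₂ := ratio m ε k ω η
  set ρ₁' := ratio m ε k ω' q'
  set ρ₂' := ratio m ε k ω' η'
  set A := weyl₀₀ m ε k ω' q' η' - weyl₀₀ m ε k ω q η with hA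
  set B := weyl₀₁ m ε k ω' q' η' - weyl₀₁ m ε k ω q η with hB
  set C := weyl₁₁ m ε k ω' q' η' - weyl₁₁ m ε k ω q η with hC
  set s₁ := ε * ρ₁ * q with hs₁
  set s₂ := ε * ρ₂ * η with hs₂
  set s₁' := ε * ρ₁' * q' with hs₁'
  set s₂' := ε * ρ₂' * η' with hs₂'
  set G₁₁ := (1 + ρ₁ * ρ₁') / (q + q') with hG₁₁
  set G₁₂ := (1 + ρ₁ * ρ₂') / (q + η') with hG₁₂
  set G₂₁ := (1 + ρ₂ * ρ₁') / (η + q') with hG₂₁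
  set G₂₂ := (1 + ρ₂ * ρ₂') / (η + η') with hG₂₂
  -- Green's identity for waves of energies ω and ω': the difference of the Weyl matrices, paired
  -- with the data (1, sᵢ) and (1, sⱼ'), is (ω - ω')Gᵢⱼ, where Gᵢⱼ is the overlap integral of the
  -- two exponentials over the half-line.
  have k11 : A + B * s₁' + s₁ * (B + C * s₁') = (ω - ω') * G₁₁ := by
    rw [hG₁₁, mul_div_assoc', eq_div_iff hq.ne', ← g11]
    rw [hA, hB, hC, hs₁, hs₁'] at *
    linear_combination (q + q') * (a1' - a1 - ε * ρ₁' * q' * a2 + ε * ρ₁ * q * a2')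
  have k12 : A + B * s₂' + s₁ * (B + C * s₂') = (ω - ω') * G₁₂ := by
    rw [hG₁₂, mul_div_assoc', eq_div_iff p12.ne', ← g12]
    rw [hA, hB, hC, hs₁, hs₂'] at *
    linear_combination (q + η') * (b1' - a1 - ε * ρ₂' * η' * a2 + ε * ρ₁ * q * b2')
  have k21 : A + B * s₁' + s₂ * (B + C * s₁') = (ω - ω') * G₂₁ := by
    rw [hG₂₁, mul_div_assoc', eq_div_iff p21.ne', ← g21]
    rw [hA, hB, hC, hs₂, hs₁'] at *
    linear_combination (η + q') * (a1' - b1 - ε * ρ₁' * q' * b2 + ε * ρ₂ * η * a2')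
  have k22 : A + B * s₂' + s₂ * (B + C * s₂') = (ω - ω') * G₂₂ := by
    rw [hG₂₂, mul_div_assoc', eq_div_iff p22.ne', ← g22]
    rw [hA, hB, hC, hs₂, hs₂'] at *
    linear_combination (η + η') * (b1' - b1 - ε * ρ₂' * η' * b2 + ε * ρ₂ * η * b2')
  have hpos : 0 < (s₁ - s₂) * (s₁' - s₂') := mul_pos_of_neg_of_neg (by linarith) (by linarith)
  -- The hypotheses are these expressions multiplied by q + q', which removes the divergence of G₁₁
  -- when both slow rates tend to 0.
  have hE₁' : 0 < G₁₁ - G₁₂ - G₂₁ + G₂₂ := by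
    have : G₁₁ - G₁₂ - G₂₁ + G₂₂ =
        ((1 + ρ₁ * ρ₁') + (q + q') * (-G₁₂ - G₂₁ + G₂₂)) / (q + q') := by
      rw [hG₁₁]; field_simp; ring
    rw [this]; exact div_pos hE₁ hq
  have hE₂' : 0 < G₁₁ * G₂₂ - G₁₂ * G₂₁ := by
    have : G₁₁ * G₂₂ - G₁₂ * G₂₁ =
        ((1 + ρ₁ * ρ₁') * G₂₂ - (q + q') * (G₁₂ * G₂₁)) / (q + q') := by
      rw [hG₁₁]; field_simp
    rw [this]; exact div_pos hE₂ hq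
  constructor
  -- Differences of the data vectors (1, s) have no first component, so the alternating sum of the
  -- four pairings isolates the last entry. Below, the determinant of the pairings isolates the
  -- determinant.
  · have : C * ((s₁ - s₂) * (s₁' - s₂')) = (ω - ω') * (G₁₁ - G₁₂ - G₂₁ + G₂₂) := by
      linear_combination k11 - k12 - k21 + k22
    refine pos_of_mul_pos_left (b := (s₁ - s₂) * (s₁' - s₂')) ?_ hpos.le
    rw [this]; exact mul_pos (by linarith) hE₁'
  · have : (A * C - B ^ 2) * ((s₁ - s₂) * (s₁' - s₂')) =
        (ω - ω') ^ 2 * (G₁₁ * G₂₂ - G₁₂ * G₂₁) := by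
      have : (ω - ω') ^ 2 * (G₁₁ * G₂₂ - G₁₂ * G₂₁) = ((ω - ω') * G₁₁) * ((ω - ω') * G₂₂) -
        ((ω - ω') * G₁₂) * ((ω - ω') * G₂₁) := by ring
      rw [this, ← k11, ← k12, ← k21, ← k22]
      ring
    refine pos_of_mul_pos_left (b := (s₁ - s₂) * (s₁' - s₂')) ?_ hpos.le
    rw [this]; exact mul_pos (by have : 0 < ω - ω' := by linarith
                                 positivity) hE₂'

end RegDirac
end

/-! ### Decay rates as functions of momentum and energy; monotonicity near the threshold -/

noncomputable section
namespace RegDirac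

/-- Sum of the squared decay rates. -/
def rateSum (m ε k : ℝ) : ℝ := 2 * k ^ 2 + (1 - 2 * ε * m) / ε ^ 2

/-- The smaller root X of X² - DX + P = 0, the dispersion relation for the squared rate X, with D =
`rateSum` and P = (ω₊(k,0)² - ω²)/ε². -/
def slowSq (m ε k ω : ℝ) : ℝ :=
  (rateSum m ε k - √(rateSum m ε k ^ 2 - 4 * ((bandPlus m ε k 0 ^ 2 - ω ^ 2) / ε ^ 2))) / 2

/-- The smaller decay rate at energy `ω`. -/
def slowRate (m ε k ω : ℝ) : ℝ := √(slowSq m ε k ω)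

/-- The larger decay rate at energy `ω`. -/
def fastRate (m ε k ω : ℝ) : ℝ := √(rateSum m ε k - slowSq m ε k ω)

theorem eventually_const_lt_of_continuousAt {X : Type*} [TopologicalSpace X] {f : X → ℝ} {x : X}
    {c : ℝ} (h : c < f x) (hf : ContinuousAt f x) : ∀ᶠ y in 𝓝 x, c < f y :=
  Tendsto.eventually_const_lt h hf

theorem bandPlus_sq (m ε k κ : ℝ) :
    bandPlus m ε k κ ^ 2 = k ^ 2 + κ ^ 2 + (m - ε * (k ^ 2 + κ ^ 2)) ^ 2 :=
  Real.sq_sqrt (by positivity)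

theorem one_sub_pos {m ε : ℝ} (hm : 0 < m) (hεm : ε < 1 / (2 * m)) : 0 < 1 - 2 * ε * m := by
  rw [lt_div_iff₀ (by positivity)] at hεm
  linarith

theorem bandPlus_arg_pos {m ε : ℝ} (hm : 0 < m) (k κ : ℝ) :
    0 < k ^ 2 + κ ^ 2 + (m - ε * (k ^ 2 + κ ^ 2)) ^ 2 := by
  rcases (by positivity : 0 ≤ k ^ 2 + κ ^ 2).eq_or_lt with h | h
  · rw [← h]; simpa using pow_pos hm 2
  · positivity

theorem bandPlus_pos {m ε : ℝ} (hm : 0 < m) (k κ : ℝ) : 0 < bandPlus m ε k κ :=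
  Real.sqrt_pos.2 (bandPlus_arg_pos hm k κ)

/-- `ω₊ + m - ε K > 0`. -/
theorem bandPlus_add_pos {m ε : ℝ} (hm : 0 < m) (k κ : ℝ) :
    0 < bandPlus m ε k κ + (m - ε * (k ^ 2 + κ ^ 2)) := by
  have h1 := bandPlus_sq m ε k κ
  have h2 := bandPlus_pos (ε := ε) hm k κ
  rcases (by positivity : 0 ≤ k ^ 2 + κ ^ 2).eq_or_lt with h | h
  · rw [← h]; linarith
  · linarith [(abs_lt.1 (abs_lt_of_sq_lt_sq (a := m - ε * (k ^ 2 + κ ^ 2)) (b := bandPlus m ε k κ)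
      (by linarith) h2.le)).1]

theorem bandPlus_sub_pos {m ε : ℝ} (hm : 0 < m) {k κ : ℝ} (h : 0 < k ^ 2 + κ ^ 2) :
    0 < bandPlus m ε k κ - (m - ε * (k ^ 2 + κ ^ 2)) := by
  have h1 := bandPlus_sq m ε k κ
  have h2 := bandPlus_pos (ε := ε) hm k κ
  linarith [(abs_lt.1 (abs_lt_of_sq_lt_sq (a := m - ε * (k ^ 2 + κ ^ 2)) (b := bandPlus m ε k κ)
        (by linarith) h2.le)).2]

theorem rateSum_pos {m ε : ℝ} (hm : 0 < m) (hε : 0 < ε) (hεm : ε < 1 / (2 * m))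
    (k : ℝ) : 0 < rateSum m ε k := by
  have := one_sub_pos hm hεm
  unfold rateSum; positivity

theorem abs_lt_sqrt_rateSum {m ε : ℝ} (hm : 0 < m) (hε : 0 < ε) (hεm : ε < 1 / (2 * m))
    (k : ℝ) : |k| < √(rateSum m ε k) := by
  apply Real.lt_sqrt_of_sq_lt
  rw [sq_abs]
  have := one_sub_pos hm hεm
  have : 0 < (1 - 2 * ε * m) / ε ^ 2 := by positivity
  unfold rateSum; nlinarith [sq_nonneg k]

theorem slowSq_threshold {m ε : ℝ} (hm : 0 < m) (hε : 0 < ε) (hεm : ε < 1 / (2 * m))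
    (k : ℝ) : slowSq m ε k (bandPlus m ε k 0) = 0 := by
  simp [slowSq, Real.sqrt_sq (rateSum_pos hm hε hεm k).le]

theorem slowRate_threshold {m ε : ℝ} (hm : 0 < m) (hε : 0 < ε) (hεm : ε < 1 / (2 * m))
    (k : ℝ) : slowRate m ε k (bandPlus m ε k 0) = 0 := by
  simp [slowRate, slowSq_threshold hm hε hεm]

theorem fastRate_threshold {m ε : ℝ} (hm : 0 < m) (hε : 0 < ε) (hεm : ε < 1 / (2 * m))
    (k : ℝ) :
    fastRate m ε k (bandPlus m ε k 0) = √(rateSum m ε k) := by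
  simp [fastRate, slowSq_threshold hm hε hεm]

theorem mu_threshold_pos {m ε : ℝ} (hm : 0 < m) (k : ℝ) : 0 < bandPlus m ε k 0 + m - ε * k ^ 2 := by
  have := bandPlus_add_pos (ε := ε) hm k 0
  simp at this; linarith

theorem continuous_slowSq (m ε : ℝ) : Continuous fun p : ℝ × ℝ => slowSq m ε p.1 p.2 := by
  unfold slowSq rateSum bandPlus; fun_prop

theorem continuous_slowRate (m ε : ℝ) : Continuous fun p : ℝ × ℝ => slowRate m ε p.1 p.2 :=
  (continuous_slowSq m ε).sqrt

theorem continuous_fastRate (m ε : ℝ) : Continuous fun p : ℝ × ℝ => fastRate m ε p.1 p.2 := by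
  unfold fastRate
  refine Continuous.sqrt (Continuous.sub ?_ (continuous_slowSq m ε))
  unfold rateSum; fun_prop

theorem rates_of_lt {m ε : ℝ} (hm : 0 < m) (hε : 0 < ε) (hεm : ε < 1 / (2 * m))
    {k ω : ℝ} (hω0 : 0 < ω) (hω : ω ≤ bandPlus m ε k 0)
    (hP : 4 * ((bandPlus m ε k 0 ^ 2 - ω ^ 2) / ε ^ 2) < rateSum m ε k ^ 2)
    (hmu : 0 < ω + m - ε * k ^ 2)
    (hden : 0 < weylDen m ε k ω (slowRate m ε k ω) (fastRate m ε k ω)) :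
    Rates m ε k ω (slowRate m ε k ω) (fastRate m ε k ω) ∧
      (ω < bandPlus m ε k 0 → 0 < slowRate m ε k ω) := by
  set D := rateSum m ε k with hD
  set P := (bandPlus m ε k 0 ^ 2 - ω ^ 2) / ε ^ 2 with hPdef
  have hD0 : 0 < D := rateSum_pos hm hε hεm k
  have hP0 : 0 ≤ P := by
    have : ω ^ 2 ≤ bandPlus m ε k 0 ^ 2 := by gcongr
    have h2 : 0 ≤ bandPlus m ε k 0 ^ 2 - ω ^ 2 := by linarith
    positivity
  set s := √(D ^ 2 - 4 * P) with hs
  have hs0 : 0 < s := Real.sqrt_pos.2 (by linarith)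
  have hs2 : s ^ 2 = D ^ 2 - 4 * P := Real.sq_sqrt (by linarith)
  have hsD : s ≤ D := by
    apply Real.sqrt_le_iff.2 ⟨hD0.le, by linarith⟩
  have hQ : slowSq m ε k ω = (D - s) / 2 := rfl
  have hq : slowRate m ε k ω ^ 2 = (D - s) / 2 := by
    rw [slowRate, Real.sq_sqrt, hQ]; rw [hQ]; linarith
  have hη : fastRate m ε k ω ^ 2 = (D + s) / 2 := by
    rw [fastRate, Real.sq_sqrt, hQ]
    · ring
    · rw [hQ]; linarith
  have hband := bandPlus_sq m ε k 0
  have hPe : ε ^ 2 * P = bandPlus m ε k 0 ^ 2 - ω ^ 2 := by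
    rw [hPdef]; field_simp
  have hDe : ε ^ 2 * D = 2 * ε ^ 2 * k ^ 2 + (1 - 2 * ε * m) := by
    rw [hD]; unfold rateSum; field_simp
  refine ⟨⟨Real.sqrt_nonneg _, ?_, ?_, ?_, hmu, hden⟩, ?_⟩
  · apply lt_of_pow_lt_pow_left₀ 2 (Real.sqrt_nonneg _)
    change slowRate m ε k ω ^ 2 < fastRate m ε k ω ^ 2
    rw [hq, hη]; linarith
  · rw [hq, hη]; show _ = D; ring
  · rw [hq]
    have : s ^ 2 * ε ^ 2 = D ^ 2 * ε ^ 2 - 4 * (bandPlus m ε k 0 ^ 2 - ω ^ 2) := by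
      rw [hs2, ← hPe]; ring
    linear_combination (-1 / 4) * this + (1) * hband - ((D - s) / 2) * hDe
  · intro hlt
    have hP1 : 0 < P := by
      have : ω ^ 2 < bandPlus m ε k 0 ^ 2 := by gcongr
      have h2 : 0 < bandPlus m ε k 0 ^ 2 - ω ^ 2 := by linarith
      positivity
    apply Real.sqrt_pos.2
    rw [hQ]
    have : s < D := by
      rw [hs]; apply (Real.sqrt_lt' hD0).2; linarith
    linarith

/-- With vanishing slow rate the denominator reduces to (ω₊ + m - εk²)(√D - k), and √D > |k|. -/
theorem weylDen_threshold_pos {m ε : ℝ} (hm : 0 < m) (hε : 0 < ε) (hεm : ε < 1 / (2 * m))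
    (k : ℝ) :
    0 < weylDen m ε k (bandPlus m ε k 0) (slowRate m ε k (bandPlus m ε k 0))
      (fastRate m ε k (bandPlus m ε k 0)) := by
  rw [slowRate_threshold hm hε hεm, fastRate_threshold hm hε hεm]
  unfold weylDen
  have h1 := mu_threshold_pos (ε := ε) hm k
  have h2 := abs_lt_sqrt_rateSum hm hε hεm k
  have h3 : 0 < √(rateSum m ε k) - k := by linarith [le_abs_self k]
  have : 0 < (bandPlus m ε k 0 + m - ε * k ^ 2) * (√(rateSum m ε k) - k) := mul_pos h1 h3
  simpa using this

/-- Apart from the position of the energy below the band, all requirements are strict inequalities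
between continuous functions, valid at the threshold point. -/
theorem eventually_rates {m ε : ℝ} (hm : 0 < m) (hε : 0 < ε) (hεm : ε < 1 / (2 * m))
    (k₀ : ℝ) :
    ∀ᶠ p : ℝ × ℝ in 𝓝 (k₀, bandPlus m ε k₀ 0), p.2 ≤ bandPlus m ε p.1 0 →
      Rates m ε p.1 p.2 (slowRate m ε p.1 p.2) (fastRate m ε p.1 p.2) ∧
      (p.2 < bandPlus m ε p.1 0 → 0 < slowRate m ε p.1 p.2) := by
  have hb : Continuous fun p : ℝ × ℝ => bandPlus m ε p.1 0 := by unfold bandPlus; fun_prop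
  have hq := continuous_slowRate m ε
  have hη := continuous_fastRate m ε
  have e1 : ∀ᶠ p : ℝ × ℝ in 𝓝 (k₀, bandPlus m ε k₀ 0), 0 < p.2 :=
    continuous_snd.continuousAt.eventually_const_lt (bandPlus_pos hm k₀ 0)
  have e2 : ∀ᶠ p : ℝ × ℝ in 𝓝 (k₀, bandPlus m ε k₀ 0),
      4 * ((bandPlus m ε p.1 0 ^ 2 - p.2 ^ 2) / ε ^ 2) < rateSum m ε p.1 ^ 2 := by
    refine ContinuousAt.eventually_lt (f := fun p : ℝ × ℝ =>
      4 * ((bandPlus m ε p.1 0 ^ 2 - p.2 ^ 2) / ε ^ 2)) (g := fun p => rateSum m ε p.1 ^ 2)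
      (by fun_prop) ?_ ?_
    · unfold rateSum; fun_prop
    · simpa using pow_pos (rateSum_pos hm hε hεm k₀) 2
  have e3 : ∀ᶠ p : ℝ × ℝ in 𝓝 (k₀, bandPlus m ε k₀ 0), 0 < p.2 + m - ε * p.1 ^ 2 :=
    eventually_const_lt_of_continuousAt (f := fun p : ℝ × ℝ => p.2 + m - ε * p.1 ^ 2)
      (mu_threshold_pos hm k₀) (by fun_prop)
  have e4 : ∀ᶠ p : ℝ × ℝ in 𝓝 (k₀, bandPlus m ε k₀ 0),
      0 < weylDen m ε p.1 p.2 (slowRate m ε p.1 p.2) (fastRate m ε p.1 p.2) :=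
    eventually_const_lt_of_continuousAt
      (f := fun p : ℝ × ℝ => weylDen m ε p.1 p.2 (slowRate m ε p.1 p.2) (fastRate m ε p.1 p.2))
      (weylDen_threshold_pos hm hε hεm k₀) (by unfold weylDen; fun_prop)
  filter_upwards [e1, e2, e3, e4] with p h1 h2 h3 h4 hle
  exact rates_of_lt hm hε hεm h1 hle h2 h3 h4

theorem rates_threshold {m ε : ℝ} (hm : 0 < m) (hε : 0 < ε) (hεm : ε < 1 / (2 * m))
    (k : ℝ) :
    Rates m ε k (bandPlus m ε k 0) 0 (√(rateSum m ε k)) := by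
  have := ((eventually_rates hm hε hεm k).self_of_nhds le_rfl).1
  simp only [slowRate_threshold hm hε hεm, fastRate_threshold hm hε hεm] at this
  exact this

/-- The Weyl matrix is strictly decreasing in the energy near the threshold. -/
theorem eventually_weyl_sub_pos {m ε : ℝ} (hm : 0 < m) (hε : 0 < ε) (hεm : ε < 1 / (2 * m))
    (k₀ : ℝ) :
    ∀ᶠ p : ℝ × ℝ × ℝ in 𝓝 (k₀, bandPlus m ε k₀ 0, bandPlus m ε k₀ 0),
      p.2.1 ≤ bandPlus m ε p.1 0 → p.2.2 < p.2.1 →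
      0 < weyl₁₁ m ε p.1 p.2.2 (slowRate m ε p.1 p.2.2) (fastRate m ε p.1 p.2.2) -
          weyl₁₁ m ε p.1 p.2.1 (slowRate m ε p.1 p.2.1) (fastRate m ε p.1 p.2.1) ∧
      0 < (weyl₀₀ m ε p.1 p.2.2 (slowRate m ε p.1 p.2.2) (fastRate m ε p.1 p.2.2) -
          weyl₀₀ m ε p.1 p.2.1 (slowRate m ε p.1 p.2.1) (fastRate m ε p.1 p.2.1)) *
        (weyl₁₁ m ε p.1 p.2.2 (slowRate m ε p.1 p.2.2) (fastRate m ε p.1 p.2.2) -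
          weyl₁₁ m ε p.1 p.2.1 (slowRate m ε p.1 p.2.1) (fastRate m ε p.1 p.2.1)) -
        (weyl₀₁ m ε p.1 p.2.2 (slowRate m ε p.1 p.2.2) (fastRate m ε p.1 p.2.2) -
          weyl₀₁ m ε p.1 p.2.1 (slowRate m ε p.1 p.2.1) (fastRate m ε p.1 p.2.1)) ^ 2 := by
  set z₀ : ℝ × ℝ × ℝ := (k₀, bandPlus m ε k₀ 0, bandPlus m ε k₀ 0) with hz₀
  set q : ℝ × ℝ × ℝ → ℝ := fun p => slowRate m ε p.1 p.2.1 with hqd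
  set q' : ℝ × ℝ × ℝ → ℝ := fun p => slowRate m ε p.1 p.2.2 with hqd'
  set η : ℝ × ℝ × ℝ → ℝ := fun p => fastRate m ε p.1 p.2.1 with hηd
  set η' : ℝ × ℝ × ℝ → ℝ := fun p => fastRate m ε p.1 p.2.2 with hηd'
  have cq : Continuous q := (continuous_slowRate m ε).comp
    (continuous_fst.prodMk (continuous_fst.comp continuous_snd))
  have cq' : Continuous q' := (continuous_slowRate m ε).comp
    (continuous_fst.prodMk (continuous_snd.comp continuous_snd))
  have cη : Continuous η := (continuous_fastRate m ε).comp
    (continuous_fst.prodMk (continuous_fst.comp continuous_snd))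
  have cη' : Continuous η' := (continuous_fastRate m ε).comp
    (continuous_fst.prodMk (continuous_snd.comp continuous_snd))
  have q0 : q z₀ = 0 := slowRate_threshold hm hε hεm k₀
  have q0' : q' z₀ = 0 := slowRate_threshold hm hε hεm k₀
  have η0 : η z₀ = √(rateSum m ε k₀) := fastRate_threshold hm hε hεm k₀
  have η0' : η' z₀ = √(rateSum m ε k₀) := fastRate_threshold hm hε hεm k₀
  have hD0 : 0 < √(rateSum m ε k₀) := Real.sqrt_pos.2 (rateSum_pos hm hε hεm k₀)
  have hR := rates_threshold hm hε hεm k₀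
  have cρ : ∀ (w : ℝ × ℝ × ℝ → ℝ) (x : ℝ × ℝ × ℝ → ℝ), Continuous w → Continuous x →
      w z₀ = bandPlus m ε k₀ 0 → ContinuousAt (fun p => ratio m ε p.1 (w p) (x p)) z₀ := by
    intro w x hw hx hw0
    unfold ratio
    refine ContinuousAt.div (by fun_prop) (by fun_prop) ?_
    rw [hw0]
    exact (hR.r_pos hε _).ne'
  have cρ1 := cρ (fun p => p.2.1) q (by fun_prop) cq rfl
  have cρ2 := cρ (fun p => p.2.1) η (by fun_prop) cη rfl
  have cρ1' := cρ (fun p => p.2.2) q' (by fun_prop) cq' rfl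
  have cρ2' := cρ (fun p => p.2.2) η' (by fun_prop) cη' rfl
  have n12 : q z₀ + η' z₀ ≠ 0 := by rw [q0, η0']; linarith
  have n21 : η z₀ + q' z₀ ≠ 0 := by rw [q0', η0]; linarith
  have n22 : η z₀ + η' z₀ ≠ 0 := by rw [η0', η0]; linarith
  have c12 : ContinuousAt (fun p => (1 + ratio m ε p.1 p.2.1 (q p) * ratio m ε p.1 p.2.2 (η' p)) /
      (q p + η' p)) z₀ := (by fun_prop : ContinuousAt (fun p => (1 + ratio m ε p.1 p.2.1 (q p) *
        ratio m ε p.1 p.2.2 (η' p))) z₀).div (by fun_prop) n12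
  have c21 : ContinuousAt (fun p => (1 + ratio m ε p.1 p.2.1 (η p) * ratio m ε p.1 p.2.2 (q' p)) /
      (η p + q' p)) z₀ := (by fun_prop : ContinuousAt (fun p => (1 + ratio m ε p.1 p.2.1 (η p) *
        ratio m ε p.1 p.2.2 (q' p))) z₀).div (by fun_prop) n21
  have c22 : ContinuousAt (fun p => (1 + ratio m ε p.1 p.2.1 (η p) * ratio m ε p.1 p.2.2 (η' p)) /
      (η p + η' p)) z₀ := (by fun_prop : ContinuousAt (fun p => (1 + ratio m ε p.1 p.2.1 (η p) *
        ratio m ε p.1 p.2.2 (η' p))) z₀).div (by fun_prop) n22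
  -- At the base point both slow rates vanish and the two energies coincide, so the expression is 1
  -- plus a square. The second one below becomes a product of two such factors divided by twice the
  -- fast rate.
  have e1 : ∀ᶠ p in 𝓝 z₀, 0 < (1 + ratio m ε p.1 p.2.1 (q p) * ratio m ε p.1 p.2.2 (q' p)) +
      (q p + q' p) *
      (-((1 + ratio m ε p.1 p.2.1 (q p) * ratio m ε p.1 p.2.2 (η' p)) / (q p + η' p))
        - (1 + ratio m ε p.1 p.2.1 (η p) * ratio m ε p.1 p.2.2 (q' p)) / (η p + q' p)
        + (1 + ratio m ε p.1 p.2.1 (η p) * ratio m ε p.1 p.2.2 (η' p)) / (η p + η' p)) := by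
    refine eventually_const_lt_of_continuousAt ?_ (by fun_prop)
    rw [q0, q0']
    have : 0 ≤ ratio m ε z₀.1 z₀.2.1 0 * ratio m ε z₀.1 z₀.2.2 0 := mul_self_nonneg _
    simp only [add_zero, zero_mul]
    linarith
  have e2 : ∀ᶠ p in 𝓝 z₀, 0 < (1 + ratio m ε p.1 p.2.1 (q p) * ratio m ε p.1 p.2.2 (q' p)) *
        ((1 + ratio m ε p.1 p.2.1 (η p) * ratio m ε p.1 p.2.2 (η' p)) / (η p + η' p)) -
      (q p + q' p) *
      ((1 + ratio m ε p.1 p.2.1 (q p) * ratio m ε p.1 p.2.2 (η' p)) / (q p + η' p) *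
        ((1 + ratio m ε p.1 p.2.1 (η p) * ratio m ε p.1 p.2.2 (q' p)) / (η p + q' p))) := by
    refine eventually_const_lt_of_continuousAt ?_ (by fun_prop)
    rw [q0, q0', η0, η0']
    have h1 : 0 ≤ ratio m ε z₀.1 z₀.2.1 0 * ratio m ε z₀.1 z₀.2.2 0 := mul_self_nonneg _
    have h2 : 0 ≤ ratio m ε z₀.1 z₀.2.1 (√(rateSum m ε k₀)) *
      ratio m ε z₀.1 z₀.2.2 (√(rateSum m ε k₀)) := mul_self_nonneg _
    simp only [add_zero, zero_mul, sub_zero]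
    positivity
  have hE := eventually_rates hm hε hεm k₀
  have t1 : Tendsto (fun p : ℝ × ℝ × ℝ => (p.1, p.2.1)) (𝓝 z₀) (𝓝 (k₀, bandPlus m ε k₀ 0)) :=
    Continuous.tendsto (by fun_prop) z₀
  have t2 : Tendsto (fun p : ℝ × ℝ × ℝ => (p.1, p.2.2)) (𝓝 z₀) (𝓝 (k₀, bandPlus m ε k₀ 0)) :=
    Continuous.tendsto (by fun_prop) z₀
  filter_upwards [e1, e2, t1.eventually hE, t2.eventually hE] with p h1 h2 h3 h4 hle hlt
  obtain ⟨r1, -⟩ := h3 hle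
  obtain ⟨r2, r3⟩ := h4 (hlt.le.trans hle)
  have r4 := r3 (hlt.trans_le hle)
  exact weyl_sub_pos hε r1 r2 hlt (add_pos_of_nonneg_of_pos r1.q_nonneg r4) h1 h2

end RegDirac
end

noncomputable section
namespace RegDirac

/-! ### Exponentially decaying solutions -/

/-- The product of `g` with exp(-ay) has zero derivative. -/
theorem eq_exp_of_hasDerivWithinAt {g : ℝ → ℂ} {a : ℂ}
    (h : ∀ y, 0 ≤ y → HasDerivWithinAt g (a * g y) (Ici 0) y) {y : ℝ} (hy : 0 ≤ y) :
    g y = g 0 * Complex.exp (a * y) := by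
  have hd : ∀ x ∈ Ici (0 : ℝ), HasDerivWithinAt (fun t : ℝ => g t * Complex.exp (-(a * t))) 0
      (Ici 0) x := by
    intro x hx
    have he : HasDerivAt (fun t : ℝ => Complex.exp (-(a * t)))
        (Complex.exp (-(a * x)) * (-(a * 1))) x :=
      (((hasDerivAt_id (x : ℂ)).comp_ofReal.const_mul a).neg).cexp
    have := (h x hx).mul he.hasDerivWithinAt
    refine HasDerivWithinAt.congr_deriv this (Eq.symm ?_)
    ring
  have := Convex.norm_image_sub_le_of_norm_hasDerivWithin_le (C := 0) hd (by simp) (convex_Ici 0)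
    self_mem_Ici (mem_Ici.2 hy)
  simp only [zero_mul, norm_le_zero_iff, Complex.ofReal_zero, mul_zero, neg_zero, Complex.exp_zero,
    mul_one] at this
  rw [← sub_eq_zero.1 this, mul_assoc, ← Complex.exp_add]
  simp

theorem eq_zero_of_exp_le_linear {c x a b : ℝ} (hx : 0 < x)
    (h : ∀ y : ℝ, 0 ≤ y → c * Real.exp (x * y) ≤ a + b * y) : c ≤ 0 := by
  by_contra hc
  push Not at hc
  have h1 : Tendsto (fun y : ℝ => (a + b * y) / Real.exp (x * y)) atTop (𝓝 0) := by
    have e0 : Tendsto (fun y : ℝ => Real.exp (-(x * y))) atTop (𝓝 0) :=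
      Real.tendsto_exp_neg_atTop_nhds_zero.comp (tendsto_id.const_mul_atTop hx)
    have e1 : Tendsto (fun y : ℝ => (x * y) * Real.exp (-(x * y))) atTop (𝓝 0) := by
      have := (Real.tendsto_pow_mul_exp_neg_atTop_nhds_zero 1).comp
        (tendsto_id.const_mul_atTop hx)
      simpa [Function.comp_def] using this
    have e2 := (e0.const_mul a).add (e1.const_mul (b / x))
    simp only [mul_zero, add_zero] at e2
    refine e2.congr fun y => ?_
    rw [Real.exp_neg]
    field_simp
  have h2 := h1.eventually_lt_const hc
  obtain ⟨y, hy1, hy2⟩ := (h2.and (eventually_ge_atTop 0)).exists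
  rw [div_lt_iff₀ (Real.exp_pos _)] at hy1
  linarith [h y hy2]

/-- The system satisfied by the components of an edge mode, in terms of `ε u' + v` and `-ε v'`. -/
structure EdgeSystem (m ε k ω : ℝ) (u v u' v' X₀ X₁ : ℝ → ℂ) : Prop where
  hu : ∀ y, 0 ≤ y → HasDerivWithinAt u (u' y) (Ici 0) y
  hv : ∀ y, 0 ≤ y → HasDerivWithinAt v (v' y) (Ici 0) y
  hX₀ : ∀ y, 0 ≤ y → X₀ y = ε * u' y + v y
  hX₁ : ∀ y, 0 ≤ y → X₁ y = -(ε * v' y)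
  dX₀ : ∀ y, 0 ≤ y → HasDerivWithinAt X₀ ((ω - m + ε * k ^ 2) * u y + k * v y) (Ici 0) y
  dX₁ : ∀ y, 0 ≤ y → HasDerivWithinAt X₁ ((ω + m - ε * k ^ 2) * v y + k * u y + u' y) (Ici 0) y

/-- By Green's identity the boundary form Ω of the solution against the decaying wave (1, ρ)
exp(-xy) satisfies Ω' = xΩ, so it grows exponentially unless it vanishes. A bound on `u` and `v`
alone, without their derivatives, excludes growth. -/
theorem EdgeSystem.boundary_form_eq_zero {m ε k ω x ρ : ℝ} {u v u' v' X₀ X₁ : ℝ → ℂ}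
    (h : EdgeSystem m ε k ω u v u' v' X₀ X₁) (hx : 0 < x)
    (h1 : ω = m - ε * (k ^ 2 - x ^ 2) - (k + x) * ρ)
    (h2 : ω * ρ = (x - k) - (m - ε * (k ^ 2 - x ^ 2)) * ρ)
    {Cu : ℝ} (hbu : ∀ y, 0 ≤ y → ‖u y‖ ≤ Cu) (hbv : ∀ y, 0 ≤ y → ‖v y‖ ≤ Cu)
    {y : ℝ} (hy : 0 ≤ y) :
    X₀ y + ρ * X₁ y + (ε * x - ρ) * u y - ε * ρ * x * v y = 0 := by
  have h1c : (ω : ℂ) = m - ε * (k ^ 2 - x ^ 2) - (k + x) * ρ := by exact_mod_cast h1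
  have h2c : (ω * ρ : ℂ) = (x - k) - (m - ε * (k ^ 2 - x ^ 2)) * ρ := by exact_mod_cast h2
  set Ω : ℝ → ℂ := fun y => X₀ y + ρ * X₁ y + (ε * x - ρ) * u y - ε * ρ * x * v y with hΩ
  have hd : ∀ y, 0 ≤ y → HasDerivWithinAt Ω (x * Ω y) (Ici 0) y := by
    intro y hy
    have := (((h.dX₀ y hy).add ((h.dX₁ y hy).const_mul (ρ : ℂ))).add
      ((h.hu y hy).const_mul (ε * x - ρ : ℂ))).sub ((h.hv y hy).const_mul (ε * ρ * x : ℂ))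
    refine HasDerivWithinAt.congr_deriv this (Eq.symm ?_)
    simp only [hΩ, h.hX₀ y hy, h.hX₁ y hy]
    linear_combination (-u y) * h1c - v y * h2c
  have hexp : ∀ y, 0 ≤ y → Ω y = Ω 0 * Complex.exp (x * y) := fun y hy =>
    eq_exp_of_hasDerivWithinAt hd hy
  -- Ω contains ε(u - ρv)'. Removing the primitive of the exponential leaves a function with bounded
  -- derivative, hence of at most linear growth; so the exponential would be bounded by a linear
  -- function.
  set F : ℝ → ℂ := fun y => ε * (u y - ρ * v y) - Ω 0 / x * Complex.exp (x * y) with hF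
  have hdF : ∀ y ∈ Ici (0 : ℝ), HasDerivWithinAt F
      (-(v y + (ε * x - ρ) * u y - ε * ρ * x * v y)) (Ici 0) y := by
    intro y hy
    have he : HasDerivAt (fun t : ℝ => Complex.exp (x * t))
        (Complex.exp (x * y) * (x * 1)) y :=
      ((hasDerivAt_id (y : ℂ)).comp_ofReal.const_mul (x : ℂ)).cexp
    have := (((h.hu y hy).sub ((h.hv y hy).const_mul (ρ : ℂ))).const_mul (ε : ℂ)).sub
      (he.hasDerivWithinAt.const_mul (Ω 0 / x))
    refine HasDerivWithinAt.congr_deriv this (Eq.symm ?_)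
    have e := hexp y hy
    simp only [hΩ, h.hX₀ y hy, h.hX₁ y hy] at e
    have hxc : (x : ℂ) ≠ 0 := by exact_mod_cast hx.ne'
    have e' : Ω 0 / x * (Complex.exp (x * y) * (x * 1)) = Ω 0 * Complex.exp (x * y) := by
      field_simp
    rw [e']
    linear_combination (-1 : ℂ) * e
  set C₂ : ℝ := Cu + ‖(ε * x - ρ : ℂ)‖ * Cu + ‖(ε * ρ * x : ℂ)‖ * Cu with hC₂
  have hbd : ∀ y ∈ Ici (0 : ℝ), ‖-(v y + (ε * x - ρ) * u y - ε * ρ * x * v y)‖ ≤ C₂ := by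
    intro y hy
    rw [norm_neg]
    refine (norm_sub_le _ _).trans (add_le_add ((norm_add_le _ _).trans (add_le_add (hbv y hy) ?_)) ?_)
    · rw [norm_mul]; exact mul_le_mul_of_nonneg_left (hbu y hy) (norm_nonneg _)
    · rw [norm_mul]; exact mul_le_mul_of_nonneg_left (hbv y hy) (norm_nonneg _)
  have hlin : ∀ y, 0 ≤ y → ‖F y - F 0‖ ≤ C₂ * y := by
    intro y hy
    have := Convex.norm_image_sub_le_of_norm_hasDerivWithin_le hdF hbd (convex_Ici 0)
      self_mem_Ici (mem_Ici.2 hy)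
    simpa [abs_of_nonneg hy] using this
  have hc : ‖Ω 0 / x‖ ≤ 0 := by
    refine eq_zero_of_exp_le_linear hx (a := ‖F 0‖ + ‖(ε : ℂ)‖ * (Cu + ‖(ρ : ℂ)‖ * Cu)) (b := C₂)
      fun y hy => ?_
    have e1 : Ω 0 / x * Complex.exp (x * y) = ε * (u y - ρ * v y) - (F y - F 0) - F 0 := by
      simp only [hF]; ring
    have e2 : ‖Ω 0 / x * Complex.exp (x * y)‖ = ‖Ω 0 / x‖ * Real.exp (x * y) := by
      rw [norm_mul, Complex.norm_exp]; simp
    rw [← e2, e1]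
    have e3 : ‖(ε : ℂ) * (u y - ρ * v y)‖ ≤ ‖(ε : ℂ)‖ * (Cu + ‖(ρ : ℂ)‖ * Cu) := by
      rw [norm_mul]
      refine mul_le_mul_of_nonneg_left ((norm_sub_le _ _).trans (add_le_add (hbu y hy) ?_))
        (norm_nonneg _)
      rw [norm_mul]; exact mul_le_mul_of_nonneg_left (hbv y hy) (norm_nonneg _)
    have := norm_sub_le ((ε : ℂ) * (u y - ρ * v y) - (F y - F 0)) (F 0)
    have := norm_sub_le ((ε : ℂ) * (u y - ρ * v y)) (F y - F 0)
    linarith [hlin y hy]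
  have h0 : Ω 0 = 0 := by
    have := norm_le_zero_iff.1 hc
    exact (div_eq_zero_iff.1 this).resolve_right (by exact_mod_cast hx.ne')
  have := hexp y hy
  rw [h0, zero_mul] at this
  exact this

/-- A bounded solution of the edge system is a combination of the two decaying waves. -/
theorem EdgeSystem.eq_waves {m ε k ω q η : ℝ} {u v u' v' X₀ X₁ : ℝ → ℂ} (hε : 0 < ε)
    (h : EdgeSystem m ε k ω u v u' v' X₀ X₁) (hR : Rates m ε k ω q η) (hq : 0 < q)
    {Cu : ℝ} (hbu : ∀ y, 0 ≤ y → ‖u y‖ ≤ Cu) (hbv : ∀ y, 0 ≤ y → ‖v y‖ ≤ Cu) :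
    ∃ c₁ c₂ : ℂ, X₁ 0 = ε * ratio m ε k ω q * q * c₁ + ε * ratio m ε k ω η * η * c₂ ∧
      X₀ 0 = (-ε * q + ratio m ε k ω q) * c₁ + (-ε * η + ratio m ε k ω η) * c₂ ∧
      ∀ y : ℝ, 0 ≤ y →
      u y = c₁ * Complex.exp (-q * y) + c₂ * Complex.exp (-η * y) ∧
      v y = ratio m ε k ω q * c₁ * Complex.exp (-q * y) +
        ratio m ε k ω η * c₂ * Complex.exp (-η * y) := by
  have hη : 0 < η := hq.trans hR.q_lt
  obtain ⟨e1, e2⟩ := ratio_eigen (hR.r_pos hε q) hR.disp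
  obtain ⟨f1, f2⟩ := ratio_eigen (hR.r_pos hε η) (hR.disp' hε.ne')
  have hs := hR.slope_lt hε
  have W1 := fun y (hy : 0 ≤ y) => h.boundary_form_eq_zero hq e1 e2 hbu hbv hy
  have W2 := fun y (hy : 0 ≤ y) => h.boundary_form_eq_zero hη f1 f2 hbu hbv hy
  obtain ⟨a1, a2⟩ := hR.weyl_slow hε
  obtain ⟨b1, b2⟩ := hR.weyl_fast hε
  have e2c : (ω * ratio m ε k ω q : ℂ) =
      (q - k) - (m - ε * (k ^ 2 - q ^ 2)) * ratio m ε k ω q := by exact_mod_cast e2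
  have f2c : (ω * ratio m ε k ω η : ℂ) =
      (η - k) - (m - ε * (k ^ 2 - η ^ 2)) * ratio m ε k ω η := by exact_mod_cast f2
  set ρ₁ := ratio m ε k ω q
  set ρ₂ := ratio m ε k ω η
  set n₀₀ := weyl₀₀ m ε k ω q η
  set n₀₁ := weyl₀₁ m ε k ω q η
  set n₁₁ := weyl₁₁ m ε k ω q η
  have a1c : (n₀₀ + n₀₁ * (ε * ρ₁ * q) : ℂ) = -ε * q + ρ₁ := by exact_mod_cast a1
  have a2c : (n₀₁ + n₁₁ * (ε * ρ₁ * q) : ℂ) = -ρ₁ := by exact_mod_cast a2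
  have b1c : (n₀₀ + n₀₁ * (ε * ρ₂ * η) : ℂ) = -ε * η + ρ₂ := by exact_mod_cast b1
  have b2c : (n₀₁ + n₁₁ * (ε * ρ₂ * η) : ℂ) = -ρ₂ := by exact_mod_cast b2
  set s₁ : ℂ := ε * ρ₁ * q with hs₁
  set s₂ : ℂ := ε * ρ₂ * η with hs₂
  have hne : s₂ - s₁ ≠ 0 := by
    have : (ε * ρ₂ * η - ε * ρ₁ * q : ℝ) ≠ 0 := (sub_pos.2 hs).ne'
    rw [hs₁, hs₂]; exact_mod_cast this
  -- the solution lies on the decaying plane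
  have L1 : ∀ y, 0 ≤ y → -v y - n₀₁ * u y - n₁₁ * X₁ y = 0 := by
    intro y hy
    refine mul_left_cancel₀ hne ?_
    linear_combination W2 y hy - W1 y hy + (-u y) * (b1c - a1c) - X₁ y * (b2c - a2c)
  have L0 : ∀ y, 0 ≤ y → X₀ y - n₀₀ * u y - n₀₁ * X₁ y = 0 := by
    intro y hy
    linear_combination W1 y hy - s₁ * L1 y hy - u y * a1c - X₁ y * a2c
  -- The coordinates of (u, X₁) in the basis formed by the input data of the two waves. On the
  -- decaying plane they decouple into c₁' = -q c₁ and c₂' = -η c₂.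
  set c₁ : ℝ → ℂ := fun y => (s₂ * u y - X₁ y) / (s₂ - s₁) with hc₁
  set c₂ : ℝ → ℂ := fun y => (X₁ y - s₁ * u y) / (s₂ - s₁) with hc₂
  have hu_eq : ∀ y, u y = c₁ y + c₂ y := fun y => by
    simp only [hc₁, hc₂]; field_simp; ring
  have hX_eq : ∀ y, X₁ y = s₁ * c₁ y + s₂ * c₂ y := fun y => by
    simp only [hc₁, hc₂]; field_simp; ring
  have hv_eq : ∀ y, 0 ≤ y → v y = ρ₁ * c₁ y + ρ₂ * c₂ y := by
    intro y hy
    have := L1 y hy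
    rw [hu_eq y, hX_eq y] at this
    linear_combination (-1 : ℂ) * this - c₁ y * a2c - c₂ y * b2c
  have hX₀_eq : ∀ y, 0 ≤ y → X₀ y = (-ε * q + ρ₁) * c₁ y + (-ε * η + ρ₂) * c₂ y := by
    intro y hy
    have := L0 y hy
    rw [hu_eq y, hX_eq y] at this
    linear_combination this + c₁ y * a1c + c₂ y * b1c
  have hεc : (ε : ℂ) ≠ 0 := by exact_mod_cast hε.ne'
  have hu'_eq : ∀ y, 0 ≤ y → u' y = -q * c₁ y - η * c₂ y := by
    intro y hy
    refine mul_left_cancel₀ hεc ?_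
    linear_combination (-1 : ℂ) * h.hX₀ y hy + hX₀_eq y hy - hv_eq y hy
  have hX₁' : ∀ y, 0 ≤ y → (ω + m - ε * k ^ 2) * v y + k * u y + u' y =
      -q * s₁ * c₁ y - η * s₂ * c₂ y := by
    intro y hy
    rw [hv_eq y hy, hu_eq y, hu'_eq y hy, hs₁, hs₂]
    linear_combination c₁ y * e2c + c₂ y * f2c
  have d1 : ∀ y, 0 ≤ y → HasDerivWithinAt c₁ (-q * c₁ y) (Ici 0) y := by
    intro y hy
    have := (((h.hu y hy).const_mul s₂).sub (h.dX₁ y hy)).div_const (s₂ - s₁)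
    refine HasDerivWithinAt.congr_deriv this (Eq.symm ?_)
    rw [hX₁' y hy, hu'_eq y hy]
    field_simp; ring
  have d2 : ∀ y, 0 ≤ y → HasDerivWithinAt c₂ (-η * c₂ y) (Ici 0) y := by
    intro y hy
    have := ((h.dX₁ y hy).sub ((h.hu y hy).const_mul s₁)).div_const (s₂ - s₁)
    refine HasDerivWithinAt.congr_deriv this (Eq.symm ?_)
    rw [hX₁' y hy, hu'_eq y hy]
    field_simp; ring
  refine ⟨c₁ 0, c₂ 0, hX_eq 0, hX₀_eq 0 le_rfl, fun y hy => ⟨?_, ?_⟩⟩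
  · rw [hu_eq y, eq_exp_of_hasDerivWithinAt d1 hy, eq_exp_of_hasDerivWithinAt d2 hy]
  · rw [hv_eq y hy, eq_exp_of_hasDerivWithinAt d1 hy, eq_exp_of_hasDerivWithinAt d2 hy]
    ring

end RegDirac
end

noncomputable section
namespace RegDirac

/-! ### Normalized boundary conditions and the edge matrix -/

/-- The boundary condition `(1 - Π) ψ + Π (χ + M ψ) = 0` with an orthogonal projection `Π` and a
Hermitian `M = Π M Π`; here `χ = (ε ψ₀' + ψ₁, -ε ψ₁')`. -/
structure IsNormalBC (Pr M : Matrix (Fin 2) (Fin 2) ℂ) : Prop where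
  herm : Prᴴ = Pr
  idem : Pr * Pr = Pr
  hermM : Mᴴ = M
  left : Pr * M = M

def bdryMap (Pr M : Matrix (Fin 2) (Fin 2) ℂ) (ψ χ : Fin 2 → ℂ) : Fin 2 → ℂ :=
  ψ - Pr *ᵥ ψ + Pr *ᵥ χ + M *ᵥ ψ

/-- The conormal data χ: with it the boundary form of H♯ becomes ⟨φ, χ⟩ - ⟨ξ, ψ⟩, where ξ belongs to
φ. -/
def chiData (ε : ℝ) (ψ ψ' : Fin 2 → ℂ) : Fin 2 → ℂ := ![ε * ψ' 0 + ψ 1, -(ε * ψ' 1)]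

/-- The Weyl matrix, as a complex matrix. -/
def weylMat (m ε k ω q η : ℝ) : Matrix (Fin 2) (Fin 2) ℂ :=
  !![(weyl₀₀ m ε k ω q η : ℂ), (weyl₀₁ m ε k ω q η : ℂ);
     (weyl₀₁ m ε k ω q η : ℂ), (weyl₁₁ m ε k ω q η : ℂ)]

/-- Extracts the input of the Weyl matrix, (Πψ)₀ and χ₁. The projection is inserted to make the
total matrix Hermitian; on kernel vectors it acts as the identity. -/
def selMat (Pr : Matrix (Fin 2) (Fin 2) ℂ) : Matrix (Fin 2) (Fin 2 ⊕ Fin 1) ℂ :=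
  fromCols !![Pr 0 0, Pr 0 1; 0, 0] !![0; 1]

/-- The unknowns are ψ and t = χ₁. The first two rows carry the boundary condition, the last one the
relation ψ₁ + n₀₁ψ₀ + n₁₁t = 0 of the decaying plane. Keeping t as a separate unknown avoids solving
for χ in terms of ψ, which may be singular. -/
def bdryForm (Pr M : Matrix (Fin 2) (Fin 2) ℂ) : Matrix (Fin 2 ⊕ Fin 1) (Fin 2 ⊕ Fin 1) ℂ :=
  fromBlocks (M + (1 - Pr)) !![Pr 0 1; Pr 1 1] !![Pr 1 0, Pr 1 1] 0

/-- The Hermitian matrix on `(ψ(0), -ε ψ₁'(0))` whose kernel consists of the boundary data of the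
edge modes. -/
def edgeMat (Pr M N : Matrix (Fin 2) (Fin 2) ℂ) : Matrix (Fin 2 ⊕ Fin 1) (Fin 2 ⊕ Fin 1) ℂ :=
  bdryForm Pr M + (selMat Pr)ᴴ * N * selMat Pr

theorem IsNormalBC.apply {Pr M : Matrix (Fin 2) (Fin 2) ℂ} (h : IsNormalBC Pr M) (i j : Fin 2) :
    star (Pr i j) = Pr j i := by
  have := congrFun (congrFun h.herm j) i
  simpa using this

theorem IsNormalBC.isHermitian_bdryForm {Pr M : Matrix (Fin 2) (Fin 2) ℂ} (h : IsNormalBC Pr M) :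
    (bdryForm Pr M).IsHermitian := by
  unfold bdryForm
  refine Matrix.IsHermitian.fromBlocks ?_ ?_ (by simp [Matrix.IsHermitian])
  · unfold Matrix.IsHermitian
    rw [conjTranspose_add, conjTranspose_sub, conjTranspose_one, h.herm, h.hermM]
  · ext i j
    fin_cases j
    fin_cases i
    · simpa using h.apply 0 1
    · simpa using h.apply 1 1

theorem isHermitian_edgeMat {Pr M N : Matrix (Fin 2) (Fin 2) ℂ} (h : IsNormalBC Pr M)
    (hN : N.IsHermitian) : (edgeMat Pr M N).IsHermitian :=
  h.isHermitian_bdryForm.add (isHermitian_conjTranspose_mul_mul _ hN)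

theorem isHermitian_weylMat (m ε k ω q η : ℝ) : (weylMat m ε k ω q η).IsHermitian := by
  ext i j
  fin_cases i <;> fin_cases j <;> simp [weylMat]

theorem selMat_mulVec (Pr : Matrix (Fin 2) (Fin 2) ℂ) (z : Fin 2 ⊕ Fin 1 → ℂ) :
    selMat Pr *ᵥ z = ![(Pr *ᵥ fun i => z (Sum.inl i)) 0, z (Sum.inr 0)] := by
  ext i
  fin_cases i <;> simp [selMat, mulVec, dotProduct, Fin.sum_univ_two]

theorem edgeMat_mulVec {Pr M : Matrix (Fin 2) (Fin 2) ℂ} (h : IsNormalBC Pr M) (m ε k ω q η : ℝ)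
    (z : Fin 2 ⊕ Fin 1 → ℂ) :
    edgeMat Pr M (weylMat m ε k ω q η) *ᵥ z =
      Sum.elim (bdryMap Pr M (fun i => z (Sum.inl i))
        ![weyl₀₀ m ε k ω q η * (Pr *ᵥ fun i => z (Sum.inl i)) 0 + weyl₀₁ m ε k ω q η * z (Sum.inr 0),
          z (Sum.inr 0)])
        (fun _ => (Pr *ᵥ fun i => z (Sum.inl i)) 1 +
          weyl₀₁ m ε k ω q η * (Pr *ᵥ fun i => z (Sum.inl i)) 0 +
          weyl₁₁ m ε k ω q η * z (Sum.inr 0)) := by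
  have h00 := h.apply 0 0
  have h01 := h.apply 0 1
  unfold edgeMat
  rw [add_mulVec, Matrix.mul_assoc, ← mulVec_mulVec, ← mulVec_mulVec, selMat_mulVec]
  ext i
  rcases i with i | i
  · fin_cases i
    · simp [bdryForm, bdryMap, weylMat, selMat, mulVec, dotProduct, Fin.sum_univ_two,
        vecHead, vecTail] at h00 ⊢
      rw [h00]; ring
    · simp [bdryForm, bdryMap, weylMat, selMat, mulVec, dotProduct, Fin.sum_univ_two,
        vecHead, vecTail] at h01 ⊢
      rw [h01]; ring
  · fin_cases i
    simp [bdryForm, weylMat, selMat, mulVec, dotProduct, Fin.sum_univ_two]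
    ring

/-- The terms (1-Π)ψ and Π(χ + Mψ) lie in complementary subspaces, so both vanish. -/
theorem IsNormalBC.proj_eq_of_bdryMap {Pr M : Matrix (Fin 2) (Fin 2) ℂ} (h : IsNormalBC Pr M)
    {ψ χ : Fin 2 → ℂ} (h0 : bdryMap Pr M ψ χ = 0) : Pr *ᵥ ψ = ψ := by
  have h1 : Pr *ᵥ bdryMap Pr M ψ χ = Pr *ᵥ χ + M *ᵥ ψ := by
    simp only [bdryMap, mulVec_add, mulVec_sub, mulVec_mulVec, h.idem, h.left]
    simp
  rw [h0, mulVec_zero] at h1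
  have h2 : bdryMap Pr M ψ χ = (ψ - Pr *ᵥ ψ) + (Pr *ᵥ χ + M *ᵥ ψ) := by
    simp only [bdryMap, add_assoc]
  rw [h0, ← h1, add_zero] at h2
  exact (sub_eq_zero.1 h2.symm).symm

/-- Either side forces Πψ = ψ, after which the projections inside the matrix disappear and the rows
read as the boundary condition and the Weyl relation. -/
theorem edgeMat_mulVec_eq_zero {Pr M : Matrix (Fin 2) (Fin 2) ℂ} (h : IsNormalBC Pr M)
    (m ε k ω q η : ℝ) (z : Fin 2 ⊕ Fin 1 → ℂ) :
    edgeMat Pr M (weylMat m ε k ω q η) *ᵥ z = 0 ↔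
      bdryMap Pr M (fun i => z (Sum.inl i))
        ![weyl₀₀ m ε k ω q η * z (Sum.inl 0) + weyl₀₁ m ε k ω q η * z (Sum.inr 0),
          z (Sum.inr 0)] = 0 ∧
      z (Sum.inl 1) + weyl₀₁ m ε k ω q η * z (Sum.inl 0) + weyl₁₁ m ε k ω q η * z (Sum.inr 0) = 0 := by
  rw [edgeMat_mulVec h]
  constructor
  · intro h0
    have h1 : bdryMap Pr M (fun i => z (Sum.inl i)) _ = 0 :=
      funext fun i => congrFun h0 (Sum.inl i)
    have h2 := congrFun h0 (Sum.inr 0)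
    have hp := h.proj_eq_of_bdryMap h1
    simp only [hp] at h1 h2
    exact ⟨h1, h2⟩
  · rintro ⟨h1, h2⟩
    have hp := h.proj_eq_of_bdryMap h1
    ext i
    simp only [hp]
    rcases i with i | i
    · exact congrFun h1 i
    · exact h2

/-- A kernel vector is determined by (ψ₀, χ₁), since the Weyl relation gives ψ₁. This makes the
monotonicity of the edge matrix strict on kernels. -/
theorem selMat_ne_zero_of_ker {Pr M : Matrix (Fin 2) (Fin 2) ℂ} (h : IsNormalBC Pr M)
    {m ε k ω q η : ℝ} {z : Fin 2 ⊕ Fin 1 → ℂ}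
    (hz : edgeMat Pr M (weylMat m ε k ω q η) *ᵥ z = 0) (hz0 : z ≠ 0) : selMat Pr *ᵥ z ≠ 0 := by
  obtain ⟨h1, h2⟩ := (edgeMat_mulVec_eq_zero h m ε k ω q η z).1 hz
  have hp := h.proj_eq_of_bdryMap h1
  rw [selMat_mulVec, hp]
  intro h0
  have e0 : z (Sum.inl 0) = 0 := by simpa using congrFun h0 0
  have e2 : z (Sum.inr 0) = 0 := by simpa using congrFun h0 1
  rw [e0, e2] at h2
  apply hz0
  ext i
  rcases i with i | i
  · fin_cases i
    · exact e0
    · simpa using h2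
  · fin_cases i; exact e2

/-! ### Edge modes -/

theorem solve_pair {s₁ s₂ : ℂ} (h : s₂ - s₁ ≠ 0) (a t : ℂ) :
    (s₂ * a - t) / (s₂ - s₁) + (t - s₁ * a) / (s₂ - s₁) = a ∧
      s₁ * ((s₂ * a - t) / (s₂ - s₁)) + s₂ * ((t - s₁ * a) / (s₂ - s₁)) = t := by
  constructor <;> field_simp <;> ring

theorem solve_pair' {s₁ s₂ : ℂ} (h : s₂ - s₁ ≠ 0) (c₁ c₂ : ℂ) :
    (s₂ * (c₁ + c₂) - (s₁ * c₁ + s₂ * c₂)) / (s₂ - s₁) = c₁ ∧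
      ((s₁ * c₁ + s₂ * c₂) - s₁ * (c₁ + c₂)) / (s₂ - s₁) = c₂ := by
  constructor <;> field_simp <;> ring

/-- The decaying wave with boundary data `(ψ₀(0), -ε ψ₁'(0)) = (z (inl 0), z (inr 0))`. -/
def waveOf (m ε k ω q η : ℝ) : (Fin 2 ⊕ Fin 1 → ℂ) →ₗ[ℂ] (ℝ → EuclideanSpace ℂ (Fin 2)) where
  toFun z y := if y < 0 then 0 else
    !₂[((ε * ratio m ε k ω η * η * z (Sum.inl 0) - z (Sum.inr 0)) /
          (ε * ratio m ε k ω η * η - ε * ratio m ε k ω q * q)) * Complex.exp (-q * y) +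
        ((z (Sum.inr 0) - ε * ratio m ε k ω q * q * z (Sum.inl 0)) /
          (ε * ratio m ε k ω η * η - ε * ratio m ε k ω q * q)) * Complex.exp (-η * y),
      ratio m ε k ω q * ((ε * ratio m ε k ω η * η * z (Sum.inl 0) - z (Sum.inr 0)) /
          (ε * ratio m ε k ω η * η - ε * ratio m ε k ω q * q)) * Complex.exp (-q * y) +
        ratio m ε k ω η * ((z (Sum.inr 0) - ε * ratio m ε k ω q * q * z (Sum.inl 0)) /
          (ε * ratio m ε k ω η * η - ε * ratio m ε k ω q * q)) * Complex.exp (-η * y)]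
  map_add' z w := by
    ext y i
    by_cases hy : y < 0
    · simp [hy]
    · fin_cases i <;> simp [hy] <;> ring
  map_smul' a z := by
    ext y i
    by_cases hy : y < 0
    · simp [hy]
    · fin_cases i <;> simp [hy] <;> ring

/-- The decaying wave with coefficients `c₁, c₂`. -/
def decWave (ρ₁ ρ₂ q η : ℝ) (c₁ c₂ : ℂ) (y : ℝ) : EuclideanSpace ℂ (Fin 2) :=
  !₂[c₁ * Complex.exp (-q * y) + c₂ * Complex.exp (-η * y),
    ρ₁ * c₁ * Complex.exp (-q * y) + ρ₂ * c₂ * Complex.exp (-η * y)]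

theorem hasDerivWithinAt_pair {f g : ℝ → ℂ} {f' g' : ℂ} {s : Set ℝ} {y : ℝ}
    (hf : HasDerivWithinAt f f' s y) (hg : HasDerivWithinAt g g' s y) :
    HasDerivWithinAt (fun t => (!₂[f t, g t] : EuclideanSpace ℂ (Fin 2))) !₂[f', g'] s y := by
  have h : HasDerivWithinAt (fun t => ![f t, g t]) ![f', g'] s y := by
    rw [hasDerivWithinAt_pi]
    intro i
    fin_cases i
    · exact hf
    · exact hg
  exact (((PiLp.continuousLinearEquiv 2 ℝ (fun _ : Fin 2 => ℂ)).symm :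
    (Fin 2 → ℂ) →L[ℝ] EuclideanSpace ℂ (Fin 2)).hasFDerivAt.comp_hasDerivWithinAt y h)

theorem hasDerivWithinAt_euclidean_apply {f : ℝ → EuclideanSpace ℂ (Fin 2)}
    {f' : EuclideanSpace ℂ (Fin 2)} {s : Set ℝ} {y : ℝ} (hf : HasDerivWithinAt f f' s y)
    (i : Fin 2) : HasDerivWithinAt (fun t => f t i) (f' i) s y :=
  ((EuclideanSpace.proj i : EuclideanSpace ℂ (Fin 2) →L[ℂ] ℂ).restrictScalars
    ℝ).hasFDerivAt.comp_hasDerivWithinAt y hf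

theorem hasDerivWithinAt_decWave (ρ₁ ρ₂ q η : ℝ) (c₁ c₂ : ℂ) (s : Set ℝ) (y : ℝ) :
    HasDerivWithinAt (decWave ρ₁ ρ₂ q η c₁ c₂) (decWave ρ₁ ρ₂ q η (-q * c₁) (-η * c₂) y) s y := by
  have he : ∀ (a : ℝ), HasDerivWithinAt (fun t : ℝ => Complex.exp (-a * t))
      (Complex.exp (-a * y) * (-a * 1)) s y := fun a =>
    ((hasDerivAt_id (y : ℂ)).comp_ofReal.const_mul (-a : ℂ)).cexp.hasDerivWithinAt
  have := hasDerivWithinAt_pair (((he q).const_mul c₁).add ((he η).const_mul c₂))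
    (((he q).const_mul (ρ₁ * c₁)).add ((he η).const_mul (ρ₂ * c₂)))
  refine HasDerivWithinAt.congr_deriv this ?_
  unfold decWave
  congr 1
  ext i
  fin_cases i <;> simp <;> ring

theorem norm_decWave_le (ρ₁ ρ₂ : ℝ) {q η : ℝ} (hqη : q ≤ η) (c₁ c₂ : ℂ) {y : ℝ} (hy : 0 ≤ y) :
    ‖decWave ρ₁ ρ₂ q η c₁ c₂ y‖ ≤ (‖(!₂[c₁, ρ₁ * c₁] : EuclideanSpace ℂ (Fin 2))‖ +
      ‖(!₂[c₂, ρ₂ * c₂] : EuclideanSpace ℂ (Fin 2))‖) * Real.exp (-q * y) := by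
  have h1 : decWave ρ₁ ρ₂ q η c₁ c₂ y = Complex.exp (-q * y) • !₂[c₁, ρ₁ * c₁] +
      Complex.exp (-η * y) • !₂[c₂, ρ₂ * c₂] := by
    ext i; fin_cases i <;> simp [decWave] <;> ring
  have hn : ∀ a : ℝ, ‖Complex.exp (-a * y)‖ = Real.exp (-a * y) := fun a => by
    rw [Complex.norm_exp]; simp
  rw [h1]
  refine (norm_add_le _ _).trans ?_
  rw [norm_smul, norm_smul, hn, hn, add_mul]
  have : Real.exp (-η * y) ≤ Real.exp (-q * y) := by
    apply Real.exp_le_exp.2; nlinarith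
  nlinarith [norm_nonneg (!₂[c₁, ρ₁ * c₁] : EuclideanSpace ℂ (Fin 2)),
    norm_nonneg (!₂[c₂, ρ₂ * c₂] : EuclideanSpace ℂ (Fin 2))]

theorem waveOf_mem_edgeModes {m ε k ω q η : ℝ} (hε : 0 < ε) (hR : Rates m ε k ω q η) (hq : 0 < q)
    {Pr M : Matrix (Fin 2) (Fin 2) ℂ} (hbc : IsNormalBC Pr M)
    {A : Matrix (Fin 2) (Fin 2 ⊕ Fin 2) ℂ}
    (hA : ∀ ψ ψ' : Fin 2 → ℂ, A *ᵥ Sum.elim ψ ψ' = 0 ↔ bdryMap Pr M ψ (chiData ε ψ ψ') = 0)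
    {z : Fin 2 ⊕ Fin 1 → ℂ} (hz : edgeMat Pr M (weylMat m ε k ω q η) *ᵥ z = 0) :
    waveOf m ε k ω q η z ∈ edgeModes m ε k A ω := by
  obtain ⟨e1, e2⟩ := ratio_eigen (hR.r_pos hε q) hR.disp
  obtain ⟨f1, f2⟩ := ratio_eigen (hR.r_pos hε η) (hR.disp' hε.ne')
  have hs := hR.slope_lt hε
  obtain ⟨a1, a2⟩ := hR.weyl_slow hε
  obtain ⟨b1, b2⟩ := hR.weyl_fast hε
  obtain ⟨hz1, hz2⟩ := (edgeMat_mulVec_eq_zero hbc m ε k ω q η z).1 hz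
  have hne : (ε * ratio m ε k ω η * η - ε * ratio m ε k ω q * q : ℂ) ≠ 0 := by
    exact_mod_cast (sub_pos.2 hs).ne'
  set c₁ : ℂ := (ε * ratio m ε k ω η * η * z (Sum.inl 0) - z (Sum.inr 0)) /
          (ε * ratio m ε k ω η * η - ε * ratio m ε k ω q * q) with hc₁
  set c₂ : ℂ := (z (Sum.inr 0) - ε * ratio m ε k ω q * q * z (Sum.inl 0)) /
          (ε * ratio m ε k ω η * η - ε * ratio m ε k ω q * q) with hc₂
  have hz0 : z (Sum.inl 0) = c₁ + c₂ := (solve_pair hne _ _).1.symm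
  have ht : z (Sum.inr 0) = ε * ratio m ε k ω q * q * c₁ + ε * ratio m ε k ω η * η * c₂ := (solve_pair hne _ _).2.symm
  set ρ₁ := ratio m ε k ω q
  set ρ₂ := ratio m ε k ω η
  set n₀₀ := weyl₀₀ m ε k ω q η
  set n₀₁ := weyl₀₁ m ε k ω q η
  set n₁₁ := weyl₁₁ m ε k ω q η
  have a1c : (n₀₀ + n₀₁ * (ε * ρ₁ * q) : ℂ) = -ε * q + ρ₁ := by exact_mod_cast a1
  have a2c : (n₀₁ + n₁₁ * (ε * ρ₁ * q) : ℂ) = -ρ₁ := by exact_mod_cast a2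
  have b1c : (n₀₀ + n₀₁ * (ε * ρ₂ * η) : ℂ) = -ε * η + ρ₂ := by exact_mod_cast b1
  have b2c : (n₀₁ + n₁₁ * (ε * ρ₂ * η) : ℂ) = -ρ₂ := by exact_mod_cast b2
  have e1c : (ω : ℂ) = m - ε * (k ^ 2 - q ^ 2) - (k + q) * ρ₁ := by exact_mod_cast e1
  have f1c : (ω : ℂ) = m - ε * (k ^ 2 - η ^ 2) - (k + η) * ρ₂ := by exact_mod_cast f1
  have e2c : (ω * ρ₁ : ℂ) = (q - k) - (m - ε * (k ^ 2 - q ^ 2)) * ρ₁ := by exact_mod_cast e2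
  have f2c : (ω * ρ₂ : ℂ) = (η - k) - (m - ε * (k ^ 2 - η ^ 2)) * ρ₂ := by exact_mod_cast f2
  have hz1' : z (Sum.inl 1) = ρ₁ * c₁ + ρ₂ * c₂ := by
    rw [hz0, ht] at hz2
    linear_combination hz2 - c₁ * a2c - c₂ * b2c
  have hχ : n₀₀ * z (Sum.inl 0) + n₀₁ * z (Sum.inr 0) =
      (-ε * q + ρ₁) * c₁ + (-ε * η + ρ₂) * c₂ := by
    rw [hz0, ht]; linear_combination c₁ * a1c + c₂ * b1c
  have hval : ∀ y : ℝ, 0 ≤ y → waveOf m ε k ω q η z y = decWave ρ₁ ρ₂ q η c₁ c₂ y := by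
    intro y hy
    simp only [waveOf, LinearMap.coe_mk, AddHom.coe_mk, if_neg (not_lt.2 hy)]
    rfl
  refine ⟨fun y hy => by simp [waveOf, hy], decWave ρ₁ ρ₂ q η (-q * c₁) (-η * c₂),
    decWave ρ₁ ρ₂ q η (-q * (-q * c₁)) (-η * (-η * c₂)), fun y hy => ⟨?_, ?_, ?_⟩, ?_, ?_⟩
  · exact (hasDerivWithinAt_decWave ρ₁ ρ₂ q η c₁ c₂ _ y).congr (fun t ht => hval t ht) (hval y hy)
  · exact hasDerivWithinAt_decWave ρ₁ ρ₂ q η _ _ _ y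
  · rw [hval y hy]
    ext i
    fin_cases i
    · simp [edgeH, decWave]
      linear_combination (-c₁ * Complex.exp (-(q * y))) * e1c - (c₂ * Complex.exp (-(η * y))) * f1c
    · simp [edgeH, decWave]
      linear_combination (-c₁ * Complex.exp (-(q * y))) * e2c - (c₂ * Complex.exp (-(η * y))) * f2c
  · rw [hA]
    have h1 : (fun i => waveOf m ε k ω q η z 0 i) = fun i => z (Sum.inl i) := by
      ext i
      rw [hval 0 le_rfl]
      fin_cases i
      · simp [decWave, hz0]
      · simp [decWave, hz1']
    have h2 : chiData ε (fun i => waveOf m ε k ω q η z 0 i)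
        (fun i => decWave ρ₁ ρ₂ q η (-q * c₁) (-η * c₂) 0 i) =
        ![n₀₀ * z (Sum.inl 0) + n₀₁ * z (Sum.inr 0), z (Sum.inr 0)] := by
      rw [h1, hχ, ht]
      ext i
      fin_cases i
      · simp [chiData, decWave, hz1']; ring
      · simp [chiData, decWave]; ring
    rw [h2, h1]
    exact hz1
  · refine ⟨‖(!₂[c₁, ρ₁ * c₁] : EuclideanSpace ℂ (Fin 2))‖ +
      ‖(!₂[c₂, ρ₂ * c₂] : EuclideanSpace ℂ (Fin 2))‖, q, hq, fun y hy => ?_⟩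
    rw [hval y hy]
    exact norm_decWave_le ρ₁ ρ₂ hR.q_lt.le c₁ c₂ hy

/-- Exponential decay implies boundedness, so the mode is a combination of the two decaying waves.
Its data (ψ(0), -εψ₁'(0)) then obey the Weyl relation as well as the boundary condition. -/
theorem exists_waveOf_of_mem_edgeModes {m ε k ω q η : ℝ} (hε : 0 < ε) (hR : Rates m ε k ω q η)
    (hq : 0 < q) {Pr M : Matrix (Fin 2) (Fin 2) ℂ} (hbc : IsNormalBC Pr M)
    {A : Matrix (Fin 2) (Fin 2 ⊕ Fin 2) ℂ}
    (hA : ∀ ψ ψ' : Fin 2 → ℂ, A *ᵥ Sum.elim ψ ψ' = 0 ↔ bdryMap Pr M ψ (chiData ε ψ ψ') = 0)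
    {ψ : ℝ → EuclideanSpace ℂ (Fin 2)} (hψ : ψ ∈ edgeModes m ε k A ω) :
    ∃ z : Fin 2 ⊕ Fin 1 → ℂ, edgeMat Pr M (weylMat m ε k ω q η) *ᵥ z = 0 ∧
      waveOf m ε k ω q η z = ψ := by
  obtain ⟨hneg, ψ', ψ'', hsol, hbdry, C, c, hc, hdec⟩ := hψ
  have hsys : EdgeSystem m ε k ω (fun y => ψ y 0) (fun y => ψ y 1) (fun y => ψ' y 0)
      (fun y => ψ' y 1) (fun y => ε * ψ' y 0 + ψ y 1) (fun y => -(ε * ψ' y 1)) := by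
    refine ⟨fun y hy => hasDerivWithinAt_euclidean_apply (hsol y hy).1 0, fun y hy => hasDerivWithinAt_euclidean_apply (hsol y hy).1 1,
      fun y _ => rfl, fun y _ => rfl, fun y hy => ?_, fun y hy => ?_⟩
    · have h1 := ((hasDerivWithinAt_euclidean_apply (hsol y hy).2.1 0).const_mul (ε : ℂ)).add
        (hasDerivWithinAt_euclidean_apply (hsol y hy).1 1)
      refine HasDerivWithinAt.congr_deriv h1 ?_
      have h2 := congrArg (fun w : EuclideanSpace ℂ (Fin 2) => w 0) (hsol y hy).2.2
      simp [edgeH] at h2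
      linear_combination h2
    · have h1 := ((hasDerivWithinAt_euclidean_apply (hsol y hy).2.1 1).const_mul (ε : ℂ)).neg
      refine HasDerivWithinAt.congr_deriv h1 ?_
      have h2 := congrArg (fun w : EuclideanSpace ℂ (Fin 2) => w 1) (hsol y hy).2.2
      simp [edgeH] at h2
      linear_combination h2
  have hC : ∀ y, 0 ≤ y → ‖ψ y‖ ≤ C := by
    intro y hy
    have h1 : 0 ≤ C := by
      have := (norm_nonneg _).trans (hdec 0 le_rfl); simpa using this
    refine (hdec y hy).trans (mul_le_of_le_one_right h1 ?_)
    apply Real.exp_le_one_iff.2; nlinarith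
  have hb : ∀ i : Fin 2, ∀ y, 0 ≤ y → ‖ψ y i‖ ≤ C := fun i y hy =>
    (PiLp.norm_apply_le (ψ y) i).trans (hC y hy)
  obtain ⟨c₁, c₂, hX₁, hX₀, hw⟩ := hsys.eq_waves hε hR hq (hb 0) (hb 1)
  have hs := hR.slope_lt hε
  obtain ⟨a1, a2⟩ := hR.weyl_slow hε
  obtain ⟨b1, b2⟩ := hR.weyl_fast hε
  have hne : (ε * ratio m ε k ω η * η - ε * ratio m ε k ω q * q : ℂ) ≠ 0 := by
    exact_mod_cast (sub_pos.2 hs).ne'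
  have hu0 := (hw 0 le_rfl).1
  have hv0 := (hw 0 le_rfl).2
  simp only [Complex.ofReal_zero, mul_zero, Complex.exp_zero, mul_one] at hu0 hv0
  refine ⟨Sum.elim (fun i => ψ 0 i) (fun _ => -(ε * ψ' 0 1)), ?_, ?_⟩
  · rw [edgeMat_mulVec_eq_zero hbc]
    have a1c : (weyl₀₀ m ε k ω q η + weyl₀₁ m ε k ω q η * (ε * ratio m ε k ω q * q) : ℂ) =
      -ε * q + ratio m ε k ω q := by exact_mod_cast a1
    have a2c : (weyl₀₁ m ε k ω q η + weyl₁₁ m ε k ω q η * (ε * ratio m ε k ω q * q) : ℂ) =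
      -ratio m ε k ω q := by exact_mod_cast a2
    have b1c : (weyl₀₀ m ε k ω q η + weyl₀₁ m ε k ω q η * (ε * ratio m ε k ω η * η) : ℂ) =
      -ε * η + ratio m ε k ω η := by exact_mod_cast b1
    have b2c : (weyl₀₁ m ε k ω q η + weyl₁₁ m ε k ω q η * (ε * ratio m ε k ω η * η) : ℂ) =
      -ratio m ε k ω η := by exact_mod_cast b2
    simp only [Sum.elim_inl, Sum.elim_inr]
    constructor
    · have h1 := (hA _ _).1 hbdry
      have h2 : chiData ε (fun i => ψ 0 i) (fun i => ψ' 0 i) =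
          ![weyl₀₀ m ε k ω q η * ψ 0 0 + weyl₀₁ m ε k ω q η * -(ε * ψ' 0 1), -(ε * ψ' 0 1)] := by
        unfold chiData
        congr 1
        rw [hX₀, hX₁, hu0]
        linear_combination (-c₁) * a1c - c₂ * b1c
      rwa [h2] at h1
    · rw [hX₁, hu0, hv0]
      linear_combination c₁ * a2c + c₂ * b2c
  · funext y
    by_cases hy : y < 0
    · simp [waveOf, hy, hneg y hy]
    · have hy' : 0 ≤ y := not_lt.1 hy
      have g1 : (ε * ratio m ε k ω η * η * ψ 0 0 - -(ε * ψ' 0 1)) /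
          (ε * ratio m ε k ω η * η - ε * ratio m ε k ω q * q) = c₁ := by
        rw [hX₁, hu0]; exact (solve_pair' hne _ _).1
      have g2 : (-(ε * ψ' 0 1) - ε * ratio m ε k ω q * q * ψ 0 0) /
          (ε * ratio m ε k ω η * η - ε * ratio m ε k ω q * q) = c₂ := by
        rw [hX₁, hu0]; exact (solve_pair' hne _ _).2
      simp only [waveOf, LinearMap.coe_mk, AddHom.coe_mk, if_neg hy, Sum.elim_inl, Sum.elim_inr,
        g1, g2]
      ext i
      fin_cases i
      · simpa using (hw y hy').1.symm
      · simpa using (hw y hy').2.symm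

/-- The edge modes are counted by the nullity of the edge matrix. -/
theorem finrank_edgeModes {m ε k ω q η : ℝ} (hε : 0 < ε) (hR : Rates m ε k ω q η)
    (hq : 0 < q) {Pr M : Matrix (Fin 2) (Fin 2) ℂ} (hbc : IsNormalBC Pr M)
    {A : Matrix (Fin 2) (Fin 2 ⊕ Fin 2) ℂ}
    (hA : ∀ ψ ψ' : Fin 2 → ℂ, A *ᵥ Sum.elim ψ ψ' = 0 ↔ bdryMap Pr M ψ (chiData ε ψ ψ') = 0) :
    Set.finrank ℂ (edgeModes m ε k A ω) = nullity (edgeMat Pr M (weylMat m ε k ω q η)) := by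
  set K := LinearMap.ker (edgeMat Pr M (weylMat m ε k ω q η)).mulVecLin with hK
  have hset : edgeModes m ε k A ω = (K.map (waveOf m ε k ω q η) : Set _) := by
    ext ψ
    constructor
    · intro h
      obtain ⟨z, hz, rfl⟩ := exists_waveOf_of_mem_edgeModes hε hR hq hbc hA h
      exact ⟨z, by simpa [hK] using hz, rfl⟩
    · rintro ⟨z, hz, rfl⟩
      exact waveOf_mem_edgeModes hε hR hq hbc hA (by simpa [hK] using hz)
  rw [Set.finrank, hset, Submodule.span_eq, nullity]
  have hs := hR.slope_lt hε
  have hne : (ε * ratio m ε k ω η * η - ε * ratio m ε k ω q * q : ℂ) ≠ 0 := by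
    exact_mod_cast (sub_pos.2 hs).ne'
  have hinj : Function.Injective ((waveOf m ε k ω q η).domRestrict K) := by
    rw [← LinearMap.ker_eq_bot, LinearMap.ker_eq_bot']
    rintro ⟨z, hz⟩ h0
    have hz' : edgeMat Pr M (weylMat m ε k ω q η) *ᵥ z = 0 := by simpa [hK] using hz
    have h0' : waveOf m ε k ω q η z = 0 := h0
    by_contra hcon
    have hz0 : z ≠ 0 := fun h => hcon (by ext1; exact h)
    have hsel := selMat_ne_zero_of_ker hbc hz' hz0
    obtain ⟨p1, p2⟩ := (edgeMat_mulVec_eq_zero hbc m ε k ω q η z).1 hz'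
    rw [selMat_mulVec, hbc.proj_eq_of_bdryMap p1] at hsel
    apply hsel
    set c₁ : ℂ := (ε * ratio m ε k ω η * η * z (Sum.inl 0) - z (Sum.inr 0)) /
          (ε * ratio m ε k ω η * η - ε * ratio m ε k ω q * q) with hc₁
    set c₂ : ℂ := (z (Sum.inr 0) - ε * ratio m ε k ω q * q * z (Sum.inl 0)) /
          (ε * ratio m ε k ω η * η - ε * ratio m ε k ω q * q) with hc₂
    have q0 : c₁ + c₂ = 0 := by
      have := congrArg (fun f : ℝ → EuclideanSpace ℂ (Fin 2) => f 0 0) h0'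
      simpa [waveOf] using this
    -- The values at y = 0 and y = 1 separate the two exponentials because q < η.
    have q1 : c₁ * Complex.exp (-q) + c₂ * Complex.exp (-η) = 0 := by
      have := congrArg (fun f : ℝ → EuclideanSpace ℂ (Fin 2) => f 1 0) h0'
      simpa [waveOf, show ¬ (1 : ℝ) < 0 by norm_num] using this
    have hexp : Complex.exp (-q) - Complex.exp (-η) ≠ 0 := by
      have : Real.exp (-q) - Real.exp (-η) ≠ 0 :=
        (sub_pos.2 (Real.exp_lt_exp.2 (neg_lt_neg hR.q_lt))).ne'
      exact_mod_cast this
    have hc1 : c₁ = 0 := by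
      have : c₁ * (Complex.exp (-q) - Complex.exp (-η)) = 0 := by
        linear_combination q1 - Complex.exp (-η) * q0
      exact (mul_eq_zero.1 this).resolve_right hexp
    have hc2 : c₂ = 0 := by linear_combination q0 - hc1
    have hz0' : z (Sum.inl 0) = c₁ + c₂ := (solve_pair hne _ _).1.symm
    have ht : z (Sum.inr 0) = ε * ratio m ε k ω q * q * c₁ + ε * ratio m ε k ω η * η * c₂ := (solve_pair hne _ _).2.symm
    rw [hc1, hc2] at hz0' ht
    ext i
    fin_cases i
    · simpa using hz0'
    · simpa using ht
  rw [← LinearMap.finrank_range_of_inj hinj, LinearMap.range_domRestrict]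

end RegDirac
end

noncomputable section
namespace RegDirac

/-! ### Spectral flow through zero of a decreasing family -/

/-- `B ω` is a strictly decreasing family on `[a, b]`, at least on the kernels. -/
def DecreasingOn {n : Type*} [Fintype n] (B : ℝ → Matrix n n ℂ) (s : Set ℝ) : Prop :=
  ∀ ω ∈ s, ∀ ω' ∈ s, ω' < ω → (∀ z, quadForm (B ω) z ≤ quadForm (B ω') z) ∧
    ∀ z, z ≠ 0 → B ω' *ᵥ z = 0 → quadForm (B ω) z < 0

/-- Semicontinuity bounds the index at `y` from below by that at `x`, and monotonicity bounds it
from above for `y < x`. -/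
theorem DecreasingOn.eventually_left {n : Type*} [Fintype n]
    {B : ℝ → Matrix n n ℂ} {a b x : ℝ} (hc : ContinuousOn B (Icc a b))
    (hd : DecreasingOn B (Icc a b)) (hx : x ∈ Ioc a b) :
    ∀ᶠ y in 𝓝[<] x, negIndex (B y) = negIndex (B x) := by
  have hx' : x ∈ Icc a b := ⟨hx.1.le, hx.2⟩
  have h1 : Tendsto B (𝓝[<] x) (𝓝 (B x)) :=
    (hc x hx').mono_left (nhdsWithin_le_of_mem
      (mem_of_superset (Ioo_mem_nhdsLT hx.1) fun y hy => ⟨hy.1.le, hy.2.le.trans hx.2⟩))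
  filter_upwards [h1.eventually (eventually_negIndex_le (B x)), Ioo_mem_nhdsLT hx.1] with y h2 hy
  exact le_antisymm (negIndex_le_of_le (hd x hx' y ⟨hy.1.le, hy.2.le.trans hx.2⟩ hy.2).1) h2

/-- Beyond `x` every kernel vector has become negative, while positive directions persist; the sum
rule for the inertia leaves no other change. -/
theorem DecreasingOn.eventually_right {n : Type*} [Fintype n] [DecidableEq n]
    {B : ℝ → Matrix n n ℂ} {a b x : ℝ} (hH : ∀ y, (B y).IsHermitian) (hc : ContinuousOn B (Icc a b))
    (hd : DecreasingOn B (Icc a b)) (hx : x ∈ Ico a b) :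
    ∀ᶠ y in 𝓝[>] x, negIndex (B y) = negIndex (B x) + nullity (B x) := by
  have hx' : x ∈ Icc a b := ⟨hx.1, hx.2.le⟩
  have h1 : Tendsto B (𝓝[>] x) (𝓝 (B x)) :=
    (hc x hx').mono_left (nhdsWithin_le_of_mem
      (mem_of_superset (Ioo_mem_nhdsGT hx.2) fun y hy => ⟨hx.1.trans hy.1.le, hy.2.le⟩))
  filter_upwards [h1.eventually (eventually_negIndex_neg_le (B x)), Ioo_mem_nhdsGT hx.2] with y h2 hy
  obtain ⟨h3, h4⟩ := hd y ⟨hx.1.trans hy.1.le, hy.2.le⟩ x hx' hy.1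
  have h5 := negIndex_add_nullity_le (hH x) h3 h4
  have h6 := negIndex_add_eq (hH x)
  have h7 := negIndex_add_eq (hH y)
  omega

/-- The index is left-continuous and its jump at each energy is the nullity there. The nullity at
`a` is subtracted because the sum runs over the open interval. -/
theorem DecreasingOn.finsum_nullity {n : Type*} [Fintype n] [DecidableEq n]
    {B : ℝ → Matrix n n ℂ} {a b : ℝ} (hab : a < b) (hH : ∀ y, (B y).IsHermitian)
    (hc : ContinuousOn B (Icc a b)) (hd : DecreasingOn B (Icc a b)) :
    ((∑ᶠ ω ∈ Ioo a b, nullity (B ω) : ℕ) : ℤ) =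
      negIndex (B b) - (negIndex (B a) + nullity (B a)) := by
  obtain ⟨hfin, hsum⟩ := finsum_jump (ν := fun x => (negIndex (B x) : ℤ))
    (L := fun x => (negIndex (B x) : ℤ)) (R := fun x => (negIndex (B x) + nullity (B x) : ℤ)) hab
    (fun x hx => by filter_upwards [hd.eventually_left hc hx] with y hy; exact_mod_cast hy)
    (fun x hx => by filter_upwards [hd.eventually_right hH hc hx] with y hy; exact_mod_cast hy)
  have h1 : ∀ x, (negIndex (B x) + nullity (B x) : ℤ) - negIndex (B x) = nullity (B x) := fun x => by
    ring
  simp only [h1] at hfin hsum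
  rw [← hsum]
  have hs : (Ioo a b ∩ Function.support fun x => nullity (B x)).Finite := by
    refine hfin.subset ?_
    rintro x ⟨hx, h⟩
    exact ⟨hx, by simpa using h⟩
  have hset : (Ioo a b ∩ Function.support fun x => nullity (B x)) =
      Ioo a b ∩ Function.support fun x => (nullity (B x) : ℤ) := by
    ext x; simp
  rw [← finsum_mem_inter_support, Nat.cast_finsum_mem hs, hset,
    finsum_mem_inter_support (fun x => (nullity (B x) : ℤ))]

/-! ### The edge matrix as a function of momentum and energy -/

/-- The edge matrix at momentum `k` and energy `ω`. -/
def edgeMatAt (m ε : ℝ) (Pr M : Matrix (Fin 2) (Fin 2) ℂ) (k ω : ℝ) :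
    Matrix (Fin 2 ⊕ Fin 1) (Fin 2 ⊕ Fin 1) ℂ :=
  edgeMat Pr M (weylMat m ε k ω (slowRate m ε k ω) (fastRate m ε k ω))

theorem continuousAt_weylMat {X : Type*} [TopologicalSpace X] {m ε : ℝ} (hε : 0 < ε)
    {k ω q η : X → ℝ} {x : X} (hk : ContinuousAt k x) (hω : ContinuousAt ω x)
    (hq : ContinuousAt q x) (hη : ContinuousAt η x)
    (h : weylDen m ε (k x) (ω x) (q x) (η x) ≠ 0) :
    ContinuousAt (fun p => weylMat m ε (k p) (ω p) (q p) (η p)) x := by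
  have hD : ContinuousAt (fun p => weylDen m ε (k p) (ω p) (q p) (η p)) x := by
    unfold weylDen; fun_prop
  have hN : ContinuousAt (fun p => weylNum m ε (k p) (ω p) (q p) (η p)) x := by
    unfold weylNum; fun_prop
  have h00 : ContinuousAt (fun p => weyl₀₀ m ε (k p) (ω p) (q p) (η p)) x := by
    unfold weyl₀₀; exact ContinuousAt.div (by fun_prop) hD h
  have h01 : ContinuousAt (fun p => weyl₀₁ m ε (k p) (ω p) (q p) (η p)) x := by
    unfold weyl₀₁; exact ContinuousAt.div (by fun_prop) hD h
  have h11 : ContinuousAt (fun p => weyl₁₁ m ε (k p) (ω p) (q p) (η p)) x := by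
    unfold weyl₁₁; exact ContinuousAt.div (by fun_prop) (by fun_prop) (mul_ne_zero hε.ne' h)
  have hc : ∀ {f : X → ℝ}, ContinuousAt f x → ContinuousAt (fun p => (f p : ℂ)) x := fun hf =>
    Complex.continuous_ofReal.continuousAt.comp hf
  refine continuousAt_pi.2 fun i => continuousAt_pi.2 fun j => ?_
  fin_cases i <;> fin_cases j
  · exact hc h00
  · exact hc h01
  · exact hc h01
  · exact hc h11

theorem continuous_edgeMat (Pr : Matrix (Fin 2) (Fin 2) ℂ) :
    Continuous fun p : Matrix (Fin 2) (Fin 2) ℂ × Matrix (Fin 2) (Fin 2) ℂ =>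
      edgeMat Pr p.1 p.2 := by
  unfold edgeMat bdryForm
  refine Continuous.add (Continuous.matrix_fromBlocks (by fun_prop) continuous_const
    continuous_const continuous_const) ?_
  exact (continuous_const.matrix_mul continuous_snd).matrix_mul continuous_const

theorem continuousAt_edgeMatAt {m ε : ℝ} (hε : 0 < ε) (Pr : Matrix (Fin 2) (Fin 2) ℂ)
    {M : ℝ → Matrix (Fin 2) (Fin 2) ℂ} (hM : Continuous M) {p : ℝ × ℝ}
    (hR : Rates m ε p.1 p.2 (slowRate m ε p.1 p.2) (fastRate m ε p.1 p.2)) :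
    ContinuousAt (fun p : ℝ × ℝ => edgeMatAt m ε Pr (M p.1) p.1 p.2) p := by
  have hd : weylDen m ε p.1 p.2 (slowRate m ε p.1 p.2) (fastRate m ε p.1 p.2) ≠ 0 := hR.den_pos.ne'
  have h1 := continuousAt_weylMat (m := m) (k := fun p : ℝ × ℝ => p.1)
    (ω := fun p : ℝ × ℝ => p.2) (q := fun p => slowRate m ε p.1 p.2)
    (η := fun p => fastRate m ε p.1 p.2) (x := p) hε continuousAt_fst continuousAt_snd
    (continuous_slowRate m ε).continuousAt (continuous_fastRate m ε).continuousAt hd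
  have h2 : ContinuousAt (fun p : ℝ × ℝ => M p.1) p := (hM.comp continuous_fst).continuousAt
  have h3 : ContinuousAt (fun p : ℝ × ℝ => (M p.1, weylMat m ε p.1 p.2 (slowRate m ε p.1 p.2)
    (fastRate m ε p.1 p.2))) p := h2.prodMk h1
  have h4 := (continuous_edgeMat Pr).continuousAt.comp h3
  unfold edgeMatAt
  exact h4

/-- The edge matrix at the threshold. -/
def thrMat (m ε : ℝ) (Pr M : Matrix (Fin 2) (Fin 2) ℂ) (k : ℝ) :
    Matrix (Fin 2 ⊕ Fin 1) (Fin 2 ⊕ Fin 1) ℂ :=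
  edgeMat Pr M (weylMat m ε k (bandPlus m ε k 0) 0 (√(rateSum m ε k)))

theorem edgeMatAt_threshold {m ε : ℝ} (hm : 0 < m) (hε : 0 < ε) (hεm : ε < 1 / (2 * m))
    (Pr M : Matrix (Fin 2) (Fin 2) ℂ) (k : ℝ) :
    edgeMatAt m ε Pr M k (bandPlus m ε k 0) = thrMat m ε Pr M k := by
  rw [edgeMatAt, slowRate_threshold hm hε hεm, fastRate_threshold hm hε hεm, thrMat]

theorem continuous_thrMat {m ε : ℝ} (hm : 0 < m) (hε : 0 < ε) (hεm : ε < 1 / (2 * m))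
    (Pr : Matrix (Fin 2) (Fin 2) ℂ) {M : ℝ → Matrix (Fin 2) (Fin 2) ℂ} (hM : Continuous M) :
    Continuous fun k => thrMat m ε Pr (M k) k := by
  have : (fun k => thrMat m ε Pr (M k) k) =
      (fun p : ℝ × ℝ => edgeMatAt m ε Pr (M p.1) p.1 p.2) ∘ fun k => (k, bandPlus m ε k 0) := by
    funext k; exact (edgeMatAt_threshold hm hε hεm Pr (M k) k).symm
  rw [this, continuous_iff_continuousAt]
  intro k
  refine ContinuousAt.comp (f := fun k : ℝ => ((k, bandPlus m ε k 0) : ℝ × ℝ))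
    (continuousAt_edgeMatAt hε Pr hM ?_) ?_
  · simp only
    rw [slowRate_threshold hm hε hεm, fastRate_threshold hm hε hεm]
    exact rates_threshold hm hε hεm k
  · unfold bandPlus; fun_prop

theorem quadForm_two_pos {a b c : ℝ} (hc : 0 < c) (hd : 0 < a * c - b ^ 2) {z : Fin 2 → ℂ}
    (hz : z ≠ 0) : 0 < quadForm !![(a : ℂ), b; b, c] z := by
  have h : quadForm !![(a : ℂ), b; b, c] z * c =
      (a * c - b ^ 2) * ‖z 0‖ ^ 2 + ‖b * z 0 + c * z 1‖ ^ 2 := by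
    simp only [quadForm, dotProduct, mulVec, Fin.sum_univ_two, ← Complex.normSq_eq_norm_sq,
      Complex.normSq_apply]
    simp
    ring
  have h2 : 0 < quadForm !![(a : ℂ), b; b, c] z * c := by
    rw [h]
    by_cases h0 : z 0 = 0
    · have h1 : z 1 ≠ 0 := fun h1 => hz (by ext i; fin_cases i <;> simp [h0, h1])
      have : (c : ℂ) ≠ 0 := by exact_mod_cast hc.ne'
      have : 0 < ‖(b * z 0 + c * z 1 : ℂ)‖ := by
        rw [h0, mul_zero, zero_add]; exact norm_pos_iff.2 (mul_ne_zero this h1)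
      positivity
    · have : 0 < ‖z 0‖ := norm_pos_iff.2 h0
      positivity
  exact pos_of_mul_pos_left h2 hc.le

theorem quadForm_edgeMat_sub (Pr M N N' : Matrix (Fin 2) (Fin 2) ℂ) (z : Fin 2 ⊕ Fin 1 → ℂ) :
    quadForm (edgeMat Pr M N') z - quadForm (edgeMat Pr M N) z =
      quadForm (N' - N) (selMat Pr *ᵥ z) := by
  rw [← quadForm_congr, ← quadForm_sub, edgeMat, edgeMat, add_sub_add_left_eq_sub, ← Matrix.sub_mul,
    ← Matrix.mul_sub]

/-- The energy enters only through the Weyl matrix, so the difference of two edge matrices is the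
form of a positive definite 2×2 matrix on the image of `selMat`, and that image is nonzero on kernel
vectors. One radius serves all nearby momenta and all small windows. -/
theorem eventually_decreasingOn_edgeMatAt {m ε : ℝ} (hm : 0 < m) (hε : 0 < ε)
    (hεm : ε < 1 / (2 * m)) {Pr : Matrix (Fin 2) (Fin 2) ℂ} {M : ℝ → Matrix (Fin 2) (Fin 2) ℂ}
    (hbc : ∀ k, IsNormalBC Pr (M k)) (k₀ : ℝ) :
    ∃ r > 0, ∀ k, |k - k₀| < r → ∀ δ, 0 < δ → δ < r →
      DecreasingOn (edgeMatAt m ε Pr (M k) k) (Icc (bandPlus m ε k 0 - δ) (bandPlus m ε k 0)) ∧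
      ∀ ω ∈ Icc (bandPlus m ε k 0 - δ) (bandPlus m ε k 0),
        Rates m ε k ω (slowRate m ε k ω) (fastRate m ε k ω) ∧
        (ω < bandPlus m ε k 0 → 0 < slowRate m ε k ω) := by
  have hb : Continuous fun k => bandPlus m ε k 0 := by unfold bandPlus; fun_prop
  set Φ : ℝ × ℝ × ℝ → ℝ × ℝ × ℝ := fun p =>
    (p.1, bandPlus m ε p.1 0 - p.2.1, bandPlus m ε p.1 0 - p.2.2) with hΦ
  have hΦc : Continuous Φ := by fun_prop
  have h1 : ∀ᶠ p in 𝓝 ((k₀, 0, 0) : ℝ × ℝ × ℝ), _ :=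
    (hΦc.tendsto' (k₀, 0, 0) (k₀, bandPlus m ε k₀ 0, bandPlus m ε k₀ 0)
      (by simp [hΦ])).eventually (eventually_weyl_sub_pos hm hε hεm k₀)
  have hΨc : Continuous fun p : ℝ × ℝ × ℝ => (p.1, bandPlus m ε p.1 0 - p.2.1) := by fun_prop
  have h2 : ∀ᶠ p in 𝓝 ((k₀, 0, 0) : ℝ × ℝ × ℝ), _ :=
    (hΨc.tendsto' (k₀, 0, 0) (k₀, bandPlus m ε k₀ 0) (by simp)).eventually
      (eventually_rates hm hε hεm k₀)
  obtain ⟨r, hr, hball⟩ := Metric.eventually_nhds_iff.1 (h1.and h2)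
  refine ⟨r, hr, fun k hk δ hδ hδr => ?_⟩
  have hmem : ∀ ω ∈ Icc (bandPlus m ε k 0 - δ) (bandPlus m ε k 0),
      ∀ ω' ∈ Icc (bandPlus m ε k 0 - δ) (bandPlus m ε k 0),
      dist ((k, bandPlus m ε k 0 - ω, bandPlus m ε k 0 - ω') : ℝ × ℝ × ℝ) (k₀, 0, 0) < r := by
    intro ω hω ω' hω'
    simp only [Prod.dist_eq, Real.dist_eq, sub_zero, max_lt_iff]
    refine ⟨hk, ?_, ?_⟩
    · rw [abs_of_nonneg (by linarith [hω.2])]; linarith [hω.1]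
    · rw [abs_of_nonneg (by linarith [hω'.2])]; linarith [hω'.1]
  constructor
  · intro ω hω ω' hω' hlt
    have h3 := (hball (hmem ω hω ω' hω')).1
    simp only [hΦ, sub_sub_cancel] at h3
    obtain ⟨p1, p2⟩ := h3 hω.2 hlt
    have hpos : ∀ w : Fin 2 → ℂ, w ≠ 0 → 0 < quadForm
        (weylMat m ε k ω' (slowRate m ε k ω') (fastRate m ε k ω') -
          weylMat m ε k ω (slowRate m ε k ω) (fastRate m ε k ω)) w := by
      intro w hw
      have := quadForm_two_pos p1 p2 hw
      convert this using 2
      ext i j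
      fin_cases i <;> fin_cases j <;> simp [weylMat]
    constructor
    · intro z
      have h4 := quadForm_edgeMat_sub Pr (M k) (weylMat m ε k ω (slowRate m ε k ω) (fastRate m ε k ω))
        (weylMat m ε k ω' (slowRate m ε k ω') (fastRate m ε k ω')) z
      by_cases hs : selMat Pr *ᵥ z = 0
      · rw [hs, quadForm_zero] at h4
        exact (sub_eq_zero.1 h4).symm.le
      · have := hpos _ hs
        unfold edgeMatAt
        linarith
    · intro z hz h0
      have h4 := quadForm_edgeMat_sub Pr (M k) (weylMat m ε k ω (slowRate m ε k ω) (fastRate m ε k ω))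
        (weylMat m ε k ω' (slowRate m ε k ω') (fastRate m ε k ω')) z
      have h5 := hpos _ (selMat_ne_zero_of_ker (hbc k) h0 hz)
      have h6 : quadForm (edgeMatAt m ε Pr (M k) k ω') z = 0 := by simp [quadForm, h0]
      unfold edgeMatAt at *
      linarith
  · intro ω hω
    have h3 := (hball (hmem ω hω ω hω)).2
    simp only [sub_sub_cancel] at h3
    exact h3 hω.2

theorem isHermitian_edgeMatAt {m ε : ℝ} {Pr M : Matrix (Fin 2) (Fin 2) ℂ} (h : IsNormalBC Pr M)
    (k ω : ℝ) : (edgeMatAt m ε Pr M k ω).IsHermitian :=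
  isHermitian_edgeMat h (isHermitian_weylMat _ _ _ _ _ _)

theorem isHermitian_thrMat {m ε : ℝ} {Pr M : Matrix (Fin 2) (Fin 2) ℂ} (h : IsNormalBC Pr M)
    (k : ℝ) : (thrMat m ε Pr M k).IsHermitian :=
  isHermitian_edgeMat h (isHermitian_weylMat _ _ _ _ _ _)

/-- The number of edge modes just below the threshold. -/
theorem eventually_edgeCount_eq {m ε : ℝ} (hm : 0 < m) (hε : 0 < ε)
    (hεm : ε < 1 / (2 * m)) {Pr : Matrix (Fin 2) (Fin 2) ℂ} {M : ℝ → Matrix (Fin 2) (Fin 2) ℂ}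
    (hM : Continuous M) (hbc : ∀ k, IsNormalBC Pr (M k))
    {A : ℝ → Matrix (Fin 2) (Fin 2 ⊕ Fin 2) ℂ} {Bad : Set ℝ}
    (hA : ∀ k ∉ Bad, ∀ ψ ψ' : Fin 2 → ℂ, A k *ᵥ Sum.elim ψ ψ' = 0 ↔
      bdryMap Pr (M k) ψ (chiData ε ψ ψ') = 0) (k₀ : ℝ) :
    ∀ᶠ δ in 𝓝[>] (0 : ℝ), ∀ᶠ k in 𝓝 k₀, k ∉ Bad →
      (edgeCount m ε k (A k) δ : ℤ) =
        negIndex (thrMat m ε Pr (M k) k) - negIndex (thrMat m ε Pr (M k₀) k₀) := by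
  obtain ⟨r, hr, hdec⟩ := eventually_decreasingOn_edgeMatAt hm hε hεm hbc k₀
  have hb : Continuous fun k => bandPlus m ε k 0 := by unfold bandPlus; fun_prop
  have hcont : ∀ k, |k - k₀| < r → ∀ δ, 0 < δ → δ < r →
      ∀ ω ∈ Icc (bandPlus m ε k 0 - δ) (bandPlus m ε k 0),
      ContinuousAt (fun p : ℝ × ℝ => edgeMatAt m ε Pr (M p.1) p.1 p.2) (k, ω) :=
    fun k hk δ hδ hδr ω hω => continuousAt_edgeMatAt hε Pr hM ((hdec k hk δ hδ hδr).2 ω hω).1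
  have hcontOn : ∀ k, |k - k₀| < r → ∀ δ, 0 < δ → δ < r →
      ContinuousOn (edgeMatAt m ε Pr (M k) k) (Icc (bandPlus m ε k 0 - δ) (bandPlus m ε k 0)) := by
    intro k hk δ hδ hδr ω hω
    exact (ContinuousAt.comp (f := fun ω : ℝ => ((k, ω) : ℝ × ℝ)) (hcont k hk δ hδ hδr ω hω)
      (by fun_prop)).continuousWithinAt
  have hk0 : |k₀ - k₀| < r := by simpa using hr
  -- At k₀ the index just below the threshold equals the index at the threshold.
  have hleft := (hdec k₀ hk0 (r / 2) (by linarith) (by linarith)).1.eventually_left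
    (hcontOn k₀ hk0 (r / 2) (by linarith) (by linarith))
    (x := bandPlus m ε k₀ 0) ⟨by linarith, le_rfl⟩
  have htend : Tendsto (fun δ : ℝ => bandPlus m ε k₀ 0 - δ) (𝓝[>] 0) (𝓝[<] (bandPlus m ε k₀ 0)) := by
    refine tendsto_nhdsWithin_iff.2 ⟨?_, ?_⟩
    · refine (Continuous.tendsto' (by fun_prop) _ _ (by simp)).mono_left nhdsWithin_le_nhds
    · filter_upwards [self_mem_nhdsWithin] with δ hδ
      simpa using hδ
  filter_upwards [htend.eventually hleft, Ioo_mem_nhdsGT hr] with δ h1 hδ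
  -- Equal indices at the two ends of the window leave no room for a kernel at its lower end.
  have hstart : nullity (edgeMatAt m ε Pr (M k₀) k₀ (bandPlus m ε k₀ 0 - δ)) = 0 := by
    obtain ⟨h2, h3⟩ := (hdec k₀ hk0 δ hδ.1 hδ.2).1 (bandPlus m ε k₀ 0) ⟨by linarith [hδ.1], le_rfl⟩
      (bandPlus m ε k₀ 0 - δ) ⟨le_rfl, by linarith [hδ.1]⟩ (by linarith [hδ.1])
    have := negIndex_add_nullity_le (isHermitian_edgeMatAt (hbc k₀) _ _) h2 h3
    omega
  have hct : Tendsto (fun k => edgeMatAt m ε Pr (M k) k (bandPlus m ε k 0 - δ)) (𝓝 k₀)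
      (𝓝 (edgeMatAt m ε Pr (M k₀) k₀ (bandPlus m ε k₀ 0 - δ))) :=
    ContinuousAt.comp (f := fun k : ℝ => ((k, bandPlus m ε k 0 - δ) : ℝ × ℝ))
      (hcont k₀ hk0 δ hδ.1 hδ.2 _ ⟨le_rfl, by linarith [hδ.1]⟩) (by fun_prop)
  -- A nondegenerate matrix keeps its index as k moves away from k₀ at fixed window width. This is
  -- what ties the count at k to the index at k₀.
  have hnear := hct.eventually (eventually_negIndex_eq_of_det_ne_zero
    (isHermitian_edgeMatAt (hbc k₀) _ _) ((nullity_eq_zero_iff _).1 hstart))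
  have hrk : ∀ᶠ k in 𝓝 k₀, |k - k₀| < r := by
    have := Metric.ball_mem_nhds k₀ hr
    filter_upwards [this] with k hk
    simpa [Real.dist_eq] using hk
  filter_upwards [hnear, hrk] with k hn hk hbad
  obtain ⟨g1, g2⟩ := hn (isHermitian_edgeMatAt (hbc k) _ _)
  have g3 := (nullity_eq_zero_iff _).2 g1
  have hcount : edgeCount m ε k (A k) δ =
      ∑ᶠ ω ∈ Ioo (bandPlus m ε k 0 - δ) (bandPlus m ε k 0),
        nullity (edgeMatAt m ε Pr (M k) k ω) := by
    unfold edgeCount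
    refine finsum_mem_congr rfl fun ω hω => ?_
    obtain ⟨p1, p2⟩ := (hdec k hk δ hδ.1 hδ.2).2 ω ⟨hω.1.le, hω.2.le⟩
    exact finrank_edgeModes hε p1 (p2 hω.2) (hbc k) (hA k hbad)
  rw [hcount, (hdec k hk δ hδ.1 hδ.2).1.finsum_nullity (by linarith [hδ.1])
    (isHermitian_edgeMatAt (hbc k) k) (hcontOn k hk δ hδ.1 hδ.2), g2, g3, h1,
    edgeMatAt_threshold hm hε hεm, edgeMatAt_threshold hm hε hεm]
  simp

end RegDirac
end

noncomputable section
namespace RegDirac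

/-! ### Tame functions -/

section Tame
variable {φ : ℝ → ℝ} {f g : ℝ → ℂ}

theorem tame_add (hf : f ∈ tameRing φ) (hg : g ∈ tameRing φ) : (fun k => f k + g k) ∈ tameRing φ :=
  (tameRing φ).add_mem hf hg

theorem tame_sub (hf : f ∈ tameRing φ) (hg : g ∈ tameRing φ) : (fun k => f k - g k) ∈ tameRing φ :=
  (tameRing φ).sub_mem hf hg

theorem tame_mul (hf : f ∈ tameRing φ) (hg : g ∈ tameRing φ) : (fun k => f k * g k) ∈ tameRing φ :=
  (tameRing φ).mul_mem hf hg

theorem tame_neg (hf : f ∈ tameRing φ) : (fun k => -f k) ∈ tameRing φ :=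
  (tameRing φ).neg_mem hf

theorem tame_pow (hf : f ∈ tameRing φ) (n : ℕ) : (fun k => f k ^ n) ∈ tameRing φ :=
  (tameRing φ).pow_mem hf n

theorem tame_div (hf : f ∈ tameRing φ) (hg : g ∈ tameRing φ) : (fun k => f k / g k) ∈ tameRing φ := by
  simp only [div_eq_mul_inv]
  exact tame_mul hf (tameRing_inv hg)

theorem tame_matrix_mul {l n o : Type*} [Fintype n] {B : ℝ → Matrix l n ℂ} {C : ℝ → Matrix n o ℂ}
    (hB : ∀ i j, (fun k => B k i j) ∈ tameRing φ) (hC : ∀ i j, (fun k => C k i j) ∈ tameRing φ)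
    (i : l) (j : o) : (fun k => (B k * C k) i j) ∈ tameRing φ := by
  have : (fun k => (B k * C k) i j) = ∑ x, (fun k => B k i x * C k x j) := by
    funext k; simp [Matrix.mul_apply]
  rw [this]
  exact (tameRing φ).sum_mem fun x _ => tame_mul (hB i x) (hC x j)

/-- Where the argument is positive, the square root is exp(log/2). -/
theorem analyticAt_ofReal_sqrt {g : ℝ → ℝ} {x : ℝ} (hg : AnalyticAt ℝ g x) (h : 0 < g x) :
    AnalyticAt ℝ (fun t => ((√(g t) : ℝ) : ℂ)) x := by
  have h1 : AnalyticAt ℝ (fun t => Real.exp (Real.log (g t) / 2)) x :=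
    ((hg.log h).div analyticAt_const (by norm_num)).rexp'
  have h2 : (fun t => √(g t)) =ᶠ[𝓝 x] fun t => Real.exp (Real.log (g t) / 2) := by
    filter_upwards [hg.continuousAt.eventually_const_lt h] with t ht
    rw [← Real.log_sqrt ht.le, Real.exp_log (Real.sqrt_pos.2 ht)]
  exact (Complex.ofRealCLM.analyticAt _).comp (h1.congr h2.symm)

/-- Along `φ` the momentum and the threshold quantities are tame. -/
structure TamePath (m ε : ℝ) (φ : ℝ → ℝ) : Prop where
  cont : ContinuousOn φ (Ioi 0)
  k_mem : (fun k : ℝ => (k : ℂ)) ∈ tameRing φ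
  band_mem : (fun k : ℝ => (bandPlus m ε k 0 : ℂ)) ∈ tameRing φ
  rate_mem : (fun k : ℝ => (√(rateSum m ε k) : ℂ)) ∈ tameRing φ

end Tame

/-! ### Momentum paths towards a point or infinity, and the total number of edge modes -/

theorem tamePath_near {m ε : ℝ} (hm : 0 < m) (hε : 0 < ε) (hεm : ε < 1 / (2 * m)) (k₀ σ : ℝ) :
    TamePath m ε fun t => k₀ + σ * t := by
  refine ⟨by fun_prop, ⟨fun t => ((k₀ + σ * t : ℝ) : ℂ), AnalyticAt.meromorphicAt ?_, by simp⟩,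
    ⟨fun t => (bandPlus m ε (k₀ + σ * t) 0 : ℂ), AnalyticAt.meromorphicAt ?_, by simp⟩,
    ⟨fun t => (√(rateSum m ε (k₀ + σ * t)) : ℂ), AnalyticAt.meromorphicAt ?_, by simp⟩⟩
  · exact (Complex.ofRealCLM.analyticAt _).comp (by fun_prop : AnalyticAt ℝ (fun t => k₀ + σ * t) 0)
  · unfold bandPlus
    exact analyticAt_ofReal_sqrt (by fun_prop) (bandPlus_arg_pos hm _ 0)
  · refine analyticAt_ofReal_sqrt ?_ (rateSum_pos hm hε hεm _)
    unfold rateSum; fun_prop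

/-- Pulling out t⁻² from the band and t⁻¹ from the rate leaves square roots of functions with the
positive values ε² and 2 at t = 0, hence analytic factors. -/
theorem tamePath_infty {m ε : ℝ} (hε : 0 < ε) {σ : ℝ}
    (hσ : σ ^ 2 = 1) : TamePath m ε fun t => σ * t⁻¹ := by
  have hid : MeromorphicAt (fun t : ℝ => (t : ℂ)) 0 :=
    ((Complex.ofRealCLM.analyticAt 0)).meromorphicAt
  refine ⟨?_, ⟨fun t => σ * (t : ℂ)⁻¹, (MeromorphicAt.const _ _).mul hid.inv, by simp⟩,
    ⟨fun t => ((t : ℂ)⁻¹) ^ 2 * (√(t ^ 2 + (m * t ^ 2 - ε) ^ 2) : ℂ),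
      (hid.inv.pow 2).mul (AnalyticAt.meromorphicAt ?_), ?_⟩,
    ⟨fun t => (t : ℂ)⁻¹ * (√(2 + (1 - 2 * ε * m) / ε ^ 2 * t ^ 2) : ℂ),
      hid.inv.mul (AnalyticAt.meromorphicAt ?_), ?_⟩⟩
  · exact continuousOn_const.mul (continuousOn_inv₀.mono fun t ht => (ne_of_gt ht))
  · refine analyticAt_ofReal_sqrt (by fun_prop) ?_
    simp; positivity
  · filter_upwards [self_mem_nhdsWithin] with t ht
    have ht' : (0 : ℝ) < t := ht
    have : bandPlus m ε (σ * t⁻¹) 0 = (t⁻¹) ^ 2 * √(t ^ 2 + (m * t ^ 2 - ε) ^ 2) := by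
      unfold bandPlus
      rw [← Real.sqrt_sq (by positivity : 0 ≤ (t⁻¹) ^ 2), ← Real.sqrt_mul (by positivity)]
      congr 1
      rw [mul_pow, hσ]
      field_simp
      ring
    rw [this]; push_cast; ring
  · refine analyticAt_ofReal_sqrt (by fun_prop) ?_
    simp
  · filter_upwards [self_mem_nhdsWithin] with t ht
    have ht' : (0 : ℝ) < t := ht
    have : √(rateSum m ε (σ * t⁻¹)) = t⁻¹ * √(2 + (1 - 2 * ε * m) / ε ^ 2 * t ^ 2) := by
      unfold rateSum
      rw [← Real.sqrt_sq (by positivity : 0 ≤ t⁻¹), ← Real.sqrt_mul (by positivity),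
        Real.sqrt_sq (by positivity : 0 ≤ t⁻¹)]
      congr 1
      rw [mul_pow, hσ]
      field_simp
    rw [this]; push_cast; ring

theorem TamePath.weylMat_mem {m ε : ℝ} {φ : ℝ → ℝ} (h : TamePath m ε φ) (i j : Fin 2) :
    (fun k => weylMat m ε k (bandPlus m ε k 0) 0 (√(rateSum m ε k)) i j) ∈ tameRing φ := by
  have hk := h.k_mem
  have hb := h.band_mem
  have hs := h.rate_mem
  have c : ∀ c : ℝ, (fun _ : ℝ => (c : ℂ)) ∈ tameRing φ := fun c => tameRing_const _
  have hN : (fun k => (weylNum m ε k (bandPlus m ε k 0) 0 (√(rateSum m ε k)) : ℂ)) ∈ tameRing φ := by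
    simp only [weylNum]
    push_cast
    exact tame_add (tame_sub (tame_sub (tame_add hb (c m)) (tame_mul (c ε) (tame_pow hk 2)))
      (tame_mul (c ε) (tame_mul (tameRing_const 0) hs))) (tame_mul (tame_mul (c ε) hk)
      (tame_add (tameRing_const 0) hs))
  have hD : (fun k => (weylDen m ε k (bandPlus m ε k 0) 0 (√(rateSum m ε k)) : ℂ)) ∈ tameRing φ := by
    simp only [weylDen]
    push_cast
    exact tame_add (tame_mul (tame_sub (tame_add hb (c m)) (tame_mul (c ε) (tame_pow hk 2)))
      (tame_sub (tame_add (tameRing_const 0) hs) hk)) (tame_mul (tame_mul (c ε) hk)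
      (tame_mul (tameRing_const 0) hs))
  have hQ : (fun k : ℝ => (0 * √(rateSum m ε k) - k * (0 + √(rateSum m ε k)) + k ^ 2 : ℂ)) ∈
      tameRing φ := tame_add (tame_sub (tame_mul (tameRing_const 0) hs)
        (tame_mul hk (tame_add (tameRing_const 0) hs))) (tame_pow hk 2)
  have h00 : (fun k => (weyl₀₀ m ε k (bandPlus m ε k 0) 0 (√(rateSum m ε k)) : ℂ)) ∈ tameRing φ := by
    simp only [weyl₀₀]
    push_cast
    exact tame_div (tame_sub hQ (tame_mul (tame_mul (c ε) (tame_mul (tameRing_const 0) hs)) hN)) hD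
  have h01 : (fun k => (weyl₀₁ m ε k (bandPlus m ε k 0) 0 (√(rateSum m ε k)) : ℂ)) ∈ tameRing φ := by
    simp only [weyl₀₁]
    push_cast
    exact tame_div (tame_neg hQ) hD
  have h11 : (fun k => (weyl₁₁ m ε k (bandPlus m ε k 0) 0 (√(rateSum m ε k)) : ℂ)) ∈ tameRing φ := by
    simp only [weyl₁₁]
    push_cast
    exact tame_div (tame_neg hN) (tame_mul (c ε) hD)
  fin_cases i <;> fin_cases j
  · exact h00
  · exact h01
  · exact h01
  · exact h11

theorem TamePath.thrMat_mem {m ε : ℝ} {φ : ℝ → ℝ} (h : TamePath m ε φ)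
    (Pr M₀ M₁ : Matrix (Fin 2) (Fin 2) ℂ) (i j : Fin 2 ⊕ Fin 1) :
    (fun k : ℝ => thrMat m ε Pr (M₀ + (k : ℂ) • M₁) k i j) ∈ tameRing φ := by
  have h1 := tame_matrix_mul (φ := φ) (B := fun _ => (selMat Pr)ᴴ)
    (fun i j => tameRing_const _) h.weylMat_mem
  have h2 := tame_matrix_mul (C := fun _ => selMat Pr) h1 (fun i j => tameRing_const _) i j
  have h3 : (fun k : ℝ => bdryForm Pr (M₀ + (k : ℂ) • M₁) i j) ∈ tameRing φ := ?_
  · exact tame_add h3 h2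
  rcases i with i | i <;> rcases j with j | j <;>
    simp only [bdryForm, fromBlocks_apply₁₁, fromBlocks_apply₁₂, fromBlocks_apply₂₁,
      fromBlocks_apply₂₂, Matrix.add_apply, Matrix.smul_apply, smul_eq_mul]
  · exact tame_add (tame_add (tameRing_const _) (tame_mul h.k_mem (tameRing_const _)))
      (tameRing_const _)
  all_goals exact tameRing_const _

theorem TamePath.exists_negIndex {m ε : ℝ} (hm : 0 < m) (hε : 0 < ε) (hεm : ε < 1 / (2 * m))
    {φ : ℝ → ℝ} (h : TamePath m ε φ) {Pr M₀ M₁ : Matrix (Fin 2) (Fin 2) ℂ}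
    (hbc : ∀ k : ℝ, IsNormalBC Pr (M₀ + (k : ℂ) • M₁)) :
    ∃ c : ℕ, ∀ᶠ t in 𝓝[>] (0 : ℝ),
      negIndex (thrMat m ε Pr (M₀ + (φ t : ℂ) • M₁) (φ t)) = c :=
  eventually_negIndex_const (B := fun k : ℝ => thrMat m ε Pr (M₀ + (k : ℂ) • M₁) k) h.cont
    (fun k => isHermitian_thrMat (hbc k) k)
    (continuous_thrMat hm hε hεm Pr (by fun_prop)) (h.thrMat_mem Pr M₀ M₁)

/-- The number of edge modes, in terms of the inertia of the edge matrix at the threshold. -/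
theorem exists_isEdgeModeNumber {m ε : ℝ} (hm : 0 < m) (hε : 0 < ε)
    (hεm : ε < 1 / (2 * m)) {Pr M₀ M₁ : Matrix (Fin 2) (Fin 2) ℂ}
    (hbc : ∀ k : ℝ, IsNormalBC Pr (M₀ + (k : ℂ) • M₁))
    {A : ℝ → Matrix (Fin 2) (Fin 2 ⊕ Fin 2) ℂ} {Bad : Set ℝ} (hBad : Bad.Finite)
    (hA : ∀ k ∉ Bad, ∀ ψ ψ' : Fin 2 → ℂ, A k *ᵥ Sum.elim ψ ψ' = 0 ↔
      bdryMap Pr (M₀ + (k : ℂ) • M₁) ψ (chiData ε ψ ψ') = 0) :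
    ∃ np nm : ℕ,
      (∀ᶠ k : ℝ in atTop, negIndex (thrMat m ε Pr (M₀ + (k : ℂ) • M₁) k) = np) ∧
      (∀ᶠ k : ℝ in atBot, negIndex (thrMat m ε Pr (M₀ + (k : ℂ) • M₁) k) = nm) ∧
      IsEdgeModeNumber m ε A (np - nm) := by
  set ν : ℝ → ℕ := fun k : ℝ => negIndex (thrMat m ε Pr (M₀ + (k : ℂ) • M₁) k) with hν
  have hright : ∀ k₀ : ℝ, ∃ c : ℕ, ∀ᶠ k in 𝓝[>] k₀, ν k = c := by
    intro k₀
    obtain ⟨c, hc⟩ := (tamePath_near hm hε hεm k₀ 1).exists_negIndex hm hε hεm hbc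
    refine ⟨c, ?_⟩
    have ht : Tendsto (fun k => k - k₀) (𝓝[>] k₀) (𝓝[>] 0) := by
      refine tendsto_nhdsWithin_iff.2 ⟨?_, ?_⟩
      · exact (Continuous.tendsto' (by fun_prop) _ _ (by simp)).mono_left nhdsWithin_le_nhds
      · filter_upwards [self_mem_nhdsWithin] with k hk
        simpa using hk
    filter_upwards [ht.eventually hc] with k hk
    simpa [hν] using hk
  have hleft : ∀ k₀ : ℝ, ∃ c : ℕ, ∀ᶠ k in 𝓝[<] k₀, ν k = c := by
    intro k₀
    obtain ⟨c, hc⟩ := (tamePath_near hm hε hεm k₀ (-1)).exists_negIndex hm hε hεm hbc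
    refine ⟨c, ?_⟩
    have ht : Tendsto (fun k => k₀ - k) (𝓝[<] k₀) (𝓝[>] 0) := by
      refine tendsto_nhdsWithin_iff.2 ⟨?_, ?_⟩
      · exact (Continuous.tendsto' (by fun_prop) _ _ (by simp)).mono_left nhdsWithin_le_nhds
      · filter_upwards [self_mem_nhdsWithin] with k hk
        simpa using hk
    filter_upwards [ht.eventually hc] with k hk
    simpa [hν] using hk
  obtain ⟨np, hnp⟩ := (tamePath_infty hε (σ := 1) (by norm_num)).exists_negIndex hm hε hεm hbc
  obtain ⟨nm, hnm⟩ := (tamePath_infty hε (σ := -1) (by norm_num)).exists_negIndex hm hε hεm hbc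
  have htop : ∀ᶠ k in atTop, ν k = np := by
    filter_upwards [tendsto_inv_atTop_nhdsGT_zero.eventually hnp] with k hk
    simpa [hν] using hk
  have hbot : ∀ᶠ k in atBot, ν k = nm := by
    filter_upwards [(tendsto_inv_atTop_nhdsGT_zero.comp tendsto_neg_atBot_atTop).eventually hnm]
      with k hk
    simpa [hν, inv_neg] using hk
  choose R hR using hright
  choose L hL using hleft
  obtain ⟨s, hs, hsν, hsum⟩ := finsum_jump_univ (ν := fun k => (ν k : ℤ)) (L := fun k => (L k : ℤ))
    (R := fun k => (R k : ℤ)) (Lb := np) (Ra := nm)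
    (fun x => (hL x).mono fun y hy => by exact_mod_cast hy)
    (fun x => (hR x).mono fun y hy => by exact_mod_cast hy)
    (htop.mono fun y hy => by exact_mod_cast hy) (hbot.mono fun y hy => by exact_mod_cast hy)
  have hMc : Continuous fun k : ℝ => M₀ + (k : ℂ) • M₁ := by fun_prop
  have hcount := fun k₀ => eventually_edgeCount_eq hm hε hεm hMc hbc hA k₀
  -- The exceptional momenta are isolated, so the one-sided counts never meet them, even when k₀ is
  -- itself exceptional.
  have hgood : ∀ k₀ : ℝ, ∀ᶠ k in 𝓝[≠] k₀, k ∉ Bad := fun k₀ => by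
    have : (Bad \ {k₀})ᶜ ∈ 𝓝 k₀ := (hBad.subset sdiff_subset).isClosed.isOpen_compl.mem_nhds (by simp)
    filter_upwards [nhdsWithin_le_nhds this, self_mem_nhdsWithin] with k h1 h2 h3
    exact h1 ⟨h3, h2⟩
  have hgR : ∀ k₀ : ℝ, ∀ᶠ k in 𝓝[>] k₀, k ∉ Bad := fun k₀ =>
    nhdsWithin_mono _ (fun x hx => ne_of_gt hx) (hgood k₀)
  have hgL : ∀ k₀ : ℝ, ∀ᶠ k in 𝓝[<] k₀, k ∉ Bad := fun k₀ =>
    nhdsWithin_mono _ (fun x hx => ne_of_lt hx) (hgood k₀)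
  -- Semicontinuity makes the differences nonnegative, so the truncated subtractions in the
  -- witnesses below are genuine.
  have hRν : ∀ k₀, ν k₀ ≤ R k₀ := fun k₀ => by
    have h1 := ((continuous_thrMat hm hε hεm Pr hMc).tendsto k₀).eventually
      (eventually_negIndex_le _)
    obtain ⟨k, h2, h3⟩ := ((h1.filter_mono nhdsWithin_le_nhds).and (hR k₀)).exists
    rw [← h3]; exact h2
  have hLν : ∀ k₀, ν k₀ ≤ L k₀ := fun k₀ => by
    have h1 := ((continuous_thrMat hm hε hεm Pr hMc).tendsto k₀).eventually
      (eventually_negIndex_le _)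
    obtain ⟨k, h2, h3⟩ := ((h1.filter_mono nhdsWithin_le_nhds).and (hL k₀)).exists
    rw [← h3]; exact h2
  -- Emerging branches number R - ν and disappearing ones L - ν; the value at the point itself drops
  -- out of the difference R - L.
  refine ⟨np, nm, htop, hbot, fun k => R k - ν k, fun k => L k - ν k, fun k₀ => ?_, fun k₀ => ?_,
    hs.subset fun x hx => ?_, hs.subset fun x hx => ?_, ?_⟩
  · filter_upwards [hcount k₀] with δ hδ
    filter_upwards [nhdsWithin_le_nhds hδ, hgR k₀, hR k₀] with k h1 h2 h3
    have h4 : (edgeCount m ε k (A k) δ : ℤ) = ν k - ν k₀ := h1 h2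
    rw [h3] at h4
    have := hRν k₀
    omega
  · filter_upwards [hcount k₀] with δ hδ
    filter_upwards [nhdsWithin_le_nhds hδ, hgL k₀, hL k₀] with k h1 h2 h3
    have h4 : (edgeCount m ε k (A k) δ : ℤ) = ν k - ν k₀ := h1 h2
    rw [h3] at h4
    have := hLν k₀
    omega
  · by_contra hxs
    have := hsν x hxs
    simp only [Function.mem_support] at hx
    omega
  · by_contra hxs
    have := hsν x hxs
    simp only [Function.mem_support] at hx
    omega
  · rw [← hsum]
    refine finsum_congr fun k => ?_
    have := hRν k
    have := hLν k
    push_cast [hRν k, hLν k]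
    ring

end RegDirac
end

noncomputable section
namespace RegDirac

/-! ### Symmetry of the boundary condition -/

/-- The test function `(p + q y) exp (-y)`. -/
def testFun (p q : Fin 2 → ℂ) (y : ℝ) : EuclideanSpace ℂ (Fin 2) :=
  (Real.exp (-y) : ℂ) • (WithLp.toLp 2 p + (y : ℂ) • WithLp.toLp 2 q)

theorem testFun_apply (p q : Fin 2 → ℂ) (y : ℝ) (i : Fin 2) :
    testFun p q y i = (Real.exp (-y) : ℂ) * (p i + y * q i) := by
  simp [testFun, mul_add]

theorem testFun_zero (p q : Fin 2 → ℂ) (i : Fin 2) : testFun p q 0 i = p i := by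
  simp [testFun_apply]

theorem hasDerivAt_testFun (p q : Fin 2 → ℂ) (y : ℝ) :
    HasDerivAt (testFun p q) (testFun (q - p) (-q) y) y := by
  have h1 : HasDerivAt (fun y : ℝ => (Real.exp (-y) : ℂ)) (-(Real.exp (-y) : ℂ)) y := by
    have := ((hasDerivAt_neg y).exp).ofReal_comp
    simpa using this
  have h2 : HasDerivAt (fun y : ℝ => WithLp.toLp 2 p + (y : ℂ) • WithLp.toLp 2 q)
      ((1 : ℂ) • WithLp.toLp 2 q : EuclideanSpace ℂ (Fin 2)) y :=
    ((hasDerivAt_id y).ofReal_comp.smul_const _).const_add _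
  refine (h1.smul h2).congr_deriv ?_
  ext i
  simp [testFun_apply]
  ring

theorem hasDerivAt_testFun_apply (p q : Fin 2 → ℂ) (y : ℝ) (i : Fin 2) :
    HasDerivAt (fun t => testFun p q t i) (testFun (q - p) (-q) y i) y := by
  rw [← hasDerivWithinAt_univ]
  exact hasDerivWithinAt_euclidean_apply (hasDerivAt_testFun p q y).hasDerivWithinAt i

theorem continuous_testFun (p q : Fin 2 → ℂ) : Continuous (testFun p q) :=
  continuous_iff_continuousAt.2 fun y => (hasDerivAt_testFun p q y).continuousAt

theorem norm_testFun_le (p q : Fin 2 → ℂ) {y : ℝ} (hy : 0 ≤ y) :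
    ‖testFun p q y‖ ≤ (‖(WithLp.toLp 2 p : EuclideanSpace ℂ (Fin 2))‖ +
      2 * ‖(WithLp.toLp 2 q : EuclideanSpace ℂ (Fin 2))‖) * Real.exp (-(1 / 2) * y) := by
  have h1 : y * Real.exp (-y) ≤ 2 * Real.exp (-(1 / 2) * y) := by
    have h2 : y / 2 ≤ Real.exp (y / 2) := by linarith [Real.add_one_le_exp (y / 2)]
    have h3 : Real.exp (y / 2) * Real.exp (-y) = Real.exp (-(1 / 2) * y) := by
      rw [← Real.exp_add]; congr 1; ring
    nlinarith [Real.exp_pos (-y)]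
  have h4 : Real.exp (-y) ≤ Real.exp (-(1 / 2) * y) := Real.exp_le_exp.2 (by linarith)
  rw [testFun, norm_smul, Complex.norm_real, Real.norm_of_nonneg (Real.exp_pos _).le]
  have h5 : ‖(WithLp.toLp 2 p + (y : ℂ) • WithLp.toLp 2 q : EuclideanSpace ℂ (Fin 2))‖ ≤
      ‖(WithLp.toLp 2 p : EuclideanSpace ℂ (Fin 2))‖ +
      y * ‖(WithLp.toLp 2 q : EuclideanSpace ℂ (Fin 2))‖ := by
    refine (norm_add_le _ _).trans ?_
    rw [norm_smul, Complex.norm_real, Real.norm_of_nonneg hy]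
  have h6 := mul_le_mul_of_nonneg_left h5 (Real.exp_pos (-y)).le
  nlinarith [norm_nonneg (WithLp.toLp 2 p : EuclideanSpace ℂ (Fin 2)),
    norm_nonneg (WithLp.toLp 2 q : EuclideanSpace ℂ (Fin 2))]

theorem memLp_testFun (p q : Fin 2 → ℂ) :
    MemLp (testFun p q) 2 (volume.restrict (Ioi (0 : ℝ))) := by
  have h1 : MemLp (fun y : ℝ => Real.exp (-(1 / 2) * y)) 2 (volume.restrict (Ioi (0 : ℝ))) := by
    rw [memLp_two_iff_integrable_sq (by fun_prop)]
    have := exp_neg_integrableOn_Ioi 0 (one_pos (α := ℝ))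
    refine this.congr_fun (fun y _ => ?_) measurableSet_Ioi
    rw [← Real.exp_nat_mul]; push_cast; ring_nf
  refine MemLp.of_le_mul h1 (continuous_testFun p q).aestronglyMeasurable
    (c := ‖(WithLp.toLp 2 p : EuclideanSpace ℂ (Fin 2))‖ +
      2 * ‖(WithLp.toLp 2 q : EuclideanSpace ℂ (Fin 2))‖) ?_
  filter_upwards [ae_restrict_mem measurableSet_Ioi] with y hy
  rw [Real.norm_of_nonneg (Real.exp_pos _).le]
  exact norm_testFun_le p q (le_of_lt hy)

theorem tendsto_testFun (p q : Fin 2 → ℂ) (i : Fin 2) :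
    Tendsto (fun y => testFun p q y i) atTop (𝓝 0) := by
  rw [tendsto_zero_iff_norm_tendsto_zero]
  have h1 : Tendsto (fun y : ℝ => (‖(WithLp.toLp 2 p : EuclideanSpace ℂ (Fin 2))‖ +
      2 * ‖(WithLp.toLp 2 q : EuclideanSpace ℂ (Fin 2))‖) * Real.exp (-(1 / 2) * y)) atTop (𝓝 0) := by
    have : Tendsto (fun y : ℝ => Real.exp (-(1 / 2) * y)) atTop (𝓝 0) :=
      Real.tendsto_exp_atBot.comp ((tendsto_const_mul_atBot_of_neg (by norm_num)).2 tendsto_id)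
    simpa using this.const_mul _
  refine squeeze_zero' (Eventually.of_forall fun _ => norm_nonneg _) ?_ h1
  filter_upwards [eventually_ge_atTop 0] with y hy
  exact (PiLp.norm_apply_le _ i).trans (norm_testFun_le p q hy)

theorem isH2_testFun (p q : Fin 2 → ℂ) :
    IsH2 (testFun p q) (testFun (q - p) (-q)) (testFun (-q - (q - p)) (- -q)) := by
  have h : ∀ (p q : Fin 2 → ℂ) (y : ℝ),
      testFun p q y = testFun p q 0 + ∫ t in (0 : ℝ)..y, testFun (q - p) (-q) t := by
    intro p q y
    rw [intervalIntegral.integral_eq_sub_of_hasDerivAt (fun t _ => hasDerivAt_testFun p q t)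
      ((continuous_testFun _ _).intervalIntegrable _ _)]
    abel
  exact ⟨memLp_testFun _ _, memLp_testFun _ _, memLp_testFun _ _, fun y _ => h _ _ y,
    fun y _ => h _ _ y⟩

theorem memLp_edgeH (m ε k : ℝ) {f f' f'' : ℝ → EuclideanSpace ℂ (Fin 2)} {μ : Measure ℝ}
    (hf : MemLp f 2 μ) (hf' : MemLp f' 2 μ) (hf'' : MemLp f'' 2 μ) :
    MemLp (fun y => edgeH m ε k (f y) (f' y) (f'' y)) 2 μ := by
  have hc : ∀ {g : ℝ → EuclideanSpace ℂ (Fin 2)} (i : Fin 2), MemLp g 2 μ →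
      MemLp (fun y => g y i) 2 μ := fun i hg => by
    refine hg.of_le ((EuclideanSpace.proj i : EuclideanSpace ℂ (Fin 2) →L[ℂ]
      ℂ).continuous.comp_aestronglyMeasurable hg.1) (Eventually.of_forall fun y => ?_)
    exact PiLp.norm_apply_le _ i
  have hp : ∀ {u v : ℝ → ℂ}, MemLp u 2 μ → MemLp v 2 μ →
      MemLp (fun y => (!₂[u y, v y] : EuclideanSpace ℂ (Fin 2))) 2 μ := by
    intro u v hu hv
    have e : (fun y => (!₂[u y, v y] : EuclideanSpace ℂ (Fin 2))) =
        (fun y => u y • (!₂[1, 0] : EuclideanSpace ℂ (Fin 2))) +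
          fun y => v y • (!₂[0, 1] : EuclideanSpace ℂ (Fin 2)) := by
      funext y; ext i; fin_cases i <;> simp
    rw [e]
    exact (((1 : ℂ →L[ℂ] ℂ).smulRight (!₂[1, 0] : EuclideanSpace ℂ (Fin 2))).comp_memLp' hu).add
      (((1 : ℂ →L[ℂ] ℂ).smulRight (!₂[0, 1] : EuclideanSpace ℂ (Fin 2))).comp_memLp' hv)
  unfold edgeH
  refine hp ?_ ?_
  · exact ((((hc 0 hf).const_mul _).add ((hc 0 hf'').const_mul _)).sub ((hc 1 hf).const_mul _)).add
      (hc 1 hf')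
  · exact ((((hc 0 hf).const_mul _).sub (hc 0 hf')).add ((hc 1 hf).const_mul _)).sub
      ((hc 1 hf'').const_mul _)

/-- The boundary data allowed by a boundary matrix form an isotropic subspace. -/
def IsIsotropicBC (ε : ℝ) (A : Matrix (Fin 2) (Fin 2 ⊕ Fin 2) ℂ) : Prop :=
  ∀ φ φ' ψ ψ' : Fin 2 → ℂ, A *ᵥ Sum.elim φ φ' = 0 → A *ᵥ Sum.elim ψ ψ' = 0 →
    star φ ⬝ᵥ chiData ε ψ ψ' = star (chiData ε φ φ') ⬝ᵥ ψ

/-- Any admissible boundary data are realized by test functions in the domain. Symmetry of H♯ on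
them, after integration by parts, is the vanishing of the boundary form at 0. -/
theorem IsSelfAdjointEdge.isIsotropicBC {m ε k : ℝ} {A : Matrix (Fin 2) (Fin 2 ⊕ Fin 2) ℂ}
    (h : IsSelfAdjointEdge m ε k A) : IsIsotropicBC ε A := by
  intro φ φ' ψ ψ' hφ hψ
  -- The linear coefficient φ + φ' compensates the derivative of the exponential, so that the
  -- derivative at 0 is φ'.
  set f := testFun φ (φ + φ') with hf
  set f1 := testFun (φ + φ' - φ) (-(φ + φ')) with hf1
  set f2 := testFun (-(φ + φ') - (φ + φ' - φ)) (- -(φ + φ')) with hf2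
  set g := testFun ψ (ψ + ψ') with hg
  set g1 := testFun (ψ + ψ' - ψ) (-(ψ + ψ')) with hg1
  set g2 := testFun (-(ψ + ψ') - (ψ + ψ' - ψ)) (- -(ψ + ψ')) with hg2
  have hHf := memLp_edgeH m ε k (isH2_testFun φ (φ + φ')).memLp (isH2_testFun φ (φ + φ')).memLp'
    (isH2_testFun φ (φ + φ')).memLp''
  have hHg := memLp_edgeH m ε k (isH2_testFun ψ (ψ + ψ')).memLp (isH2_testFun ψ (ψ + ψ')).memLp'
    (isH2_testFun ψ (ψ + ψ')).memLp''
  have f10 : ∀ i, f1 0 i = φ' i := fun i => by simp [hf1, testFun_zero]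
  have g10 : ∀ i, g1 0 i = ψ' i := fun i => by simp [hg1, testFun_zero]
  have f0 : ∀ i, f 0 i = φ i := fun i => by simp [hf, testFun_zero]
  have g0 : ∀ i, g 0 i = ψ i := fun i => by simp [hg, testFun_zero]
  have hpf : ((memLp_testFun φ (φ + φ')).toLp _, hHf.toLp _) ∈ edgeGraph m ε k A :=
    ⟨f, f1, f2, isH2_testFun _ _, by simpa only [f0, f10] using hφ,
      (memLp_testFun φ (φ + φ')).coeFn_toLp, hHf.coeFn_toLp⟩
  have hpg : ((memLp_testFun ψ (ψ + ψ')).toLp _, hHg.toLp _) ∈ edgeGraph m ε k A :=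
    ⟨g, g1, g2, isH2_testFun _ _, by simpa only [g0, g10] using hψ,
      (memLp_testFun ψ (ψ + ψ')).coeFn_toLp, hHg.coeFn_toLp⟩
  have key := (h _).1 hpf _ hpg
  simp only [L2.inner_def] at key
  have i1 := L2.integrable_inner (𝕜 := ℂ) ((memLp_testFun φ (φ + φ')).toLp _) (hHg.toLp _)
  have i2 := L2.integrable_inner (𝕜 := ℂ) (hHf.toLp _) ((memLp_testFun ψ (ψ + ψ')).toLp _)
  set F : ℝ → ℂ := fun y => inner ℂ (f y) (edgeH m ε k (g y) (g1 y) (g2 y)) with hF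
  set G : ℝ → ℂ := fun y => inner ℂ (edgeH m ε k (f y) (f1 y) (f2 y)) (g y) with hG
  have e1 : (fun y => inner ℂ ((memLp_testFun φ (φ + φ')).toLp _ y) (hHg.toLp _ y))
      =ᵐ[volume.restrict (Ioi (0 : ℝ))] F := by
    filter_upwards [(memLp_testFun φ (φ + φ')).coeFn_toLp, hHg.coeFn_toLp] with y h1 h2
    rw [h1, h2]
  have e2 : (fun y => inner ℂ (hHf.toLp _ y) ((memLp_testFun ψ (ψ + ψ')).toLp _ y))
      =ᵐ[volume.restrict (Ioi (0 : ℝ))] G := by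
    filter_upwards [(memLp_testFun ψ (ψ + ψ')).coeFn_toLp, hHf.coeFn_toLp] with y h1 h2
    rw [h1, h2]
  rw [integral_congr_ae e1, integral_congr_ae e2] at key
  have i1' : IntegrableOn F (Ioi 0) := i1.congr e1
  have i2' : IntegrableOn G (Ioi 0) := i2.congr e2
  -- The boundary form at y. Its derivative is the difference of the two integrands and it tends to
  -- 0 at infinity, so symmetry forces b(0) = 0.
  set b : ℝ → ℂ := fun y => star (f y 0) * (ε * g1 y 0 + g y 1) -
    (ε * star (f1 y 0) + star (f y 1)) * g y 0 + star (f y 1) * (-(ε * g1 y 1)) -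
    (-(ε * star (f1 y 1))) * g y 1 with hb
  have df : ∀ i y, HasDerivAt (fun t => f t i) (f1 y i) y := fun i y =>
    hasDerivAt_testFun_apply _ _ y i
  have df1 : ∀ i y, HasDerivAt (fun t => f1 t i) (f2 y i) y := fun i y =>
    hasDerivAt_testFun_apply _ _ y i
  have dg : ∀ i y, HasDerivAt (fun t => g t i) (g1 y i) y := fun i y =>
    hasDerivAt_testFun_apply _ _ y i
  have dg1 : ∀ i y, HasDerivAt (fun t => g1 t i) (g2 y i) y := fun i y =>
    hasDerivAt_testFun_apply _ _ y i
  have hbd : ∀ y, HasDerivAt b (F y - G y) y := by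
    intro y
    have := (((df 0 y).star.mul (((dg1 0 y).const_mul (ε : ℂ)).add (dg 1 y))).sub
      ((((df1 0 y).star.const_mul (ε : ℂ)).add (df 1 y).star).mul (dg 0 y))).add
      ((df 1 y).star.mul ((dg1 1 y).const_mul (ε : ℂ)).neg) |>.sub
      ((((df1 1 y).star.const_mul (ε : ℂ)).neg).mul (dg 1 y))
    refine this.congr_deriv ?_
    simp [hF, hG, edgeH, PiLp.inner_apply, Fin.sum_univ_two]
    ring
  have hlim : Tendsto b atTop (𝓝 0) := by
    have t1 : ∀ i, Tendsto (fun y => f y i) atTop (𝓝 0) := tendsto_testFun _ _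
    have t2 : ∀ i, Tendsto (fun y => f1 y i) atTop (𝓝 0) := tendsto_testFun _ _
    have t3 : ∀ i, Tendsto (fun y => g y i) atTop (𝓝 0) := tendsto_testFun _ _
    have t4 : ∀ i, Tendsto (fun y => g1 y i) atTop (𝓝 0) := tendsto_testFun _ _
    have := (((t1 0).star.mul (((t4 0).const_mul (ε : ℂ)).add (t3 1))).sub
      ((((t2 0).star.const_mul (ε : ℂ)).add (t1 1).star).mul (t3 0))).add
      ((t1 1).star.mul ((t4 1).const_mul (ε : ℂ)).neg) |>.sub
      ((((t2 1).star.const_mul (ε : ℂ)).neg).mul (t3 1))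
    simpa [hb] using this
  have hint := integral_Ioi_of_hasDerivAt_of_tendsto' (a := 0) (fun y _ => hbd y)
    (i1'.sub i2') hlim
  rw [integral_sub i1' i2', key, sub_self, zero_sub, eq_comm, neg_eq_zero] at hint
  simp only [hb, f0, g0, f10, g10] at hint
  simp [chiData, dotProduct, Fin.sum_univ_two] at hint ⊢
  linear_combination hint

end RegDirac
end

noncomputable section
namespace RegDirac

/-! ### Normal forms of the boundary conditions -/

/-- Coefficient of `χ` in the boundary condition. -/
def bcChi (ε : ℝ) (B₂ : Matrix (Fin 2) (Fin 2) ℂ) : Matrix (Fin 2) (Fin 2) ℂ :=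
  B₂ * !![(ε : ℂ)⁻¹, 0; 0, -(ε : ℂ)⁻¹]

/-- Coefficient of `ψ` in the boundary condition, at `k = 0`. -/
def bcPsi (ε : ℝ) (B₀ B₂ : Matrix (Fin 2) (Fin 2) ℂ) : Matrix (Fin 2) (Fin 2) ℂ :=
  B₀ - bcChi ε B₂ * !![0, 1; 0, 0]

theorem bcMatrix_mulVec {ε : ℝ} (hε : ε ≠ 0) (B₀ B₁ B₂ : Matrix (Fin 2) (Fin 2) ℂ) (k : ℝ)
    (ψ ψ' : Fin 2 → ℂ) :
    bcMatrix B₀ B₁ B₂ k *ᵥ Sum.elim ψ ψ' =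
      (bcPsi ε B₀ B₂ + (k : ℂ) • (Complex.I • B₁)) *ᵥ ψ + bcChi ε B₂ *ᵥ chiData ε ψ ψ' := by
  have hε' : (ε : ℂ) ≠ 0 := by exact_mod_cast hε
  ext i
  fin_cases i <;>
  · simp [bcMatrix, bcPsi, bcChi, chiData, mulVec, dotProduct, Fin.sum_univ_two, Matrix.mul_apply,
      fromCols_apply_inl, fromCols_apply_inr, Fintype.sum_sum_type]
    field_simp
    ring

/-- Derivative with given `ψ` and `χ`. -/
def derivData (ε : ℝ) (ψ χ : Fin 2 → ℂ) : Fin 2 → ℂ := ![(χ 0 - ψ 1) / ε, -(χ 1 / ε)]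

theorem chiData_derivData {ε : ℝ} (hε : ε ≠ 0) (ψ χ : Fin 2 → ℂ) :
    chiData ε ψ (derivData ε ψ χ) = χ := by
  have hε' : (ε : ℂ) ≠ 0 := by exact_mod_cast hε
  ext i
  fin_cases i <;> (simp [chiData, derivData]; field_simp; try ring)

/-- The boundary condition `X ψ + Y χ = 0` is isotropic. -/
def IsIsotropicPair (X Y : Matrix (Fin 2) (Fin 2) ℂ) : Prop :=
  ∀ φ ξ ψ χ : Fin 2 → ℂ, X *ᵥ φ + Y *ᵥ ξ = 0 → X *ᵥ ψ + Y *ᵥ χ = 0 → star φ ⬝ᵥ χ = star ξ ⬝ᵥ ψ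

theorem IsIsotropicBC.isIsotropicPair {ε : ℝ} (hε : ε ≠ 0) {B₀ B₁ B₂ : Matrix (Fin 2) (Fin 2) ℂ}
    {k : ℝ} (h : IsIsotropicBC ε (bcMatrix B₀ B₁ B₂ k)) :
    IsIsotropicPair (bcPsi ε B₀ B₂ + (k : ℂ) • (Complex.I • B₁)) (bcChi ε B₂) := by
  intro φ ξ ψ χ h1 h2
  have := h φ (derivData ε φ ξ) ψ (derivData ε ψ χ)
    (by rw [bcMatrix_mulVec hε, chiData_derivData hε, h1])
    (by rw [bcMatrix_mulVec hε, chiData_derivData hε, h2])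
  rwa [chiData_derivData hε, chiData_derivData hε] at this

/-- Orthogonal projection onto the span of a unit vector. -/
def rankOne (r : Fin 2 → ℂ) : Matrix (Fin 2) (Fin 2) ℂ := vecMulVec r (star r)

/-- The three normal forms. -/
inductive IsNormalForm (Pr M₀ M₁ : Matrix (Fin 2) (Fin 2) ℂ) : Prop
  | robin (hPr : Pr = 1) (h₀ : M₀ᴴ = M₀) (h₁ : M₁ᴴ = M₁)
  | mixed (r : Fin 2 → ℂ) (t₀ t₁ : ℝ) (hr : star r ⬝ᵥ r = 1) (hPr : Pr = rankOne r)
      (h₀ : M₀ = (t₀ : ℂ) • rankOne r) (h₁ : M₁ = (t₁ : ℂ) • rankOne r)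
  | dirichlet (hPr : Pr = 0) (h₀ : M₀ = 0) (h₁ : M₁ = 0)

theorem IsNormalForm.isNormalBC {Pr M₀ M₁ : Matrix (Fin 2) (Fin 2) ℂ}
    (h : IsNormalForm Pr M₀ M₁) (k : ℝ) : IsNormalBC Pr (M₀ + (k : ℂ) • M₁) := by
  rcases h with ⟨rfl, h₀, h₁⟩ | ⟨r, t₀, t₁, hr, rfl, rfl, rfl⟩ | ⟨rfl, rfl, rfl⟩
  · refine ⟨by simp, by simp, ?_, by simp⟩
    rw [conjTranspose_add, conjTranspose_smul, h₀, h₁]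
    simp
  · have h1 : (rankOne r)ᴴ = rankOne r := by
      simp [rankOne, conjTranspose_vecMulVec]
    have h2 : rankOne r * rankOne r = rankOne r := by
      rw [rankOne, vecMulVec_mul_vecMulVec, hr, one_smul]
    refine ⟨h1, h2, ?_, ?_⟩
    · simp [conjTranspose_add, conjTranspose_smul, h1]
    · rw [Matrix.mul_add, Matrix.mul_smul, Matrix.mul_smul, Matrix.mul_smul, h2]
  · exact ⟨by simp, by simp, by simp, by simp⟩

theorem isHermitian_of_forall {M : Matrix (Fin 2) (Fin 2) ℂ}
    (h : ∀ φ ψ : Fin 2 → ℂ, star φ ⬝ᵥ M *ᵥ ψ = star (M *ᵥ φ) ⬝ᵥ ψ) : Mᴴ = M := by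
  ext i j
  have := h (Pi.single i 1) (Pi.single j 1)
  simpa [Pi.star_single] using this.symm

/-- Hermiticity is a real-linear condition, so for an affine family two momenta decide about both
coefficients. -/
theorem herm_of_affine {M₀ M₁ : Matrix (Fin 2) (Fin 2) ℂ} {k₁ k₂ : ℝ} (hk : k₁ ≠ k₂)
    (h1 : (M₀ + (k₁ : ℂ) • M₁)ᴴ = M₀ + (k₁ : ℂ) • M₁)
    (h2 : (M₀ + (k₂ : ℂ) • M₁)ᴴ = M₀ + (k₂ : ℂ) • M₁) : M₀ᴴ = M₀ ∧ M₁ᴴ = M₁ := by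
  have hne : (k₁ : ℂ) - k₂ ≠ 0 := by
    rw [sub_ne_zero]; exact_mod_cast hk
  have e1 : ∀ i j, star (M₀ j i) + k₁ * star (M₁ j i) = M₀ i j + k₁ * M₁ i j := fun i j => by
    have := congrFun (congrFun h1 i) j
    simpa using this
  have e2 : ∀ i j, star (M₀ j i) + k₂ * star (M₁ j i) = M₀ i j + k₂ * M₁ i j := fun i j => by
    have := congrFun (congrFun h2 i) j
    simpa using this
  have e3 : ∀ i j, star (M₁ j i) = M₁ i j := fun i j => by
    have : ((k₁ : ℂ) - k₂) * (star (M₁ j i) - M₁ i j) = 0 := by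
      linear_combination e1 i j - e2 i j
    exact sub_eq_zero.1 ((mul_eq_zero.1 this).resolve_left hne)
  refine ⟨?_, ?_⟩
  · ext i j
    have h3 := e3 i j
    have := e1 i j
    rw [h3] at this
    simpa using this
  · ext i j
    simpa using e3 i j

/-- Solving for χ gives χ = -Y⁻¹Xψ with ψ arbitrary, and such a graph is isotropic exactly when Y⁻¹X
is Hermitian. -/
theorem exists_normalForm_of_isUnit {X₀ X₁ Y : Matrix (Fin 2) (Fin 2) ℂ} {k₁ k₂ : ℝ} (hk : k₁ ≠ k₂)
    (h₁ : IsIsotropicPair (X₀ + (k₁ : ℂ) • X₁) Y) (h₂ : IsIsotropicPair (X₀ + (k₂ : ℂ) • X₁) Y)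
    (hY : Y.det ≠ 0) :
    IsNormalForm 1 (Y⁻¹ * X₀) (Y⁻¹ * X₁) ∧ ∀ (k : ℝ) (ψ χ : Fin 2 → ℂ),
      (X₀ + (k : ℂ) • X₁) *ᵥ ψ + Y *ᵥ χ = 0 ↔
        bdryMap 1 (Y⁻¹ * X₀ + (k : ℂ) • (Y⁻¹ * X₁)) ψ χ = 0 := by
  have hu : IsUnit Y.det := isUnit_iff_ne_zero.2 hY
  have hmul : ∀ k : ℝ, Y⁻¹ * X₀ + (k : ℂ) • (Y⁻¹ * X₁) = Y⁻¹ * (X₀ + (k : ℂ) • X₁) := fun k => by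
    rw [Matrix.mul_add, Matrix.mul_smul]
  have hherm : ∀ k : ℝ, IsIsotropicPair (X₀ + (k : ℂ) • X₁) Y →
      (Y⁻¹ * X₀ + (k : ℂ) • (Y⁻¹ * X₁))ᴴ = Y⁻¹ * X₀ + (k : ℂ) • (Y⁻¹ * X₁) := by
    intro k h
    rw [hmul]
    apply isHermitian_of_forall
    intro φ ψ
    have hker : ∀ ψ : Fin 2 → ℂ, (X₀ + (k : ℂ) • X₁) *ᵥ ψ +
        Y *ᵥ (-((Y⁻¹ * (X₀ + (k : ℂ) • X₁)) *ᵥ ψ)) = 0 := by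
      intro ψ
      rw [mulVec_neg, mulVec_mulVec, ← Matrix.mul_assoc, Matrix.mul_nonsing_inv _ hu, Matrix.one_mul,
        add_neg_cancel]
    have := h _ _ _ _ (hker φ) (hker ψ)
    rw [dotProduct_neg, star_neg, neg_dotProduct] at this
    exact neg_injective this
  obtain ⟨g0, g1⟩ := herm_of_affine hk (hherm k₁ h₁) (hherm k₂ h₂)
  refine ⟨.robin rfl g0 g1, fun k ψ χ => ?_⟩
  have e : bdryMap 1 (Y⁻¹ * X₀ + (k : ℂ) • (Y⁻¹ * X₁)) ψ χ =
      Y⁻¹ *ᵥ ((X₀ + (k : ℂ) • X₁) *ᵥ ψ + Y *ᵥ χ) := by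
    rw [hmul, bdryMap, mulVec_add, mulVec_mulVec, mulVec_mulVec, Matrix.nonsing_inv_mul _ hu]
    simp [add_comm]
  rw [e]
  constructor
  · intro h; rw [h, mulVec_zero]
  · intro h
    have h2 := congrArg (Y *ᵥ ·) h
    simp only [mulVec_zero] at h2
    rwa [mulVec_mulVec, Matrix.mul_nonsing_inv _ hu, one_mulVec] at h2

theorem finite_det_eq_zero {X₀ X₁ : Matrix (Fin 2) (Fin 2) ℂ} {k₁ : ℝ}
    (h : (X₀ + (k₁ : ℂ) • X₁).det ≠ 0) : {k : ℝ | (X₀ + (k : ℂ) • X₁).det = 0}.Finite := by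
  set p : Polynomial ℂ := (Polynomial.C (X₀ 0 0) + Polynomial.X * Polynomial.C (X₁ 0 0)) *
    (Polynomial.C (X₀ 1 1) + Polynomial.X * Polynomial.C (X₁ 1 1)) -
    (Polynomial.C (X₀ 0 1) + Polynomial.X * Polynomial.C (X₁ 0 1)) *
    (Polynomial.C (X₀ 1 0) + Polynomial.X * Polynomial.C (X₁ 1 0)) with hp
  have he : ∀ k : ℝ, (X₀ + (k : ℂ) • X₁).det = p.eval (k : ℂ) := by
    intro k; simp [det_fin_two, hp]; ring
  have hp0 : p ≠ 0 := fun h0 => h (by rw [he, h0]; simp)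
  have : {k : ℝ | (X₀ + (k : ℂ) • X₁).det = 0} ⊆ (fun k : ℝ => (k : ℂ)) ⁻¹' p.rootSet ℂ := by
    intro k hk
    rw [mem_ofPred_eq, he] at hk
    simp [Polynomial.mem_rootSet, hp0, hk]
  exact ((p.rootSet_finite ℂ).preimage Complex.ofReal_injective.injOn).subset this

/-- Here χ is unconstrained, so isotropy forces every ψ with Xψ = 0 to vanish. Thus X is invertible
at one momentum, and its determinant is a polynomial in k. -/
theorem exists_normalForm_of_zero {X₀ X₁ : Matrix (Fin 2) (Fin 2) ℂ} {k₁ : ℝ}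
    (h₁ : IsIsotropicPair (X₀ + (k₁ : ℂ) • X₁) 0) :
    {k : ℝ | (X₀ + (k : ℂ) • X₁).det = 0}.Finite ∧
    ∀ k ∉ {k : ℝ | (X₀ + (k : ℂ) • X₁).det = 0}, ∀ ψ χ : Fin 2 → ℂ,
      (X₀ + (k : ℂ) • X₁) *ᵥ ψ + (0 : Matrix (Fin 2) (Fin 2) ℂ) *ᵥ χ = 0 ↔
        bdryMap 0 (0 + (k : ℂ) • 0) ψ χ = 0 := by
  constructor
  · apply finite_det_eq_zero (k₁ := k₁)
    intro h0
    obtain ⟨v, hv, hv0⟩ := Matrix.exists_mulVec_eq_zero_iff.2 h0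
    apply hv
    ext i
    have := h₁ 0 (Pi.single i 1) v 0 
      (by rw [mulVec_zero, zero_mulVec, add_zero]) (by rw [hv0, mulVec_zero, add_zero])
    simpa [Pi.star_single] using this.symm
  · intro k hk ψ χ
    simp only [bdryMap, zero_mulVec, add_zero, smul_zero, sub_zero]
    constructor
    · intro h
      by_contra hψ
      exact hk (Matrix.exists_mulVec_eq_zero_iff.1 ⟨ψ, hψ, h⟩)
    · rintro rfl; simp

theorem exists_rankOne_factor {Y : Matrix (Fin 2) (Fin 2) ℂ} (h0 : Y ≠ 0) (hdet : Y.det = 0) :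
    ∃ l r : Fin 2 → ℂ, star r ⬝ᵥ r = 1 ∧ l ≠ 0 ∧ Y = vecMulVec l (star r) := by
  have key : ∀ a b : ℂ, (a ≠ 0 ∨ b ≠ 0) → ∃ N : ℝ, 0 < N ∧ a * star a + b * star b = (N : ℂ) ^ 2 := by
    intro a b hab
    have hpos : 0 < ‖a‖ ^ 2 + ‖b‖ ^ 2 := by
      rcases hab with h | h
      · have := norm_pos_iff.2 h; positivity
      · have := norm_pos_iff.2 h; positivity
    refine ⟨√(‖a‖ ^ 2 + ‖b‖ ^ 2), Real.sqrt_pos.2 hpos, ?_⟩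
    rw [← Complex.ofReal_pow, Real.sq_sqrt hpos.le]
    simp [Complex.mul_conj']
  rw [det_fin_two] at hdet
  by_cases hrow : Y 0 0 ≠ 0 ∨ Y 0 1 ≠ 0
  · obtain ⟨N, hN, hN2⟩ := key _ _ hrow
    have hN' : (N : ℂ) ≠ 0 := by exact_mod_cast hN.ne'
    refine ⟨![N, (Y 1 0 * star (Y 0 0) + Y 1 1 * star (Y 0 1)) / N],
      ![star (Y 0 0) / N, star (Y 0 1) / N], ?_, ?_, ?_⟩
    · simp [dotProduct, Fin.sum_univ_two] at hN2 ⊢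
      field_simp
      linear_combination hN2
    · intro h; exact hN' (by simpa using congrFun h 0)
    · ext i j
      fin_cases i <;> fin_cases j <;> simp [vecMulVec_apply] at hN2 ⊢ <;> field_simp
      · linear_combination (-Y 1 0) * hN2 - (starRingEnd ℂ) (Y 0 1) * hdet
      · linear_combination (-Y 1 1) * hN2 + (starRingEnd ℂ) (Y 0 0) * hdet
  · push Not at hrow
    have hrow1 : Y 1 0 ≠ 0 ∨ Y 1 1 ≠ 0 := by
      by_contra hcon
      push Not at hcon
      apply h0
      ext i j
      fin_cases i <;> fin_cases j <;> simp [hrow, hcon]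
    obtain ⟨N, hN, hN2⟩ := key _ _ hrow1
    have hN' : (N : ℂ) ≠ 0 := by exact_mod_cast hN.ne'
    refine ⟨![0, N], ![star (Y 1 0) / N, star (Y 1 1) / N], ?_, ?_, ?_⟩
    · simp [dotProduct, Fin.sum_univ_two] at hN2 ⊢
      field_simp
      linear_combination hN2
    · intro h; exact hN' (by simpa using congrFun h 1)
    · ext i j
      fin_cases i <;> fin_cases j <;> simp [vecMulVec_apply, hrow] <;> field_simp


theorem star_dotProduct_self_ne_zero {l : Fin 2 → ℂ} (hl : l ≠ 0) : star l ⬝ᵥ l ≠ 0 := by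
  open ComplexOrder in
  exact fun h => hl (dotProduct_star_self_eq_zero.1 h)

theorem eq_zero_iff_of_ne_zero {l : Fin 2 → ℂ} (hl : l ≠ 0) (u : Fin 2 → ℂ) :
    u = 0 ↔ ![-l 1, l 0] ⬝ᵥ u = 0 ∧ star l ⬝ᵥ u = 0 := by
  constructor
  · rintro rfl; simp
  · rintro ⟨h1, h2⟩
    have hn : star l ⬝ᵥ l ≠ 0 := star_dotProduct_self_ne_zero hl
    simp only [dotProduct, Fin.sum_univ_two, cons_val_zero, cons_val_one, Pi.star_apply] at h1 h2 hn
    have e0 : u 0 = 0 := by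
      have : (star (l 0) * l 0 + star (l 1) * l 1) * u 0 = 0 := by
        linear_combination l 0 * h2 - star (l 1) * h1
      exact (mul_eq_zero.1 this).resolve_left hn
    have e1 : u 1 = 0 := by
      have : (star (l 0) * l 0 + star (l 1) * l 1) * u 1 = 0 := by
        linear_combination l 1 * h2 + star (l 0) * h1
      exact (mul_eq_zero.1 this).resolve_left hn
    ext i
    fin_cases i
    · exact e0
    · exact e1

theorem decomp_orthonormal {r : Fin 2 → ℂ} (hr : star r ⬝ᵥ r = 1) (ψ : Fin 2 → ℂ) :
    ψ = (star r ⬝ᵥ ψ) • r + (![-r 1, r 0] ⬝ᵥ ψ) • ![-star (r 1), star (r 0)] := by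
  simp only [dotProduct, Fin.sum_univ_two, Pi.star_apply] at hr ⊢
  ext i
  fin_cases i
  · simp at hr ⊢
    linear_combination (-ψ 0) * hr
  · simp at hr ⊢
    linear_combination (-ψ 1) * hr

theorem finite_affine_eq_zero {β₀ β₁ : ℂ} {k₁ : ℝ} (h : β₀ + k₁ * β₁ ≠ 0) :
    {k : ℝ | β₀ + k * β₁ = 0}.Finite := by
  refine Set.Subsingleton.finite fun x hx y hy => ?_
  have hx' : β₀ + x * β₁ = 0 := hx
  have hy' : β₀ + y * β₁ = 0 := hy
  have h1 : β₁ ≠ 0 := fun h1 => h (by rw [h1, mul_zero] at hx' ⊢; exact hx')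
  have : ((x : ℂ) - y) * β₁ = 0 := by linear_combination hx' - hy'
  have := (mul_eq_zero.1 this).resolve_right h1
  exact_mod_cast sub_eq_zero.1 this

/-- Annihilating `l` with `n` leaves a condition on ψ alone; isotropy makes it the vanishing of the
component of ψ orthogonal to r, except where its coefficient, affine in k, is zero. The remaining
equation along `l` is ⟨r, χ⟩ + τ⟨r, ψ⟩ = 0, and isotropy makes the affine function τ real. -/
theorem exists_normalForm_of_rankOne {X₀ X₁ : Matrix (Fin 2) (Fin 2) ℂ} {l r : Fin 2 → ℂ}
    (hr : star r ⬝ᵥ r = 1) (hl : l ≠ 0) {k₁ k₂ : ℝ} (hk : k₁ ≠ k₂)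
    (h₁ : IsIsotropicPair (X₀ + (k₁ : ℂ) • X₁) (vecMulVec l (star r)))
    (h₂ : IsIsotropicPair (X₀ + (k₂ : ℂ) • X₁) (vecMulVec l (star r))) :
    ∃ (t₀ t₁ : ℝ) (Bad : Set ℝ), Bad.Finite ∧ ∀ k ∉ Bad, ∀ ψ χ : Fin 2 → ℂ,
      (X₀ + (k : ℂ) • X₁) *ᵥ ψ + vecMulVec l (star r) *ᵥ χ = 0 ↔
        bdryMap (rankOne r) ((t₀ : ℂ) • rankOne r + (k : ℂ) • ((t₁ : ℂ) • rankOne r)) ψ χ = 0 := by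
  set rp : Fin 2 → ℂ := ![-star (r 1), star (r 0)] with hrp
  set n : Fin 2 → ℂ := ![-l 1, l 0] with hn
  set m : Fin 2 → ℂ := ![-r 1, r 0] with hm
  have hll : star l ⬝ᵥ l ≠ 0 := star_dotProduct_self_ne_zero hl
  have hnl : n ⬝ᵥ l = 0 := by simp [hn, dotProduct, Fin.sum_univ_two]; ring
  have hrrp : star r ⬝ᵥ rp = 0 := by simp [hrp, dotProduct, Fin.sum_univ_two]; ring
  have hmr : m ⬝ᵥ r = 0 := by simp [hm, dotProduct, Fin.sum_univ_two]; ring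
  have hmrp : m ⬝ᵥ rp = 1 := by
    rw [← hr]; simp [hm, hrp, dotProduct, Fin.sum_univ_two]; ring
  have hrpm : star rp = m := by
    ext i; fin_cases i <;> simp [hm, hrp]
  have hrpr : rp ≠ 0 := fun h => by rw [h] at hmrp; simp at hmrp
  have hY : ∀ χ, vecMulVec l (star r) *ᵥ χ = (star r ⬝ᵥ χ) • l := fun χ => by
    ext i; simp [vecMulVec_apply, mulVec, dotProduct, Fin.sum_univ_two]; ring
  have hker : ∀ (X : Matrix (Fin 2) (Fin 2) ℂ) (ψ χ : Fin 2 → ℂ),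
      X *ᵥ ψ + vecMulVec l (star r) *ᵥ χ = 0 ↔
        n ⬝ᵥ X *ᵥ ψ = 0 ∧ star l ⬝ᵥ X *ᵥ ψ + (star r ⬝ᵥ χ) * (star l ⬝ᵥ l) = 0 := by
    intro X ψ χ
    rw [eq_zero_iff_of_ne_zero hl, hY]
    simp only [dotProduct_add, dotProduct_smul, smul_eq_mul]
    change n ⬝ᵥ _ + _ * n ⬝ᵥ l = 0 ∧ _ ↔ _
    rw [hnl, mul_zero, add_zero]
  -- consequences of isotropy
  have iso : ∀ X : Matrix (Fin 2) (Fin 2) ℂ, IsIsotropicPair X (vecMulVec l (star r)) →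
      n ⬝ᵥ X *ᵥ rp ≠ 0 ∧ n ⬝ᵥ X *ᵥ r = 0 ∧
      star ((star l ⬝ᵥ X *ᵥ r) / (star l ⬝ᵥ l)) = (star l ⬝ᵥ X *ᵥ r) / (star l ⬝ᵥ l) := by
    intro X hX
    have hlift : ∀ ψ, n ⬝ᵥ X *ᵥ ψ = 0 →
        X *ᵥ ψ + vecMulVec l (star r) *ᵥ (-((star l ⬝ᵥ X *ᵥ ψ) / (star l ⬝ᵥ l)) • r) = 0 := by
      intro ψ hψ
      refine (hker X ψ _).2 ⟨hψ, ?_⟩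
      rw [dotProduct_smul, hr, smul_eq_mul, mul_one]
      field_simp
      ring
    -- The data ψ = 0, χ = `rp` are always admissible, because Y sees only the component of χ along
    -- r. Isotropy against them kills the component of an admissible ψ orthogonal to r.
    have hperp : ∀ ψ, n ⬝ᵥ X *ᵥ ψ = 0 → m ⬝ᵥ ψ = 0 := by
      intro ψ hψ
      have h0 : X *ᵥ (0 : Fin 2 → ℂ) + vecMulVec l (star r) *ᵥ rp = 0 := by
        rw [mulVec_zero, hY, hrrp, zero_smul, add_zero]
      have := hX _ _ _ _ h0 (hlift ψ hψ)
      rw [star_zero, zero_dotProduct, hrpm] at this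
      exact this.symm
    have hβ : n ⬝ᵥ X *ᵥ rp ≠ 0 := fun h => by
      have := hperp rp h
      rw [hmrp] at this
      exact one_ne_zero this
    have hα : n ⬝ᵥ X *ᵥ r = 0 := by
      have h1 : n ⬝ᵥ X *ᵥ ((n ⬝ᵥ X *ᵥ rp) • r - (n ⬝ᵥ X *ᵥ r) • rp) = 0 := by
        simp only [mulVec_sub, mulVec_smul, dotProduct_sub, dotProduct_smul, smul_eq_mul]
        ring
      have h2 := hperp _ h1
      simp only [dotProduct_sub, dotProduct_smul, smul_eq_mul, hmr, hmrp] at h2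
      linear_combination -h2
    refine ⟨hβ, hα, ?_⟩
    have := hX _ _ _ _ (hlift r hα) (hlift r hα)
    simp only [dotProduct_smul, star_smul, smul_dotProduct, hr, smul_eq_mul, mul_one, star_neg]
      at this
    exact (neg_injective this).symm
  obtain ⟨b1, a1, s1⟩ := iso _ h₁
  obtain ⟨b2, a2, s2⟩ := iso _ h₂
  have hlin : ∀ (v w : Fin 2 → ℂ) (k : ℝ), v ⬝ᵥ (X₀ + (k : ℂ) • X₁) *ᵥ w =
      v ⬝ᵥ X₀ *ᵥ w + k * (v ⬝ᵥ X₁ *ᵥ w) := fun v w k => by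
    rw [add_mulVec, smul_mulVec, dotProduct_add, dotProduct_smul, smul_eq_mul]
  have hkne : (k₁ : ℂ) - k₂ ≠ 0 := by rw [sub_ne_zero]; exact_mod_cast hk
  rw [hlin] at a1 a2 b1 s1 s2
  have α1 : n ⬝ᵥ X₁ *ᵥ r = 0 := by
    have : ((k₁ : ℂ) - k₂) * (n ⬝ᵥ X₁ *ᵥ r) = 0 := by linear_combination a1 - a2
    exact (mul_eq_zero.1 this).resolve_left hkne
  have α0 : n ⬝ᵥ X₀ *ᵥ r = 0 := by rw [α1] at a1; linear_combination a1
  set τ₀ := (star l ⬝ᵥ X₀ *ᵥ r) / (star l ⬝ᵥ l) with hτ₀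
  set τ₁ := (star l ⬝ᵥ X₁ *ᵥ r) / (star l ⬝ᵥ l) with hτ₁
  have s1' : star (τ₀ + k₁ * τ₁) = τ₀ + k₁ * τ₁ := by
    have e : (star l ⬝ᵥ X₀ *ᵥ r + k₁ * (star l ⬝ᵥ X₁ *ᵥ r)) / (star l ⬝ᵥ l) = τ₀ + k₁ * τ₁ := by
      rw [hτ₀, hτ₁]; ring
    rwa [e] at s1
  have s2' : star (τ₀ + k₂ * τ₁) = τ₀ + k₂ * τ₁ := by
    have e : (star l ⬝ᵥ X₀ *ᵥ r + k₂ * (star l ⬝ᵥ X₁ *ᵥ r)) / (star l ⬝ᵥ l) = τ₀ + k₂ * τ₁ := by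
      rw [hτ₀, hτ₁]; ring
    rwa [e] at s2
  simp at s1' s2'
  have hc1 : (starRingEnd ℂ) τ₁ = τ₁ := by
    have : ((k₁ : ℂ) - k₂) * ((starRingEnd ℂ) τ₁ - τ₁) = 0 := by linear_combination s1' - s2'
    exact sub_eq_zero.1 ((mul_eq_zero.1 this).resolve_left hkne)
  have hc0 : (starRingEnd ℂ) τ₀ = τ₀ := by rw [hc1] at s1'; linear_combination s1'
  obtain ⟨t₀, ht₀⟩ := Complex.conj_eq_iff_real.1 hc0
  obtain ⟨t₁, ht₁⟩ := Complex.conj_eq_iff_real.1 hc1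
  refine ⟨t₀, t₁, _, finite_affine_eq_zero b1, fun k hkB ψ χ => ?_⟩
  have hβk : n ⬝ᵥ X₀ *ᵥ rp + k * (n ⬝ᵥ X₁ *ᵥ rp) ≠ 0 := hkB
  rw [hker]
  have hψ := decomp_orthonormal hr ψ
  change ψ = (star r ⬝ᵥ ψ) • r + (m ⬝ᵥ ψ) • rp at hψ
  set s := star r ⬝ᵥ ψ with hs
  set s' := m ⬝ᵥ ψ with hs'
  set x := star r ⬝ᵥ χ with hx
  have hP : ∀ v, rankOne r *ᵥ v = (star r ⬝ᵥ v) • r := fun v => by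
    ext i; simp [rankOne, vecMulVec_apply, mulVec, dotProduct, Fin.sum_univ_two]; ring
  have e1 : n ⬝ᵥ (X₀ + (k : ℂ) • X₁) *ᵥ ψ =
      s' * (n ⬝ᵥ X₀ *ᵥ rp + k * (n ⬝ᵥ X₁ *ᵥ rp)) := by
    rw [hlin, hψ]
    simp only [mulVec_add, mulVec_smul, dotProduct_add, dotProduct_smul, smul_eq_mul, α0, α1]
    ring
  have e2 : bdryMap (rankOne r) ((t₀ : ℂ) • rankOne r + (k : ℂ) • ((t₁ : ℂ) • rankOne r)) ψ χ =
      s' • rp + (x + (τ₀ + k * τ₁) * s) • r := by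
    unfold bdryMap
    simp only [add_mulVec, smul_mulVec, hP]
    rw [← hs, ← hx, ← ht₀, ← ht₁]
    nth_rewrite 1 [hψ]
    module
  have e3 : s' = 0 → star l ⬝ᵥ (X₀ + (k : ℂ) • X₁) *ᵥ ψ = (τ₀ + k * τ₁) * s * (star l ⬝ᵥ l) := by
    intro h0
    rw [hlin, hψ, h0]
    simp only [mulVec_smul, dotProduct_smul, smul_eq_mul, hτ₀, hτ₁, add_zero, zero_smul]
    field_simp
  rw [e1, e2]
  constructor
  · rintro ⟨g1, g2⟩
    have h0 : s' = 0 := (mul_eq_zero.1 g1).resolve_right hβk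
    rw [e3 h0, ← add_mul] at g2
    have h3 := (mul_eq_zero.1 g2).resolve_right hll
    rw [h0, add_comm x, h3, zero_smul, zero_smul, add_zero]
  · intro g
    have h0 : s' = 0 := by
      have := congrArg (m ⬝ᵥ ·) g
      simpa [dotProduct_add, dotProduct_smul, hmr, hmrp, -dotProduct_cons] using this
    have h1 : x + (τ₀ + k * τ₁) * s = 0 := by
      have := congrArg (star r ⬝ᵥ ·) g
      simpa [dotProduct_add, dotProduct_smul, hr, hrrp, -dotProduct_cons] using this
    refine ⟨by rw [h0, zero_mul], ?_⟩
    rw [e3 h0]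
    linear_combination (star l ⬝ᵥ l) * h1

/-- A boundary condition that is isotropic at two momenta is equivalent to a normal form, off
finitely many momenta. -/
theorem rankOne_ne_one (r : Fin 2 → ℂ) : rankOne r ≠ 1 := by
  intro h
  have h1 := congrArg Matrix.det h
  rw [det_fin_two, det_one] at h1
  simp [rankOne, vecMulVec_apply] at h1
  exact zero_ne_one (α := ℂ) (by linear_combination h1)

/-- The coefficient of χ does not depend on k, and its rank 2, 1 or 0 selects the form. For Π = 1 no
momentum is exceptional; this is needed to apply the uniqueness of scattering states at every
momentum. -/
theorem exists_normalForm {ε : ℝ} (hε : ε ≠ 0) {B₀ B₁ B₂ : Matrix (Fin 2) (Fin 2) ℂ} {k₁ k₂ : ℝ}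
    (hk : k₁ ≠ k₂) (h₁ : IsIsotropicBC ε (bcMatrix B₀ B₁ B₂ k₁))
    (h₂ : IsIsotropicBC ε (bcMatrix B₀ B₁ B₂ k₂)) :
    ∃ (Pr M₀ M₁ : Matrix (Fin 2) (Fin 2) ℂ) (Bad : Set ℝ), Bad.Finite ∧ (Pr = 1 → Bad = ∅) ∧
      IsNormalForm Pr M₀ M₁ ∧ ∀ k ∉ Bad, ∀ ψ ψ' : Fin 2 → ℂ, bcMatrix B₀ B₁ B₂ k *ᵥ Sum.elim ψ ψ' = 0 ↔
        bdryMap Pr (M₀ + (k : ℂ) • M₁) ψ (chiData ε ψ ψ') = 0 := by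
  have g₁ := h₁.isIsotropicPair hε
  have g₂ := h₂.isIsotropicPair hε
  simp only [bcMatrix_mulVec hε]
  generalize bcPsi ε B₀ B₂ = X₀ at *
  generalize Complex.I • B₁ = X₁ at *
  generalize bcChi ε B₂ = Y at *
  by_cases hdet : Y.det = 0
  · by_cases hY : Y = 0
    · rw [hY] at g₁ ⊢
      obtain ⟨f1, f2⟩ := exists_normalForm_of_zero g₁
      exact ⟨0, 0, 0, _, f1, fun h => absurd h zero_ne_one, .dirichlet rfl rfl rfl, fun k hk ψ ψ' => f2 k hk ψ _⟩
    · obtain ⟨l, r, hr, hl, hYlr⟩ := exists_rankOne_factor hY hdet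
      rw [hYlr] at g₁ g₂ ⊢
      obtain ⟨t₀, t₁, Bad, f1, f2⟩ := exists_normalForm_of_rankOne hr hl hk g₁ g₂
      exact ⟨_, _, _, Bad, f1, fun h => absurd h (rankOne_ne_one r), .mixed r t₀ t₁ hr rfl rfl rfl, fun k hk ψ ψ' => f2 k hk ψ _⟩
  · obtain ⟨f1, f2⟩ := exists_normalForm_of_isUnit hk g₁ g₂ hdet
    exact ⟨_, _, _, ∅, finite_empty, fun _ => rfl, f1, fun k _ ψ ψ' => f2 k ψ _⟩

/-- The matrix has the same kernel as the normalized boundary map, and that map is onto ℂ². -/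
theorem rank_eq_two {ε : ℝ} (hε : ε ≠ 0) {Pr M : Matrix (Fin 2) (Fin 2) ℂ} (h : IsNormalBC Pr M)
    {A : Matrix (Fin 2) (Fin 2 ⊕ Fin 2) ℂ}
    (hA : ∀ ψ ψ' : Fin 2 → ℂ, A *ᵥ Sum.elim ψ ψ' = 0 ↔ bdryMap Pr M ψ (chiData ε ψ ψ') = 0) :
    A.rank = 2 := by
  set T : (Fin 2 ⊕ Fin 2 → ℂ) →ₗ[ℂ] (Fin 2 → ℂ) :=
    { toFun := fun z => bdryMap Pr M (fun i => z (Sum.inl i))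
        (chiData ε (fun i => z (Sum.inl i)) (fun i => z (Sum.inr i)))
      map_add' := fun z w => by
        ext i; fin_cases i <;>
        simp [bdryMap, chiData, vecHead, vecTail] <;> ring
      map_smul' := fun c z => by
        ext i; fin_cases i <;>
        simp [bdryMap, chiData, vecHead, vecTail] <;> ring } with hT
  have hsplit : ∀ z : Fin 2 ⊕ Fin 2 → ℂ,
      Sum.elim (fun i => z (Sum.inl i)) (fun i => z (Sum.inr i)) = z := fun z => by
    ext i; rcases i with i | i <;> rfl
  have hker : LinearMap.ker A.mulVecLin = LinearMap.ker T := by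
    ext z
    rw [LinearMap.mem_ker, LinearMap.mem_ker, Matrix.mulVecLin_apply]
    conv_lhs => rw [← hsplit z]
    exact hA _ _
  have hright : M * Pr = M := by
    have := congrArg conjTranspose h.left
    rwa [conjTranspose_mul, h.herm, h.hermM] at this
  have hsurj : LinearMap.range T = ⊤ := by
    rw [LinearMap.range_eq_top]
    intro v
    -- The preimage of v has ψ = (1-Π)v and χ = Πv; the term with M vanishes since MΠ = M.
    refine ⟨Sum.elim (v - Pr *ᵥ v) (derivData ε (v - Pr *ᵥ v) (Pr *ᵥ v)), ?_⟩
    change bdryMap Pr M (v - Pr *ᵥ v) (chiData ε (v - Pr *ᵥ v)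
      (derivData ε (v - Pr *ᵥ v) (Pr *ᵥ v))) = v
    rw [chiData_derivData hε, bdryMap, mulVec_sub, mulVec_sub, mulVec_mulVec, mulVec_mulVec, h.idem,
      hright]
    abel
  have e1 := LinearMap.finrank_range_add_finrank_ker T
  have e2 := LinearMap.finrank_range_add_finrank_ker A.mulVecLin
  rw [hsurj, finrank_top] at e1
  rw [hker] at e2
  rw [Matrix.rank]
  simp at e1 e2 ⊢
  omega

end RegDirac
end

noncomputable section
namespace RegDirac

/-! ### The asymptotic winding number from a logarithm of the scattering amplitude -/

theorem pathInfty_sq (δ x : ℝ) (hδ : δ ≠ 0) :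
    (pathInfty δ x).1 ^ 2 + (pathInfty δ x).2 ^ 2 = (x ^ 2 + δ ^ 2)⁻¹ := by
  have : x ^ 2 + δ ^ 2 ≠ 0 := by positivity
  simp only [pathInfty]
  field_simp

theorem contDiff_pathInfty {δ : ℝ} (hδ : δ ≠ 0) : ContDiff ℝ 1 (pathInfty δ) := by
  have : ∀ x : ℝ, x ^ 2 + δ ^ 2 ≠ 0 := fun x => by positivity
  unfold pathInfty
  exact (contDiff_neg.div (by fun_prop) this).prodMk (contDiff_const.div (by fun_prop) this)

/-- Hitting a given momentum is a polynomial equation in x whose linear coefficient is 1, so it is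
never trivial. -/
theorem finite_pathInfty_preimage {δ : ℝ} (hδ : δ ≠ 0) {Bad : Set ℝ} (hBad : Bad.Finite) :
    {x | (pathInfty δ x).1 ∈ Bad}.Finite := by
  have h1 : {x | (pathInfty δ x).1 ∈ Bad} = ⋃ c ∈ Bad, {x | (pathInfty δ x).1 = c} := by
    ext x; simp
  rw [h1]
  refine hBad.biUnion fun c _ => ?_
  set p : Polynomial ℝ := Polynomial.C c * Polynomial.X ^ 2 + Polynomial.X +
    Polynomial.C (c * δ ^ 2) with hp
  have hp0 : p ≠ 0 := fun h => by
    have := congrArg (fun q => Polynomial.coeff q 1) h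
    simp [hp, Polynomial.coeff_X, Polynomial.coeff_X_pow,
      -map_mul] at this
  refine (p.rootSet_finite ℝ).subset fun x hx => ?_
  have h2 : x ^ 2 + δ ^ 2 ≠ 0 := by positivity
  have h3 : -x / (x ^ 2 + δ ^ 2) = c := hx
  rw [div_eq_iff h2] at h3
  rw [Polynomial.mem_rootSet]
  refine ⟨hp0, ?_⟩
  simp [hp]
  linear_combination -h3

/-- Along the path S = -exp Λ up to finitely many points, so S⁻¹dS = dΛ almost everywhere, and the
integral is the difference of Λ at the ends. The resulting inner limit is already independent of
`l`. -/
theorem isAsymptoticWinding_of_lift {S Λ : ℝ × ℝ → ℂ} {R : ℝ} {Bad : Set ℝ} (hBad : Bad.Finite)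
    {ep em : ℂ}
    (hΛ : ∀ p : ℝ × ℝ, 0 < p.2 → R < p.1 ^ 2 + p.2 ^ 2 → ContDiffAt ℝ 1 Λ p)
    (hS : ∀ p : ℝ × ℝ, 0 < p.2 → R < p.1 ^ 2 + p.2 ^ 2 → p.1 ∉ Bad → S p = -Complex.exp (Λ p))
    (hp : ∀ᶠ k : ℝ in atTop, Tendsto Λ (𝓝[{p | 0 < p.2}] (k, 0)) (𝓝 (2 * Real.pi * Complex.I * ep)))
    (hm : ∀ᶠ k : ℝ in atBot, Tendsto Λ (𝓝[{p | 0 < p.2}] (k, 0)) (𝓝 (2 * Real.pi * Complex.I * em))) :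
    IsAsymptoticWinding S (em - ep) := by
  refine ⟨fun _ => em - ep, ?_, tendsto_const_nhds⟩
  have hinv : Tendsto (fun l : ℝ => l⁻¹) (𝓝[>] 0) atTop := tendsto_inv_nhdsGT_zero
  have hninv : Tendsto (fun l : ℝ => -l⁻¹) (𝓝[>] 0) atBot := tendsto_neg_atTop_atBot.comp hinv
  -- On the path k² + κ² = (x² + δ²)⁻¹, which is at least (2l²)⁻¹ once δ ≤ l; so the path stays in
  -- the region where Λ is defined.
  have hsq : ∀ᶠ l : ℝ in 𝓝[>] 0, R < (2 * l ^ 2)⁻¹ := by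
    have h1 : Tendsto (fun l : ℝ => (2 * l ^ 2)⁻¹) (𝓝[>] 0) atTop := by
      refine tendsto_inv_nhdsGT_zero.comp (tendsto_nhdsWithin_iff.2 ⟨?_, ?_⟩)
      · exact (Continuous.tendsto' (by fun_prop) _ _ (by simp)).mono_left nhdsWithin_le_nhds
      · filter_upwards [self_mem_nhdsWithin] with l hl
        have : (0 : ℝ) < l := hl
        simp only [mem_Ioi]; positivity
    exact h1.eventually_gt_atTop R
  filter_upwards [hinv.eventually hp, hninv.eventually hm, hsq, self_mem_nhdsWithin]
    with l hlp hlm hlR hl0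
  have hl0 : 0 < l := hl0
  have hK : ∀ δ ∈ Ioo 0 l, ∀ x ∈ Icc (-l) l, 0 < (pathInfty δ x).2 ∧
      R < (pathInfty δ x).1 ^ 2 + (pathInfty δ x).2 ^ 2 := by
    intro δ hδ x hx
    have hδ0 := hδ.1
    refine ⟨by simp only [pathInfty]; positivity, ?_⟩
    rw [pathInfty_sq _ _ hδ0.ne']
    refine hlR.trans_le ?_
    apply inv_anti₀ (by positivity)
    have : x ^ 2 ≤ l ^ 2 := sq_le_sq' hx.1 hx.2
    have : δ ^ 2 ≤ l ^ 2 := by gcongr; exact hδ.2.le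
    linarith
  set f : ℝ → ℝ → ℂ := fun δ x => Λ (pathInfty δ x) with hf
  have hfC : ∀ δ ∈ Ioo 0 l, ∀ x ∈ Icc (-l) l, ContDiffAt ℝ 1 (f δ) x := fun δ hδ x hx =>
    (hΛ _ (hK δ hδ x hx).1 (hK δ hδ x hx).2).comp x (contDiff_pathInfty hδ.1.ne').contDiffAt
  have hfd : ∀ δ ∈ Ioo 0 l, IntervalIntegrable (deriv (f δ)) volume (-l) l := by
    intro δ hδ
    refine ContinuousOn.intervalIntegrable fun x hx => ?_
    rw [uIcc_of_le (by linarith)] at hx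
    have h1 := ((hfC δ hδ x hx).fderiv_right (m := 0) (by simp)).continuousAt
    exact (h1.clm_apply continuousAt_const).continuousWithinAt
  have hae : ∀ δ ∈ Ioo 0 l, ∀ᵐ x, x ∈ uIoc (-l) l → logDerivPath S δ x = deriv (f δ) x := by
    intro δ hδ
    have hfin := finite_pathInfty_preimage hδ.1.ne' hBad
    filter_upwards [hfin.countable.ae_notMem volume] with x hxB hx
    rw [uIoc_of_le (by linarith)] at hx
    have hx' : x ∈ Icc (-l) l := ⟨hx.1.le, hx.2⟩
    have hcont := (contDiff_pathInfty hδ.1.ne').continuous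
    have e1 : ∀ᶠ t in 𝓝 x, R < (pathInfty δ t).1 ^ 2 + (pathInfty δ t).2 ^ 2 :=
      eventually_const_lt_of_continuousAt (hK δ hδ x hx').2 (Continuous.continuousAt
        (((continuous_fst.comp hcont).pow 2).add ((continuous_snd.comp hcont).pow 2)))
    have e2 : ∀ᶠ t in 𝓝 x, 0 < (pathInfty δ t).2 :=
      eventually_const_lt_of_continuousAt (hK δ hδ x hx').1
        (continuous_snd.comp hcont).continuousAt
    have e3 : ∀ᶠ t in 𝓝 x, (pathInfty δ t).1 ∉ Bad :=
      (hBad.isClosed.isOpen_compl.preimage (continuous_fst.comp hcont)).mem_nhds hxB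
    have e4 : (fun t => S (pathInfty δ t)) =ᶠ[𝓝 x] fun t => -Complex.exp (f δ t) := by
      filter_upwards [e1, e2, e3] with t h1 h2 h3
      exact hS _ h2 h1 h3
    have hd : HasDerivAt (f δ) (deriv (f δ) x) x :=
      ((hfC δ hδ x hx').differentiableAt (by simp)).hasDerivAt
    have hd2 : HasDerivAt (fun t => -Complex.exp (f δ t)) (-(Complex.exp (f δ x) * deriv (f δ) x)) x :=
      hd.cexp.neg
    rw [logDerivPath, e4.deriv_eq, hd2.deriv, e4.eq_of_nhds]
    have := Complex.exp_ne_zero (f δ x)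
    field_simp
  have hint : ∀ δ ∈ Ioo 0 l, IntervalIntegrable (logDerivPath S δ) volume (-l) l := by
    intro δ hδ
    refine (hfd δ hδ).congr_ae ?_
    rw [EventuallyEq, ae_restrict_iff' measurableSet_uIoc]
    filter_upwards [hae δ hδ] with x hx hx'
    exact (hx hx').symm
  have hval : ∀ δ ∈ Ioo 0 l, ∫ x in (-l)..l, logDerivPath S δ x = f δ l - f δ (-l) := by
    intro δ hδ
    rw [intervalIntegral.integral_congr_ae (hae δ hδ)]
    refine intervalIntegral.integral_deriv_eq_sub (fun x hx => ?_) (hfd δ hδ)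
    rw [uIcc_of_le (by linarith)] at hx
    exact (hfC δ hδ x hx).differentiableAt (by simp)
  have hmem : Ioo 0 l ∈ 𝓝[>] (0 : ℝ) := Ioo_mem_nhdsGT hl0
  refine ⟨by filter_upwards [hmem] with δ hδ using hint δ hδ, ?_⟩
  have hpt : ∀ x : ℝ, x ≠ 0 → Tendsto (fun δ => pathInfty δ x) (𝓝[>] 0) (𝓝[{p | 0 < p.2}] (-x⁻¹, 0)) := by
    intro x hx
    refine tendsto_nhdsWithin_iff.2 ⟨?_, ?_⟩
    · have hx2 : x ^ 2 + 0 ^ 2 ≠ 0 := by positivity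
      have : ContinuousAt (fun δ => pathInfty δ x) 0 := by
        unfold pathInfty
        exact ContinuousAt.prodMk (ContinuousAt.div (by fun_prop) (by fun_prop) hx2)
          (ContinuousAt.div (by fun_prop) (by fun_prop) hx2)
      have h2 : pathInfty 0 x = (-x⁻¹, 0) := by
        simp only [pathInfty]
        ext
        · simp; field_simp
        · simp
      rw [← h2]
      exact this.tendsto.mono_left nhdsWithin_le_nhds
    · filter_upwards [self_mem_nhdsWithin] with δ hδ
      have : (0 : ℝ) < δ := hδ
      simp only [pathInfty]; positivity
  -- The path runs from k = 1/l at x = -l to k = -1/l at x = l. Hence the limit at negative momenta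
  -- enters with the plus sign.
  have t1 := hlm.comp (hpt l hl0.ne')
  have t2 := hlp.comp (by simpa using hpt (-l) (neg_ne_zero.2 hl0.ne'))
  have t3 := (t1.sub t2).const_mul (2 * (Real.pi : ℂ) * Complex.I)⁻¹
  have hπ : (2 * (Real.pi : ℂ) * Complex.I) ≠ 0 := Complex.two_pi_I_ne_zero
  have e : (2 * (Real.pi : ℂ) * Complex.I)⁻¹ * (2 * Real.pi * Complex.I * em - 2 * Real.pi * Complex.I * ep)
      = em - ep := by
    field_simp
  rw [e] at t3
  refine t3.congr' ?_
  filter_upwards [hmem] with δ hδ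
  rw [hval δ hδ]
  rfl

/-! ### Jumps of the logarithm -/

/-- Reflection in the boundary of the half-plane. -/
def refl (p : ℝ × ℝ) : ℝ × ℝ := (p.1, -p.2)

theorem contDiff_refl {n : WithTop ℕ∞} : ContDiff ℝ n refl := by
  unfold refl; fun_prop

theorem tendsto_refl (k : ℝ) :
    Tendsto refl (𝓝[{p | 0 < p.2}] (k, 0)) (𝓝[{p | p.2 < 0}] (k, 0)) := by
  refine tendsto_nhdsWithin_iff.2 ⟨?_, ?_⟩
  · exact ((contDiff_refl (n := 0)).continuous.tendsto' _ _ (by simp [refl])).mono_left nhdsWithin_le_nhds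
  · filter_upwards [self_mem_nhdsWithin] with p hp
    have : 0 < p.2 := hp
    simpa [refl] using this

/-- The jump of a function across the boundary of the half-plane at `(k, 0)`, in units of `2πi`. -/
def HasJump (l : ℝ × ℝ → ℂ) (k : ℝ) (e : ℂ) : Prop :=
  Tendsto (fun p => l (refl p) - l p) (𝓝[{p | 0 < p.2}] (k, 0)) (𝓝 (2 * Real.pi * Complex.I * e))

theorem HasJump.add {l l' : ℝ × ℝ → ℂ} {k : ℝ} {e e' : ℂ} (h : HasJump l k e) (h' : HasJump l' k e') :
    HasJump (fun p => l p + l' p) k (e + e') := by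
  unfold HasJump at *
  rw [mul_add]
  exact (h.add h').congr fun p => by ring

theorem HasJump.neg {l : ℝ × ℝ → ℂ} {k : ℝ} {e : ℂ} (h : HasJump l k e) :
    HasJump (fun p => -l p) k (-e) := by
  unfold HasJump at *
  rw [mul_neg]
  exact (Tendsto.neg h).congr fun p => by ring

theorem hasJump_zero_of_continuousAt {l : ℝ × ℝ → ℂ} {k : ℝ} (h : ContinuousAt l (k, 0)) :
    HasJump l k 0 := by
  unfold HasJump
  have h1 : Tendsto (fun p => l (refl p)) (𝓝[{p | 0 < p.2}] (k, 0)) (𝓝 (l (k, 0))) :=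
    (h.tendsto.mono_left nhdsWithin_le_nhds).comp (tendsto_refl k)
  have h2 : Tendsto l (𝓝[{p | 0 < p.2}] (k, 0)) (𝓝 (l (k, 0))) :=
    h.tendsto.mono_left nhdsWithin_le_nhds
  simpa using h1.sub h2

theorem hasJump_log_of_slitPlane {f : ℝ × ℝ → ℂ} {k : ℝ} (h : ContinuousAt f (k, 0))
    (hs : f (k, 0) ∈ Complex.slitPlane) : HasJump (fun p => Complex.log (f p)) k 0 :=
  hasJump_zero_of_continuousAt (h.clog hs)

/-- The value lies on the cut; the argument tends to π on the upper side of the axis and to -π after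
reflection. -/
theorem hasJump_log_of_neg {f : ℝ × ℝ → ℂ} {k : ℝ} (h : ContinuousAt f (k, 0))
    (hre : (f (k, 0)).re < 0) (him : (f (k, 0)).im = 0)
    (hup : ∀ᶠ p in 𝓝 (k, (0 : ℝ)), 0 < p.2 → 0 < (f p).im)
    (hdn : ∀ᶠ p in 𝓝 (k, (0 : ℝ)), p.2 < 0 → (f p).im < 0) :
    HasJump (fun p => Complex.log (f p)) k (-1) := by
  have h1 : Tendsto f (𝓝[{p | 0 < p.2}] (k, 0)) (𝓝[{z | 0 ≤ z.im}] (f (k, 0))) := by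
    refine tendsto_nhdsWithin_iff.2 ⟨h.tendsto.mono_left nhdsWithin_le_nhds, ?_⟩
    filter_upwards [nhdsWithin_le_nhds hup, self_mem_nhdsWithin] with p h1 h2
    exact (h1 h2).le
  have h2 : Tendsto f (𝓝[{p | p.2 < 0}] (k, 0)) (𝓝[{z | z.im < 0}] (f (k, 0))) := by
    refine tendsto_nhdsWithin_iff.2 ⟨h.tendsto.mono_left nhdsWithin_le_nhds, ?_⟩
    filter_upwards [nhdsWithin_le_nhds hdn, self_mem_nhdsWithin] with p h1 h2
    exact h1 h2
  have h3 := (Complex.tendsto_log_nhdsWithin_im_nonneg_of_re_neg_of_im_zero hre him).comp h1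
  have h4 := ((Complex.tendsto_log_nhdsWithin_im_neg_of_re_neg_of_im_zero hre him).comp h2).comp
    (tendsto_refl k)
  have h5 := h4.sub h3
  unfold HasJump
  have e : 2 * (Real.pi : ℂ) * Complex.I * -1 = (Real.log ‖f (k, 0)‖ : ℂ) - Real.pi * Complex.I -
      (Real.log ‖f (k, 0)‖ + Real.pi * Complex.I) := by ring
  rw [e]
  exact h5

theorem hasJump_log_of_neg' {f : ℝ × ℝ → ℂ} {k : ℝ} (h : ContinuousAt f (k, 0))
    (hre : (f (k, 0)).re < 0) (him : (f (k, 0)).im = 0)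
    (hup : ∀ᶠ p in 𝓝 (k, (0 : ℝ)), 0 < p.2 → (f p).im < 0)
    (hdn : ∀ᶠ p in 𝓝 (k, (0 : ℝ)), p.2 < 0 → 0 < (f p).im) :
    HasJump (fun p => Complex.log (f p)) k 1 := by
  have hr : Tendsto refl (𝓝 (k, (0 : ℝ))) (𝓝 (k, 0)) :=
    (contDiff_refl (n := 0)).continuous.tendsto' _ _ (by simp [refl])
  have h0 : refl (k, 0) = (k, 0) := by simp [refl]
  have h1 : HasJump (fun p => Complex.log (f (refl p))) k (-1) := by
    refine hasJump_log_of_neg ?_ (by rwa [h0]) (by rwa [h0]) ?_ ?_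
    · exact ContinuousAt.comp (by rwa [h0]) (contDiff_refl (n := 0)).continuous.continuousAt
    · filter_upwards [hr.eventually hdn] with p hp h
      exact hp (by simpa [refl] using h)
    · filter_upwards [hr.eventually hup] with p hp h
      exact hp (by simpa [refl] using h)
  unfold HasJump at *
  have h2 := h1.neg
  have h3 : ∀ p, refl (refl p) = p := fun p => by simp [refl]
  simp only [h3, neg_sub] at h2
  convert h2 using 2
  ring

/-- The half jump at a simple zero. -/
theorem hasJump_log_of_zero {f : ℝ × ℝ → ℂ} {k : ℝ} (h : ContDiffAt ℝ 1 f (k, 0))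
    (h0 : ∀ᶠ x in 𝓝 k, f (x, 0) = 0) (him : 0 < (fderiv ℝ f (k, 0) (0, 1)).im) :
    HasJump (fun p => Complex.log (f p)) k (-(1 / 2)) := by
  set D := fderiv ℝ f (k, 0) (0, 1) with hD
  have hst := h.hasStrictFDerivAt (by simp)
  -- Near the axis `f` behaves like κD. Since Im D > 0, both D and -D avoid the cut, and the jump
  -- becomes log(-D) - log D = -πi, the moduli of the factors κ cancelling.
  have hlim : Tendsto (fun p : ℝ × ℝ => (p.2 : ℂ)⁻¹ * f p) (𝓝[{p | p.2 ≠ 0}] (k, 0)) (𝓝 D) := by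
    have hpair : Tendsto (fun p : ℝ × ℝ => (p, (p.1, (0 : ℝ)))) (𝓝[{p | p.2 ≠ 0}] (k, 0))
        (𝓝 ((k, 0), (k, 0))) :=
      (Continuous.tendsto' (by fun_prop) _ _ rfl).mono_left nhdsWithin_le_nhds
    have h1 := hst.isLittleO.comp_tendsto hpair
    have h2 : (fun p : ℝ × ℝ => f p - (p.2 : ℂ) * D) =o[𝓝[{p | p.2 ≠ 0}] (k, 0)] fun p => (p.2 : ℂ) := by
      refine (h1.congr' ?_ (EventuallyEq.refl _ _)).trans_isBigO ?_
      · have h0' : ∀ᶠ p : ℝ × ℝ in 𝓝 (k, 0), f (p.1, 0) = 0 :=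
          (continuous_fst.tendsto (k, (0 : ℝ))).eventually h0
        filter_upwards [nhdsWithin_le_nhds h0'] with p hp
        have e : p - (p.1, (0 : ℝ)) = p.2 • ((0 : ℝ), (1 : ℝ)) := by ext <;> simp
        simp only [Function.comp_apply, e, map_smul, hp, sub_zero]
        simp [hD]
      · refine Asymptotics.IsBigO.of_bound 1 (Eventually.of_forall fun p => ?_)
        have e : p - (p.1, (0 : ℝ)) = ((0 : ℝ), p.2) := by ext <;> simp
        simp [e, Prod.norm_def]
    have h3 := h2.tendsto_inv_smul_nhds_zero
    have h4 := h3.add_const D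
    rw [zero_add] at h4
    refine h4.congr' ?_
    filter_upwards [self_mem_nhdsWithin] with p hp
    have hp' : (p.2 : ℂ) ≠ 0 := by exact_mod_cast hp
    simp only [smul_eq_mul]
    field_simp
    ring
  have hDs : D ∈ Complex.slitPlane := Or.inr him.ne'
  have hDs' : -D ∈ Complex.slitPlane := Or.inr (by simpa using him.ne')
  have hpos : 𝓝[{p : ℝ × ℝ | 0 < p.2}] (k, 0) ≤ 𝓝[{p | p.2 ≠ 0}] (k, 0) :=
    nhdsWithin_mono _ fun p hp => (ne_of_gt hp)
  have hneg : 𝓝[{p : ℝ × ℝ | p.2 < 0}] (k, 0) ≤ 𝓝[{p | p.2 ≠ 0}] (k, 0) :=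
    nhdsWithin_mono _ fun p hp => (ne_of_lt hp)
  have t1 := (hlim.mono_left hpos).clog hDs
  have t2 := (((hlim.mono_left hneg).comp (tendsto_refl k)).neg).clog hDs'
  have harg : Complex.log (-D) - Complex.log D = 2 * Real.pi * Complex.I * (-(1 / 2)) := by
    apply Complex.ext
    · simp [Complex.log_re]
    · simp [Complex.log_im, Complex.arg_neg_eq_arg_sub_pi_of_im_pos him]
      ring
  unfold HasJump
  rw [← harg]
  refine (t2.sub t1).congr' ?_
  have hnz1 := (hlim.mono_left hpos).eventually (hDs |> fun h => Complex.isOpen_slitPlane.mem_nhds h)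
  have hnz2 := ((hlim.mono_left hneg).comp (tendsto_refl k)).eventually_ne
    (show D ≠ 0 from fun h => by rw [h] at him; simp at him)
  filter_upwards [self_mem_nhdsWithin, hnz1, hnz2] with p hp h1 h2
  have hp : 0 < p.2 := hp
  have hp' : (p.2 : ℂ) ≠ 0 := by exact_mod_cast hp.ne'
  simp only [Function.comp_apply, refl] at h2 ⊢
  have e1 : f p = (p.2 : ℂ) * ((p.2 : ℂ)⁻¹ * f p) := by field_simp
  have e2 : f (p.1, -p.2) = (p.2 : ℂ) * (-(((-p.2 : ℝ) : ℂ)⁻¹ * f (p.1, -p.2))) := by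
    push_cast; field_simp
  conv_rhs => rw [e1, e2]
  rw [Complex.log_ofReal_mul hp (Complex.slitPlane_ne_zero h1),
    Complex.log_ofReal_mul hp (neg_ne_zero.2 h2)]
  ring

end RegDirac
end

noncomputable section
namespace RegDirac

/-! ### Bulk waves at energy `ω₊(k, κ)` -/

/-- Decay rate of the evanescent wave. -/
def evRate (m ε : ℝ) (p : ℝ × ℝ) : ℝ := √(p.2 ^ 2 + 2 * p.1 ^ 2 + (1 - 2 * ε * m) / ε ^ 2)

/-- The energy `ω₊`. -/
def band (m ε : ℝ) (p : ℝ × ℝ) : ℝ := bandPlus m ε p.1 p.2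

/-- The mass term `m - ε K`. -/
def massTerm (m ε : ℝ) (p : ℝ × ℝ) : ℝ := m - ε * (p.1 ^ 2 + p.2 ^ 2)

/-- Second component of the propagating wave. -/
def propSnd (m ε : ℝ) (p : ℝ × ℝ) : ℝ := band m ε p - massTerm m ε p

/-- First component of the evanescent wave. -/
def evFst (m ε : ℝ) (p : ℝ × ℝ) : ℝ := band m ε p + (ε⁻¹ - massTerm m ε p)

/-- Amplitude of the propagating wave. -/
def propVec (m ε : ℝ) (p : ℝ × ℝ) : Fin 2 → ℂ :=
  ![-(p.1 : ℂ) + Complex.I * p.2, propSnd m ε p]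

/-- Amplitude of the evanescent wave. -/
def evVec (m ε : ℝ) (p : ℝ × ℝ) : Fin 2 → ℂ := ![(evFst m ε p : ℂ), ((evRate m ε p - p.1 : ℝ) : ℂ)]

def propChi (m ε : ℝ) (p : ℝ × ℝ) : Fin 2 → ℂ :=
  chiData ε (propVec m ε p) ((Complex.I * p.2) • propVec m ε p)

def evChi (m ε : ℝ) (p : ℝ × ℝ) : Fin 2 → ℂ :=
  chiData ε (evVec m ε p) ((-(evRate m ε p : ℂ)) • evVec m ε p)

section
variable {m ε : ℝ}

theorem evRate_sq (hm : 0 < m) (hεm : ε < 1 / (2 * m)) (p : ℝ × ℝ) :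
    evRate m ε p ^ 2 = p.2 ^ 2 + 2 * p.1 ^ 2 + (1 - 2 * ε * m) / ε ^ 2 := by
  have := one_sub_pos hm hεm
  exact Real.sq_sqrt (by positivity)

theorem abs_lt_evRate (hm : 0 < m) (hε : 0 < ε) (hεm : ε < 1 / (2 * m)) (p : ℝ × ℝ) :
    |p.1| < evRate m ε p := by
  apply Real.lt_sqrt_of_sq_lt
  rw [sq_abs]
  have := one_sub_pos hm hεm
  have : 0 < (1 - 2 * ε * m) / ε ^ 2 := by positivity
  nlinarith [sq_nonneg p.1, sq_nonneg p.2]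

theorem band_sq (p : ℝ × ℝ) : band m ε p ^ 2 = p.1 ^ 2 + p.2 ^ 2 + massTerm m ε p ^ 2 :=
  bandPlus_sq m ε p.1 p.2

theorem propSnd_pos (hm : 0 < m) {p : ℝ × ℝ} (hp : 0 < p.1 ^ 2 + p.2 ^ 2) : 0 < propSnd m ε p :=
  bandPlus_sub_pos hm hp

theorem propSnd_nonneg (hm : 0 < m) (p : ℝ × ℝ) : 0 ≤ propSnd m ε p := by
  rcases (by positivity : 0 ≤ p.1 ^ 2 + p.2 ^ 2).eq_or_lt with h | h
  · have h1 := band_sq (m := m) (ε := ε) p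
    have h2 : massTerm m ε p = m := by rw [massTerm, ← h]; ring
    rw [propSnd, h2]
    rw [← h, h2, zero_add] at h1
    have h3 : band m ε p = m := by
      have h4 : 0 < band m ε p := bandPlus_pos hm _ _
      nlinarith
    linarith
  · exact (propSnd_pos hm h).le

theorem evFst_pos (hm : 0 < m) (hε : 0 < ε) (p : ℝ × ℝ) : 0 < evFst m ε p := by
  have h1 := propSnd_nonneg (ε := ε) hm p
  have : 0 < ε⁻¹ := by positivity
  unfold evFst
  unfold propSnd at h1
  linarith

theorem evSnd_pos (hm : 0 < m) (hε : 0 < ε) (hεm : ε < 1 / (2 * m)) (p : ℝ × ℝ) :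
    0 < evRate m ε p - p.1 := by
  linarith [abs_lt_evRate hm hε hεm p, le_abs_self p.1]

/-- A bulk eigenvector is a multiple of the propagating wave. -/
theorem eq_smul_propVec (hm : 0 < m) {p : ℝ × ℝ} (hp : 0 < p.1 ^ 2 + p.2 ^ 2) {u : Fin 2 → ℂ}
    (hu : bulkH m ε p.1 p.2 *ᵥ u = (band m ε p : ℂ) • u) :
    u = (u 1 / propSnd m ε p) • propVec m ε p := by
  have hb : (propSnd m ε p : ℂ) ≠ 0 := by exact_mod_cast (propSnd_pos hm hp).ne'
  have h0 := congrFun hu 0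
  simp [bulkH, vecHead, vecTail] at h0
  ext i
  fin_cases i
  · simp only [propVec, Pi.smul_apply, smul_eq_mul, Fin.zero_eta, cons_val_zero]
    rw [div_mul_eq_mul_div, eq_div_iff hb]
    simp only [propSnd, massTerm]
    push_cast
    linear_combination -h0
  · simp [propVec]
    field_simp

/-- At the evanescent momentum the mass term equals ε⁻¹ - (m - ε(k² + κ²)). The second row then
fixes the ratio of the components, its coefficient `evFst` being positive, and the first row is the
dispersion relation. -/
theorem eq_smul_evVec (hm : 0 < m) (hε : 0 < ε) (hεm : ε < 1 / (2 * m)) {p : ℝ × ℝ} {u : Fin 2 → ℂ} :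
    bulkH m ε p.1 (kappaEv m ε p.1 p.2) *ᵥ u = (band m ε p : ℂ) • u ↔
      ∃ c : ℂ, u = c • evVec m ε p := by
  have hε' : (ε : ℂ) ≠ 0 := by exact_mod_cast hε.ne'
  have hk : kappaEv m ε p.1 p.2 = Complex.I * (evRate m ε p : ℂ) := rfl
  have hk2 : kappaEv m ε p.1 p.2 ^ 2 = -(evRate m ε p : ℂ) ^ 2 := by
    rw [hk, mul_pow, Complex.I_sq]; ring
  have hIk : Complex.I * kappaEv m ε p.1 p.2 = -(evRate m ε p : ℂ) := by
    rw [hk, ← mul_assoc, Complex.I_mul_I]; ring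
  have hη : (evRate m ε p : ℂ) ^ 2 = p.2 ^ 2 + 2 * p.1 ^ 2 + (1 - 2 * ε * m) / ε ^ 2 := by
    exact_mod_cast evRate_sq hm hεm p
  have hη' : (ε : ℂ) * (evRate m ε p : ℂ) ^ 2 =
      ε * p.2 ^ 2 + 2 * ε * p.1 ^ 2 + (ε : ℂ)⁻¹ - 2 * m := by
    rw [hη]; field_simp; ring
  have hω : (band m ε p : ℂ) ^ 2 = p.1 ^ 2 + p.2 ^ 2 + (m - ε * (p.1 ^ 2 + p.2 ^ 2)) ^ 2 := by
    exact_mod_cast band_sq p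
  have hv0 : (evFst m ε p : ℂ) ≠ 0 := by exact_mod_cast (evFst_pos hm hε p).ne'
  constructor
  · intro hu
    have h1 := congrFun hu 1
    simp [bulkH, hk2, hIk, vecHead, vecTail] at h1
    refine ⟨u 0 / evFst m ε p, ?_⟩
    ext i
    fin_cases i
    · simp [evVec]; field_simp
    · simp only [evVec, Pi.smul_apply, smul_eq_mul, Fin.mk_one, cons_val_one]
      rw [div_mul_eq_mul_div, eq_div_iff hv0]
      simp only [evFst, massTerm]
      push_cast
      linear_combination -h1 - u 1 * hη'
  · rintro ⟨c, rfl⟩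
    ext i
    have hεi : (ε : ℂ) * (ε : ℂ)⁻¹ = 1 := mul_inv_cancel₀ hε'
    fin_cases i
    · simp [bulkH, hk2, hIk, evVec, evFst, massTerm]
      have e1 : (ε : ℂ)⁻¹ * ε * (evRate m ε p : ℂ) ^ 2 =
        (ε : ℂ)⁻¹ * (ε * p.2 ^ 2 + 2 * ε * p.1 ^ 2 + (ε : ℂ)⁻¹ - 2 * m) := by
        rw [mul_assoc, hη']
      linear_combination c * (-hω - e1 + ((band m ε p : ℂ) + ((ε : ℂ)⁻¹ - (m - ε * (p.1 ^ 2 + p.2 ^ 2)))) * hη'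
        + ((evRate m ε p : ℂ) ^ 2 + p.2 ^ 2) * hεi)
    · simp [bulkH, hk2, hIk, evVec, evFst, massTerm]
      linear_combination (-c * (evRate m ε p - p.1)) * hη'

end

end RegDirac
end

noncomputable section
namespace RegDirac

/-! ### The scattering amplitude as a quotient of boundary determinants -/

/-- Boundary value of the propagating wave. -/
def bdryProp (m ε : ℝ) (Pr M₀ M₁ : Matrix (Fin 2) (Fin 2) ℂ) (p : ℝ × ℝ) : Fin 2 → ℂ :=
  bdryMap Pr (M₀ + (p.1 : ℂ) • M₁) (propVec m ε p) (propChi m ε p)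

/-- Boundary value of the evanescent wave. -/
def bdryEv (m ε : ℝ) (Pr M₀ M₁ : Matrix (Fin 2) (Fin 2) ℂ) (p : ℝ × ℝ) : Fin 2 → ℂ :=
  bdryMap Pr (M₀ + (p.1 : ℂ) • M₁) (evVec m ε p) (evChi m ε p)

/-- Boundary determinant of the propagating and the evanescent wave. -/
def scatDet (m ε : ℝ) (Pr M₀ M₁ : Matrix (Fin 2) (Fin 2) ℂ) (p : ℝ × ℝ) : ℂ :=
  bdryProp m ε Pr M₀ M₁ p 0 * bdryEv m ε Pr M₀ M₁ p 1 -
    bdryProp m ε Pr M₀ M₁ p 1 * bdryEv m ε Pr M₀ M₁ p 0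

theorem band_refl (m ε : ℝ) (p : ℝ × ℝ) : band m ε (refl p) = band m ε p := by
  simp [band, bandPlus, refl]

theorem massTerm_refl (m ε : ℝ) (p : ℝ × ℝ) : massTerm m ε (refl p) = massTerm m ε p := by
  simp [massTerm, refl]

theorem propSnd_refl (m ε : ℝ) (p : ℝ × ℝ) : propSnd m ε (refl p) = propSnd m ε p := by
  simp [propSnd, band_refl, massTerm_refl]

theorem evFst_refl (m ε : ℝ) (p : ℝ × ℝ) : evFst m ε (refl p) = evFst m ε p := by
  simp [evFst, band_refl, massTerm_refl]

theorem evRate_refl (m ε : ℝ) (p : ℝ × ℝ) : evRate m ε (refl p) = evRate m ε p := by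
  simp [evRate, refl]

theorem evVec_refl (m ε : ℝ) (p : ℝ × ℝ) : evVec m ε (refl p) = evVec m ε p := by
  simp only [evVec, evFst_refl, evRate_refl]; rfl

theorem evChi_refl (m ε : ℝ) (p : ℝ × ℝ) : evChi m ε (refl p) = evChi m ε p := by
  simp [evChi, evVec_refl, evRate_refl]

theorem bdryEv_refl (m ε : ℝ) (Pr M₀ M₁ : Matrix (Fin 2) (Fin 2) ℂ) (p : ℝ × ℝ) :
    bdryEv m ε Pr M₀ M₁ (refl p) = bdryEv m ε Pr M₀ M₁ p := by
  simp only [bdryEv, evVec_refl, evChi_refl]; rfl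

theorem bdryMap_add (Pr M : Matrix (Fin 2) (Fin 2) ℂ) (ψ χ ψ' χ' : Fin 2 → ℂ) :
    bdryMap Pr M (ψ + ψ') (χ + χ') = bdryMap Pr M ψ χ + bdryMap Pr M ψ' χ' := by
  simp only [bdryMap, mulVec_add]; abel

theorem bdryMap_smul (Pr M : Matrix (Fin 2) (Fin 2) ℂ) (c : ℂ) (ψ χ : Fin 2 → ℂ) :
    bdryMap Pr M (c • ψ) (c • χ) = c • bdryMap Pr M ψ χ := by
  simp only [bdryMap, mulVec_smul, smul_add, smul_sub]

theorem chiData_add (ε : ℝ) (ψ χ ψ' χ' : Fin 2 → ℂ) :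
    chiData ε (ψ + ψ') (χ + χ') = chiData ε ψ χ + chiData ε ψ' χ' := by
  ext i; fin_cases i <;> simp [chiData] <;> ring

theorem chiData_smul (ε : ℝ) (c : ℂ) (ψ χ : Fin 2 → ℂ) :
    chiData ε (c • ψ) (c • χ) = c • chiData ε ψ χ := by
  ext i; fin_cases i <;> simp [chiData] <;> ring

section
variable {m ε : ℝ} {Pr M₀ M₁ : Matrix (Fin 2) (Fin 2) ℂ} {A : Matrix (Fin 2) (Fin 2 ⊕ Fin 2) ℂ}
  {ψ : ℝ × ℝ → Fin 2 → ℂ} {p : ℝ × ℝ}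

theorem isScatteringState_iff (hm : 0 < m) (hε : 0 < ε) (hεm : ε < 1 / (2 * m))
    (hψ : IsBulkSection m ε ψ)
    (hA : ∀ ψ ψ' : Fin 2 → ℂ, A *ᵥ Sum.elim ψ ψ' = 0 ↔
      bdryMap Pr (M₀ + (p.1 : ℂ) • M₁) ψ (chiData ε ψ ψ') = 0)
    (hp : 0 < p.2) (S : ℂ) (v : Fin 2 → ℂ) :
    IsScatteringState m ε A ψ p.1 p.2 S v ↔ ∃ d : ℂ, v = d • evVec m ε p ∧
      (ψ (refl p) 1 / propSnd m ε p) • bdryProp m ε Pr M₀ M₁ (refl p) +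
        (S * (ψ p 1 / propSnd m ε p)) • bdryProp m ε Pr M₀ M₁ p + d • bdryEv m ε Pr M₀ M₁ p = 0 := by
  have hK : 0 < p.1 ^ 2 + p.2 ^ 2 := by positivity
  have hne : p ≠ 0 := fun h => by simp [h] at hp
  have hne' : refl p ≠ 0 := fun h => by
    have := congrArg Prod.snd h
    simp [refl] at this
    exact hp.ne' this
  have e1 := eq_smul_propVec hm hK (hψ.eigen p hne)
  have e2 := eq_smul_propVec (p := refl p) hm (by simpa [refl] using hK) (hψ.eigen _ hne')
  rw [propSnd_refl] at e2
  set c := ψ p 1 / propSnd m ε p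
  set c' := ψ (refl p) 1 / propSnd m ε p
  unfold IsScatteringState
  refine (and_congr_left fun _ => eq_smul_evVec hm hε hεm).trans ?_
  rw [exists_and_right.symm]
  refine exists_congr fun d => and_congr_right ?_
  rintro rfl
  have hk : Complex.I * kappaEv m ε p.1 p.2 = -(evRate m ε p : ℂ) := by
    change Complex.I * (Complex.I * (evRate m ε p : ℂ)) = _
    rw [← mul_assoc, Complex.I_mul_I]; ring
  have e3 : waveData (ψ (p.1, -p.2)) (-(p.2 : ℂ)) + S • waveData (ψ (p.1, p.2)) (p.2 : ℂ) +
      waveData (d • evVec m ε p) (kappaEv m ε p.1 p.2) =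
      Sum.elim (c' • propVec m ε (refl p) + (S * c) • propVec m ε p + d • evVec m ε p)
        (c' • ((Complex.I * (refl p).2) • propVec m ε (refl p)) +
          (S * c) • ((Complex.I * p.2) • propVec m ε p) +
          d • ((-(evRate m ε p : ℂ)) • evVec m ε p)) := by
    change waveData (ψ (refl p)) _ + S • waveData (ψ p) _ + _ = _
    rw [e1, e2]
    unfold waveData
    rw [hk]
    ext i
    rcases i with i | i
    · simp; ring
    · simp [refl]; ring
  rw [e3, hA, chiData_add, chiData_add, bdryMap_add, bdryMap_add, chiData_smul, chiData_smul,
    chiData_smul, bdryMap_smul, bdryMap_smul, bdryMap_smul]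
  rfl

theorem section_snd_ne_zero (hm : 0 < m) (hψ : IsBulkSection m ε ψ) (hp : 0 < p.1 ^ 2 + p.2 ^ 2) :
    ψ p 1 ≠ 0 := by
  have hne : p ≠ 0 := fun h => by simp [h] at hp
  intro h0
  have e1 := eq_smul_propVec hm hp (hψ.eigen p hne)
  rw [h0, zero_div, zero_smul] at e1
  have := hψ.norm_eq_one p hne
  simp [e1] at this

/-- Cramer's rule: taking the determinant with the boundary value of the evanescent wave eliminates
its coefficient. That boundary value is even in κ, so the incoming wave contributes the same
determinant at the reflected point. -/
theorem amplitude_eq (hm : 0 < m) (hε : 0 < ε) (hεm : ε < 1 / (2 * m)) (hψ : IsBulkSection m ε ψ)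
    (hA : ∀ ψ ψ' : Fin 2 → ℂ, A *ᵥ Sum.elim ψ ψ' = 0 ↔
      bdryMap Pr (M₀ + (p.1 : ℂ) • M₁) ψ (chiData ε ψ ψ') = 0)
    (hp : 0 < p.2) (hg : scatDet m ε Pr M₀ M₁ p ≠ 0) {S : ℂ} {v : Fin 2 → ℂ}
    (h : IsScatteringState m ε A ψ p.1 p.2 S v) :
    S = -(ψ (refl p) 1 / ψ p 1 *
      (scatDet m ε Pr M₀ M₁ (refl p) / scatDet m ε Pr M₀ M₁ p)) := by
  have hK : 0 < p.1 ^ 2 + p.2 ^ 2 := by positivity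
  obtain ⟨d, -, hd⟩ := (isScatteringState_iff hm hε hεm hψ hA hp S v).1 h
  have hb : (propSnd m ε p : ℂ) ≠ 0 := by exact_mod_cast (propSnd_pos hm hK).ne'
  have hc := section_snd_ne_zero hm hψ hK
  have h0 := congrFun hd 0
  have h1 := congrFun hd 1
  simp only [Pi.add_apply, Pi.smul_apply, smul_eq_mul, Pi.zero_apply] at h0 h1
  have hg' : scatDet m ε Pr M₀ M₁ (refl p) = bdryProp m ε Pr M₀ M₁ (refl p) 0 * bdryEv m ε Pr M₀ M₁ p 1 -
    bdryProp m ε Pr M₀ M₁ (refl p) 1 * bdryEv m ε Pr M₀ M₁ p 0 := by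
    rw [scatDet, bdryEv_refl]
  rw [hg']
  field_simp
  field_simp at h0 h1
  rw [scatDet]
  linear_combination bdryEv m ε Pr M₀ M₁ p 1 * h0 - bdryEv m ε Pr M₀ M₁ p 0 * h1

theorem uniqueScatteringState (hm : 0 < m) (hε : 0 < ε) (hεm : ε < 1 / (2 * m))
    (hψ : IsBulkSection m ε ψ)
    (hA : ∀ ψ ψ' : Fin 2 → ℂ, A *ᵥ Sum.elim ψ ψ' = 0 ↔
      bdryMap Pr (M₀ + (p.1 : ℂ) • M₁) ψ (chiData ε ψ ψ') = 0)
    (hp : 0 < p.2) (hg : scatDet m ε Pr M₀ M₁ p ≠ 0) :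
    UniqueScatteringState m ε A ψ p.1 p.2 := by
  have hK : 0 < p.1 ^ 2 + p.2 ^ 2 := by positivity
  have hb : (propSnd m ε p : ℂ) ≠ 0 := by exact_mod_cast (propSnd_pos hm hK).ne'
  have hc := section_snd_ne_zero hm hψ hK
  set w := bdryProp m ε Pr M₀ M₁ p with hw
  set w' := bdryProp m ε Pr M₀ M₁ (refl p) with hw'
  set e := bdryEv m ε Pr M₀ M₁ p with he
  have hg1 : w 0 * e 1 - w 1 * e 0 ≠ 0 := hg
  have hiff := isScatteringState_iff hm hε hεm hψ hA hp
  obtain ⟨S, d, hSd⟩ : ∃ S d : ℂ, (ψ (refl p) 1 / propSnd m ε p) • w' +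
      (S * (ψ p 1 / propSnd m ε p)) • w + d • e = 0 := by
    refine ⟨-(ψ (refl p) 1 / ψ p 1 * ((w' 0 * e 1 - w' 1 * e 0) / (w 0 * e 1 - w 1 * e 0))),
      -(ψ (refl p) 1 / propSnd m ε p * ((w 0 * w' 1 - w 1 * w' 0) / (w 0 * e 1 - w 1 * e 0))), ?_⟩
    obtain ⟨D, hD⟩ : ∃ D, D = w 0 * e 1 - w 1 * e 0 := ⟨_, rfl⟩
    rw [← hD] at hg1 ⊢
    ext i
    fin_cases i <;> (simp; field_simp; rw [hD]; ring)
  have hex : IsScatteringState m ε A ψ p.1 p.2 S (d • evVec m ε p) := (hiff _ _).2 ⟨d, rfl, hSd⟩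
  refine ⟨(S, d • evVec m ε p), hex, ?_⟩
  rintro ⟨S', v'⟩ h'
  have h' : IsScatteringState m ε A ψ p.1 p.2 S' v' := h'
  have hS : S' = S := (amplitude_eq hm hε hεm hψ hA hp hg h').trans
    (amplitude_eq hm hε hεm hψ hA hp hg hex).symm
  obtain ⟨d', hv', hd'⟩ := (hiff _ _).1 h'
  rw [hS] at hd' ⊢
  have h3 : d' = d := by
    by_contra hne
    have h4 : (d' - d) • e = 0 := by
      rw [sub_smul]
      have : d' • e = d • e := by
        rw [← hSd] at hd'
        exact add_left_cancel hd'
      rw [this, sub_self]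
    rcases smul_eq_zero.1 h4 with h5 | h5
    · exact hne (sub_eq_zero.1 h5)
    · apply hg1; rw [h5]; simp
  rw [hv', h3]

theorem evVec_ne_zero (hm : 0 < m) (hε : 0 < ε) (p : ℝ × ℝ) : evVec m ε p ≠ 0 := fun h => by
  have := congrFun h 0
  simp [evVec] at this
  exact (evFst_pos hm hε p).ne' this

/-- If the evanescent wave satisfies the boundary condition by itself, it can be added to any
scattering state. -/
theorem not_uniqueScatteringState (hm : 0 < m) (hε : 0 < ε) (hεm : ε < 1 / (2 * m))
    (hψ : IsBulkSection m ε ψ)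
    (hA : ∀ ψ ψ' : Fin 2 → ℂ, A *ᵥ Sum.elim ψ ψ' = 0 ↔
      bdryMap Pr (M₀ + (p.1 : ℂ) • M₁) ψ (chiData ε ψ ψ') = 0)
    (hp : 0 < p.2) (he : bdryEv m ε Pr M₀ M₁ p = 0) :
    ¬ UniqueScatteringState m ε A ψ p.1 p.2 := by
  rintro ⟨⟨S, v⟩, h1, h2⟩
  have hiff := isScatteringState_iff hm hε hεm hψ hA hp
  obtain ⟨d, hd, hd'⟩ := (hiff S v).1 h1
  rw [he, smul_zero] at hd'
  have h3 := h2 (S, (d + 1) • evVec m ε p) ((hiff _ _).2 ⟨d + 1, rfl, by rw [he, smul_zero]; exact hd'⟩)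
  have h4 := congrArg Prod.snd h3
  simp only [hd, add_smul, one_smul, add_eq_left] at h4
  exact evVec_ne_zero hm hε p h4

end

end RegDirac
end

noncomputable section
namespace RegDirac

/-! ### The winding number from a lift of the boundary determinant -/

theorem contDiffAt_log_comp {f : ℝ × ℝ → ℂ} {p : ℝ × ℝ} (hf : ContDiffAt ℝ 1 f p)
    (h : f p ∈ Complex.slitPlane) : ContDiffAt ℝ 1 (fun q => Complex.log (f q)) p :=
  ((Complex.contDiffAt_log h).restrict_scalars ℝ).comp p hf

theorem exists_radius_of_eventually_cocompact {P : ℝ × ℝ → Prop} (h : ∀ᶠ p in cocompact (ℝ × ℝ), P p) :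
    ∃ R : ℝ, ∀ p : ℝ × ℝ, R < p.1 ^ 2 + p.2 ^ 2 → P p := by
  rw [← Metric.cobounded_eq_cocompact] at h
  obtain ⟨r, -, hr⟩ := (Metric.hasBasis_cobounded_compl_closedBall (0 : ℝ × ℝ)).eventually_iff.1 h
  refine ⟨2 * r ^ 2, fun p hp => hr ?_⟩
  simp only [mem_compl_iff, mem_closedBall_zero_iff, not_le, Prod.norm_def, Real.norm_eq_abs]
  by_contra hcon
  push Not at hcon
  obtain ⟨h1, h2⟩ := max_le_iff.1 hcon
  nlinarith [sq_abs p.1, sq_abs p.2, abs_nonneg p.1, abs_nonneg p.2]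

theorem eventually_cocompact_of_radius {P : ℝ × ℝ → Prop} {R : ℝ}
    (h : ∀ p : ℝ × ℝ, R < p.1 ^ 2 + p.2 ^ 2 → P p) : ∀ᶠ p in cocompact (ℝ × ℝ), P p := by
  rw [← Metric.cobounded_eq_cocompact]
  refine (Metric.hasBasis_cobounded_compl_closedBall (0 : ℝ × ℝ)).eventually_iff.2
    ⟨|R| + 1, trivial, fun p hp => h p ?_⟩
  simp only [mem_compl_iff, mem_closedBall_zero_iff, not_le, Prod.norm_def, Real.norm_eq_abs] at hp
  have h0 := le_abs_self R
  have h1 := abs_nonneg R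
  rcases lt_max_iff.1 hp with h | h
  · nlinarith [sq_abs p.1, sq_nonneg p.2]
  · nlinarith [sq_abs p.2, sq_nonneg p.1]

/-- Where the mass term is negative, an upper-band eigenvector has at least half of its weight in
the second component. So this component of a regular section has a nonzero limit at infinity. -/
theorem IsBulkSection.norm_snd_sq {m ε : ℝ} (hm : 0 < m) (hε : 0 < ε) {ψ : ℝ × ℝ → Fin 2 → ℂ}
    (hψ : IsBulkSection m ε ψ) {p : ℝ × ℝ} (hp : m / ε < p.1 ^ 2 + p.2 ^ 2) :
    1 / 2 ≤ ‖ψ p 1‖ ^ 2 := by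
  have hK : 0 < p.1 ^ 2 + p.2 ^ 2 := lt_trans (by positivity) hp
  have hne : p ≠ 0 := fun h => by simp [h] at hK
  have hb := propSnd_pos (ε := ε) hm hK
  have e1 := congrFun (eq_smul_propVec hm hK (hψ.eigen p hne)) 0
  simp only [Pi.smul_apply, smul_eq_mul, propVec, cons_val_zero] at e1
  have e2 : ‖-(p.1 : ℂ) + Complex.I * p.2‖ ^ 2 = p.1 ^ 2 + p.2 ^ 2 := by
    rw [Complex.sq_norm, Complex.normSq_apply]; simp; ring
  have e3 : ‖ψ p 0‖ ^ 2 = ‖ψ p 1‖ ^ 2 * ((p.1 ^ 2 + p.2 ^ 2) / propSnd m ε p ^ 2) := by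
    rw [e1, norm_mul, mul_pow, e2, norm_div, Complex.norm_real, Real.norm_of_nonneg hb.le]
    ring
  have e4 : (p.1 ^ 2 + p.2 ^ 2) / propSnd m ε p ^ 2 ≤ 1 := by
    rw [div_le_one (by positivity)]
    have h1 := band_sq (m := m) (ε := ε) p
    have h2 : massTerm m ε p < 0 := by
      rw [div_lt_iff₀ hε] at hp
      unfold massTerm; linarith
    have h3 : 0 < band m ε p := bandPlus_pos hm _ _
    unfold propSnd
    nlinarith
  have e5 := hψ.norm_eq_one p hne
  nlinarith [sq_nonneg ‖ψ p 1‖]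

/-- The second component of a regular section has a smooth logarithm at large momenta. -/
theorem IsBulkSection.exists_slitPlane {m ε : ℝ} (hm : 0 < m) (hε : 0 < ε) {ψ : ℝ × ℝ → Fin 2 → ℂ}
    (hψ : IsBulkSection m ε ψ) :
    ∃ (R : ℝ) (a : ℂ), a ≠ 0 ∧ ∀ p : ℝ × ℝ, R < p.1 ^ 2 + p.2 ^ 2 →
      ψ p 1 / a ∈ Complex.slitPlane := by
  obtain ⟨v, hv⟩ := hψ.regular_infty
  have h1 : Tendsto (fun p => ψ p 1) (cocompact (ℝ × ℝ)) (𝓝 (v 1)) := (tendsto_pi_nhds.1 hv) 1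
  have h2 : 1 / 2 ≤ ‖v 1‖ ^ 2 := by
    refine ge_of_tendsto (h1.norm.pow 2) ?_
    exact eventually_cocompact_of_radius fun p hp => hψ.norm_snd_sq hm hε hp
  have h3 : v 1 ≠ 0 := fun h => by rw [h] at h2; norm_num at h2
  have h4 : Tendsto (fun p => ψ p 1 / v 1) (cocompact (ℝ × ℝ)) (𝓝 1) := by
    have := h1.div_const (v 1)
    rwa [div_self h3] at this
  obtain ⟨R, hR⟩ := exists_radius_of_eventually_cocompact
    (h4.eventually (Complex.isOpen_slitPlane.mem_nhds Complex.one_mem_slitPlane))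
  exact ⟨R, v 1, h3, hR⟩

/-- A logarithm of the boundary determinant at large momenta, off the real axis, whose jump across
the axis is given by the number of bound states at threshold. -/
def HasScatLift (m ε : ℝ) (Pr M₀ M₁ : Matrix (Fin 2) (Fin 2) ℂ) : Prop :=
  ∃ (R : ℝ) (a c : ℂ) (l : ℝ × ℝ → ℂ), a ≠ 0 ∧
    (∀ p : ℝ × ℝ, p.2 ≠ 0 → R < p.1 ^ 2 + p.2 ^ 2 →
      ContDiffAt ℝ 1 l p ∧ Complex.exp (l p) = a * scatDet m ε Pr M₀ M₁ p) ∧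
    (∀ᶠ k : ℝ in atTop, HasJump l k (negIndex (thrMat m ε Pr (M₀ + (k : ℂ) • M₁) k) - 1 - c)) ∧
    (∀ᶠ k : ℝ in atBot, HasJump l k (negIndex (thrMat m ε Pr (M₀ + (k : ℂ) • M₁) k) - c))

/-- A lift of S is the difference of u + l at the reflected point and at the point, where u is a
logarithm of the section component. As u is continuous across the axis at large momenta, only the
jumps of l count; the constants a and c cancel. -/
theorem HasScatLift.isAsymptoticWinding {m ε : ℝ} (hm : 0 < m) (hε : 0 < ε) (hεm : ε < 1 / (2 * m))
    {Pr M₀ M₁ : Matrix (Fin 2) (Fin 2) ℂ} (hl : HasScatLift m ε Pr M₀ M₁)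
    {A : ℝ → Matrix (Fin 2) (Fin 2 ⊕ Fin 2) ℂ} {Bad : Set ℝ} (hBad : Bad.Finite)
    (hA : ∀ k ∉ Bad, ∀ ψ ψ' : Fin 2 → ℂ, A k *ᵥ Sum.elim ψ ψ' = 0 ↔
      bdryMap Pr (M₀ + (k : ℂ) • M₁) ψ (chiData ε ψ ψ') = 0)
    {ψ : ℝ × ℝ → Fin 2 → ℂ} (hψ : IsBulkSection m ε ψ) {S : ℝ × ℝ → ℂ}
    (hS : IsScatteringAmplitude m ε A ψ S) {np nm : ℕ}
    (hnp : ∀ᶠ k : ℝ in atTop, negIndex (thrMat m ε Pr (M₀ + (k : ℂ) • M₁) k) = np)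
    (hnm : ∀ᶠ k : ℝ in atBot, negIndex (thrMat m ε Pr (M₀ + (k : ℂ) • M₁) k) = nm) :
    IsAsymptoticWinding S (1 - ((np : ℂ) - nm)) := by
  obtain ⟨R₁, a, c, l, ha, hl1, hjp, hjm⟩ := hl
  obtain ⟨R₂, b, hb, hsl⟩ := hψ.exists_slitPlane hm hε
  set u : ℝ × ℝ → ℂ := fun p => Complex.log (ψ p 1 / b) with hu
  set R := max (max R₁ R₂) 0
  have hR : ∀ p : ℝ × ℝ, R < p.1 ^ 2 + p.2 ^ 2 →
      R₁ < p.1 ^ 2 + p.2 ^ 2 ∧ R₂ < p.1 ^ 2 + p.2 ^ 2 ∧ 0 < p.1 ^ 2 + p.2 ^ 2 := fun p hp =>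
    ⟨((le_max_left _ _).trans (le_max_left _ _)).trans_lt hp,
      ((le_max_right _ _).trans (le_max_left _ _)).trans_lt hp, (le_max_right _ _).trans_lt hp⟩
  have hψC : ∀ p : ℝ × ℝ, 0 < p.1 ^ 2 + p.2 ^ 2 → ContDiffAt ℝ 1 (fun p => ψ p 1) p := by
    intro p hp
    have hne : p ≠ 0 := fun h => by simp [h] at hp
    have h1 := hψ.regular.contDiffAt (isOpen_compl_singleton.mem_nhds hne)
    exact (contDiffAt_pi.1 h1) 1
  have huC : ∀ p : ℝ × ℝ, R < p.1 ^ 2 + p.2 ^ 2 → ContDiffAt ℝ 1 u p := fun p hp =>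
    contDiffAt_log_comp ((hψC p (hR p hp).2.2).div_const b) (hsl p (hR p hp).2.1)
  have hsum : ∀ p : ℝ × ℝ, (refl p).1 ^ 2 + (refl p).2 ^ 2 = p.1 ^ 2 + p.2 ^ 2 := fun p => by
    simp [refl]
  have hC : ∀ p : ℝ × ℝ, p.2 ≠ 0 → R < p.1 ^ 2 + p.2 ^ 2 → ContDiffAt ℝ 1 (fun p => u p + l p) p :=
    fun p hp2 hp => (huC p hp).add (hl1 p hp2 (hR p hp).1).1
  have hjump : ∀ k : ℝ, R < k ^ 2 → ∀ e, HasJump l k e → HasJump (fun p => u p + l p) k e := by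
    intro k hk e he
    have h1 := (hasJump_zero_of_continuousAt
      (huC (k, 0) (by simpa using hk)).continuousAt).add he
    rwa [zero_add] at h1
  have hsqp : ∀ᶠ k : ℝ in atTop, R < k ^ 2 :=
    (tendsto_pow_atTop (two_ne_zero)).eventually_gt_atTop R
  have hsqm : ∀ᶠ k : ℝ in atBot, R < k ^ 2 := by
    have := tendsto_neg_atBot_atTop.eventually hsqp
    simpa using this
  have hfin : (1 - ((np : ℂ) - nm)) = (nm - c) - (np - 1 - c) := by ring
  rw [hfin]
  refine isAsymptoticWinding_of_lift (Λ := fun p => (u (refl p) + l (refl p)) - (u p + l p))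
    (R := R) hBad ?_ ?_ ?_ ?_
  · intro p hp hpR
    refine ContDiffAt.sub ?_ (hC p hp.ne' hpR)
    exact ContDiffAt.comp p (hC (refl p) (by simpa [refl] using hp.ne') (by rwa [hsum]))
      contDiff_refl.contDiffAt
  · intro p hp hpR hpB
    obtain ⟨h1, h2, h3⟩ := hR p hpR
    obtain ⟨-, e1⟩ := hl1 p hp.ne' h1
    obtain ⟨-, e2⟩ := hl1 (refl p) (by simpa [refl] using hp.ne') (by rwa [hsum])
    have hg : scatDet m ε Pr M₀ M₁ p ≠ 0 := fun h => by
      rw [h, mul_zero] at e1; exact Complex.exp_ne_zero _ e1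
    obtain ⟨v, hv⟩ := hS p.1 p.2 hp (uniqueScatteringState hm hε hεm hψ (hA p.1 hpB) hp hg)
    have e3 := amplitude_eq hm hε hεm hψ (hA p.1 hpB) hp hg hv
    have hψ1 := section_snd_ne_zero hm hψ h3
    have hψ2 : ψ (refl p) 1 ≠ 0 := section_snd_ne_zero hm hψ (by rwa [hsum])
    rw [show S p = S (p.1, p.2) from rfl, e3, Complex.exp_sub, Complex.exp_add, Complex.exp_add, e1, e2,
      hu, Complex.exp_log (div_ne_zero hψ1 hb), Complex.exp_log (div_ne_zero hψ2 hb)]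
    field_simp
  · filter_upwards [hjp, hnp, hsqp] with k h1 h2 h3
    rw [h2] at h1
    exact hjump k h3 _ h1
  · filter_upwards [hjm, hnm, hsqm] with k h1 h2 h3
    rw [h2] at h1
    exact hjump k h3 _ h1

end RegDirac
end

noncomputable section
namespace RegDirac

/-! ### Algebra of the bulk waves -/

/-- Determinant of the amplitudes of the propagating and the evanescent wave. -/
def waveDet (m ε : ℝ) (p : ℝ × ℝ) : ℂ :=
  propVec m ε p 0 * evVec m ε p 1 - propVec m ε p 1 * evVec m ε p 0

section
variable {m ε : ℝ}

theorem propSnd_sq (p : ℝ × ℝ) :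
    propSnd m ε p ^ 2 = p.1 ^ 2 + p.2 ^ 2 - 2 * massTerm m ε p * propSnd m ε p := by
  have := band_sq (m := m) (ε := ε) p
  unfold propSnd
  linear_combination this

/-- For two waves of the same energy the boundary form is independent of y, but here it is a
multiple of exp((iκ - η)y); hence it vanishes. -/
theorem wave_symplectic (hm : 0 < m) (hε : 0 < ε) (hεm : ε < 1 / (2 * m)) (p : ℝ × ℝ) :
    star (evVec m ε p) ⬝ᵥ propChi m ε p = star (evChi m ε p) ⬝ᵥ propVec m ε p := by
  have hε' : (ε : ℂ) ≠ 0 := by exact_mod_cast hε.ne'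
  have hη : (ε : ℂ) * (evRate m ε p : ℂ) ^ 2 =
      ε * p.2 ^ 2 + 2 * ε * p.1 ^ 2 + (ε : ℂ)⁻¹ - 2 * m := by
    have : (evRate m ε p : ℂ) ^ 2 = p.2 ^ 2 + 2 * p.1 ^ 2 + (1 - 2 * ε * m) / ε ^ 2 := by
      exact_mod_cast evRate_sq hm hεm p
    rw [this]; field_simp; ring
  have hb : (propSnd m ε p : ℂ) ^ 2 =
      p.1 ^ 2 + p.2 ^ 2 - 2 * (m - ε * (p.1 ^ 2 + p.2 ^ 2)) * propSnd m ε p := by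
    exact_mod_cast propSnd_sq p
  have hv : (evFst m ε p : ℂ) = propSnd m ε p + (ε : ℂ)⁻¹ := by
    simp only [evFst, propSnd]; push_cast; ring
  have hI := Complex.I_sq
  simp [propChi, evChi, chiData, propVec, evVec, dotProduct, Fin.sum_univ_two, hv]
  have hεi : (ε : ℂ) * (ε : ℂ)⁻¹ = 1 := mul_inv_cancel₀ hε'
  linear_combination hb - (propSnd m ε p : ℂ) * hη + (ε * propSnd m ε p + 1 : ℂ) * p.2 ^ 2 * hI
    + (Complex.I * p.2 + evRate m ε p) * (Complex.I * p.2 - p.1) * hεi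

/-- The flux of the propagating wave, proportional to its group velocity ∂ω₊/∂κ = κ(1 - 2ε(m -
εK))/ω₊, where K = k² + κ². Its sign is opposite to that of κ as long as k² + κ² > 0. -/
theorem im_propForm (p : ℝ × ℝ) :
    (star (propVec m ε p) ⬝ᵥ propChi m ε p).im =
      -(p.2 * (propSnd m ε p * (1 - 2 * ε * massTerm m ε p))) := by
  simp [propChi, chiData, propVec, dotProduct, Fin.sum_univ_two]
  linear_combination -(p.2 * ε) * propSnd_sq (m := m) (ε := ε) p

theorem im_evForm (p : ℝ × ℝ) : (star (evVec m ε p) ⬝ᵥ evChi m ε p).im = 0 := by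
  simp [evChi, chiData, evVec, dotProduct, Fin.sum_univ_two]

theorem massTerm_factor_pos (hm : 0 < m) (hεm : ε < 1 / (2 * m)) (p : ℝ × ℝ) :
    0 < 1 - 2 * ε * massTerm m ε p := by
  have := one_sub_pos hm hεm
  unfold massTerm
  nlinarith [mul_nonneg (sq_nonneg ε) (add_nonneg (sq_nonneg p.1) (sq_nonneg p.2))]

/-- With K = k² + κ², the product of second and first components is at least ε²K², while the other
term is of order K. -/
theorem exists_re_waveDet_neg (hm : 0 < m) (hε : 0 < ε) (hεm : ε < 1 / (2 * m)) :
    ∃ R : ℝ, ∀ p : ℝ × ℝ, R < p.1 ^ 2 + p.2 ^ 2 → (waveDet m ε p).re < 0 := by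
  set c := (1 - 2 * ε * m) / ε ^ 2 with hc
  have hc0 : 0 < c := by have := one_sub_pos hm hεm; positivity
  refine ⟨max (max (2 * m / ε) 1) ((5 + c) / ε ^ 2), fun p hp => ?_⟩
  obtain ⟨h1, h3⟩ := max_lt_iff.1 hp
  obtain ⟨h1, h2⟩ := max_lt_iff.1 h1
  rw [div_lt_iff₀ (by positivity)] at h1 h3
  have hη := evRate_sq hm hεm p
  rw [← hc] at hη
  have hw : 0 ≤ band m ε p := Real.sqrt_nonneg _
  have hω : -massTerm m ε p ≤ band m ε p := by
    have := band_sq (m := m) (ε := ε) p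
    nlinarith [sq_nonneg p.1, sq_nonneg p.2]
  have e1 : (waveDet m ε p).re = -p.1 * (evRate m ε p - p.1) - propSnd m ε p * evFst m ε p := by
    simp [waveDet, propVec, evVec]
  rw [e1]
  set K := p.1 ^ 2 + p.2 ^ 2 with hK
  have hM : massTerm m ε p = m - ε * K := rfl
  have hb : ε * K ≤ propSnd m ε p := by unfold propSnd; linarith
  have hv : ε * K ≤ evFst m ε p := by
    have : 0 < ε⁻¹ := by positivity
    unfold evFst; linarith
  have e2 : (ε * K) * (ε * K) ≤ propSnd m ε p * evFst m ε p := by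
    apply mul_le_mul hb hv (by positivity)
    exact le_trans (by positivity) hb
  -- The bound is k² - kη ≤ k² + (k² + η²)/2 with η² ≤ 2K + c and K > 1, which gives the constant (5
  -- + c)/2.
  have e3 : -p.1 * (evRate m ε p - p.1) ≤ (5 + c) * K / 2 := by
    nlinarith [sq_nonneg (p.1 + evRate m ε p), sq_nonneg p.2, mul_le_mul_of_nonneg_left h2.le hc0.le]
  have e4 : (5 + c) * K / 2 < (ε * K) * (ε * K) := by
    have : 0 < K := by linarith
    nlinarith [mul_lt_mul_of_pos_right h3 this, mul_pos hc0 this]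
  linarith

/-! ### Regularity -/

theorem contDiff_band (hm : 0 < m) : ContDiff ℝ 1 (band m ε) := by
  unfold band bandPlus
  exact ContDiff.sqrt (by fun_prop) fun p => (bandPlus_arg_pos hm p.1 p.2).ne'

theorem contDiff_massTerm : ContDiff ℝ 1 (massTerm m ε) := by unfold massTerm; fun_prop

theorem contDiff_propSnd (hm : 0 < m) : ContDiff ℝ 1 (propSnd m ε) :=
  (contDiff_band hm).sub contDiff_massTerm

theorem contDiff_evFst (hm : 0 < m) : ContDiff ℝ 1 (evFst m ε) :=
  (contDiff_band hm).add (contDiff_const.sub contDiff_massTerm)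

theorem contDiff_evRate (hm : 0 < m) (hε : 0 < ε) (hεm : ε < 1 / (2 * m)) :
    ContDiff ℝ 1 (evRate m ε) := by
  unfold evRate
  refine ContDiff.sqrt (by fun_prop) fun p => ?_
  have := one_sub_pos hm hεm
  positivity

theorem contDiff_ofReal {f : ℝ × ℝ → ℝ} (hf : ContDiff ℝ 1 f) :
    ContDiff ℝ 1 fun p => (f p : ℂ) :=
  Complex.ofRealCLM.contDiff.comp hf

theorem contDiff_propVec (hm : 0 < m) (i : Fin 2) : ContDiff ℝ 1 fun p => propVec m ε p i := by
  have h1 : ContDiff ℝ 1 fun p : ℝ × ℝ => (p.1 : ℂ) := contDiff_ofReal contDiff_fst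
  have h2 : ContDiff ℝ 1 fun p : ℝ × ℝ => (p.2 : ℂ) := contDiff_ofReal contDiff_snd
  fin_cases i
  · exact h1.neg.add (contDiff_const.mul h2)
  · exact contDiff_ofReal (contDiff_propSnd hm)

theorem contDiff_evVec (hm : 0 < m) (hε : 0 < ε) (hεm : ε < 1 / (2 * m)) (i : Fin 2) :
    ContDiff ℝ 1 fun p => evVec m ε p i := by
  fin_cases i
  · exact contDiff_ofReal (contDiff_evFst hm)
  · exact contDiff_ofReal ((contDiff_evRate hm hε hεm).sub contDiff_fst)

theorem contDiff_propChi (hm : 0 < m) (i : Fin 2) : ContDiff ℝ 1 fun p => propChi m ε p i := by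
  have h2 : ContDiff ℝ 1 fun p : ℝ × ℝ => Complex.I * (p.2 : ℂ) :=
    contDiff_const.mul (contDiff_ofReal contDiff_snd)
  fin_cases i
  · exact (contDiff_const.mul (h2.mul (contDiff_propVec hm 0))).add (contDiff_propVec hm 1)
  · exact (contDiff_const.mul (h2.mul (contDiff_propVec hm 1))).neg

theorem contDiff_evChi (hm : 0 < m) (hε : 0 < ε) (hεm : ε < 1 / (2 * m)) (i : Fin 2) :
    ContDiff ℝ 1 fun p => evChi m ε p i := by
  have h2 : ContDiff ℝ 1 fun p : ℝ × ℝ => -(evRate m ε p : ℂ) :=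
    (contDiff_ofReal (contDiff_evRate hm hε hεm)).neg
  fin_cases i
  · exact (contDiff_const.mul (h2.mul (contDiff_evVec hm hε hεm 0))).add (contDiff_evVec hm hε hεm 1)
  · exact (contDiff_const.mul (h2.mul (contDiff_evVec hm hε hεm 1))).neg

theorem contDiff_bdryMap {Pr M₀ M₁ : Matrix (Fin 2) (Fin 2) ℂ} {u x : ℝ × ℝ → Fin 2 → ℂ}
    (hu : ∀ i, ContDiff ℝ 1 fun p => u p i) (hx : ∀ i, ContDiff ℝ 1 fun p => x p i) (i : Fin 2) :
    ContDiff ℝ 1 fun p : ℝ × ℝ => bdryMap Pr (M₀ + (p.1 : ℂ) • M₁) (u p) (x p) i := by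
  have h1 : ContDiff ℝ 1 fun p : ℝ × ℝ => (p.1 : ℂ) := contDiff_ofReal contDiff_fst
  have hu0 := hu 0
  have hu1 := hu 1
  have hx0 := hx 0
  have hx1 := hx 1
  have hui := hu i
  simp only [bdryMap, mulVec, dotProduct, Fin.sum_univ_two, Pi.add_apply, Pi.sub_apply, Matrix.add_apply,
    Matrix.smul_apply, smul_eq_mul]
  fun_prop

theorem contDiff_bdryProp (hm : 0 < m) (Pr M₀ M₁ : Matrix (Fin 2) (Fin 2) ℂ) (i : Fin 2) :
    ContDiff ℝ 1 fun p => bdryProp m ε Pr M₀ M₁ p i :=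
  contDiff_bdryMap (contDiff_propVec hm) (contDiff_propChi hm) i

theorem contDiff_bdryEv (hm : 0 < m) (hε : 0 < ε) (hεm : ε < 1 / (2 * m))
    (Pr M₀ M₁ : Matrix (Fin 2) (Fin 2) ℂ) (i : Fin 2) :
    ContDiff ℝ 1 fun p => bdryEv m ε Pr M₀ M₁ p i :=
  contDiff_bdryMap (contDiff_evVec hm hε hεm) (contDiff_evChi hm hε hεm) i

theorem contDiff_waveDet (hm : 0 < m) (hε : 0 < ε) (hεm : ε < 1 / (2 * m)) :
    ContDiff ℝ 1 (waveDet m ε) :=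
  ((contDiff_propVec hm 0).mul (contDiff_evVec hm hε hεm 1)).sub
    ((contDiff_propVec hm 1).mul (contDiff_evVec hm hε hεm 0))

theorem contDiff_scatDet (hm : 0 < m) (hε : 0 < ε) (hεm : ε < 1 / (2 * m))
    (Pr M₀ M₁ : Matrix (Fin 2) (Fin 2) ℂ) : ContDiff ℝ 1 (scatDet m ε Pr M₀ M₁) :=
  ((contDiff_bdryProp hm Pr M₀ M₁ 0).mul (contDiff_bdryEv hm hε hεm Pr M₀ M₁ 1)).sub
    ((contDiff_bdryProp hm Pr M₀ M₁ 1).mul (contDiff_bdryEv hm hε hεm Pr M₀ M₁ 0))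

end

end RegDirac
end

noncomputable section
namespace RegDirac

/-! ### Jumps from the boundary form -/

theorem HasJump.of_comp_refl {l : ℝ × ℝ → ℂ} {k : ℝ} {e : ℂ} (h : HasJump (fun p => l (refl p)) k e) :
    HasJump l k (-e) := by
  unfold HasJump at *
  have h2 := Tendsto.neg h
  have h3 : ∀ p, refl (refl p) = p := fun p => by simp [refl]
  simp only [h3, neg_sub] at h2
  rwa [mul_neg]

theorem fderiv_im_of_eq {f : ℝ × ℝ → ℂ} {h : ℝ × ℝ → ℝ} {k : ℝ} (hf : ContDiffAt ℝ 1 f (k, 0))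
    (hh : ContinuousAt h (k, 0)) (him : ∀ᶠ p in 𝓝 (k, (0 : ℝ)), (f p).im = p.2 * h p) :
    (fderiv ℝ f (k, 0) (0, 1)).im = h (k, 0) := by
  have hline : HasDerivAt (fun t : ℝ => ((k, t) : ℝ × ℝ)) (0, 1) 0 :=
    (hasDerivAt_const (0 : ℝ) k).prodMk (hasDerivAt_id 0)
  have hd : HasDerivAt (fun t : ℝ => (f (k, t)).im) (fderiv ℝ f (k, 0) (0, 1)).im 0 := by
    have h1 := (hf.differentiableAt (by simp)).hasFDerivAt.comp_hasDerivAt (0 : ℝ) hline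
    exact Complex.imCLM.hasFDerivAt.comp_hasDerivAt (0 : ℝ) h1
  have hcont : Tendsto (fun t : ℝ => ((k, t) : ℝ × ℝ)) (𝓝 0) (𝓝 (k, 0)) :=
    Continuous.tendsto' (by fun_prop) _ _ rfl
  have him' := hcont.eventually him
  have hs := hasDerivAt_iff_tendsto_slope_zero.1 hd
  refine tendsto_nhds_unique hs ?_
  have h2 : Tendsto (fun t : ℝ => h (k, t)) (𝓝[≠] 0) (𝓝 (h (k, 0))) :=
    (hh.tendsto.comp hcont).mono_left nhdsWithin_le_nhds
  refine h2.congr' ?_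
  filter_upwards [self_mem_nhdsWithin, nhdsWithin_le_nhds him'] with t ht h3
  have ht : t ≠ 0 := ht
  have h4 := him'.self_of_nhds
  simp only [zero_add] at h4 ⊢
  rw [h3, h4]
  simp [ht]

/-- Number of negative squares of a Hermitian `2 × 2` form with determinant `g` and a diagonal entry
of the sign of `s`. -/
def negSquares (s g : ℝ) : ℕ :=
  -- With a vanishing diagonal entry the determinant is minus a squared modulus; when it is nonzero
  -- the form is hyperbolic with one negative square.
  if s = 0 then 1 else (if s < 0 then 1 else 0) + if s * g < 0 then 1 else 0

section
variable {G : ℝ × ℝ → ℂ} {s h : ℝ × ℝ → ℝ} {k : ℝ}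

/-- If G < 0 on the axis the form is indefinite, -G is off the cut and nothing jumps. If G > 0 the
form is definite, -G lies on the cut, and the sign of s decides in which direction it is crossed: 0
or 2 negative squares give the jump -1 or +1. -/
theorem hasJump_log_of_form (hG : ContDiffAt ℝ 1 G (k, 0)) (hs : ContinuousAt s (k, 0))
    (hh : ContinuousAt h (k, 0)) (hpos : 0 < h (k, 0))
    (him : ∀ᶠ p in 𝓝 (k, (0 : ℝ)), (G p).im = -(p.2 * (h p * s p)))
    (hs0 : s (k, 0) = 0 → (G (k, 0)).re ≤ 0) (hne : (G (k, 0)).re ≠ 0) :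
    HasJump (fun p => Complex.log (-G p)) k ((negSquares (s (k, 0)) (G (k, 0)).re : ℂ) - 1) := by
  have him0 : (G (k, 0)).im = 0 := by simpa using him.self_of_nhds
  have hcont : ContinuousAt (fun p => -G p) (k, 0) := hG.continuousAt.neg
  rcases lt_or_gt_of_ne hne with hlt | hgt
  · have h1 : negSquares (s (k, 0)) (G (k, 0)).re = 1 := by
      unfold negSquares
      rcases lt_trichotomy (s (k, 0)) 0 with h | h | h
      · rw [if_neg h.ne, if_pos h, if_neg (mul_pos_of_neg_of_neg h hlt).not_gt]
      · rw [if_pos h]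
      · rw [if_neg h.ne', if_neg h.not_gt, if_pos (mul_neg_of_pos_of_neg h hlt)]
    rw [h1, Nat.cast_one, sub_self]
    refine hasJump_log_of_slitPlane hcont (Or.inl ?_)
    simpa using hlt
  · have hsne : s (k, 0) ≠ 0 := fun h => (hs0 h).not_gt hgt
    have hprod : ContinuousAt (fun p => h p * s p) (k, 0) := hh.mul hs
    rcases lt_or_gt_of_ne hsne with hk | hk
    · have h1 : negSquares (s (k, 0)) (G (k, 0)).re = 2 := by
        unfold negSquares
        rw [if_neg hk.ne, if_pos hk, if_pos (mul_neg_of_neg_of_pos hk hgt)]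
      rw [h1]
      have h2 : ∀ᶠ p in 𝓝 (k, (0 : ℝ)), 0 < -(h p * s p) := by
        refine eventually_const_lt_of_continuousAt ?_ hprod.neg
        have := mul_neg_of_pos_of_neg hpos hk
        linarith
      have h3 := hasJump_log_of_neg' hcont (by simpa using hgt) (by simpa using him0)
        (by filter_upwards [h2, him] with p h3 h4 h5
            rw [Complex.neg_im, h4]; nlinarith)
        (by filter_upwards [h2, him] with p h3 h4 h5
            rw [Complex.neg_im, h4]; nlinarith)
      convert h3 using 1
      norm_num
    · have h1 : negSquares (s (k, 0)) (G (k, 0)).re = 0 := by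
        unfold negSquares
        rw [if_neg hk.ne', if_neg hk.not_gt, if_neg (mul_pos hk hgt).not_gt]
      rw [h1]
      have h2 : ∀ᶠ p in 𝓝 (k, (0 : ℝ)), 0 < h p * s p :=
        eventually_const_lt_of_continuousAt (mul_pos hpos hk) hprod
      have h3 := hasJump_log_of_neg hcont (by simpa using hgt) (by simpa using him0)
        (by filter_upwards [h2, him] with p h3 h4 h5
            rw [Complex.neg_im, h4]; nlinarith)
        (by filter_upwards [h2, him] with p h3 h4 h5
            rw [Complex.neg_im, h4]; nlinarith)
      convert h3 using 1
      norm_num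

/-- A degenerate form on the whole axis: G has a zero of first order in κ there, so its logarithm
makes half a jump, +1/2 or -1/2 as s is negative or positive. -/
theorem hasJump_log_of_form_zero (hG : ContDiffAt ℝ 1 G (k, 0)) (hs : ContinuousAt s (k, 0))
    (hh : ContinuousAt h (k, 0)) (hpos : 0 < h (k, 0))
    (him : ∀ᶠ p in 𝓝 (k, (0 : ℝ)), (G p).im = -(p.2 * (h p * s p)))
    (hG0 : ∀ x : ℝ, G (x, 0) = 0) (hne : s (k, 0) ≠ 0) :
    HasJump (fun p => Complex.log (-G p)) k ((negSquares (s (k, 0)) (G (k, 0)).re : ℂ) - 1 / 2) := by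
  have hr : Tendsto refl (𝓝 (k, (0 : ℝ))) (𝓝 (k, 0)) :=
    (contDiff_refl (n := 0)).continuous.tendsto' _ _ (by simp [refl])
  have h0 : refl (k, 0) = (k, 0) := by simp [refl]
  rw [hG0, Complex.zero_re]
  rcases lt_or_gt_of_ne hne with hlt | hgt
  · have h1 : negSquares (s (k, 0)) 0 = 1 := by
      unfold negSquares
      rw [if_neg hlt.ne, if_pos hlt]; simp
    rw [h1]
    have hC : ContDiffAt ℝ 1 (fun p => -G (refl p)) (k, 0) :=
      (ContDiffAt.comp (k, (0 : ℝ)) (by rwa [h0]) contDiff_refl.contDiffAt).neg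
    have h2 : ContinuousAt (fun p => -(h (refl p) * s (refl p))) (k, 0) :=
      (ContinuousAt.comp (f := refl) (g := fun p => h p * s p) (by rw [h0]; exact hh.mul hs)
        (contDiff_refl (n := 0)).continuous.continuousAt).neg
    have h3 := fderiv_im_of_eq (h := fun p => -(h (refl p) * s (refl p))) hC h2 (by
      filter_upwards [hr.eventually him] with p hp
      rw [Complex.neg_im, hp]; simp [refl])
    have h4 := hasJump_log_of_zero hC (Eventually.of_forall fun x => by simp [refl, hG0])
      (by rw [h3, h0]; have := mul_neg_of_pos_of_neg hpos hlt; linarith)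
    have h5 := HasJump.of_comp_refl (l := fun p => Complex.log (-G p)) h4
    convert h5 using 1
    norm_num
  · have h1 : negSquares (s (k, 0)) 0 = 0 := by
      unfold negSquares
      rw [if_neg hgt.ne', if_neg hgt.not_gt]; simp
    rw [h1]
    have h3 := fderiv_im_of_eq (h := fun p => h p * s p) hG.neg (hh.mul hs) (by
      filter_upwards [him] with p hp
      rw [Complex.neg_im, hp]; ring)
    have h4 := hasJump_log_of_zero hG.neg (Eventually.of_forall fun x => by simp [hG0])
      (by rw [h3]; exact mul_pos hpos hgt)
    convert h4 using 1
    norm_num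

end

/-- The boundary form determinant. -/
def formDet (m ε : ℝ) (Pr M₀ M₁ : Matrix (Fin 2) (Fin 2) ℂ) (p : ℝ × ℝ) : ℂ :=
  star (waveDet m ε p) * scatDet m ε Pr M₀ M₁ p

theorem contDiff_formDet {m ε : ℝ} (hm : 0 < m) (hε : 0 < ε) (hεm : ε < 1 / (2 * m))
    (Pr M₀ M₁ : Matrix (Fin 2) (Fin 2) ℂ) : ContDiff ℝ 1 (formDet m ε Pr M₀ M₁) :=
  (Complex.conjCLE.contDiff.comp (contDiff_waveDet hm hε hεm)).mul
    (contDiff_scatDet hm hε hεm Pr M₀ M₁)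

/-- The contribution to the number of bound states at threshold that does not depend on the
boundary condition. -/
def weylSign (m ε k : ℝ) : ℕ :=
  if weyl₁₁ m ε k (bandPlus m ε k 0) 0 (√(rateSum m ε k)) < 0 then 1 else 0

theorem eventually_weylSign_atTop {m ε : ℝ} (hm : 0 < m) (hε : 0 < ε) (hεm : ε < 1 / (2 * m)) :
    ∀ᶠ k in atTop, weylSign m ε k = 1 := by
  filter_upwards [eventually_gt_atTop 0] with k hk
  have hd : 0 < weylDen m ε k (bandPlus m ε k 0) 0 (√(rateSum m ε k)) :=
    (rates_threshold hm hε hεm k).den_pos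
  have hη := Real.sqrt_nonneg (rateSum m ε k)
  have hμ := mu_threshold_pos (ε := ε) hm k
  rw [weylSign, if_pos]
  unfold weyl₁₁
  rw [neg_div]
  have : 0 < weylNum m ε k (bandPlus m ε k 0) 0 (√(rateSum m ε k)) := by
    unfold weylNum
    have : 0 ≤ ε * k * (0 + √(rateSum m ε k)) := by positivity
    linarith
  have : 0 < weylNum m ε k (bandPlus m ε k 0) 0 (√(rateSum m ε k)) /
    (ε * weylDen m ε k (bandPlus m ε k 0) 0 (√(rateSum m ε k))) := by positivity
  linarith

/-- The numerator is ω₊ + m - εk² + εk√D. For very negative k one has εk√D ≤ -εk² and ω₊ ≤ 2εk² - m,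
so it is not positive. -/
theorem eventually_weylSign_atBot {m ε : ℝ} (hm : 0 < m) (hε : 0 < ε) (hεm : ε < 1 / (2 * m)) :
    ∀ᶠ k in atBot, weylSign m ε k = 0 := by
  filter_upwards [eventually_lt_atBot (-(1 / ε + 1 + 2 * m / ε))] with k hk
  have hd : 0 < weylDen m ε k (bandPlus m ε k 0) 0 (√(rateSum m ε k)) :=
    (rates_threshold hm hε hεm k).den_pos
  have hη := abs_lt_sqrt_rateSum hm hε hεm k
  have hp1 : 0 < 1 / ε := by positivity
  have hp2 : 0 < 2 * m / ε := by positivity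
  have hk0 : k < 0 := by linarith
  rw [abs_of_neg hk0] at hη
  rw [weylSign, if_neg]
  rw [not_lt]
  unfold weyl₁₁
  have h1 : weylNum m ε k (bandPlus m ε k 0) 0 (√(rateSum m ε k)) ≤ 0 := by
    have hb := bandPlus_sq m ε k 0
    have hbp := bandPlus_pos (ε := ε) hm k 0
    set ω := bandPlus m ε k 0
    set η := √(rateSum m ε k)
    have e1 : ε * k * η ≤ -(ε * k ^ 2) := by nlinarith [mul_pos hε (neg_pos.2 hk0)]
    have hεk : 1 < ε * -k := by
      have : 1 / ε < -k := by linarith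
      rw [div_lt_iff₀ hε] at this; linarith
    have hεk2 : 2 * m < ε * -k := by
      have : 2 * m / ε < -k := by linarith
      rw [div_lt_iff₀ hε] at this; linarith
    have e2 : ω ≤ 2 * (ε * k ^ 2) - m := by
      have h3 : 0 ≤ 2 * (ε * k ^ 2) - m := by nlinarith
      refine abs_le_of_sq_le_sq' ?_ h3 |>.2
      rw [hb]
      have h4 : k ^ 2 ≤ (ε * k ^ 2) ^ 2 := by
        have h5 : 1 ≤ (ε * -k) ^ 2 := one_le_pow₀ hεk.le
        have h6 : (ε * k ^ 2) ^ 2 = (ε * -k) ^ 2 * k ^ 2 := by ring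
        rw [h6]
        exact le_mul_of_one_le_left (sq_nonneg k) h5
      have h5 : 0 ≤ ε * k ^ 2 := by positivity
      have h6 : 2 * m ≤ ε * k ^ 2 := by nlinarith
      nlinarith
    unfold weylNum
    linarith
  apply div_nonneg (by linarith) (by positivity)

/-- The lift is log(-G) minus the logarithm of the negated conjugate wave determinant; the latter is
smooth at large momenta. The jump of log(-G) is the number of negative squares minus 1, or minus 1/2
if G vanishes on the axis. `hdich` provides the same alternative at both ends, so that the constant
cancels later; the index of `thrMat` adds `weylSign`, which is 1 at +∞ and 0 at -∞. -/
theorem HasScatLift.of_form {m ε : ℝ} (hm : 0 < m) (hε : 0 < ε) (hεm : ε < 1 / (2 * m))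
    {Pr M₀ M₁ : Matrix (Fin 2) (Fin 2) ℂ} {s : ℝ × ℝ → ℝ} {R : ℝ} (hs : Continuous s)
    (him : ∀ p, (formDet m ε Pr M₀ M₁ p).im =
      -(p.2 * (propSnd m ε p * (1 - 2 * ε * massTerm m ε p) * s p)))
    (hs0 : ∀ p : ℝ × ℝ, R < p.1 ^ 2 + p.2 ^ 2 → s p = 0 → (formDet m ε Pr M₀ M₁ p).re ≤ 0)
    (hne : ∀ p : ℝ × ℝ, p.2 ≠ 0 → R < p.1 ^ 2 + p.2 ^ 2 → formDet m ε Pr M₀ M₁ p ≠ 0)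
    (hdich : (∀ k : ℝ, formDet m ε Pr M₀ M₁ (k, 0) = 0) ∧
        (∀ᶠ k : ℝ in atTop, s (k, 0) ≠ 0) ∧ (∀ᶠ k : ℝ in atBot, s (k, 0) ≠ 0) ∨
      (∀ᶠ k : ℝ in atTop, formDet m ε Pr M₀ M₁ (k, 0) ≠ 0) ∧
        ∀ᶠ k : ℝ in atBot, formDet m ε Pr M₀ M₁ (k, 0) ≠ 0)
    (hind : ∀ k : ℝ, R < k ^ 2 → (s (k, 0) = 0 → (formDet m ε Pr M₀ M₁ (k, 0)).re ≠ 0) →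
      negIndex (thrMat m ε Pr (M₀ + (k : ℂ) • M₁) k) =
        negSquares (s (k, 0)) (formDet m ε Pr M₀ M₁ (k, 0)).re + weylSign m ε k) :
    HasScatLift m ε Pr M₀ M₁ := by
  obtain ⟨R', hR'⟩ := exists_re_waveDet_neg hm hε hεm
  set G := formDet m ε Pr M₀ M₁ with hGdef
  have hGC : ContDiff ℝ 1 G := contDiff_formDet hm hε hεm Pr M₀ M₁
  have hDC : ContDiff ℝ 1 (fun p => -star (waveDet m ε p)) :=
    (Complex.conjCLE.contDiff.comp (contDiff_waveDet hm hε hεm)).neg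
  have hh : Continuous fun p => propSnd m ε p * (1 - 2 * ε * massTerm m ε p) :=
    (contDiff_propSnd hm).continuous.mul
      (continuous_const.sub (continuous_const.mul contDiff_massTerm.continuous))
  have hhpos : ∀ p : ℝ × ℝ, 0 < p.1 ^ 2 + p.2 ^ 2 →
      0 < propSnd m ε p * (1 - 2 * ε * massTerm m ε p) := fun p hp =>
    mul_pos (propSnd_pos hm hp) (massTerm_factor_pos hm hεm p)
  have hDs : ∀ p : ℝ × ℝ, R' < p.1 ^ 2 + p.2 ^ 2 → -star (waveDet m ε p) ∈ Complex.slitPlane := by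
    intro p hp
    left
    have := hR' p hp
    simp; linarith
  have hjD : ∀ k : ℝ, R' < k ^ 2 → HasJump (fun p => -Complex.log (-star (waveDet m ε p))) k 0 := by
    intro k hk
    have := (hasJump_log_of_slitPlane (k := k) hDC.continuous.continuousAt
      (hDs (k, 0) (by simpa using hk))).neg
    rwa [neg_zero] at this
  have hsq : ∀ r : ℝ, (∀ᶠ k : ℝ in atTop, r < k ^ 2) ∧ ∀ᶠ k : ℝ in atBot, r < k ^ 2 := by
    intro r
    have h1 : ∀ᶠ k : ℝ in atTop, r < k ^ 2 := (tendsto_pow_atTop (two_ne_zero)).eventually_gt_atTop r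
    refine ⟨h1, ?_⟩
    have := tendsto_neg_atBot_atTop.eventually h1
    simpa using this
  have hGim : ∀ k : ℝ, (G (k, 0)).im = 0 := fun k => by rw [him]; simp
  have hGre : ∀ k : ℝ, G (k, 0) ≠ 0 → (G (k, 0)).re ≠ 0 := fun k h h' =>
    h (Complex.ext h' (hGim k))
  have key : ∃ c : ℂ, (∀ᶠ k : ℝ in atTop, HasJump (fun p => Complex.log (-G p)) k
        (negIndex (thrMat m ε Pr (M₀ + (k : ℂ) • M₁) k) - weylSign m ε k - c)) ∧
      (∀ᶠ k : ℝ in atBot, HasJump (fun p => Complex.log (-G p)) k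
        (negIndex (thrMat m ε Pr (M₀ + (k : ℂ) • M₁) k) - weylSign m ε k - c)) := by
    rcases hdich with ⟨hz, ht, hb⟩ | ⟨ht, hb⟩
    · refine ⟨1 / 2, ?_⟩
      have h1 : ∀ k : ℝ, R < k ^ 2 → 0 < k ^ 2 → s (k, 0) ≠ 0 →
          HasJump (fun p => Complex.log (-G p)) k
            (negIndex (thrMat m ε Pr (M₀ + (k : ℂ) • M₁) k) - weylSign m ε k - 1 / 2) := by
        intro k hk hk0 hsk
        rw [hind k hk (fun h => absurd h hsk)]
        have := hasJump_log_of_form_zero hGC.contDiffAt hs.continuousAt hh.continuousAt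
          (hhpos (k, 0) (by simpa using hk0)) (Eventually.of_forall him) hz hsk
        push_cast
        convert this using 1
        ring
      constructor
      · filter_upwards [(hsq R).1, (hsq 0).1, ht] with k a b c using h1 k a b c
      · filter_upwards [(hsq R).2, (hsq 0).2, hb] with k a b c using h1 k a b c
    · refine ⟨1, ?_⟩
      have h1 : ∀ k : ℝ, R < k ^ 2 → 0 < k ^ 2 → G (k, 0) ≠ 0 →
          HasJump (fun p => Complex.log (-G p)) k
            (negIndex (thrMat m ε Pr (M₀ + (k : ℂ) • M₁) k) - weylSign m ε k - 1) := by
        intro k hk hk0 hGk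
        rw [hind k hk (fun _ => hGre k hGk)]
        have := hasJump_log_of_form hGC.contDiffAt hs.continuousAt hh.continuousAt
          (hhpos (k, 0) (by simpa using hk0)) (Eventually.of_forall him) (hs0 _ (by simpa using hk)) (hGre k hGk)
        push_cast
        convert this using 1
        ring
      constructor
      · filter_upwards [(hsq R).1, (hsq 0).1, ht] with k a b c using h1 k a b c
      · filter_upwards [(hsq R).2, (hsq 0).2, hb] with k a b c using h1 k a b c
  obtain ⟨c, hkp, hkm⟩ := key
  refine ⟨max (max R R') 0, 1, c, fun p => Complex.log (-G p) + -Complex.log (-star (waveDet m ε p)),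
    one_ne_zero, ?_, ?_, ?_⟩
  · intro p hp hpR
    obtain ⟨h1, h3⟩ := max_lt_iff.1 hpR
    obtain ⟨h1, h2⟩ := max_lt_iff.1 h1
    have hGs : -G p ∈ Complex.slitPlane := by
      rw [Complex.mem_slitPlane_iff]
      by_cases h4 : s p = 0
      · left
        have h5 := hs0 p h1 h4
        have h6 : (G p).im = 0 := by rw [him, h4]; simp
        have h7 : (G p).re ≠ 0 := fun h => hne p hp h1 (Complex.ext h h6)
        have := lt_of_le_of_ne h5 h7
        simpa using this
      · right
        rw [Complex.neg_im, him, neg_neg]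
        exact mul_ne_zero hp (mul_ne_zero (hhpos p h3).ne' h4)
    refine ⟨(contDiffAt_log_comp hGC.contDiffAt.neg hGs).add
      (contDiffAt_log_comp hDC.contDiffAt (hDs p h2)).neg, ?_⟩
    have hD0 := Complex.slitPlane_ne_zero (hDs p h2)
    rw [Complex.exp_add, Complex.exp_neg, Complex.exp_log (Complex.slitPlane_ne_zero hGs),
      Complex.exp_log hD0, hGdef, formDet, one_mul]
    have : star (waveDet m ε p) ≠ 0 := neg_ne_zero.1 hD0
    field_simp
  · filter_upwards [hkp, (hsq R').1, eventually_weylSign_atTop hm hε hεm] with k h1 h2 h3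
    have := h1.add (hjD k h2)
    rwa [h3, add_zero, Nat.cast_one] at this
  · filter_upwards [hkm, (hsq R').2, eventually_weylSign_atBot hm hε hεm] with k h1 h2 h3
    have := h1.add (hjD k h2)
    rwa [h3, add_zero, Nat.cast_zero, sub_zero] at this

end RegDirac
end

noncomputable section
namespace RegDirac

/-! ### The number of bound states at threshold in terms of bulk waves -/

theorem negIndex_diagonal {n : Type*} [Fintype n] [DecidableEq n] (d : n → ℝ) :
    negIndex (diagonal fun i => (d i : ℂ)) = ∑ i, if d i < 0 then 1 else 0 := by
  rw [← Finset.card_filter]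
  refine le_antisymm ?_ (card_le_negIndex_diagonal d)
  obtain ⟨W, hW, hWn⟩ := exists_negOn (diagonal fun i => (d i : ℂ))
  set V := Submodule.span ℂ ((fun i => (Pi.single i 1 : n → ℂ)) ''
    ((Finset.univ.filter fun i => ¬ d i < 0 : Finset n) : Set n)) with hV
  have h1 : W ⊓ V = ⊥ := by
    rw [eq_bot_iff]
    rintro z ⟨hz1, hz2⟩
    by_contra hz0
    have h2 := hWn z hz1 hz0
    rw [quadForm_diagonal] at h2
    refine h2.not_ge (Finset.sum_nonneg fun i _ => ?_)
    by_cases hi : d i < 0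
    · rw [apply_eq_zero_of_mem_span_single hz2 (i := i) (by simpa using hi)]
      simp
    · exact mul_nonneg (not_lt.1 hi) (sq_nonneg _)
  have h2 := finrank_add_le_of_disjoint h1
  rw [hW, hV, finrank_span_single] at h2
  have h3 := Finset.card_filter_add_card_filter_not (s := (Finset.univ : Finset n)) (fun i => d i < 0)
  rw [Finset.card_univ] at h3
  omega

/-- A congruence: the columns (z j, y j) together with the last basis vector form an invertible
matrix. They diagonalize E, because E maps the former into vectors without last component. -/
theorem negIndex_eq_of_cols {E : Matrix (Fin 2 ⊕ Fin 1) (Fin 2 ⊕ Fin 1) ℂ} (hE : E.IsHermitian)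
    {z w : Fin 2 → Fin 2 → ℂ} {y : Fin 2 → ℂ} (hdet : z 0 0 * z 1 1 - z 1 0 * z 0 1 ≠ 0) {d : Fin 2 → ℝ}
    {n : ℝ} (hcol : ∀ j, E *ᵥ Sum.elim (z j) (fun _ => y j) = Sum.elim (w j) 0)
    (hw : ∀ i j, star (z i) ⬝ᵥ w j = if i = j then (d i : ℂ) else 0)
    (hn : E (Sum.inr 0) (Sum.inr 0) = n) :
    negIndex E = ((if d 0 < 0 then 1 else 0) + if d 1 < 0 then 1 else 0) + if n < 0 then 1 else 0 := by
  set P : Matrix (Fin 2 ⊕ Fin 1) (Fin 2 ⊕ Fin 1) ℂ :=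
    fromBlocks (of fun i j => z j i) 0 (of fun _ j => y j) 1 with hP
  have hPu : IsUnit P := by
    rw [Matrix.isUnit_iff_isUnit_det, hP, det_fromBlocks_zero₁₂, det_one, mul_one, det_fin_two]
    exact isUnit_iff_ne_zero.2 hdet
  have hPl : ∀ j x, P x (Sum.inl j) = Sum.elim (z j) (fun _ => y j) x := by
    intro j x; rcases x with x | x <;> simp [hP]
  have hEP : ∀ j x, (E * P) x (Sum.inl j) = Sum.elim (w j) 0 x := by
    intro j x
    rw [← hcol j, Matrix.mul_apply]
    simp only [mulVec, dotProduct, hPl]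
  have hll : ∀ i j, (Pᴴ * E * P) (Sum.inl i) (Sum.inl j) = if i = j then (d i : ℂ) else 0 := by
    intro i j
    rw [Matrix.mul_assoc, Matrix.mul_apply, ← hw i j]
    simp [hPl, hEP, dotProduct]
  have hrl : ∀ i j, (Pᴴ * E * P) (Sum.inr i) (Sum.inl j) = 0 := by
    intro i j
    rw [Matrix.mul_assoc, Matrix.mul_apply]
    simp [hEP]
    simp [hP]
  have hlr : ∀ i j, (Pᴴ * E * P) (Sum.inl i) (Sum.inr j) = 0 := by
    intro i j
    have h1 : (Pᴴ * E * P).IsHermitian := isHermitian_conjTranspose_mul_mul P hE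
    rw [← h1.apply, hrl, star_zero]
  have hrr : ∀ i j, (Pᴴ * E * P) (Sum.inr i) (Sum.inr j) = n := by
    intro i j
    rw [Matrix.mul_assoc, Matrix.mul_apply]
    simp [hP, Matrix.mul_apply, Subsingleton.elim i 0, Subsingleton.elim j 0, hn]
  have hdiag : Pᴴ * E * P = Matrix.diagonal fun i : Fin 2 ⊕ Fin 1 => ((Sum.elim d (fun _ => n) i : ℝ) : ℂ) := by
    ext i j
    rcases i with i | i <;> rcases j with j | j
    · rw [hll]; simp [diagonal_apply]
    · rw [hlr]; simp
    · rw [hrl]; simp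
    · rw [hrr, Subsingleton.elim i j]; simp
  rw [← negIndex_congr E P hPu, hdiag, negIndex_diagonal, Fintype.sum_sum_type, Fin.sum_univ_two, Fin.sum_univ_one]
  rfl

section
variable {m ε : ℝ}

theorem evRate_threshold (k : ℝ) : evRate m ε (k, 0) = √(rateSum m ε k) := by
  simp [evRate, rateSum]

/-- At κ = 0 the propagating wave is constant: it is -k times the slow wave with rate 0. In
`weyl_evVec` below, the evanescent wave is likewise `evFst` times the fast wave. -/
theorem weyl_propVec (hm : 0 < m) (hε : 0 < ε) (hεm : ε < 1 / (2 * m)) (k : ℝ) :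
    weyl₀₀ m ε k (bandPlus m ε k 0) 0 (√(rateSum m ε k)) * propVec m ε (k, 0) 0 +
        weyl₀₁ m ε k (bandPlus m ε k 0) 0 (√(rateSum m ε k)) * propChi m ε (k, 0) 1 =
          propChi m ε (k, 0) 0 ∧
      propVec m ε (k, 0) 1 +
        weyl₀₁ m ε k (bandPlus m ε k 0) 0 (√(rateSum m ε k)) * propVec m ε (k, 0) 0 +
        weyl₁₁ m ε k (bandPlus m ε k 0) 0 (√(rateSum m ε k)) * propChi m ε (k, 0) 1 = 0 := by
  have hR := rates_threshold hm hε hεm k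
  obtain ⟨a1, a2⟩ := hR.weyl_slow hε
  have hρ : ratio m ε k (bandPlus m ε k 0) 0 * -k = propSnd m ε (k, 0) := by
    have h1 := mu_threshold_pos (ε := ε) hm k
    have h2 := bandPlus_sq m ε k 0
    simp only [ratio, propSnd, band, massTerm]
    rw [div_mul_eq_mul_div, div_eq_iff (by simpa using h1.ne')]
    linear_combination -h2
  simp only [mul_zero, add_zero, zero_add] at a1 a2
  rw [a1, a2]
  have hρ' : (ratio m ε k (bandPlus m ε k 0) 0 : ℂ) * -k = propSnd m ε (k, 0) := by exact_mod_cast hρ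
  simp [propVec, propChi, chiData]
  constructor
  · linear_combination hρ'
  · linear_combination -hρ'

theorem weyl_evVec (hm : 0 < m) (hε : 0 < ε) (hεm : ε < 1 / (2 * m)) (k : ℝ) :
    weyl₀₀ m ε k (bandPlus m ε k 0) 0 (√(rateSum m ε k)) * evVec m ε (k, 0) 0 +
        weyl₀₁ m ε k (bandPlus m ε k 0) 0 (√(rateSum m ε k)) * evChi m ε (k, 0) 1 =
          evChi m ε (k, 0) 0 ∧
      evVec m ε (k, 0) 1 +
        weyl₀₁ m ε k (bandPlus m ε k 0) 0 (√(rateSum m ε k)) * evVec m ε (k, 0) 0 +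
        weyl₁₁ m ε k (bandPlus m ε k 0) 0 (√(rateSum m ε k)) * evChi m ε (k, 0) 1 = 0 := by
  have hR := rates_threshold hm hε hεm k
  obtain ⟨b1, b2⟩ := hR.weyl_fast hε
  have hη := evRate_threshold (m := m) (ε := ε) k
  have hη2 : √(rateSum m ε k) ^ 2 = rateSum m ε k := Real.sq_sqrt (rateSum_pos hm hε hεm k).le
  have hρ : ratio m ε k (bandPlus m ε k 0) (√(rateSum m ε k)) * evFst m ε (k, 0) =
      √(rateSum m ε k) - k := by
    have h1 : bandPlus m ε k 0 + m - ε * k ^ 2 + ε * √(rateSum m ε k) ^ 2 = evFst m ε (k, 0) := by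
      rw [hη2]
      simp only [rateSum, evFst, band, massTerm]
      field_simp
      ring
    rw [ratio, h1, div_mul_cancel₀ _ (evFst_pos hm hε (k, 0)).ne']
  set n₀₀ := weyl₀₀ m ε k (bandPlus m ε k 0) 0 (√(rateSum m ε k))
  set n₀₁ := weyl₀₁ m ε k (bandPlus m ε k 0) 0 (√(rateSum m ε k))
  set n₁₁ := weyl₁₁ m ε k (bandPlus m ε k 0) 0 (√(rateSum m ε k))
  set ρ := ratio m ε k (bandPlus m ε k 0) (√(rateSum m ε k))
  set η := √(rateSum m ε k)
  have hρ' : (ρ : ℂ) * evFst m ε (k, 0) = η - k := by exact_mod_cast hρ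
  have b1' : (n₀₀ : ℂ) + n₀₁ * (ε * ρ * η) = -ε * η + ρ := by exact_mod_cast b1
  have b2' : (n₀₁ : ℂ) + n₁₁ * (ε * ρ * η) = -ρ := by exact_mod_cast b2
  simp [evVec, evChi, chiData, hη]
  constructor
  · linear_combination (evFst m ε (k, 0) : ℂ) * b1' + (1 - n₀₁ * ε * η) * hρ'
  · linear_combination (evFst m ε (k, 0) : ℂ) * b2' - (1 + n₁₁ * ε * η) * hρ'

/-- The threshold matrix maps the boundary data of a bulk wave to its boundary value. -/
theorem thrMat_mulVec_wave (hm : 0 < m) (hε : 0 < ε) (hεm : ε < 1 / (2 * m)) (k : ℝ)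
    {Pr M : Matrix (Fin 2) (Fin 2) ℂ} (h : IsNormalBC Pr M) {a b : ℂ} {u x : Fin 2 → ℂ}
    (hu : u = a • propVec m ε (k, 0) + b • evVec m ε (k, 0))
    (hx : x = a • propChi m ε (k, 0) + b • evChi m ε (k, 0)) (hPr : Pr *ᵥ u = u) :
    thrMat m ε Pr M k *ᵥ Sum.elim u (fun _ => x 1) = Sum.elim (bdryMap Pr M u x) 0 := by
  obtain ⟨p1, p2⟩ := weyl_propVec hm hε hεm k
  obtain ⟨q1, q2⟩ := weyl_evVec hm hε hεm k
  rw [thrMat, edgeMat_mulVec h]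
  simp only [Sum.elim_inl, Sum.elim_inr]
  change Sum.elim (bdryMap Pr M u ![_ * (Pr *ᵥ u) 0 + _, _]) (fun _ => (Pr *ᵥ u) 1 + _ * (Pr *ᵥ u) 0 + _) = _
  rw [hPr]
  have e1 : ![weyl₀₀ m ε k (bandPlus m ε k 0) 0 (√(rateSum m ε k)) * u 0 +
      weyl₀₁ m ε k (bandPlus m ε k 0) 0 (√(rateSum m ε k)) * x 1, x 1] = x := by
    ext i
    fin_cases i
    · rw [hu, hx]
      simp
      linear_combination a * p1 + b * q1
    · rfl
  rw [e1]
  congr 1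
  ext i
  rw [hu, hx]
  simp
  linear_combination a * p2 + b * q2

theorem thrMat_inr {Pr M : Matrix (Fin 2) (Fin 2) ℂ} (k : ℝ) :
    thrMat m ε Pr M k (Sum.inr 0) (Sum.inr 0) =
      (weyl₁₁ m ε k (bandPlus m ε k 0) 0 (√(rateSum m ε k)) : ℂ) := by
  simp [thrMat, edgeMat, bdryForm, selMat, weylMat, Matrix.mul_apply, Fin.sum_univ_two]

/-- Dirichlet boundary conditions. -/
theorem hasScatLift_dirichlet (hm : 0 < m) (hε : 0 < ε) (hεm : ε < 1 / (2 * m)) :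
    HasScatLift m ε 0 0 0 := by
  obtain ⟨R, hR⟩ := exists_re_waveDet_neg hm hε hεm
  have hC : ContDiff ℝ 1 (fun p => -waveDet m ε p) := (contDiff_waveDet hm hε hεm).neg
  have hs : ∀ p : ℝ × ℝ, R < p.1 ^ 2 + p.2 ^ 2 → -waveDet m ε p ∈ Complex.slitPlane := fun p hp => by
    left; simpa using hR p hp
  have hbc : IsNormalBC 0 (0 : Matrix (Fin 2) (Fin 2) ℂ) := by constructor <;> simp
  have hind : ∀ k : ℝ, negIndex (thrMat m ε 0 (0 + (k : ℂ) • 0) k) = weylSign m ε k := by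
    intro k
    rw [smul_zero, add_zero]
    rw [negIndex_eq_of_cols (z := fun j => Pi.single j 1) (w := fun j => Pi.single j 1) (y := 0)
      (d := fun _ => 1) (isHermitian_thrMat hbc k) (by simp) ?_ ?_ (thrMat_inr k)]
    · simp [weylSign]
    · intro j
      rw [thrMat, edgeMat_mulVec hbc]
      ext i
      rcases i with i | i <;> simp [bdryMap]
    · intro i j
      simp [Pi.single_apply, eq_comm]
  have hj : ∀ k : ℝ, R < k ^ 2 → HasJump (fun p => Complex.log (-waveDet m ε p)) k 0 := fun k hk =>
    hasJump_log_of_slitPlane hC.continuous.continuousAt (hs (k, 0) (by simpa using hk))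
  have h1 : ∀ᶠ k : ℝ in atTop, R < k ^ 2 := (tendsto_pow_atTop (two_ne_zero)).eventually_gt_atTop R
  have h2 : ∀ᶠ k : ℝ in atBot, R < k ^ 2 := by
    have := tendsto_neg_atBot_atTop.eventually h1
    simpa using this
  -- For Dirichlet conditions the boundary determinant is the wave determinant itself, whose
  -- negative has a logarithm without jump. The index of `thrMat` is the Weyl sign alone, so the
  -- constant is 0.
  refine ⟨R, -1, 0, fun p => Complex.log (-waveDet m ε p), by simp, fun p _ hp => ⟨?_, ?_⟩, ?_, ?_⟩
  · exact contDiffAt_log_comp hC.contDiffAt (hs p hp)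
  · rw [Complex.exp_log (Complex.slitPlane_ne_zero (hs p hp))]
    simp [waveDet, scatDet, bdryProp, bdryEv, bdryMap]
  · filter_upwards [h1, eventually_weylSign_atTop hm hε hεm] with k h3 h4
    rw [hind, h4]
    simpa using hj k h3
  · filter_upwards [h2, eventually_weylSign_atBot hm hε hεm] with k h3 h4
    rw [hind, h4]
    simpa using hj k h3

end

end RegDirac
end

noncomputable section
namespace RegDirac

/-! ### Functions of the momentum at threshold -/

/-- Analytic functions of the momentum that are meromorphic at `±∞`. -/
def threshRing : Subring (ℝ → ℂ) where
  carrier := {f | (∀ k, AnalyticAt ℝ f k) ∧ ∀ σ : ℝ, σ ^ 2 = 1 → f ∈ tameRing fun t => σ * t⁻¹}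
  mul_mem' := fun hf hg => ⟨fun k => (hf.1 k).mul (hg.1 k), fun σ h =>
    Subring.mul_mem _ (hf.2 σ h) (hg.2 σ h)⟩
  one_mem' := ⟨fun _ => analyticAt_const, fun _ _ => Subring.one_mem _⟩
  add_mem' := fun hf hg => ⟨fun k => (hf.1 k).add (hg.1 k), fun σ h =>
    Subring.add_mem _ (hf.2 σ h) (hg.2 σ h)⟩
  zero_mem' := ⟨fun _ => analyticAt_const, fun _ _ => Subring.zero_mem _⟩
  neg_mem' := fun hf => ⟨fun k => (hf.1 k).neg, fun σ h => Subring.neg_mem _ (hf.2 σ h)⟩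

theorem thresh_const (c : ℂ) : (fun _ => c) ∈ threshRing :=
  ⟨fun _ => analyticAt_const, fun _ _ => tameRing_const c⟩

section
variable {f g : ℝ → ℂ}

theorem thresh_add (hf : f ∈ threshRing) (hg : g ∈ threshRing) : (fun k => f k + g k) ∈ threshRing :=
  threshRing.add_mem hf hg

theorem thresh_sub (hf : f ∈ threshRing) (hg : g ∈ threshRing) : (fun k => f k - g k) ∈ threshRing :=
  threshRing.sub_mem hf hg

theorem thresh_mul (hf : f ∈ threshRing) (hg : g ∈ threshRing) : (fun k => f k * g k) ∈ threshRing :=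
  threshRing.mul_mem hf hg

theorem thresh_neg (hf : f ∈ threshRing) : (fun k => -f k) ∈ threshRing :=
  threshRing.neg_mem hf

theorem thresh_pow (hf : f ∈ threshRing) (n : ℕ) : (fun k => f k ^ n) ∈ threshRing :=
  threshRing.pow_mem hf n

/-- Meromorphy at infinity excludes accumulation of zeros there, unless the function vanishes near
one end; analyticity then spreads the zeros over the whole line. So both ends show the same
alternative. -/
theorem thresh_dichotomy (hf : f ∈ threshRing) :
    (∀ k, f k = 0) ∨ (∀ᶠ k in atTop, f k ≠ 0) ∧ ∀ᶠ k in atBot, f k ≠ 0 := by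
  have hzero : ∀ x : ℝ, (∀ᶠ k in 𝓝 x, f k = 0) → ∀ k, f k = 0 := by
    intro x hx k
    have h1 : AnalyticOnNhd ℝ f univ := fun y _ => hf.1 y
    exact congrFun (h1.eq_of_eventuallyEq (g := 0) (fun y _ => analyticAt_const) hx) k
  by_cases h0 : ∀ k, f k = 0
  · exact Or.inl h0
  right
  have key : ∀ σ : ℝ, σ ^ 2 = 1 → ∀ᶠ t in 𝓝[>] (0 : ℝ), f (σ * t⁻¹) ≠ 0 := by
    intro σ hσ
    refine (tameRing_dichotomy (hf.2 σ hσ)).resolve_left fun h => h0 ?_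
    have hσ0 : σ ≠ 0 := fun h => by simp [h] at hσ
    obtain ⟨r, hr, hr'⟩ := mem_nhdsGT_iff_exists_Ioo_subset.1 h
    have hr0 : (0 : ℝ) < r := hr
    refine hzero (σ * (r / 2)⁻¹) ?_
    have hc : ContinuousAt (fun k : ℝ => σ / k) (σ * (r / 2)⁻¹) :=
      ContinuousAt.div continuousAt_const continuousAt_id (mul_ne_zero hσ0 (by positivity))
    have hm : Ioo 0 r ∈ 𝓝 (σ / (σ * (r / 2)⁻¹)) := by
      apply Ioo_mem_nhds <;> (field_simp; linarith)
    filter_upwards [hc hm] with k hk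
    have h2 : f (σ * (σ / k)⁻¹) = 0 := hr' hk
    have h3 : σ * (σ / k)⁻¹ = k := by rw [inv_div]; field_simp
    rwa [h3] at h2
  constructor
  · have := tendsto_inv_atTop_nhdsGT_zero.eventually (key 1 (by norm_num))
    simpa using this
  · have h1 : Tendsto (fun k : ℝ => (-k)⁻¹) atBot (𝓝[>] 0) :=
      tendsto_inv_atTop_nhdsGT_zero.comp tendsto_neg_atBot_atTop
    have := h1.eventually (key (-1) (by norm_num))
    simpa using this

end

section
variable {m ε : ℝ}

theorem thresh_k : (fun k : ℝ => (k : ℂ)) ∈ threshRing :=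
  ⟨fun k => Complex.ofRealCLM.analyticAt k, fun _ h =>
    (tamePath_infty (m := 1) (ε := 1) one_pos h).k_mem⟩

theorem thresh_band (hm : 0 < m) (hε : 0 < ε) : (fun k : ℝ => (band m ε (k, 0) : ℂ)) ∈ threshRing := by
  refine ⟨fun k => ?_, fun σ h => (tamePath_infty (m := m) hε h).band_mem⟩
  unfold band bandPlus
  exact analyticAt_ofReal_sqrt (by fun_prop) (bandPlus_arg_pos hm _ 0)

theorem thresh_evRate (hm : 0 < m) (hε : 0 < ε) (hεm : ε < 1 / (2 * m)) :
    (fun k : ℝ => (evRate m ε (k, 0) : ℂ)) ∈ threshRing := by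
  simp only [evRate_threshold]
  refine ⟨fun k => ?_, fun σ h => (tamePath_infty (m := m) hε h).rate_mem⟩
  exact analyticAt_ofReal_sqrt (by unfold rateSum; fun_prop) (rateSum_pos hm hε hεm k)

theorem thresh_massTerm : (fun k : ℝ => (massTerm m ε (k, 0) : ℂ)) ∈ threshRing := by
  have := thresh_sub (thresh_const m) (thresh_mul (thresh_const ε) (thresh_pow thresh_k 2))
  simpa [massTerm] using this

theorem thresh_propVec (hm : 0 < m) (hε : 0 < ε) (i : Fin 2) :
    (fun k : ℝ => propVec m ε (k, 0) i) ∈ threshRing := by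
  fin_cases i
  · simpa [propVec] using thresh_neg thresh_k
  · simpa [propVec, propSnd] using thresh_sub (thresh_band hm hε) thresh_massTerm

theorem thresh_evVec (hm : 0 < m) (hε : 0 < ε) (hεm : ε < 1 / (2 * m)) (i : Fin 2) :
    (fun k : ℝ => evVec m ε (k, 0) i) ∈ threshRing := by
  fin_cases i
  · simpa [evVec, evFst] using
      thresh_add (thresh_band hm hε) (thresh_sub (thresh_const (ε : ℂ)⁻¹) thresh_massTerm)
  · simpa [evVec] using thresh_sub (thresh_evRate hm hε hεm) thresh_k

theorem thresh_propChi (hm : 0 < m) (hε : 0 < ε) (i : Fin 2) :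
    (fun k : ℝ => propChi m ε (k, 0) i) ∈ threshRing := by
  fin_cases i
  · simpa [propChi, chiData] using thresh_propVec hm hε 1
  · simpa [propChi, chiData] using thresh_const 0

theorem thresh_evChi (hm : 0 < m) (hε : 0 < ε) (hεm : ε < 1 / (2 * m)) (i : Fin 2) :
    (fun k : ℝ => evChi m ε (k, 0) i) ∈ threshRing := by
  have h := fun i => thresh_mul (thresh_const ε)
    (thresh_mul (thresh_neg (thresh_evRate hm hε hεm)) (thresh_evVec hm hε hεm i))
  fin_cases i
  · exact thresh_add (h 0) (thresh_evVec hm hε hεm 1)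
  · exact thresh_neg (h 1)

theorem thresh_bdryMap {Pr M₀ M₁ : Matrix (Fin 2) (Fin 2) ℂ} {u x : ℝ → Fin 2 → ℂ}
    (hu : ∀ i, (fun k => u k i) ∈ threshRing) (hx : ∀ i, (fun k => x k i) ∈ threshRing) (i : Fin 2) :
    (fun k : ℝ => bdryMap Pr (M₀ + (k : ℂ) • M₁) (u k) (x k) i) ∈ threshRing := by
  have hmv : ∀ {N : ℝ → Matrix (Fin 2) (Fin 2) ℂ} {y : ℝ → Fin 2 → ℂ}, (∀ j, (fun k => N k i j) ∈ threshRing) →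
      (∀ j, (fun k => y k j) ∈ threshRing) → (fun k => (N k *ᵥ y k) i) ∈ threshRing := by
    intro N y hN hy
    simp only [mulVec, dotProduct, Fin.sum_univ_two]
    exact thresh_add (thresh_mul (hN 0) (hy 0)) (thresh_mul (hN 1) (hy 1))
  have hP := fun j => thresh_const (Pr i j)
  have hM := fun j => thresh_add (thresh_const (M₀ i j)) (thresh_mul thresh_k (thresh_const (M₁ i j)))
  exact thresh_add (thresh_add (thresh_sub (hu i) (hmv hP hu)) (hmv hP hx)) (hmv hM hu)

theorem thresh_bdryProp (hm : 0 < m) (hε : 0 < ε) (Pr M₀ M₁ : Matrix (Fin 2) (Fin 2) ℂ) (i : Fin 2) :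
    (fun k : ℝ => bdryProp m ε Pr M₀ M₁ (k, 0) i) ∈ threshRing :=
  thresh_bdryMap (thresh_propVec hm hε) (thresh_propChi hm hε) i

theorem thresh_bdryEv (hm : 0 < m) (hε : 0 < ε) (hεm : ε < 1 / (2 * m))
    (Pr M₀ M₁ : Matrix (Fin 2) (Fin 2) ℂ) (i : Fin 2) :
    (fun k : ℝ => bdryEv m ε Pr M₀ M₁ (k, 0) i) ∈ threshRing :=
  thresh_bdryMap (thresh_evVec hm hε hεm) (thresh_evChi hm hε hεm) i

theorem star_waveDet_threshold (k : ℝ) : star (waveDet m ε (k, 0)) = waveDet m ε (k, 0) := by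
  simp [waveDet, propVec, evVec]

theorem thresh_formDet (hm : 0 < m) (hε : 0 < ε) (hεm : ε < 1 / (2 * m))
    (Pr M₀ M₁ : Matrix (Fin 2) (Fin 2) ℂ) :
    (fun k : ℝ => formDet m ε Pr M₀ M₁ (k, 0)) ∈ threshRing := by
  simp only [formDet, star_waveDet_threshold]
  refine thresh_mul (thresh_sub ?_ ?_) (thresh_sub ?_ ?_)
  · exact thresh_mul (thresh_propVec hm hε 0) (thresh_evVec hm hε hεm 1)
  · exact thresh_mul (thresh_propVec hm hε 1) (thresh_evVec hm hε hεm 0)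
  · exact thresh_mul (thresh_bdryProp hm hε Pr M₀ M₁ 0) (thresh_bdryEv hm hε hεm Pr M₀ M₁ 1)
  · exact thresh_mul (thresh_bdryProp hm hε Pr M₀ M₁ 1) (thresh_bdryEv hm hε hεm Pr M₀ M₁ 0)

theorem waveDet_ne_zero_of_re {p : ℝ × ℝ} (h : (waveDet m ε p).re < 0) : waveDet m ε p ≠ 0 := fun h0 => by
  rw [h0] at h; simp at h

end

end RegDirac
end

noncomputable section
namespace RegDirac

/-! ### Mixed boundary conditions -/

theorem negSquares_of_pos {s g : ℝ} (hs : 0 < s) : negSquares s g = if g < 0 then 1 else 0 := by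
  rw [negSquares, if_neg hs.ne', if_neg hs.not_gt, zero_add]
  by_cases hg : g < 0
  · rw [if_pos hg, if_pos (mul_neg_of_pos_of_neg hs hg)]
  · rw [if_neg hg, if_neg (mul_nonneg hs.le (not_lt.1 hg)).not_gt]

/-- The unit vector orthogonal to `r`. -/
def orthVec (r : Fin 2 → ℂ) : Fin 2 → ℂ := ![-star (r 1), star (r 0)]

/-- The component orthogonal to `r`. -/
def orthComp (r u : Fin 2 → ℂ) : ℂ := -r 1 * u 0 + r 0 * u 1

section
variable {r : Fin 2 → ℂ}

theorem rankOne_mulVec (r u : Fin 2 → ℂ) : rankOne r *ᵥ u = (star r ⬝ᵥ u) • r := by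
  ext i
  simp [rankOne, vecMulVec_apply, mulVec, dotProduct, Fin.sum_univ_two]
  ring

theorem unit_sum (hr : star r ⬝ᵥ r = 1) : star (r 0) * r 0 + star (r 1) * r 1 = 1 := by
  simpa [dotProduct, Fin.sum_univ_two] using hr

theorem sub_proj_eq (hr : star r ⬝ᵥ r = 1) (u : Fin 2 → ℂ) :
    u - (star r ⬝ᵥ u) • r = orthComp r u • orthVec r := by
  have h := unit_sum hr
  simp only [RCLike.star_def] at h
  ext i
  fin_cases i <;> simp [orthComp, orthVec, dotProduct, Fin.sum_univ_two]
  · linear_combination (-u 0) * h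
  · linear_combination (-u 1) * h

theorem bdryMap_mixed (hr : star r ⬝ᵥ r = 1) (t : ℂ) (u x : Fin 2 → ℂ) :
    bdryMap (rankOne r) (t • rankOne r) u x =
      orthComp r u • orthVec r + (star r ⬝ᵥ x + t * (star r ⬝ᵥ u)) • r := by
  rw [bdryMap, smul_mulVec, rankOne_mulVec, rankOne_mulVec, sub_proj_eq hr, add_smul, mul_smul, add_assoc]

theorem det_orthVec (hr : star r ⬝ᵥ r = 1) : orthVec r 0 * r 1 - orthVec r 1 * r 0 = -1 := by
  have h := unit_sum hr
  simp [orthVec] at h ⊢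
  linear_combination -h

/-- Eliminating the component orthogonal to `r`. -/
theorem elim_orthComp (r u v : Fin 2 → ℂ) :
    orthComp r v • u - orthComp r u • v = (u 0 * v 1 - u 1 * v 0) • r := by
  ext i
  fin_cases i <;> simp [orthComp] <;> ring

end

section
variable {m ε : ℝ} {r : Fin 2 → ℂ} {t₀ t₁ : ℝ}

/-- The elimination of the component orthogonal to `r`, for the data `χ`. -/
def mixedChi (m ε : ℝ) (r : Fin 2 → ℂ) (p : ℝ × ℝ) : Fin 2 → ℂ :=
  orthComp r (evVec m ε p) • propChi m ε p - orthComp r (propVec m ε p) • evChi m ε p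

theorem scatDet_mixed (hr : star r ⬝ᵥ r = 1) (p : ℝ × ℝ) :
    scatDet m ε (rankOne r) ((t₀ : ℂ) • rankOne r) ((t₁ : ℂ) • rankOne r) p =
      star r ⬝ᵥ mixedChi m ε r p + (t₀ + p.1 * t₁) * waveDet m ε p := by
  have hM : (t₀ : ℂ) • rankOne r + (p.1 : ℂ) • (t₁ : ℂ) • rankOne r = (t₀ + p.1 * t₁ : ℂ) • rankOne r := by
    rw [smul_smul, add_smul]
  have h1 := congrArg (star r ⬝ᵥ ·) (elim_orthComp r (propVec m ε p) (evVec m ε p))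
  simp only [dotProduct_sub, dotProduct_smul, hr, smul_eq_mul, mul_one] at h1
  have hd := det_orthVec hr
  rw [scatDet, bdryProp, bdryEv, hM, bdryMap_mixed hr, bdryMap_mixed hr, mixedChi, waveDet, dotProduct_sub,
    dotProduct_smul, dotProduct_smul]
  simp only [Pi.add_apply, Pi.smul_apply, smul_eq_mul]
  linear_combination (t₀ + p.1 * t₁ : ℂ) * h1 +
    (orthComp r (propVec m ε p) * (star r ⬝ᵥ evChi m ε p + (t₀ + p.1 * t₁) * (star r ⬝ᵥ evVec m ε p)) -
    orthComp r (evVec m ε p) * (star r ⬝ᵥ propChi m ε p + (t₀ + p.1 * t₁) * (star r ⬝ᵥ propVec m ε p))) * hd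

theorem formDet_mixed (hr : star r ⬝ᵥ r = 1) (p : ℝ × ℝ) :
    formDet m ε (rankOne r) ((t₀ : ℂ) • rankOne r) ((t₁ : ℂ) • rankOne r) p =
      star (waveDet m ε p • r) ⬝ᵥ mixedChi m ε r p +
        ((t₀ + p.1 * t₁) * ‖waveDet m ε p‖ ^ 2 : ℝ) := by
  rw [formDet, scatDet_mixed hr, star_smul, smul_dotProduct, smul_eq_mul, mul_add]
  congr 1
  push_cast
  rw [← Complex.conj_mul']
  simp only [RCLike.star_def]
  ring

/-- The vector (wave determinant)·r is the combination of the two waves without component orthogonal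
to r. In its boundary form the cross terms add up to a real number and the evanescent wave carries
no flux, so only the flux of the propagating wave is left, weighted by the squared modulus of its
coefficient. -/
theorem im_formDet_mixed (hm : 0 < m) (hε : 0 < ε) (hεm : ε < 1 / (2 * m)) (hr : star r ⬝ᵥ r = 1)
    (p : ℝ × ℝ) :
    (formDet m ε (rankOne r) ((t₀ : ℂ) • rankOne r) ((t₁ : ℂ) • rankOne r) p).im =
      -(p.2 * (propSnd m ε p * (1 - 2 * ε * massTerm m ε p) * ‖orthComp r (evVec m ε p)‖ ^ 2)) := by
  rw [formDet_mixed hr, Complex.add_im, Complex.ofReal_im, add_zero,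
    show waveDet m ε p • r = _ from (elim_orthComp r (propVec m ε p) (evVec m ε p)).symm, mixedChi]
  set a := orthComp r (evVec m ε p)
  set b := orthComp r (propVec m ε p)
  have h1 : star (evVec m ε p) ⬝ᵥ propChi m ε p = star (star (propVec m ε p) ⬝ᵥ evChi m ε p) := by
    rw [wave_symplectic hm hε hεm, star_dotProduct]
  simp only [star_sub, star_smul, sub_dotProduct, dotProduct_sub, smul_dotProduct, dotProduct_smul,
    smul_eq_mul, h1]
  set y := star (propVec m ε p) ⬝ᵥ evChi m ε p
  have h2 := im_propForm (m := m) (ε := ε) p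
  have h3 := im_evForm (m := m) (ε := ε) p
  set x := star (propVec m ε p) ⬝ᵥ propChi m ε p
  set z := star (evVec m ε p) ⬝ᵥ evChi m ε p
  have h4 : a * (star a * x) - b * (star a * y) - (a * (star b * star y) - b * (star b * z)) =
      (‖a‖ ^ 2 : ℝ) * x - (b * (star a * y) + star (b * (star a * y))) + (‖b‖ ^ 2 : ℝ) * z := by
    push_cast
    rw [← Complex.mul_conj', ← Complex.mul_conj']
    simp only [star_mul', RCLike.star_def, Complex.conj_conj]
    ring
  have h5 : ∀ w : ℂ, (w + star w).im = 0 := fun w => by simp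
  have h6 : (star a * (a * x) - star a * (b * y) - (star b * (a * star y) - star b * (b * z))).im =
      ‖a‖ ^ 2 * x.im := by
    rw [show star a * (a * x) - star a * (b * y) - (star b * (a * star y) - star b * (b * z)) =
      a * (star a * x) - b * (star a * y) - (a * (star b * star y) - b * (star b * z)) by ring, h4,
      Complex.add_im, Complex.sub_im, h5, Complex.im_ofReal_mul, Complex.im_ofReal_mul, h3]
    ring
  rw [h2] at h6
  refine Eq.trans ?_ (h6.trans (by ring))
  congr 1
  ring

/-- The first component of the evanescent amplitude grows like K = k² + κ² and the second at most
like √K, so asymptotically it is not a multiple of r if r₁ ≠ 0. If r₁ = 0 the positivity of the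
second component suffices. -/
theorem exists_orthComp_evVec_ne_zero (hm : 0 < m) (hε : 0 < ε) (hεm : ε < 1 / (2 * m))
    (hr : star r ⬝ᵥ r = 1) :
    ∃ R : ℝ, ∀ p : ℝ × ℝ, R < p.1 ^ 2 + p.2 ^ 2 → orthComp r (evVec m ε p) ≠ 0 := by
  have hu := unit_sum hr
  by_cases h1 : r 1 = 0
  · refine ⟨0, fun p _ => ?_⟩
    have h0 : r 0 ≠ 0 := fun h => by simp [h, h1] at hu
    simp only [orthComp, h1, neg_zero, zero_mul, zero_add, evVec, cons_val_one]
    refine mul_ne_zero h0 ?_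
    change ((evRate m ε p - p.1 : ℝ) : ℂ) ≠ 0
    exact_mod_cast (evSnd_pos hm hε hεm p).ne'
  · set c := (1 - 2 * ε * m) / ε ^ 2 with hc
    have hc0 : 0 < c := by have := one_sub_pos hm hεm; positivity
    set ρ := ‖r 1‖ with hρ
    have hρ0 : 0 < ρ := norm_pos_iff.2 h1
    have hr0 : ‖r 0‖ ≤ 1 := by
      have h2 : ‖r 0‖ ^ 2 + ‖r 1‖ ^ 2 = 1 := by
        simp only [RCLike.star_def, Complex.conj_mul'] at hu
        exact_mod_cast hu
      nlinarith [norm_nonneg (r 0), sq_nonneg ‖r 1‖]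
    refine ⟨max (max (2 * m / ε) 1) ((6 + 2 * c) / (ρ * ε) ^ 2), fun p hp h0 => ?_⟩
    obtain ⟨h2, h4⟩ := max_lt_iff.1 hp
    obtain ⟨h2, h3⟩ := max_lt_iff.1 h2
    rw [div_lt_iff₀ (by positivity)] at h2 h4
    have hη := evRate_sq hm hεm p
    rw [← hc] at hη
    have hv1 := evSnd_pos hm hε hεm p
    have hv0 := evFst_pos hm hε p
    have hω : -massTerm m ε p ≤ band m ε p := by
      have := band_sq (m := m) (ε := ε) p
      have hw : 0 ≤ band m ε p := Real.sqrt_nonneg _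
      nlinarith [sq_nonneg p.1, sq_nonneg p.2]
    set K := p.1 ^ 2 + p.2 ^ 2 with hK
    have hM : massTerm m ε p = m - ε * K := rfl
    have hv : ε * K ≤ evFst m ε p := by
      have : 0 < ε⁻¹ := by positivity
      unfold evFst; linarith
    have e1 : r 1 * evFst m ε p = r 0 * ((evRate m ε p - p.1 : ℝ) : ℂ) := by
      have : -r 1 * (evFst m ε p : ℂ) + r 0 * ((evRate m ε p - p.1 : ℝ) : ℂ) = 0 := h0
      linear_combination -this
    have e2 := congrArg norm e1
    rw [norm_mul, norm_mul, Complex.norm_real, Complex.norm_real, Real.norm_of_nonneg hv0.le,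
      Real.norm_of_nonneg hv1.le] at e2
    have e3 : ρ * (ε * K) ≤ evRate m ε p - p.1 := by
      calc ρ * (ε * K) ≤ ρ * evFst m ε p := by gcongr
        _ = ‖r 0‖ * (evRate m ε p - p.1) := e2
        _ ≤ 1 * (evRate m ε p - p.1) := by gcongr
        _ = _ := one_mul _
    have hK0 : 0 < K := by linarith
    have e4 : (ρ * (ε * K)) ^ 2 ≤ (evRate m ε p - p.1) ^ 2 := by gcongr
    have e5 : (evRate m ε p - p.1) ^ 2 ≤ (6 + 2 * c) * K := by
      nlinarith [sq_nonneg (p.1 + evRate m ε p), sq_nonneg p.2, mul_le_mul_of_nonneg_left h3.le hc0.le]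
    nlinarith [mul_lt_mul_of_pos_right h4 hK0]

/-- The entry s is a squared modulus, positive at large momenta. So G has no zeros off the axis, and
the number of negative squares is decided by the sign of G alone. -/
theorem hasScatLift_mixed (hm : 0 < m) (hε : 0 < ε) (hεm : ε < 1 / (2 * m)) (hr : star r ⬝ᵥ r = 1)
    (hbc : ∀ k : ℝ, IsNormalBC (rankOne r) ((t₀ : ℂ) • rankOne r + (k : ℂ) • (t₁ : ℂ) • rankOne r)) :
    HasScatLift m ε (rankOne r) ((t₀ : ℂ) • rankOne r) ((t₁ : ℂ) • rankOne r) := by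
  obtain ⟨R₁, hR₁⟩ := exists_orthComp_evVec_ne_zero hm hε hεm hr
  obtain ⟨R₂, hR₂⟩ := exists_re_waveDet_neg hm hε hεm
  set s : ℝ × ℝ → ℝ := fun p => ‖orthComp r (evVec m ε p)‖ ^ 2 with hs
  have hsc : Continuous s := by
    have h0 := (contDiff_evVec hm hε hεm 0).continuous
    have h1 := (contDiff_evVec hm hε hεm 1).continuous
    simp only [hs, orthComp]
    fun_prop
  have hspos : ∀ p : ℝ × ℝ, max (max R₁ R₂) 0 < p.1 ^ 2 + p.2 ^ 2 → 0 < s p := fun p hp =>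
    pow_pos (norm_pos_iff.2 (hR₁ p (lt_of_le_of_lt
      ((le_max_left _ _).trans (le_max_left _ _)) hp))) 2
  have hsq : ∀ q : ℝ, (∀ᶠ k : ℝ in atTop, q < k ^ 2) ∧ ∀ᶠ k : ℝ in atBot, q < k ^ 2 := by
    intro q
    have h1 : ∀ᶠ k : ℝ in atTop, q < k ^ 2 := (tendsto_pow_atTop (two_ne_zero)).eventually_gt_atTop q
    refine ⟨h1, ?_⟩
    have := tendsto_neg_atBot_atTop.eventually h1
    simpa using this
  have him := im_formDet_mixed (t₀ := t₀) (t₁ := t₁) hm hε hεm hr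
  refine HasScatLift.of_form hm hε hεm (s := s) (R := max (max R₁ R₂) 0) hsc him ?_ ?_ ?_ ?_
  · intro p hp h0
    exact absurd h0 (hspos p hp).ne'
  · intro p hp hpR h0
    have h1 := him p
    rw [h0, Complex.zero_im] at h1
    have h2 := mul_pos (mul_pos (propSnd_pos (ε := ε) hm ((le_max_right _ _).trans_lt hpR))
      (massTerm_factor_pos hm hεm p)) (hspos p hpR)
    exact mul_ne_zero hp h2.ne' (neg_eq_zero.1 h1.symm)
  · rcases thresh_dichotomy (thresh_formDet hm hε hεm (rankOne r) ((t₀ : ℂ) • rankOne r)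
      ((t₁ : ℂ) • rankOne r)) with h | h
    · left
      refine ⟨h, ?_, ?_⟩
      · filter_upwards [(hsq (max (max R₁ R₂) 0)).1] with k hk
        exact (hspos (k, 0) (by simpa using hk)).ne'
      · filter_upwards [(hsq (max (max R₁ R₂) 0)).2] with k hk
        exact (hspos (k, 0) (by simpa using hk)).ne'
    · exact Or.inr h
  · intro k hk _
    have hk' : max (max R₁ R₂) 0 < ((k, 0) : ℝ × ℝ).1 ^ 2 + ((k, 0) : ℝ × ℝ).2 ^ 2 := by simpa using hk
    have hsk := hspos (k, 0) hk'
    have hD := waveDet_ne_zero_of_re (hR₂ (k, 0) (lt_of_le_of_lt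
      ((le_max_right _ _).trans (le_max_left _ _)) hk'))
    have hM : (t₀ : ℂ) • rankOne r + (k : ℂ) • (t₁ : ℂ) • rankOne r = (t₀ + k * t₁ : ℂ) • rankOne r := by
      rw [smul_smul, add_smul]
    set D := waveDet m ε (k, 0) with hDdef
    set g := scatDet m ε (rankOne r) ((t₀ : ℂ) • rankOne r) ((t₁ : ℂ) • rankOne r) (k, 0) with hg
    set G := formDet m ε (rankOne r) ((t₀ : ℂ) • rankOne r) ((t₁ : ℂ) • rankOne r) (k, 0) with hG
    have hGreal : G = ((G.re : ℝ) : ℂ) := Complex.ext rfl (by rw [him]; simp)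
    have horth : orthComp r r = 0 := by simp [orthComp]; ring
    have hzw : bdryMap (rankOne r) ((t₀ : ℂ) • rankOne r + (k : ℂ) • (t₁ : ℂ) • rankOne r)
        (D • r) (mixedChi m ε r (k, 0)) = g • r := by
      rw [hM, bdryMap_mixed hr, hg, scatDet_mixed hr]
      have : orthComp r (D • r) = 0 := by
        have : orthComp r (D • r) = D * orthComp r r := by simp [orthComp]; ring
        rw [this, horth, mul_zero]
      rw [this, zero_smul, zero_add, dotProduct_smul, hr, smul_eq_mul, mul_one]
    have hu := unit_sum hr
    have hro : star r ⬝ᵥ orthVec r = 0 := by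
      simp [orthVec, dotProduct, Fin.sum_univ_two]; ring
    have hor : star (orthVec r) ⬝ᵥ r = 0 := by rw [star_dotProduct, hro, star_zero]
    have hoo : star (orthVec r) ⬝ᵥ orthVec r = 1 := by
      simp [orthVec, dotProduct, Fin.sum_univ_two] at hu ⊢
      linear_combination hu
    -- The diagonalizing vectors are the combination of the waves along r, on which the form takes
    -- the value G, and the orthogonal direction, on which 1 - Π gives 1.
    rw [negIndex_eq_of_cols (z := ![D • r, orthVec r]) (w := ![g • r, orthVec r])
      (y := ![mixedChi m ε r (k, 0) 1, 0]) (d := ![G.re, 1]) (isHermitian_thrMat (hbc k) k) ?_ ?_ ?_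
      (thrMat_inr k)]
    · rw [negSquares_of_pos hsk, weylSign]
      change ((if G.re < 0 then 1 else 0) + if (1 : ℝ) < 0 then 1 else 0) + _ = _
      rw [if_neg (zero_le_one (α := ℝ)).not_gt, add_zero]
    · have : D * (star (r 0) * r 0 + star (r 1) * r 1) ≠ 0 := by rw [hu, mul_one]; exact hD
      intro h0
      apply this
      simp [orthVec] at h0
      simp only [RCLike.star_def]
      linear_combination h0
    · intro j
      fin_cases j
      · have h1 := thrMat_mulVec_wave hm hε hεm k (hbc k) (u := D • r) (x := mixedChi m ε r (k, 0))
          (a := orthComp r (evVec m ε (k, 0))) (b := -orthComp r (propVec m ε (k, 0)))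
          (by rw [hDdef, waveDet, ← elim_orthComp, neg_smul, sub_eq_add_neg])
          (by rw [mixedChi, neg_smul, sub_eq_add_neg])
          (by rw [mulVec_smul, rankOne_mulVec, hr, one_smul])
        rw [hzw] at h1
        exact h1
      · have hP : rankOne r *ᵥ orthVec r = 0 := by rw [rankOne_mulVec, hro, zero_smul]
        change thrMat _ _ _ _ _ *ᵥ Sum.elim (orthVec r) (fun _ => 0) = Sum.elim (orthVec r) 0
        rw [thrMat, edgeMat_mulVec (hbc k)]
        simp only [Sum.elim_inl, Sum.elim_inr]
        change Sum.elim (bdryMap _ _ (orthVec r) ![_ * (rankOne r *ᵥ orthVec r) 0 + _, _])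
          (fun _ => (rankOne r *ᵥ orthVec r) 1 + _ * (rankOne r *ᵥ orthVec r) 0 + _) = _
        rw [hP, hM]
        have h0 : (![(weyl₀₀ m ε k (bandPlus m ε k 0) 0 (√(rateSum m ε k)) : ℂ) * (0 : Fin 2 → ℂ) 0 +
          weyl₀₁ m ε k (bandPlus m ε k 0) 0 (√(rateSum m ε k)) * 0, 0] : Fin 2 → ℂ) = 0 := by
          ext i; fin_cases i <;> simp
        rw [h0, bdryMap, smul_mulVec, hP]
        ext i
        rcases i with i | i <;> simp
    · intro i j
      have hGg : star D * g = ((G.re : ℝ) : ℂ) := by rw [← hGreal]; rfl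
      fin_cases i <;> fin_cases j
      · simp only [Fin.zero_eta, cons_val_zero, if_true]
        rw [star_smul, smul_dotProduct, dotProduct_smul, hr, smul_eq_mul, smul_eq_mul, mul_one]
        exact hGg
      · simp [hro, smul_dotProduct]
      · simp [hor, dotProduct_smul]
      · simpa using hoo

end

end RegDirac
end

noncomputable section
namespace RegDirac

/-! ### Robin boundary conditions -/

section
variable {m ε : ℝ} {M₀ M₁ : Matrix (Fin 2) (Fin 2) ℂ}

theorem bdryMap_one (M : Matrix (Fin 2) (Fin 2) ℂ) (u x : Fin 2 → ℂ) :
    bdryMap 1 M u x = x + M *ᵥ u := by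
  simp [bdryMap]

theorem star_dotProduct_mulVec_of_hermitian {M : Matrix (Fin 2) (Fin 2) ℂ} (hM : Mᴴ = M) (u v : Fin 2 → ℂ) :
    star u ⬝ᵥ M *ᵥ v = star (M *ᵥ u) ⬝ᵥ v := by
  rw [star_mulVec, hM, dotProduct_mulVec]

theorem hermitian_affine (h₀ : M₀ᴴ = M₀) (h₁ : M₁ᴴ = M₁) (k : ℝ) :
    (M₀ + (k : ℂ) • M₁)ᴴ = M₀ + (k : ℂ) • M₁ := by
  simp [conjTranspose_add, conjTranspose_smul, h₀, h₁]

/-- Diagonal entry of the boundary form on the propagating wave. -/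
def robinProp (m ε : ℝ) (M₀ M₁ : Matrix (Fin 2) (Fin 2) ℂ) (p : ℝ × ℝ) : ℂ :=
  star (propVec m ε p) ⬝ᵥ bdryProp m ε 1 M₀ M₁ p

/-- Diagonal entry of the boundary form on the evanescent wave. -/
def robinEv (m ε : ℝ) (M₀ M₁ : Matrix (Fin 2) (Fin 2) ℂ) (p : ℝ × ℝ) : ℂ :=
  star (evVec m ε p) ⬝ᵥ bdryEv m ε 1 M₀ M₁ p

/-- Off-diagonal entry of the boundary form. -/
def robinMix (m ε : ℝ) (M₀ M₁ : Matrix (Fin 2) (Fin 2) ℂ) (p : ℝ × ℝ) : ℂ :=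
  star (propVec m ε p) ⬝ᵥ bdryEv m ε 1 M₀ M₁ p

theorem star_robinMix (hm : 0 < m) (hε : 0 < ε) (hεm : ε < 1 / (2 * m)) (h₀ : M₀ᴴ = M₀)
    (h₁ : M₁ᴴ = M₁) (p : ℝ × ℝ) :
    star (evVec m ε p) ⬝ᵥ bdryProp m ε 1 M₀ M₁ p = star (robinMix m ε M₀ M₁ p) := by
  rw [robinMix, bdryProp, bdryEv, bdryMap_one, bdryMap_one, dotProduct_add, dotProduct_add, star_add,
    wave_symplectic hm hε hεm, star_dotProduct_mulVec_of_hermitian (hermitian_affine h₀ h₁ p.1),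
    ← star_dotProduct, ← star_dotProduct]

theorem im_hermitian_form {M : Matrix (Fin 2) (Fin 2) ℂ} (hM : Mᴴ = M) (u : Fin 2 → ℂ) :
    (star u ⬝ᵥ M *ᵥ u).im = 0 :=
  IsHermitian.im_star_dotProduct_mulVec_self (A := M) hM u

theorem im_robinEv (h₀ : M₀ᴴ = M₀) (h₁ : M₁ᴴ = M₁) (p : ℝ × ℝ) : (robinEv m ε M₀ M₁ p).im = 0 := by
  rw [robinEv, bdryEv, bdryMap_one, dotProduct_add, Complex.add_im, im_evForm,
    im_hermitian_form (hermitian_affine h₀ h₁ p.1), add_zero]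

theorem im_robinProp (h₀ : M₀ᴴ = M₀) (h₁ : M₁ᴴ = M₁) (p : ℝ × ℝ) :
    (robinProp m ε M₀ M₁ p).im = -(p.2 * (propSnd m ε p * (1 - 2 * ε * massTerm m ε p))) := by
  rw [robinProp, bdryProp, bdryMap_one, dotProduct_add, Complex.add_im, im_propForm,
    im_hermitian_form (hermitian_affine h₀ h₁ p.1), add_zero]

theorem robinEv_eq_ofReal (h₀ : M₀ᴴ = M₀) (h₁ : M₁ᴴ = M₁) (p : ℝ × ℝ) :
    robinEv m ε M₀ M₁ p = ((robinEv m ε M₀ M₁ p).re : ℂ) :=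
  Complex.ext rfl (by rw [im_robinEv h₀ h₁]; simp)

/-- Multiplicativity of the determinant: with W the matrix of amplitudes and V that of boundary
values, the conjugate of det W times det V is det(W*V), a 2×2 matrix of form entries with conjugate
off-diagonal entries. -/
theorem formDet_robin (hm : 0 < m) (hε : 0 < ε) (hεm : ε < 1 / (2 * m)) (h₀ : M₀ᴴ = M₀)
    (h₁ : M₁ᴴ = M₁) (p : ℝ × ℝ) :
    formDet m ε 1 M₀ M₁ p = robinProp m ε M₀ M₁ p * (robinEv m ε M₀ M₁ p).re -
      (‖robinMix m ε M₀ M₁ p‖ ^ 2 : ℝ) := by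
  push_cast
  rw [← Complex.mul_conj', ← RCLike.star_def, ← star_robinMix hm hε hεm h₀ h₁, ← robinEv_eq_ofReal h₀ h₁]
  simp only [formDet, waveDet, scatDet, robinProp, robinEv, robinMix, dotProduct, Fin.sum_univ_two,
    star_sub, star_mul', Pi.star_apply]
  ring

/-- The boundary value of the evanescent wave vanishes if its form entries do. -/
theorem bdryEv_eq_zero_of_form {p : ℝ × ℝ} (hD : waveDet m ε p ≠ 0) (h1 : robinMix m ε M₀ M₁ p = 0)
    (h2 : robinEv m ε M₀ M₁ p = 0) : bdryEv m ε 1 M₀ M₁ p = 0 := by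
  have hD' : star (waveDet m ε p) ≠ 0 := star_ne_zero.2 hD
  simp only [robinMix, robinEv, dotProduct, Fin.sum_univ_two, Pi.star_apply] at h1 h2
  simp only [waveDet, star_sub, star_mul'] at hD'
  ext i
  refine (mul_eq_zero.1 ?_).resolve_left hD'
  fin_cases i
  · simp only [Fin.zero_eta]
    linear_combination star (evVec m ε p 1) * h1 - star (propVec m ε p 1) * h2
  · simp only [Fin.mk_one]
    linear_combination star (propVec m ε p 0) * h2 - star (evVec m ε p 0) * h1

theorem norm_robinMix_eq_zero (hm : 0 < m) (hε : 0 < ε) (hεm : ε < 1 / (2 * m)) (h₀ : M₀ᴴ = M₀)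
    (h₁ : M₁ᴴ = M₁) {p : ℝ × ℝ} (hG : formDet m ε 1 M₀ M₁ p = 0) (hs : (robinEv m ε M₀ M₁ p).re = 0) :
    robinMix m ε M₀ M₁ p = 0 := by
  rw [formDet_robin hm hε hεm h₀ h₁, hs, Complex.ofReal_zero, mul_zero, zero_sub, neg_eq_zero] at hG
  have : ‖robinMix m ε M₀ M₁ p‖ ^ 2 = 0 := by exact_mod_cast hG
  simpa using this

theorem continuous_robinEv (hm : 0 < m) (hε : 0 < ε) (hεm : ε < 1 / (2 * m)) :
    Continuous (robinEv m ε M₀ M₁) := by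
  have h0 := (contDiff_evVec hm hε hεm 0).continuous
  have h1 := (contDiff_evVec hm hε hεm 1).continuous
  have h2 := (contDiff_bdryEv hm hε hεm 1 M₀ M₁ 0).continuous
  have h3 := (contDiff_bdryEv hm hε hεm 1 M₀ M₁ 1).continuous
  unfold robinEv
  simp only [dotProduct, Fin.sum_univ_two, Pi.star_apply]
  fun_prop

theorem thresh_robinEv (hm : 0 < m) (hε : 0 < ε) (hεm : ε < 1 / (2 * m)) :
    (fun k : ℝ => robinEv m ε M₀ M₁ (k, 0)) ∈ threshRing := by
  have hst : ∀ p i, star (evVec m ε p i) = evVec m ε p i := fun p i => by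
    fin_cases i <;> simp [evVec]
  simp only [robinEv, dotProduct, Fin.sum_univ_two, Pi.star_apply, hst]
  exact thresh_add (thresh_mul (thresh_evVec hm hε hεm 0) (thresh_bdryEv hm hε hεm 1 M₀ M₁ 0))
    (thresh_mul (thresh_evVec hm hε hεm 1) (thresh_bdryEv hm hε hεm 1 M₀ M₁ 1))

/-- The boundary value of the evanescent wave at threshold does not vanish at both ends. -/
theorem not_eventually_bdryEv_eq_zero (hm : 0 < m) (hε : 0 < ε) (hεm : ε < 1 / (2 * m)) :
    ¬ ∀ᶠ k : ℝ in atTop, bdryEv m ε 1 M₀ M₁ (k, 0) = 0 ∧ bdryEv m ε 1 M₀ M₁ (-k, 0) = 0 := by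
  intro h
  have hlarge : ∀ c : ℝ, ∀ᶠ k : ℝ in atTop, c < k := fun c => eventually_gt_atTop c
  obtain ⟨k, ⟨h1, h2⟩, hk1, hk2, hk3, hk4, hk5⟩ := (h.and ((hlarge 1).and ((hlarge (2 * m / ε)).and
    ((hlarge (2 * ‖M₀ 0 0‖ / ε)).and ((hlarge (4 * (1 + ‖M₀ 0 1‖) / ε ^ 2)).and
      (hlarge (4 * ‖M₁ 0 1‖ / ε ^ 2))))))).exists
  rw [div_lt_iff₀ (by positivity)] at hk2 hk3 hk4 hk5
  have e1 := congrFun h1 0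
  have e2 := congrFun h2 0
  set η := evRate m ε (k, 0) with hη
  set v := evFst m ε (k, 0) with hv
  have hη' : evRate m ε (-k, 0) = η := by simp [hη, evRate]
  have hv' : evFst m ε (-k, 0) = v := by simp [hv, evFst, band, bandPlus, massTerm]
  simp only [bdryEv, bdryMap_one] at e1 e2
  simp [evChi, evVec, chiData, hη', hv', ← hη, ← hv] at e1 e2
  -- Averaging the first components at k and -k cancels the terms odd in k. The left side then grows
  -- like k³, the right side at most like k².
  have e3 : (ε * η * v : ℂ) = η + M₀ 0 0 * v + M₀ 0 1 * η - k ^ 2 * M₁ 0 1 := by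
    linear_combination (-1 / 2 : ℂ) * (e1 + e2)
  have hηk : k < η := by
    have := abs_lt_evRate hm hε hεm (k, 0)
    exact (le_abs_self k).trans_lt this
  have hvk : ε * k ^ 2 ≤ v := by
    have hω : -massTerm m ε (k, 0) ≤ band m ε (k, 0) := by
      have := band_sq (m := m) (ε := ε) (k, 0)
      have hw : 0 ≤ band m ε (k, 0) := Real.sqrt_nonneg _
      nlinarith [sq_nonneg k, sq_nonneg (0 : ℝ)]
    have : 0 < ε⁻¹ := by positivity
    have h5 : massTerm m ε (k, 0) = m - ε * k ^ 2 := by simp [massTerm]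
    rw [hv, evFst, h5]
    rw [h5] at hω
    nlinarith [mul_pos hε (by linarith : (0 : ℝ) < k)]
  have hk0 : 0 < k := by linarith
  have hη0 : 0 < η := by linarith
  have hv0 : 0 < v := evFst_pos hm hε _
  have e4 := congrArg norm e3
  have e5 : ε * η * v ≤ η + ‖M₀ 0 0‖ * v + ‖M₀ 0 1‖ * η + k ^ 2 * ‖M₁ 0 1‖ := by
    have h6 : ‖(ε * η * v : ℂ)‖ = ε * η * v := by
      rw [norm_mul, norm_mul, Complex.norm_real, Complex.norm_real, Complex.norm_real,
        Real.norm_of_nonneg hε.le, Real.norm_of_nonneg hη0.le, Real.norm_of_nonneg hv0.le]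
    rw [← h6, e4]
    refine (norm_sub_le _ _).trans ?_
    refine add_le_add ((norm_add_le _ _).trans (add_le_add ((norm_add_le _ _).trans (add_le_add ?_ ?_)) ?_)) ?_
    · rw [Complex.norm_real, Real.norm_of_nonneg hη0.le]
    · rw [norm_mul, Complex.norm_real, Real.norm_of_nonneg hv0.le]
    · rw [norm_mul, Complex.norm_real, Real.norm_of_nonneg hη0.le]
    · rw [norm_mul, norm_pow, Complex.norm_real, Real.norm_of_nonneg hk0.le]
  have f1 : 2 * ‖M₀ 0 0‖ * v < ε * η * v := by
    apply mul_lt_mul_of_pos_right _ hv0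
    nlinarith
  have f2 : 4 * (1 + ‖M₀ 0 1‖) * η ≤ ε * η * v := by
    have : 4 * (1 + ‖M₀ 0 1‖) ≤ ε * v := by
      have a1 : k * ε ^ 2 ≤ k ^ 2 * ε ^ 2 := by
        apply mul_le_mul_of_nonneg_right _ (sq_nonneg ε)
        nlinarith
      nlinarith [mul_le_mul_of_nonneg_left hvk hε.le]
    nlinarith
  have f3 : 4 * ‖M₁ 0 1‖ * k ^ 2 ≤ ε * η * v := by
    have g1 : ε * k * (ε * k ^ 2) ≤ ε * η * v :=
      mul_le_mul (by nlinarith) hvk (by positivity) (by positivity)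
    nlinarith [mul_le_mul_of_nonneg_right hk5.le (sq_nonneg k)]
  nlinarith

/-- A zero of G off the axis forces the real entry s, then the mixed entry, and with them the
boundary value of the evanescent wave to vanish, contrary to `he`. On the axis the index is found by
diagonalizing the 2×2 form. -/
theorem hasScatLift_robin (hm : 0 < m) (hε : 0 < ε) (hεm : ε < 1 / (2 * m)) (h₀ : M₀ᴴ = M₀)
    (h₁ : M₁ᴴ = M₁) {R₁ : ℝ}
    (he : ∀ p : ℝ × ℝ, p.2 ≠ 0 → R₁ < p.1 ^ 2 + p.2 ^ 2 → bdryEv m ε 1 M₀ M₁ p ≠ 0) :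
    HasScatLift m ε 1 M₀ M₁ := by
  obtain ⟨R₂, hR₂⟩ := exists_re_waveDet_neg hm hε hεm
  have hbc : ∀ k : ℝ, IsNormalBC 1 (M₀ + (k : ℂ) • M₁) := fun k =>
    ⟨by simp, by simp, hermitian_affine h₀ h₁ k, by simp⟩
  have hform := formDet_robin hm hε hεm h₀ h₁
  have him : ∀ p, (formDet m ε 1 M₀ M₁ p).im =
      -(p.2 * (propSnd m ε p * (1 - 2 * ε * massTerm m ε p) * (robinEv m ε M₀ M₁ p).re)) := by
    intro p
    rw [hform, Complex.sub_im, Complex.ofReal_im, Complex.im_mul_ofReal, im_robinProp h₀ h₁]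
    ring
  have hsq : ∀ q : ℝ, (∀ᶠ k : ℝ in atTop, q < k ^ 2) ∧ ∀ᶠ k : ℝ in atBot, q < k ^ 2 := by
    intro q
    have h1 : ∀ᶠ k : ℝ in atTop, q < k ^ 2 := (tendsto_pow_atTop (two_ne_zero)).eventually_gt_atTop q
    refine ⟨h1, ?_⟩
    have := tendsto_neg_atBot_atTop.eventually h1
    simpa using this
  refine HasScatLift.of_form hm hε hεm (s := fun p => (robinEv m ε M₀ M₁ p).re)
    (R := max (max R₁ R₂) 0) (Complex.continuous_re.comp (continuous_robinEv hm hε hεm)) him ?_ ?_ ?_ ?_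
  · intro p _ h0
    have h0 : (robinEv m ε M₀ M₁ p).re = 0 := h0
    rw [hform, h0, Complex.ofReal_zero, mul_zero, zero_sub, Complex.neg_re, Complex.ofReal_re]
    have := sq_nonneg ‖robinMix m ε M₀ M₁ p‖
    linarith
  · intro p hp hpR hG
    obtain ⟨h1, h3⟩ := max_lt_iff.1 hpR
    obtain ⟨h1, h2⟩ := max_lt_iff.1 h1
    have h4 := him p
    rw [hG, Complex.zero_im] at h4
    have h5 := mul_pos (propSnd_pos (ε := ε) hm h3) (massTerm_factor_pos hm hεm p)
    have h6 : (robinEv m ε M₀ M₁ p).re = 0 :=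
      (mul_eq_zero.1 ((mul_eq_zero.1 (neg_eq_zero.1 h4.symm)).resolve_left hp)).resolve_left h5.ne'
    refine he p hp h1 (bdryEv_eq_zero_of_form (waveDet_ne_zero_of_re (hR₂ p h2))
      (norm_robinMix_eq_zero hm hε hεm h₀ h₁ hG h6) ?_)
    rw [robinEv_eq_ofReal h₀ h₁, h6, Complex.ofReal_zero]
  · rcases thresh_dichotomy (thresh_formDet hm hε hεm 1 M₀ M₁) with h | h
    · left
      refine ⟨h, ?_⟩
      -- If G and s both vanished identically on the axis, so would the boundary value of the
      -- evanescent wave at large k and at -k, which its growth excludes.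
      rcases thresh_dichotomy (thresh_robinEv (M₀ := M₀) (M₁ := M₁) hm hε hεm) with h' | h'
      · exfalso
        refine not_eventually_bdryEv_eq_zero (M₀ := M₀) (M₁ := M₁) hm hε hεm ?_
        filter_upwards [(hsq R₂).1] with k hk
        have key : ∀ x : ℝ, R₂ < x ^ 2 → bdryEv m ε 1 M₀ M₁ (x, 0) = 0 := fun x hx =>
          bdryEv_eq_zero_of_form (waveDet_ne_zero_of_re (hR₂ (x, 0) (by simpa using hx)))
            (norm_robinMix_eq_zero hm hε hεm h₀ h₁ (h x) (by rw [h' x]; simp)) (h' x)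
        exact ⟨key k hk, key (-k) (by simpa using hk)⟩
      · have hre : ∀ k : ℝ, robinEv m ε M₀ M₁ (k, 0) ≠ 0 → (robinEv m ε M₀ M₁ (k, 0)).re ≠ 0 :=
          fun k hk h0 => hk (by rw [robinEv_eq_ofReal h₀ h₁, h0, Complex.ofReal_zero])
        exact ⟨h'.1.mono hre, h'.2.mono hre⟩
    · exact Or.inr h
  · intro k hk hdet
    obtain ⟨h1, h3⟩ := max_lt_iff.1 hk
    obtain ⟨h1, h2⟩ := max_lt_iff.1 h1
    have hD := waveDet_ne_zero_of_re (hR₂ (k, 0) (by simpa using h2))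
    have hcol : ∀ b : ℂ, thrMat m ε 1 (M₀ + (k : ℂ) • M₁) k *ᵥ
        Sum.elim (propVec m ε (k, 0) + b • evVec m ε (k, 0))
          (fun _ => (propChi m ε (k, 0) + b • evChi m ε (k, 0)) 1) =
        Sum.elim (bdryProp m ε 1 M₀ M₁ (k, 0) + b • bdryEv m ε 1 M₀ M₁ (k, 0)) 0 := by
      intro b
      rw [thrMat_mulVec_wave hm hε hεm k (hbc k) (a := 1) (b := b) (by rw [one_smul]) (by rw [one_smul])
        (by rw [one_mulVec]), bdryMap_add, bdryMap_smul]
      rfl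
    have hcol' : thrMat m ε 1 (M₀ + (k : ℂ) • M₁) k *ᵥ
        Sum.elim (evVec m ε (k, 0)) (fun _ => evChi m ε (k, 0) 1) =
        Sum.elim (bdryEv m ε 1 M₀ M₁ (k, 0)) 0 := by
      rw [thrMat_mulVec_wave hm hε hεm k (hbc k) (a := 0) (b := 1) (by simp) (by simp)
        (by rw [one_mulVec])]
      rfl
    have q1 : star (propVec m ε (k, 0)) ⬝ᵥ bdryProp m ε 1 M₀ M₁ (k, 0) =
        ((robinProp m ε M₀ M₁ (k, 0)).re : ℂ) :=
      Complex.ext rfl (by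
        have := im_robinProp (m := m) (ε := ε) h₀ h₁ (k, 0)
        rw [robinProp] at this
        simpa using this)
    have q2 : star (propVec m ε (k, 0)) ⬝ᵥ bdryEv m ε 1 M₀ M₁ (k, 0) = robinMix m ε M₀ M₁ (k, 0) := rfl
    have q3 := star_robinMix hm hε hεm h₀ h₁ (k, 0)
    have q4 : star (evVec m ε (k, 0)) ⬝ᵥ bdryEv m ε 1 M₀ M₁ (k, 0) =
        ((robinEv m ε M₀ M₁ (k, 0)).re : ℂ) := robinEv_eq_ofReal h₀ h₁ (k, 0)
    have hG : (formDet m ε 1 M₀ M₁ (k, 0)).re = (robinProp m ε M₀ M₁ (k, 0)).re *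
        (robinEv m ε M₀ M₁ (k, 0)).re - ‖robinMix m ε M₀ M₁ (k, 0)‖ ^ 2 := by
      rw [hform, Complex.sub_re, Complex.ofReal_re, Complex.re_mul_ofReal]
    set g := (formDet m ε 1 M₀ M₁ (k, 0)).re
    set ρ := (robinProp m ε M₀ M₁ (k, 0)).re
    set τ := (robinEv m ε M₀ M₁ (k, 0)).re
    set s := robinMix m ε M₀ M₁ (k, 0)
    have hss : s * star s = (‖s‖ ^ 2 : ℝ) := by push_cast; rw [← Complex.mul_conj']; rfl
    have hDdef : waveDet m ε (k, 0) = propVec m ε (k, 0) 0 * evVec m ε (k, 0) 1 -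
      propVec m ε (k, 0) 1 * evVec m ε (k, 0) 0 := rfl
    change negIndex _ = negSquares τ g + _
    by_cases hτ : τ = 0
    · have hg : g ≠ 0 := hdet hτ
      have hs : s ≠ 0 := fun h => hg (by rw [hG, hτ, h]; simp)
      have hs' : star s ≠ 0 := star_ne_zero.2 hs
      -- A hyperbolic form with isotropic evanescent vector. Adding b times that vector to the
      -- propagating one changes the value ρ by 2 Re(bs), so b = (±1 - ρ)/(2s) yields the values ±1.
      rw [negIndex_eq_of_cols
        (z := ![propVec m ε (k, 0) + ((1 - ρ) / (2 * s)) • evVec m ε (k, 0),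
          propVec m ε (k, 0) + ((-1 - ρ) / (2 * s)) • evVec m ε (k, 0)])
        (w := ![bdryProp m ε 1 M₀ M₁ (k, 0) + ((1 - ρ) / (2 * s)) • bdryEv m ε 1 M₀ M₁ (k, 0),
          bdryProp m ε 1 M₀ M₁ (k, 0) + ((-1 - ρ) / (2 * s)) • bdryEv m ε 1 M₀ M₁ (k, 0)])
        (y := ![(propChi m ε (k, 0) + ((1 - ρ) / (2 * s)) • evChi m ε (k, 0)) 1,
          (propChi m ε (k, 0) + ((-1 - ρ) / (2 * s)) • evChi m ε (k, 0)) 1])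
        (d := ![1, -1]) (isHermitian_thrMat (hbc k) k) ?_ ?_ ?_ (thrMat_inr k)]
      · rw [negSquares, if_pos hτ, weylSign]
        change ((if (1 : ℝ) < 0 then 1 else 0) + if (-1 : ℝ) < 0 then 1 else 0) + _ = _
        rw [if_neg (by norm_num), if_pos (by norm_num), zero_add]
      · intro h0
        apply hD
        rw [hDdef]
        simp at h0
        have h5 : ((-1 - ρ) / (2 * s) - (1 - ρ) / (2 * s) : ℂ) = -1 / s := by field_simp; ring
        refine (mul_eq_zero.1 ?_).resolve_left (div_ne_zero (neg_ne_zero.2 one_ne_zero) hs)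
        rw [← h5]
        linear_combination h0
      · intro j
        fin_cases j
        · exact hcol _
        · exact hcol _
      · intro i j
        have hstar : ∀ x : ℝ, star (((x : ℂ) - ρ) / (2 * s)) = (x - ρ) / (2 * star s) := fun x => by
          simp
        have hs1 := hstar 1
        have hs2 := hstar (-1)
        push_cast at hs1 hs2
        fin_cases i <;> fin_cases j <;>
        · simp only [Fin.zero_eta, Fin.mk_one, cons_val_zero, cons_val_one, star_add, star_smul,
            add_dotProduct, dotProduct_add, smul_dotProduct, dotProduct_smul, q1, q2, q3, q4, hτ,
            smul_eq_mul, hs1, hs2]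
          simp only [Complex.ofReal_zero, mul_zero, add_zero, Fin.isValue, zero_ne_one, one_ne_zero,
            if_true, if_false, Complex.ofReal_one, Complex.ofReal_neg]
          field_simp
          ring
    · have hτ' : (τ : ℂ) ≠ 0 := by exact_mod_cast hτ
      -- Completing the square: subtracting the evanescent component makes the two vectors
      -- orthogonal, with values g/τ and τ.
      rw [negIndex_eq_of_cols
        (z := ![propVec m ε (k, 0) + (-star s / τ) • evVec m ε (k, 0), evVec m ε (k, 0)])
        (w := ![bdryProp m ε 1 M₀ M₁ (k, 0) + (-star s / τ) • bdryEv m ε 1 M₀ M₁ (k, 0),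
          bdryEv m ε 1 M₀ M₁ (k, 0)])
        (y := ![(propChi m ε (k, 0) + (-star s / τ) • evChi m ε (k, 0)) 1, evChi m ε (k, 0) 1])
        (d := ![g / τ, τ]) (isHermitian_thrMat (hbc k) k) ?_ ?_ ?_ (thrMat_inr k)]
      · rw [negSquares, if_neg hτ, weylSign]
        change ((if g / τ < 0 then 1 else 0) + if τ < 0 then 1 else 0) + _ = _
        have : g / τ < 0 ↔ τ * g < 0 := by
          rw [div_neg_iff, mul_neg_iff]; tauto
        simp only [this]
        rw [add_comm (if τ * g < 0 then 1 else 0)]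
      · intro h0
        apply hD
        rw [hDdef]
        simp at h0
        linear_combination h0
      · intro j
        fin_cases j
        · exact hcol _
        · exact hcol'
      · intro i j
        have hs1 : star (-star s / (τ : ℂ)) = -s / τ := by simp
        have hgC : (g : ℂ) = ρ * τ - s * star s := by rw [hss, hG]; push_cast; ring
        fin_cases i <;> fin_cases j <;>
        · simp only [Fin.zero_eta, Fin.mk_one, cons_val_zero, cons_val_one, star_add, star_smul,
            add_dotProduct, dotProduct_add, smul_dotProduct, dotProduct_smul, q1, q2, q3, q4,
            smul_eq_mul, hs1]
          simp only [Fin.isValue, zero_ne_one, one_ne_zero, if_true, if_false, Complex.ofReal_div, hgC]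
          try field_simp
          try ring

end

end RegDirac
end

noncomputable section
namespace RegDirac

/-! ### The Chern number of the upper band -/

/-- The derivatives of the normalization, `fx` and `fy`, drop out because tr(H[H, ·]) = 0, and the
identity part of the projection because commutators are traceless. -/
theorem trace_eigenprojection_commutator (f fx fy kx ky M ε : ℂ) :
    ((1 / 2 : ℂ) • (1 + f • !![M, -kx + Complex.I * ky; -kx - Complex.I * ky, -M]) *
      (((1 / 2 : ℂ) • (fx • !![M, -kx + Complex.I * ky; -kx - Complex.I * ky, -M] +
          f • !![-(2 * ε * kx), -1; -1, 2 * ε * kx])) *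
        ((1 / 2 : ℂ) • (fy • !![M, -kx + Complex.I * ky; -kx - Complex.I * ky, -M] +
          f • !![-(2 * ε * ky), Complex.I; -Complex.I, 2 * ε * ky])) -
       ((1 / 2 : ℂ) • (fy • !![M, -kx + Complex.I * ky; -kx - Complex.I * ky, -M] +
          f • !![-(2 * ε * ky), Complex.I; -Complex.I, 2 * ε * ky])) *
        ((1 / 2 : ℂ) • (fx • !![M, -kx + Complex.I * ky; -kx - Complex.I * ky, -M] +
          f • !![-(2 * ε * kx), -1; -1, 2 * ε * kx])))).trace =
      Complex.I / 2 * (f ^ 3 * (M + 2 * ε * (kx ^ 2 + ky ^ 2))) := by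
  simp [Matrix.trace, Fin.sum_univ_two, Matrix.mul_apply, Matrix.one_apply]
  ring_nf

section
variable {m ε : ℝ}

theorem bulkH_eq (m ε kx ky : ℝ) :
    bulkH m ε kx ky = !![(m - ε * (kx ^ 2 + ky ^ 2) : ℂ), -(kx : ℂ) + Complex.I * ky;
      -(kx : ℂ) - Complex.I * ky, -(m - ε * (kx ^ 2 + ky ^ 2) : ℂ)] := by
  ext i j
  fin_cases i <;> fin_cases j <;> simp [bulkH]
  ring

theorem differentiable_bandPlus (hm : 0 < m) (ε : ℝ) :
    Differentiable ℝ fun p : ℝ × ℝ => bandPlus m ε p.1 p.2 :=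
  (contDiff_band hm).differentiable (by simp)

/-- The derivative of 1/ω₊ is left unspecified, since it does not contribute to the trace. -/
theorem exists_projPlusDx (hm : 0 < m) (ε kx ky : ℝ) :
    ∃ fx : ℂ, projPlusDx m ε kx ky = (1 / 2 : ℂ) • (fx • bulkH m ε kx ky +
      ((bandPlus m ε kx ky : ℂ))⁻¹ • !![-(2 * ε * kx : ℂ), -1; -1, (2 * ε * kx : ℂ)]) := by
  have hd : DifferentiableAt ℝ (fun t : ℝ => ((bandPlus m ε t ky : ℂ))⁻¹) kx := by
    refine DifferentiableAt.inv ?_ (by exact_mod_cast (bandPlus_pos hm kx ky).ne')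
    have h1 : DifferentiableAt ℝ (fun t : ℝ => bandPlus m ε t ky) kx :=
      ((differentiable_bandPlus hm ε).comp
        (by fun_prop : Differentiable ℝ fun t : ℝ => ((t, ky) : ℝ × ℝ))).differentiableAt
    exact Complex.ofRealCLM.differentiableAt.comp _ h1
  refine ⟨deriv (fun t : ℝ => ((bandPlus m ε t ky : ℂ))⁻¹) kx, ?_⟩
  have hid : HasDerivAt (fun t : ℝ => (t : ℂ)) 1 kx := (hasDerivAt_id kx).ofReal_comp
  have hH : ∀ i j, HasDerivAt (fun t : ℝ => bulkH m ε t ky i j)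
      ((!![-(2 * ε * kx : ℂ), -1; -1, (2 * ε * kx : ℂ)] : Matrix (Fin 2) (Fin 2) ℂ) i j) kx := by
    have hsq := ((hid.pow 2).add_const ((ky : ℂ) ^ 2)).const_mul (ε : ℂ)
    intro i j
    fin_cases i <;> fin_cases j <;> simp only [bulkH]
    · exact (hsq.const_sub (m : ℂ)).congr_deriv (by simp; ring)
    · exact hid.neg.add_const _
    · exact hid.neg.sub_const _
    · exact (hsq.const_add (-(m : ℂ))).congr_deriv (by simp; ring)
  ext i j
  have h2 : HasDerivAt (fun t : ℝ => projPlus m ε t ky i j) _ kx :=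
    ((hd.hasDerivAt.mul (hH i j)).const_add ((1 : Matrix (Fin 2) (Fin 2) ℂ) i j)).const_mul (1 / 2 : ℂ)
  rw [projPlusDx, of_apply, h2.deriv]
  simp only [Matrix.smul_apply, Matrix.add_apply, smul_eq_mul]

theorem exists_projPlusDy (hm : 0 < m) (ε kx ky : ℝ) :
    ∃ fy : ℂ, projPlusDy m ε kx ky = (1 / 2 : ℂ) • (fy • bulkH m ε kx ky +
      ((bandPlus m ε kx ky : ℂ))⁻¹ • !![-(2 * ε * ky : ℂ), Complex.I; -Complex.I, (2 * ε * ky : ℂ)]) := by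
  have hd : DifferentiableAt ℝ (fun t : ℝ => ((bandPlus m ε kx t : ℂ))⁻¹) ky := by
    refine DifferentiableAt.inv ?_ (by exact_mod_cast (bandPlus_pos hm kx ky).ne')
    have h1 : DifferentiableAt ℝ (fun t : ℝ => bandPlus m ε kx t) ky :=
      ((differentiable_bandPlus hm ε).comp
        (by fun_prop : Differentiable ℝ fun t : ℝ => ((kx, t) : ℝ × ℝ))).differentiableAt
    exact Complex.ofRealCLM.differentiableAt.comp _ h1
  refine ⟨deriv (fun t : ℝ => ((bandPlus m ε kx t : ℂ))⁻¹) ky, ?_⟩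
  have hid : HasDerivAt (fun t : ℝ => (t : ℂ)) 1 ky := (hasDerivAt_id ky).ofReal_comp
  have hH : ∀ i j, HasDerivAt (fun t : ℝ => bulkH m ε kx t i j)
      ((!![-(2 * ε * ky : ℂ), Complex.I; -Complex.I, (2 * ε * ky : ℂ)] : Matrix (Fin 2) (Fin 2) ℂ) i j) ky := by
    have hsq := ((hid.pow 2).const_add ((kx : ℂ) ^ 2)).const_mul (ε : ℂ)
    have hIk := hid.const_mul Complex.I
    intro i j
    fin_cases i <;> fin_cases j <;> simp only [bulkH]
    · exact (hsq.const_sub (m : ℂ)).congr_deriv (by simp; ring)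
    · exact (hIk.const_add (-(kx : ℂ))).congr_deriv (by simp)
    · exact (hIk.const_sub (-(kx : ℂ))).congr_deriv (by simp)
    · exact (hsq.const_add (-(m : ℂ))).congr_deriv (by simp; ring)
  ext i j
  have h2 : HasDerivAt (fun t : ℝ => projPlus m ε kx t i j) _ ky :=
    ((hd.hasDerivAt.mul (hH i j)).const_add ((1 : Matrix (Fin 2) (Fin 2) ℂ) i j)).const_mul (1 / 2 : ℂ)
  rw [projPlusDy, of_apply, h2.deriv]
  simp only [Matrix.smul_apply, Matrix.add_apply, smul_eq_mul]

/-- The Berry curvature of the upper band. -/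
theorem trace_projPlus_commutator (hm : 0 < m) (ε kx ky : ℝ) :
    (projPlus m ε kx ky * (projPlusDx m ε kx ky * projPlusDy m ε kx ky -
        projPlusDy m ε kx ky * projPlusDx m ε kx ky)).trace =
      ((m + ε * (kx ^ 2 + ky ^ 2)) / bandPlus m ε kx ky ^ 3 : ℝ) * (Complex.I / 2) := by
  obtain ⟨fx, hx⟩ := exists_projPlusDx hm ε kx ky
  obtain ⟨fy, hy⟩ := exists_projPlusDy hm ε kx ky
  rw [hx, hy, projPlus, bulkH_eq, trace_eigenprojection_commutator]
  push_cast
  field_simp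
  ring

theorem tendsto_massTerm_div_band (hm : 0 < m) (hε : 0 < ε) :
    Tendsto (fun r : ℝ => -(m - ε * r ^ 2) / bandPlus m ε r 0) atTop (𝓝 1) := by
  have h1 : Tendsto (fun r : ℝ => 1 - 4 / ε ^ 2 * (r ^ 2)⁻¹) atTop (𝓝 (1 - 4 / ε ^ 2 * 0)) := by
    refine tendsto_const_nhds.sub (Tendsto.const_mul _ ?_)
    exact tendsto_inv_atTop_zero.comp (tendsto_pow_atTop two_ne_zero)
  rw [mul_zero, sub_zero] at h1
  refine tendsto_of_tendsto_of_tendsto_of_le_of_le' h1 tendsto_const_nhds ?_ ?_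
  · filter_upwards [eventually_gt_atTop (2 * m / ε + 1)] with r hr
    have hq : 0 < 2 * m / ε := by positivity
    have hr1 : 2 * m / ε < r := by linarith
    rw [div_lt_iff₀ hε] at hr1
    have hr0 : 0 < r := by linarith
    have hM : ε * r ^ 2 / 2 ≤ -(m - ε * r ^ 2) := by nlinarith
    have hω := bandPlus_pos (ε := ε) hm r 0
    have hsq := bandPlus_sq m ε r 0
    simp only [ne_eq, OfNat.ofNat_ne_zero, not_false_eq_true, zero_pow, add_zero] at hsq
    set ω := bandPlus m ε r 0
    set N := -(m - ε * r ^ 2) with hN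
    have hN2 : (m - ε * r ^ 2) ^ 2 = N ^ 2 := by rw [hN]; ring
    rw [hN2] at hsq
    have hN0 : 0 < ε * r ^ 2 / 2 := by positivity
    have hNω : N ≤ ω := by nlinarith
    rw [le_div_iff₀ hω]
    have e1 : (ω - N) * (ε * r ^ 2) ≤ r ^ 2 := by nlinarith
    have e2 : (ω - N) * ε ≤ 1 := by
      have : 0 < r ^ 2 := by positivity
      nlinarith
    have e3 : ε * r ^ 2 / 2 ≤ ω := hM.trans hNω
    have e4 : ω - N ≤ 4 / ε ^ 2 * (r ^ 2)⁻¹ * ω := by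
      have e5 : 4 / ε ^ 2 * (r ^ 2)⁻¹ * ω = 4 * ω / (ε ^ 2 * r ^ 2) := by field_simp
      rw [e5, le_div_iff₀ (by positivity)]
      nlinarith
    linarith
  · filter_upwards with r
    have hω := bandPlus_pos (ε := ε) hm r 0
    rw [div_le_one hω]
    have hsq := bandPlus_sq m ε r 0
    simp only [ne_eq, OfNat.ofNat_ne_zero, not_false_eq_true, zero_pow, add_zero] at hsq
    nlinarith [sq_nonneg r]

theorem hasDerivAt_massTerm_div_band (hm : 0 < m) (ε r : ℝ) :
    HasDerivAt (fun r : ℝ => -(m - ε * r ^ 2) / bandPlus m ε r 0)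
      (r * ((m + ε * r ^ 2) / bandPlus m ε r 0 ^ 3)) r := by
  have hω := bandPlus_pos (ε := ε) hm r 0
  have hsq := bandPlus_sq m ε r 0
  have h0 : HasDerivAt (fun r : ℝ => m - ε * r ^ 2) (-(ε * (2 * r))) r := by
    have := ((hasDerivAt_pow 2 r).const_mul ε).const_sub m
    exact this.congr_deriv (by simp)
  have h1 : HasDerivAt (fun r : ℝ => r ^ 2 + 0 ^ 2 + (m - ε * (r ^ 2 + 0 ^ 2)) ^ 2)
      (2 * r + 2 * (m - ε * r ^ 2) * -(ε * (2 * r))) r := by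
    have h2 := (hasDerivAt_pow 2 r).add (h0.pow 2)
    refine (h2.congr_deriv (by simp)).congr_of_eventuallyEq (Eventually.of_forall fun x => ?_)
    simp
  have h2 : HasDerivAt (fun r : ℝ => bandPlus m ε r 0)
      ((2 * r + 2 * (m - ε * r ^ 2) * -(ε * (2 * r))) / (2 * bandPlus m ε r 0)) r :=
    h1.sqrt (bandPlus_arg_pos hm r 0).ne'
  have h3 : HasDerivAt (fun r : ℝ => -(m - ε * r ^ 2)) (ε * (2 * r)) r := h0.neg.congr_deriv (neg_neg _)
  refine (h3.div h2 hω.ne').congr_deriv ?_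
  simp only [ne_eq, OfNat.ofNat_ne_zero, not_false_eq_true, zero_pow, add_zero] at hsq
  field_simp
  rw [hsq]
  ring

/-- The radial integrand is the derivative of -(m - εr²)/ω₊, which runs from -1 at the origin to +1
at infinity; the angle contributes 2π. The regularization ε > 0 is what makes the limit +1. -/
theorem integral_berry (hm : 0 < m) (hε : 0 < ε) :
    ∫ k : ℝ × ℝ, (m + ε * (k.1 ^ 2 + k.2 ^ 2)) / bandPlus m ε k.1 k.2 ^ 3 = 4 * Real.pi := by
  rw [← integral_comp_polarCoord_symm]
  have h1 : ∀ q : ℝ × ℝ, q.1 • ((m + ε * ((polarCoord.symm q).1 ^ 2 + (polarCoord.symm q).2 ^ 2)) /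
      bandPlus m ε (polarCoord.symm q).1 (polarCoord.symm q).2 ^ 3) =
      (q.1 * ((m + ε * q.1 ^ 2) / bandPlus m ε q.1 0 ^ 3)) * 1 := by
    intro q
    have h2 : (polarCoord.symm q).1 ^ 2 + (polarCoord.symm q).2 ^ 2 = q.1 ^ 2 := by
      simp only [polarCoord_symm_apply]
      linear_combination q.1 ^ 2 * Real.cos_sq_add_sin_sq q.2
    simp only [bandPlus, h2, smul_eq_mul, mul_one]
    simp
  simp only [h1]
  rw [show polarCoord.target = Ioi (0 : ℝ) ×ˢ Ioo (-Real.pi) Real.pi from rfl,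
    Measure.volume_eq_prod, setIntegral_prod_mul (fun r => r * ((m + ε * r ^ 2) / bandPlus m ε r 0 ^ 3))
      (fun _ => (1 : ℝ))]
  have h3 := integral_Ioi_of_hasDerivAt_of_nonneg' (a := 0)
    (fun r _ => hasDerivAt_massTerm_div_band hm ε r)
    (fun r (hr : 0 < r) => by have := bandPlus_pos (ε := ε) hm r 0; positivity)
    (tendsto_massTerm_div_band hm hε)
  rw [h3]
  have h4 : bandPlus m ε 0 0 = m := by
    simp [bandPlus, Real.sqrt_sq hm.le]
  rw [h4]
  have hπ := Real.pi_pos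
  have : -(m - ε * 0 ^ 2) / m = -1 := by field_simp; ring
  rw [this]
  simp [Real.volume_real_Ioo_of_le (by linarith : -Real.pi ≤ Real.pi)]
  ring

theorem chernPlus_eq_one (hm : 0 < m) (hε : 0 < ε) : chernPlus m ε = 1 := by
  unfold chernPlus
  simp only [trace_projPlus_commutator hm]
  rw [integral_mul_const, integral_complex_ofReal, integral_berry hm hε]
  have := Complex.two_pi_I_ne_zero
  have hπ : (Real.pi : ℂ) ≠ 0 := by exact_mod_cast Real.pi_ne_zero
  push_cast
  field_simp
  norm_num

end

end RegDirac
end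

noncomputable section
namespace RegDirac

/-! ### The bulk-edge relation -/

/-- A zero of the boundary value at κ > 0 destroys uniqueness, and the condition has full rank at
every momentum. The finitely many exceptions lie in a ball, and evenness in κ covers the other
half-plane. -/
theorem exists_bdryEv_ne_zero {m ε : ℝ} (hm : 0 < m) (hε : 0 < ε) (hεm : ε < 1 / (2 * m))
    {M₀ M₁ : Matrix (Fin 2) (Fin 2) ℂ} (hbc : ∀ k : ℝ, IsNormalBC 1 (M₀ + (k : ℂ) • M₁))
    {A : ℝ → Matrix (Fin 2) (Fin 2 ⊕ Fin 2) ℂ}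
    (hA : ∀ k : ℝ, ∀ ψ ψ' : Fin 2 → ℂ, A k *ᵥ Sum.elim ψ ψ' = 0 ↔
      bdryMap 1 (M₀ + (k : ℂ) • M₁) ψ (chiData ε ψ ψ') = 0)
    {ψ : ℝ × ℝ → Fin 2 → ℂ} (hψ : IsBulkSection m ε ψ)
    (huniq : {p : ℝ × ℝ | 0 < p.2 ∧ (A p.1).rank = 2 ∧
      ¬ UniqueScatteringState m ε (A p.1) ψ p.1 p.2}.Finite) :
    ∃ R : ℝ, ∀ p : ℝ × ℝ, p.2 ≠ 0 → R < p.1 ^ 2 + p.2 ^ 2 → bdryEv m ε 1 M₀ M₁ p ≠ 0 := by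
  obtain ⟨R, hR⟩ := exists_radius_of_eventually_cocompact huniq.isCompact.compl_mem_cocompact
  have key : ∀ p : ℝ × ℝ, 0 < p.2 → R < p.1 ^ 2 + p.2 ^ 2 → bdryEv m ε 1 M₀ M₁ p ≠ 0 := by
    intro p hp hpR h0
    exact hR p hpR ⟨hp, rank_eq_two hε.ne' (hbc p.1) (hA p.1),
      not_uniqueScatteringState hm hε hεm hψ (hA p.1) hp h0⟩
  refine ⟨R, fun p hp hpR => ?_⟩
  rcases lt_or_gt_of_ne hp with h | h
  · rw [← bdryEv_refl]
    exact key (refl p) (by simpa [refl] using h) (by simpa [refl] using hpR)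
  · exact key p h hpR

theorem exists_ne_of_ae {P : ℝ → Prop} (h : ∀ᵐ k : ℝ, P k) : ∃ k₁ k₂ : ℝ, k₁ ≠ k₂ ∧ P k₁ ∧ P k₂ := by
  obtain ⟨k₁, h₁⟩ := h.exists
  obtain ⟨k₂, h₂, hne⟩ := (h.and ((Set.countable_singleton k₁).ae_notMem volume)).exists
  exact ⟨k₁, k₂, fun h => hne h.symm, h₁, h₂⟩

end RegDirac
end

theorem lemma1 (m ε : ℝ) (hm : 0 < m) (hε : 0 < ε) (hεm : ε < 1 / (2 * m))
    (B₀ B₁ B₂ : Matrix (Fin 2) (Fin 2) ℂ)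
    (hsa : ∀ᵐ kx : ℝ, RegDirac.IsSelfAdjointEdge m ε kx (RegDirac.bcMatrix B₀ B₁ B₂ kx))
    (ψ : ℝ × ℝ → Fin 2 → ℂ) (hψ : RegDirac.IsBulkSection m ε ψ)
    (huniq : {p : ℝ × ℝ | 0 < p.2 ∧ (RegDirac.bcMatrix B₀ B₁ B₂ p.1).rank = 2 ∧
      ¬ RegDirac.UniqueScatteringState m ε (RegDirac.bcMatrix B₀ B₁ B₂ p.1) ψ p.1 p.2}.Finite)
    (S : ℝ × ℝ → ℂ)
    (hS : RegDirac.IsScatteringAmplitude m ε (RegDirac.bcMatrix B₀ B₁ B₂) ψ S) :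
    ∃ (nb : ℤ) (w : ℂ),
      RegDirac.IsEdgeModeNumber m ε (RegDirac.bcMatrix B₀ B₁ B₂) nb ∧
      RegDirac.IsAsymptoticWinding S w ∧
      RegDirac.chernPlus m ε = (nb : ℂ) + w := by
  obtain ⟨k₁, k₂, hk, h₁, h₂⟩ := RegDirac.exists_ne_of_ae hsa
  obtain ⟨Pr, M₀, M₁, Bad, hBad, hBad1, hNF, hA⟩ := RegDirac.exists_normalForm hε.ne' hk
    h₁.isIsotropicBC h₂.isIsotropicBC
  have hbc : ∀ k : ℝ, RegDirac.IsNormalBC Pr (M₀ + (k : ℂ) • M₁) := hNF.isNormalBC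
  obtain ⟨np, nm, hnp, hnm, hnb⟩ := RegDirac.exists_isEdgeModeNumber hm hε hεm hbc hBad hA
  have hlift : RegDirac.HasScatLift m ε Pr M₀ M₁ := by
    rcases hNF with ⟨hPr, h₀, h₁⟩ | ⟨r, t₀, t₁, hr, hPr, h₀, h₁⟩ | ⟨hPr, h₀, h₁⟩
    · subst hPr
      -- Without exceptional momenta the normal form holds at every k, so a line of zeros of the
      -- evanescent boundary value cannot hide above an excluded momentum.
      rw [hBad1 rfl] at hA
      obtain ⟨R, hR⟩ := RegDirac.exists_bdryEv_ne_zero hm hε hεm hbc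
        (fun k => hA k (notMem_empty k)) hψ huniq
      exact RegDirac.hasScatLift_robin hm hε hεm h₀ h₁ hR
    · subst hPr h₀ h₁
      exact RegDirac.hasScatLift_mixed hm hε hεm hr hbc
    · subst hPr h₀ h₁
      exact RegDirac.hasScatLift_dirichlet hm hε hεm
  refine ⟨(np : ℤ) - nm, 1 - ((np : ℂ) - nm), hnb,
    hlift.isAsymptoticWinding hm hε hεm hBad hA hψ hS hnp hnm, ?_⟩
  rw [RegDirac.chernPlus_eq_one hm hε]
  push_cast
  ring
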